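/- **Setting.** Let $\Lambda$ be the complex Grassmann algebra on $N$ odd generators; an element is *real* if it is a real polynomial in the generators. Let $V_1,V_2,V_3$ be finite-dimensional real super vector spaces with position/momentum coordinates $(x^a,p_a)$, $(y^i,q_i)$, $(z^\mu,r_\mu)$ on $T^*V_1,T^*V_2,T^*V_3$; $\tilde\imath$ is the parity of $y^i$. A *quadratic action* from $V_1$ to $V_2$ is an even function $$S(x,q)=s_0+x^aS_a+S^iq_i+\tfrac12x^ax^bS_{ba}+x^aS_a^iq_i+\tfrac12S^{ij}q_jq_i$$ with coefficients in $\Lambda$ of the appropriate parities, $S_{ab}=(-1)^{\tilde a\tilde b}S_{ba}$, $S^{ij}=(-1)^{\tilde\imath\tilde\jmath}S^{ji}$, all real except that the even constant $s_0$ may be complex. Its canonical relation in $T^*V_1\times T^*V_2$ is $p_a=\partial S/\partial x^a$, $y^i=(-1)^{\tilde\imath}\partial S/\partial q_i$ (left derivatives; on points over $\Lambda$ and over all its extensions by finitely many odd generators). For $\hbar>0$ the *quantum thick morphism* $\hat\Phi\colon V_1\to V_2$ with action $S$ is given by the pullback $$(\hat\Phi^*w)(x)=\int_{T^*V_2}d\mu(y,q)\,e^{\frac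 i\hbar(S(x,q)-y^iq_i)}w(y).$$ Here $d\mu(y,q)$ is the Liouville measure normalized by $\int d\mu(y,q)\,e^{-\frac i\hbar y^iq_i}=1$: the measure $dy\,dq/(2\pi\hbar)^n$ for the $n$ pairs of even coordinates, with oscillatory integrals understood as limits for $\varepsilon\to0^+$ of integrals with the extra factor $e^{-\varepsilon(|y|^2+|q|^2)}$, and the Berezin integral for the odd ones. The composition $\hat\Phi_{32}\circ\hat\Phi_{21}$ of quantum thick morphisms with quadratic actions $S_{32}(y,r)$, $S_{21}(x,q)$ has action $S_{31}(x,r)$ if $$e^{\frac i\hbar S_{31}(x,r)}=\int_{T^*V_2}d\mu(y,q)\,e^{\frac i\hbar(S_{32}(y,r)+S_{21}(x,q)-y^iq_i)}.$$ The classical composition is $S_{31}^{\rm class}(x,r)=S_{32}(y,r)+S_{21}(x,q)-y^iq_i$, where $y,q$ are determined by $q_i=\partial S_{32}/\partial y^i(y,r)$ and $y^i=(-1)^{\tilde\imath}\partial S_{21}/\partial q_i(x,q)$. Let $T_{ij}$ denote the coefficients of $\tfrac12y^iy^jT_{ji}$ in $S_{32}$ and $S^{ij}$ those of $\tfrac12S^{ij}q_jq_i$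 in $S_{21}$. Call $(S_{32},S_{21})$ *composable* if the matrix $\delta_i^j-T_{ik}S^{kj}(-1)^{\tilde k}$ is invertible. **Theorem.** There is an assignment of an even element $c=c(\hat\Phi_{32},\hat\Phi_{21})\in\Lambda$, depending only on the matrices $(T_{ij})$ and $(S^{ij})$, such that for all composable $S_{32}$, $S_{21}$: 1. $c=\tfrac12\ln\operatorname{Ber}\bigl(\delta_i^j-T_{ik}S^{kj}(-1)^{\tilde k}\bigr)$, i.e. $e^{2c}=\operatorname{Ber}\bigl(\delta_i^j-T_{ik}S^{kj}(-1)^{\tilde k}\bigr)$; and $c$ is the real logarithm (a real element) whenever $\delta_i^j-t\,T_{ik}S^{kj}(-1)^{\tilde k}$ is invertible for all $t\in[0,1]$. 2. There is exactly one quadratic action $S_{31}^{\rm class}$ that is the classical composition, and its canonical relation is the set-theoretic composition of the canonical relations of $S_{21}$ and $S_{32}$. 3. For every $\hbar>0$, the quadratic actions of the composition $\hat\Phi_{32}\circ\hat\Phi_{21}$ are exactly $$S_{31}=S_{31}^{\rm class}-\frac\hbar i\,c(\hat\Phi_{32},\hat\Phi_{21})\qquad\text{up to adding constants in }2\pi\hbar\,\mathbb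 Z .$$ 4. For every $\hbar>0$ and every Schwartz superfunction $w$ on $V_3$, the pullbacks exist and $\hat\Phi_{21}^*\hat\Phi_{32}^*w=e^{-c}\,(\hat\Phi_{31}^{\rm class})^*w$, where $\hat\Phi_{31}^{\rm class}$ has the action $S_{31}^{\rm class}$. Consequently quadratic quantum thick morphisms give a projective representation of the (partial) category of framed linear canonical relations. Namely: a quadratic action is determined by its canonical relation and its constant term $s_0$ (the framing); the actions $x^aq_a$ are identities for the classical composition, composable with every action on either side, and $x^aq_a$ is represented by the identity on Schwartz superfunctions; classical composition is associative, in the sense that if $(S_{43},S_{32})$ and $(S_{32},S_{21})$ are composable with classical compositions $S_{42}$ and $S_{31}$, then $(S_{43},S_{31})$ is composable with classical composition $S_{41}$ if and only if $(S_{42},S_{21})$ is; and by 4 compositions are represented up to the scalar multiplier $e^{-c}$. -/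

import Mathlib

open MeasureTheory Filter Topology
open scoped SchwartzMap

namespace SuperThick

noncomputable section

/-! ### Grassmann algebras -/

/-- The complex Grassmann algebra with (odd, anticommuting) generators indexed by `τ`. -/
abbrev Grassmann (τ : Type) : Type := ExteriorAlgebra ℂ (τ →₀ ℂ)

/-- The Grassmann generator with index `k`. -/
def gen {τ : Type} (k : τ) : Grassmann τ := ExteriorAlgebra.ι ℂ (Finsupp.single k 1)

/-- The homogeneous part of parity `i` of a Grassmann algebra. -/
def parityPart (τ : Type) (i : ZMod 2) : Submodule ℂ (Grassmann τ) :=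
  CliffordAlgebra.evenOdd (0 : QuadraticForm ℂ (τ →₀ ℂ)) i

/-- The even subalgebra of a Grassmann algebra. -/
abbrev GEven (τ : Type) : Subalgebra ℂ (Grassmann τ) :=
  CliffordAlgebra.even (0 : QuadraticForm ℂ (τ →₀ ℂ))

/-- Real elements: polynomials with real coefficients in the generators. -/
def realPart (τ : Type) : Subalgebra ℝ (Grassmann τ) := Algebra.adjoin ℝ (Set.range gen)

theorem commute_of_even {τ : Type} {x : Grassmann τ} (hx : x ∈ GEven τ) (y : Grassmann τ) :
    Commute x y := by
  have hx' : x ∈ CliffordAlgebra.evenOdd (0 : QuadraticForm ℂ (τ →₀ ℂ)) 0 := hx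
  clear hx
  have anti : ∀ a b : τ →₀ ℂ, CliffordAlgebra.ι (0 : QuadraticForm ℂ (τ →₀ ℂ)) a *
      CliffordAlgebra.ι 0 b = - (CliffordAlgebra.ι 0 b * CliffordAlgebra.ι 0 a) := by
    intro a b
    have h := CliffordAlgebra.ι_mul_ι_add_swap (Q := (0 : QuadraticForm ℂ (τ →₀ ℂ))) a b
    rw [show QuadraticMap.polar (⇑(0 : QuadraticForm ℂ (τ →₀ ℂ))) a b = 0 by
      simp [QuadraticMap.polar], map_zero] at h
    exact eq_neg_of_add_eq_zero_left h
  induction x, hx' using CliffordAlgebra.even_induction with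
  | algebraMap r => exact Algebra.commutes r y
  | add x y hx hy h1 h2 => exact h1.add_left h2
  | ι_mul_ι_mul m₁ m₂ x hx h =>
    refine Commute.mul_left ?_ h
    clear h hx
    induction y using CliffordAlgebra.induction with
    | algebraMap r => exact (Algebra.commutes r _).symm
    | ι c =>
      show _ * _ = _ * _
      rw [mul_assoc, anti m₂ c, mul_neg, ← mul_assoc, anti m₁ c, neg_mul, neg_neg, mul_assoc]
    | mul a b ha hb => exact ha.mul_right hb
    | add a b ha hb => exact ha.add_right hb

instance {τ : Type} : CommRing (GEven τ) :=
  { (inferInstance : Ring (GEven τ)) with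
    mul_comm := fun x y => Subtype.ext (commute_of_even x.2 (y : Grassmann τ)) }

/-- The even component of an element. -/
def evenComponent {τ : Type} (x : Grassmann τ) : GEven τ :=
  ⟨(DirectSum.decompose (CliffordAlgebra.evenOdd (0 : QuadraticForm ℂ (τ →₀ ℂ))) x 0 :
      CliffordAlgebra.evenOdd (0 : QuadraticForm ℂ (τ →₀ ℂ)) 0),
    (DirectSum.decompose (CliffordAlgebra.evenOdd (0 : QuadraticForm ℂ (τ →₀ ℂ))) x 0).2⟩

/-- The algebra homomorphism induced by a map of the index sets of generators. -/
def genMap {σ τ : Type} (f : σ → τ) : Grassmann σ →ₐ[ℂ] Grassmann τ :=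
  ExteriorAlgebra.map (Finsupp.lmapDomain ℂ ℂ f)

/-- The exponential: an element is the sum of its body (a complex number) and its soul, which is
nilpotent, and the exponential of the sum is the product of the exponentials. -/
def gexp {τ : Type} (a : Grassmann τ) : Grassmann τ :=
  Complex.exp (ExteriorAlgebra.algebraMapInv a) •
    IsNilpotent.exp (a - algebraMap ℂ (Grassmann τ) (ExteriorAlgebra.algebraMapInv a))

/-- The left partial derivative with respect to the odd variable `gen k`. -/
def oddDeriv {τ : Type} (k : τ) : Grassmann τ →ₗ[ℂ] Grassmann τ :=
  CliffordAlgebra.contractLeft (Finsupp.lapply k)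

/-! ### Super vector spaces in coordinates, and the Berezinian -/

/-- A super vector space of dimension `even|odd`, with standard coordinates. -/
structure SuperSpace where
  even : ℕ
  odd : ℕ

/-- The index set of the coordinates. -/
abbrev SuperSpace.Idx (V : SuperSpace) : Type := Fin V.even ⊕ Fin V.odd

/-- Parity of a coordinate (and of the conjugate momentum). -/
def par {α β : Type} : α ⊕ β → ZMod 2 := Sum.elim (fun _ => 0) (fun _ => 1)

/-- The sign `(-1)^ĩ`. -/
def sgn {α β : Type} : α ⊕ β → ℂ := Sum.elim (fun _ => 1) (fun _ => -1)

/-- The sign `(-1)^(ĩ j̃)`. -/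
def sgn₂ {α β : Type} : α ⊕ β → α ⊕ β → ℂ
  | .inr _, .inr _ => -1
  | _, _ => 1

/-- The Berezinian `det (A - B D⁻¹ C) / det D` of an even matrix with blocks `A, B, C, D`. For an
even matrix the entries of `A - B D⁻¹ C` and of `D` are even, so that `evenComponent` only moves them
into the commutative ring of even elements. -/
def Ber {τ : Type} {V : SuperSpace} (M : Matrix V.Idx V.Idx (Grassmann τ)) : GEven τ :=
  let D : Matrix (Fin V.odd) (Fin V.odd) (GEven τ) := M.toBlocks₂₂.map evenComponent
  let Dinv : Matrix (Fin V.odd) (Fin V.odd) (Grassmann τ) := (D⁻¹).map Subtype.val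
  ((M.toBlocks₁₁ - M.toBlocks₁₂ * Dinv * M.toBlocks₂₁).map evenComponent).det * Ring.inverse D.det

/-! ### Quadratic actions (quadratic generating functions) -/

/-- A quadratic generating function of a thick morphism `V₁ → V₂`, with coefficients in the Grassmann
algebra on `κ`:
`S(x,q) = s₀ + xᵃ S_a + Sⁱ q_i + ½ xᵃ xᵇ S_{ba} + xᵃ S_aⁱ q_i + ½ S^{ij} q_j q_i`.
It is even, and its non-constant coefficients are real. The constant may be complex. -/
@[ext] structure QuadAction (κ : Type) (V₁ V₂ : SuperSpace) where
  const : GEven κ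
  linX : V₁.Idx → Grassmann κ
  linQ : V₂.Idx → Grassmann κ
  xx : V₁.Idx → V₁.Idx → Grassmann κ
  xq : V₁.Idx → V₂.Idx → Grassmann κ
  qq : V₂.Idx → V₂.Idx → Grassmann κ
  linX_parity : ∀ a, linX a ∈ parityPart κ (par a)
  linQ_parity : ∀ i, linQ i ∈ parityPart κ (par i)
  xx_parity : ∀ a b, xx a b ∈ parityPart κ (par a + par b)
  xq_parity : ∀ a i, xq a i ∈ parityPart κ (par a + par i)
  qq_parity : ∀ i j, qq i j ∈ parityPart κ (par i + par j)
  xx_symm : ∀ a b, xx a b = sgn₂ a b • xx b a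
  qq_symm : ∀ i j, qq i j = sgn₂ i j • qq j i
  linX_real : ∀ a, linX a ∈ realPart κ
  linQ_real : ∀ i, linQ i ∈ realPart κ
  xx_real : ∀ a b, xx a b ∈ realPart κ
  xq_real : ∀ a i, xq a i ∈ realPart κ
  qq_real : ∀ i j, qq i j ∈ realPart κ

/-- A tuple whose entries have the parities of the coordinates. -/
def IsPoint {τ : Type} {V : SuperSpace} (x : V.Idx → Grassmann τ) : Prop :=
  ∀ a, x a ∈ parityPart τ (par a)

/-- The pairing `yⁱ q_i`. -/
def pairing {τ : Type} {V : SuperSpace} (y q : V.Idx → Grassmann τ) : Grassmann τ :=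
  ∑ i, y i * q i

namespace QuadAction

variable {κ τ : Type} {V₁ V₂ : SuperSpace}

/-- The value `S(x,q)` at Grassmann-valued arguments; `φ` embeds the algebra of coefficients. -/
def eval (S : QuadAction κ V₁ V₂) (φ : Grassmann κ →ₐ[ℂ] Grassmann τ)
    (x : V₁.Idx → Grassmann τ) (q : V₂.Idx → Grassmann τ) : Grassmann τ :=
  φ S.const + ∑ a, x a * φ (S.linX a) + ∑ i, φ (S.linQ i) * q i
    + (1 / 2 : ℂ) • ∑ a, ∑ b, x a * x b * φ (S.xx b a)
    + ∑ a, ∑ i, x a * φ (S.xq a i) * q i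
    + (1 / 2 : ℂ) • ∑ i, ∑ j, φ (S.qq i j) * q j * q i

/-- The (left) partial derivative `∂S/∂xᵃ (x,q)`. -/
def derivX (S : QuadAction κ V₁ V₂) (φ : Grassmann κ →ₐ[ℂ] Grassmann τ)
    (x : V₁.Idx → Grassmann τ) (q : V₂.Idx → Grassmann τ) (a : V₁.Idx) : Grassmann τ :=
  φ (S.linX a) + ∑ b, x b * φ (S.xx b a) + ∑ i, φ (S.xq a i) * q i

/-- The (left) partial derivative with its sign, `(-1)^ĩ ∂S/∂q_i (x,q)`. -/
def derivQ (S : QuadAction κ V₁ V₂) (φ : Grassmann κ →ₐ[ℂ] Grassmann τ)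
    (x : V₁.Idx → Grassmann τ) (q : V₂.Idx → Grassmann τ) (i : V₂.Idx) : Grassmann τ :=
  φ (S.linQ i) + ∑ a, x a * φ (S.xq a i) + ∑ j, φ (S.qq i j) * q j

/-- Add a constant to an action. -/
def addConst (S : QuadAction κ V₁ V₂) (c : GEven κ) : QuadAction κ V₁ V₂ :=
  { S with const := S.const + c }

/-- The canonical relation of `S`, on points over the Grassmann algebra with `M` extra generators:
`((x,p),(y,q))` with `p_a = ∂S/∂xᵃ`, `yⁱ = (-1)^ĩ ∂S/∂q_i`. -/
def rel (S : QuadAction κ V₁ V₂) (M : ℕ) :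
    Set (((V₁.Idx → Grassmann (κ ⊕ Fin M)) × (V₁.Idx → Grassmann (κ ⊕ Fin M))) ×
      ((V₂.Idx → Grassmann (κ ⊕ Fin M)) × (V₂.Idx → Grassmann (κ ⊕ Fin M)))) :=
  {P | IsPoint P.1.1 ∧ IsPoint P.1.2 ∧ IsPoint P.2.1 ∧ IsPoint P.2.2 ∧
    (∀ a, P.1.2 a = S.derivX (genMap Sum.inl) P.1.1 P.2.2 a) ∧
    (∀ i, P.2.1 i = S.derivQ (genMap Sum.inl) P.1.1 P.2.2 i)}

end QuadAction

theorem gen_mem (κ : Type) {α β : Type} (i j : α ⊕ β) [DecidableEq (α ⊕ β)] :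
    (if i = j then (1 : Grassmann κ) else 0) ∈ parityPart κ (par i + par j) := by
  split_ifs with h
  · subst h
    have : par i + par i = 0 := by
      have : ∀ z : ZMod 2, z + z = 0 := by decide
      exact this _
    rw [this]
    exact (CliffordAlgebra.even (0 : QuadraticForm ℂ (κ →₀ ℂ))).one_mem
  · exact Submodule.zero_mem _

/-- The action `xᵃ q_a` of the identity morphism. -/
def idAction (κ : Type) (V : SuperSpace) : QuadAction κ V V where
  const := 0
  linX _ := 0
  linQ _ := 0
  xx _ _ := 0
  xq a i := if a = i then 1 else 0
  qq _ _ := 0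
  linX_parity _ := Submodule.zero_mem _
  linQ_parity _ := Submodule.zero_mem _
  xx_parity _ _ := Submodule.zero_mem _
  xq_parity a i := gen_mem κ a i
  qq_parity _ _ := Submodule.zero_mem _
  xx_symm _ _ := by simp
  qq_symm _ _ := by simp
  linX_real _ := Subalgebra.zero_mem _
  linQ_real _ := Subalgebra.zero_mem _
  xx_real _ _ := Subalgebra.zero_mem _
  xq_real a i := by
    split_ifs
    · exact Subalgebra.one_mem _
    · exact Subalgebra.zero_mem _
  qq_real _ _ := Subalgebra.zero_mem _

/-! ### Classical composition -/

/-- The matrix `T_{ik} S^{kj} (-1)^k̃`. -/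
def tsMatrix {κ : Type} {V : SuperSpace} (T S : V.Idx → V.Idx → Grassmann κ) :
    Matrix V.Idx V.Idx (Grassmann κ) :=
  Matrix.of fun i j => ∑ k, sgn k • (T i k * S k j)

/-- Non-degeneracy: the matrix `δ_iʲ - T_{ik} S^{kj} (-1)^k̃` is invertible. -/
def Composable {κ : Type} {V₁ V₂ V₃ : SuperSpace} (S₃₂ : QuadAction κ V₂ V₃)
    (S₂₁ : QuadAction κ V₁ V₂) : Prop :=
  IsUnit (1 - tsMatrix S₃₂.xx S₂₁.qq)

/-- `S₃₁` is the generating function of the classical composition: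
`S₃₁(x,r) = S₃₂(y,r) + S₂₁(x,q) - yⁱ q_i`, where `q_i = ∂S₃₂/∂yⁱ (y,r)` and
`yⁱ = (-1)^ĩ ∂S₂₁/∂q_i (x,q)` (and these equations determine `y` and `q`). -/
def IsClassicalComposite {κ : Type} {V₁ V₂ V₃ : SuperSpace} (S₃₂ : QuadAction κ V₂ V₃)
    (S₂₁ : QuadAction κ V₁ V₂) (S₃₁ : QuadAction κ V₁ V₃) : Prop :=
  ∀ (M : ℕ) (x : V₁.Idx → Grassmann (κ ⊕ Fin M)) (r : V₃.Idx → Grassmann (κ ⊕ Fin M)),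
    IsPoint x → IsPoint r →
    (∃! yq : (V₂.Idx → Grassmann (κ ⊕ Fin M)) × (V₂.Idx → Grassmann (κ ⊕ Fin M)),
      IsPoint yq.1 ∧ IsPoint yq.2 ∧
      (∀ i, yq.2 i = S₃₂.derivX (genMap Sum.inl) yq.1 r i) ∧
      (∀ i, yq.1 i = S₂₁.derivQ (genMap Sum.inl) x yq.2 i)) ∧
    ∀ y q : V₂.Idx → Grassmann (κ ⊕ Fin M), IsPoint y → IsPoint q →
      (∀ i, q i = S₃₂.derivX (genMap Sum.inl) y r i) →
      (∀ i, y i = S₂₁.derivQ (genMap Sum.inl) x q i) →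
      S₃₁.eval (genMap Sum.inl) x r =
        S₃₂.eval (genMap Sum.inl) y r + S₂₁.eval (genMap Sum.inl) x q - pairing y q

/-! ### Integration over `T*V` with the normalized Liouville measure -/

/-- The normalized Berezin integral over odd variables `ηʲ = gen (inr (inl j))` and
`θ_j = gen (inr (inr j))`: the normalization is such that `exp (-(i/ħ) ηʲ θ_j)` has integral `1`. -/
def berezin (ħ : ℝ) {σ : Type} (m : ℕ) :
    Grassmann (σ ⊕ (Fin m ⊕ Fin m)) →ₗ[ℂ] Grassmann σ :=
  (ExteriorAlgebra.map
      (Finsupp.linearCombination ℂ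
        (Sum.elim (fun k : σ => Finsupp.single k (1 : ℂ)) fun _ => 0))).toLinearMap ∘ₗ
    (List.ofFn fun j : Fin m =>
      ((Complex.I * ħ) • (oddDeriv (Sum.inr (Sum.inr j)) ∘ₗ oddDeriv (Sum.inr (Sum.inl j))) :
        Module.End ℂ (Grassmann (σ ⊕ (Fin m ⊕ Fin m))))).prod

/-- `∫ đ(y,q) f(y,q) = I`, as an oscillatory integral, over `T*V` where `V` is `n|m`-dimensional.
The even coordinates run over `ℝⁿ × ℝⁿ` with the measure `dy dq / (2πħ)ⁿ` and the integral is the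
limit for `ε → 0+` of absolutely convergent integrals with the factor `exp (-ε(|y|² + |q|²))`;
the odd coordinates are integrated by the Berezin integral. Convergence in the finite-dimensional
algebra of values is convergence of all coordinates. -/
def HasSuperIntegral (ħ : ℝ) {σ : Type} (n m : ℕ)
    (f : (Fin n → ℝ) → (Fin n → ℝ) → Grassmann (σ ⊕ (Fin m ⊕ Fin m))) (I : Grassmann σ) : Prop :=
  ∀ l : Module.Dual ℂ (Grassmann σ),
    (∀ ε : ℝ, 0 < ε → Integrable (fun v : (Fin n → ℝ) × (Fin n → ℝ) =>
      (Real.exp (-ε * (∑ j, (v.1 j ^ 2 + v.2 j ^ 2))) : ℂ) * l (berezin ħ m (f v.1 v.2)))) ∧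
    Tendsto (fun ε : ℝ => ((2 * Real.pi * ħ : ℝ) : ℂ)⁻¹ ^ n *
        ∫ v : (Fin n → ℝ) × (Fin n → ℝ),
          (Real.exp (-ε * (∑ j, (v.1 j ^ 2 + v.2 j ^ 2))) : ℂ) * l (berezin ħ m (f v.1 v.2)))
      (𝓝[>] 0) (𝓝 (l I))

/-- The point with real even coordinates `e` and with Grassmann generators as odd coordinates, i.e.
the coordinate functions of a superspace. -/
def coords {τ : Type} {V : SuperSpace} (e : Fin V.even → ℝ) (o : Fin V.odd → τ) :
    V.Idx → Grassmann τ :=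
  Sum.elim (fun a => algebraMap ℂ _ (e a)) (fun a => gen (o a))

/-- `S₃₁` is an action of the composition of the quantum thick morphisms with actions
`S₃₂` and `S₂₁`: `exp ((i/ħ) S₃₁(x,r)) = ∫ đ(y,q) exp ((i/ħ) (S₃₂(y,r) + S₂₁(x,q) - yⁱ q_i))`,
as functions of `x, r`, that is, for real even and free odd coordinates. -/
def IsQuantumComposite (ħ : ℝ) {κ : Type} {V₁ V₂ V₃ : SuperSpace} (S₃₂ : QuadAction κ V₂ V₃)
    (S₂₁ : QuadAction κ V₁ V₂) (S₃₁ : QuadAction κ V₁ V₃) : Prop :=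
  ∀ (xe : Fin V₁.even → ℝ) (re : Fin V₃.even → ℝ),
    HasSuperIntegral ħ (σ := κ ⊕ (Fin V₁.odd ⊕ Fin V₃.odd)) V₂.even V₂.odd
      (fun ye qe =>
        let x := coords (V := V₁) xe (fun a => Sum.inl (Sum.inr (Sum.inl a)))
        let r := coords (V := V₃) re (fun a => Sum.inl (Sum.inr (Sum.inr a)))
        let y := coords (V := V₂) ye (fun a => Sum.inr (Sum.inl a))
        let q := coords (V := V₂) qe (fun a => Sum.inr (Sum.inr a))
        let φ := genMap (Sum.inl ∘ Sum.inl)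
        gexp ((Complex.I / ħ) • (S₃₂.eval φ y r + S₂₁.eval φ x q - pairing y q)))
      (gexp ((Complex.I / ħ) • S₃₁.eval (genMap Sum.inl)
        (coords xe (fun a => Sum.inr (Sum.inl a))) (coords re (fun a => Sum.inr (Sum.inr a)))))

/-! ### Wave functions and quantum pullbacks -/

/-- Functions on the superspace `V` with parameters from the Grassmann algebra on `κ`: functions of
the real even coordinates, with values in the Grassmann algebra on `κ` and the odd coordinates. -/
abbrev WaveFun (κ : Type) (V : SuperSpace) : Type :=
  (Fin V.even → ℝ) → Grassmann (κ ⊕ Fin V.odd)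

/-- Schwartz superfunctions: every coordinate of the value is a Schwartz function. -/
def IsSchwartz {κ : Type} {V : SuperSpace} (w : WaveFun κ V) : Prop :=
  ∀ l : Module.Dual ℂ (Grassmann (κ ⊕ Fin V.odd)),
    ∃ f : 𝓢(Fin V.even → ℝ, ℂ), ∀ y, f y = l (w y)

/-- `u = Φ̂* w`, where `Φ̂ : V₁ → V₂` is the quantum thick morphism with action `S`:
`u(x) = ∫ đ(y,q) exp ((i/ħ) (S(x,q) - yⁱ q_i)) w(y)`. -/
def IsPullback (ħ : ℝ) {κ : Type} {V₁ V₂ : SuperSpace} (S : QuadAction κ V₁ V₂)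
    (w : WaveFun κ V₂) (u : WaveFun κ V₁) : Prop :=
  ∀ xe : Fin V₁.even → ℝ,
    HasSuperIntegral ħ (σ := κ ⊕ Fin V₁.odd) V₂.even V₂.odd
      (fun ye qe =>
        let x := coords (V := V₁) xe (fun a => Sum.inl (Sum.inr a))
        let y := coords (V := V₂) ye (fun a => Sum.inr (Sum.inl a))
        let q := coords (V := V₂) qe (fun a => Sum.inr (Sum.inr a))
        gexp ((Complex.I / ħ) • (S.eval (genMap (Sum.inl ∘ Sum.inl)) x q - pairing y q)) *
          genMap (Sum.elim (Sum.inl ∘ Sum.inl) (Sum.inr ∘ Sum.inl)) (w ye))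
      (u xe)

end

end SuperThick

set_option linter.unusedSectionVars false

open Sum (inl inr elim elim_inl elim_inr)
open Submodule (smul_mem)
local notation "Λ" => SuperThick.Grassmann
open Finset (sum_congr univ sum_mul mul_sum sum_add_distrib sum_const_zero mem_univ smul_sum sum_neg_distrib sum_comm prod_mul_distrib)
open scoped Real
open Real (pi_pos pi_ne_zero)
local notation:max "𝕋" n:max => Fin n ⊕ Fin n → ℝ
local notation:max σ " ⧺ " m:max => σ ⊕ (Fin m ⊕ Fin m)

namespace SuperThick

section Basics

variable {σ τ υ : Type}

/-- The body of an element of a Grassmann algebra: its scalar component. -/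
noncomputable abbrev body : Λ τ →ₐ[ℂ] ℂ := ExteriorAlgebra.algebraMapInv

/-- The soul of an element of a Grassmann algebra: the element minus its body. -/
noncomputable def soul (a : Λ τ) : Λ τ := a - algebraMap ℂ _ (body a)

theorem gen_def (k : τ) : gen k = ExteriorAlgebra.ι ℂ (Finsupp.single k 1) := rfl

theorem body_ι (v : τ →₀ ℂ) : body (ExteriorAlgebra.ι ℂ v) = 0 := by
  simp [body, ExteriorAlgebra.algebraMapInv]

@[simp] theorem body_gen (k : τ) : body (gen k) = 0 := body_ι _

theorem gen_odd (k : τ) : gen k ∈ parityPart τ 1 := CliffordAlgebra.ι_mem_evenOdd_one _ _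

theorem ι_eq_sum_gen (v : τ →₀ ℂ) :
    ExteriorAlgebra.ι ℂ v = v.sum fun k c => c • gen k := by
  classical
  conv_lhs => rw [← v.sum_single]
  rw [Finsupp.sum, map_sum]
  refine sum_congr rfl fun k _ => ?_
  change ExteriorAlgebra.ι ℂ (Finsupp.single k (v k)) = v k • gen k
  rw [gen_def, ← map_smul, Finsupp.smul_single, smul_eq_mul, mul_one]

/-- Induction on the elements of a Grassmann algebra. -/
theorem grassmann_induction {p : Λ τ → Prop} (hC : ∀ r : ℂ, p (algebraMap ℂ _ r))
    (hadd : ∀ x y, p x → p y → p (x + y)) (hgen : ∀ k x, p x → p (gen k * x)) (x : Λ τ) :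
    p x := by
  suffices h : ∀ x : Λ τ, ∀ c : ℂ, p (c • x) by simpa using h x 1
  intro x
  induction x using CliffordAlgebra.left_induction with
  | algebraMap r => intro c; rw [Algebra.smul_def]; exact (map_mul (algebraMap ℂ (Λ τ)) c r) ▸ hC (c * r)
  | add x y hx hy => intro c; rw [smul_add]; exact hadd _ _ (hx c) (hy c)
  | ι_mul x m hx =>
    intro c
    change p (c • (ExteriorAlgebra.ι ℂ m * x))
    rw [ι_eq_sum_gen, Finsupp.sum, sum_mul, smul_sum]
    refine Finset.sum_induction _ p hadd (by simpa using hC 0) fun k _ => ?_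
    rw [smul_mul_assoc, smul_smul, ← mul_smul_comm]
    exact hgen _ _ (hx _)

theorem grassmann_hom_ext {A : Type*} [Semiring A] [Algebra ℂ A] {f g : Λ τ →ₐ[ℂ] A}
    (h : ∀ k, f (gen k) = g (gen k)) : f = g := by
  refine ExteriorAlgebra.hom_ext (Finsupp.lhom_ext' fun k => LinearMap.ext_ring ?_)
  exact h k

theorem map_gen (f : (σ →₀ ℂ) →ₗ[ℂ] (τ →₀ ℂ)) (k : σ) :
    ExteriorAlgebra.map f (gen k) = ExteriorAlgebra.ι ℂ (f (Finsupp.single k 1)) :=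
  ExteriorAlgebra.map_apply_ι _ _

@[simp] theorem genMap_gen (f : σ → τ) (k : σ) : genMap f (gen k) = gen (f k) := by
  rw [genMap, map_gen, gen, Finsupp.lmapDomain_apply, Finsupp.mapDomain_single]

theorem genMap_genMap (g : τ → υ) (f : σ → τ) (x : Λ σ) :
    genMap g (genMap f x) = genMap (g ∘ f) x := by
  have : (genMap g).comp (genMap f) = genMap (g ∘ f) := grassmann_hom_ext fun k => by simp
  exact DFunLike.congr_fun this x

@[simp] theorem body_map (f : (σ →₀ ℂ) →ₗ[ℂ] (τ →₀ ℂ)) (x : Λ σ) :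
    body (ExteriorAlgebra.map f x) = body x := by
  have : body.comp (ExteriorAlgebra.map f) = body := grassmann_hom_ext fun k => by
    simp [map_gen, body_ι]
  exact DFunLike.congr_fun this x

@[simp] theorem body_genMap (f : σ → τ) (x : Λ σ) : body (genMap f x) = body x :=
  body_map _ x

@[simp] theorem body_algebraMap (r : ℂ) : body (algebraMap ℂ (Λ τ) r) = r := by simp

/-! Parity -/

/-- The parity involution. -/
noncomputable abbrev inv : Λ τ →ₐ[ℂ] Λ τ := CliffordAlgebra.involute

@[simp] theorem inv_gen (k : τ) : inv (gen k) = -gen k := CliffordAlgebra.involute_ι _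

theorem mul_mem_parity {i j : ZMod 2} {x y : Λ τ} (hx : x ∈ parityPart τ i)
    (hy : y ∈ parityPart τ j) : x * y ∈ parityPart τ (i + j) :=
  (CliffordAlgebra.evenOdd_mul_le (0 : QuadraticForm ℂ (τ →₀ ℂ)) i j)
    (Submodule.mul_mem_mul hx hy)

theorem algebraMap_even (r : ℂ) : algebraMap ℂ (Λ τ) r ∈ parityPart τ 0 :=
  Subalgebra.algebraMap_mem (GEven τ) r

theorem one_even : (1 : Λ τ) ∈ parityPart τ 0 := Subalgebra.one_mem (GEven τ)

theorem inv_of_even {x : Λ τ} (h : x ∈ parityPart τ 0) : inv x = x :=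
  CliffordAlgebra.involute_eq_of_mem_even h

theorem inv_of_odd {x : Λ τ} (h : x ∈ parityPart τ 1) : inv x = -x :=
  CliffordAlgebra.involute_eq_of_mem_odd h

theorem exists_even_add_odd (x : Λ τ) :
    ∃ y ∈ parityPart τ 0, ∃ z ∈ parityPart τ 1, y + z = x := by
  have h := (CliffordAlgebra.evenOdd_isCompl (0 : QuadraticForm ℂ (τ →₀ ℂ))).sup_eq_top
  have hx : x ∈ (⊤ : Submodule ℂ (Λ τ)) := trivial
  rw [← h] at hx
  exact Submodule.mem_sup.1 hx

theorem even_iff {x : Λ τ} : x ∈ parityPart τ 0 ↔ inv x = x := by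
  refine ⟨inv_of_even, fun h => ?_⟩
  obtain ⟨y, hy, z, hz, rfl⟩ := exists_even_add_odd x
  rw [map_add, inv_of_even hy, inv_of_odd hz] at h
  have h2 : (2 : ℂ) • z = 0 := by
    rw [two_smul, ← sub_eq_zero.2 h.symm]; abel
  rw [smul_eq_zero_iff_right two_ne_zero] at h2
  rwa [h2, add_zero]

theorem odd_iff {x : Λ τ} : x ∈ parityPart τ 1 ↔ inv x = -x := by
  refine ⟨inv_of_odd, fun h => ?_⟩
  obtain ⟨y, hy, z, hz, rfl⟩ := exists_even_add_odd x
  rw [map_add, inv_of_even hy, inv_of_odd hz] at h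
  have h2 : (2 : ℂ) • y = 0 := by
    rw [two_smul, ← sub_eq_zero.2 h]; abel
  rw [smul_eq_zero_iff_right two_ne_zero] at h2
  rwa [h2, zero_add]

theorem inv_map (f : (σ →₀ ℂ) →ₗ[ℂ] (τ →₀ ℂ)) (x : Λ σ) :
    inv (ExteriorAlgebra.map f x) = ExteriorAlgebra.map f (inv x) := by
  have : (inv (τ := τ)).comp (ExteriorAlgebra.map f) = (ExteriorAlgebra.map f).comp inv :=
    grassmann_hom_ext fun k => by
      simp only [AlgHom.comp_apply, map_gen, inv_gen, map_neg]
      exact CliffordAlgebra.involute_ι _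
  exact DFunLike.congr_fun this x

theorem zmod_two_cases (i : ZMod 2) : i = 0 ∨ i = 1 := by revert i; decide

theorem map_mem_parity (f : (σ →₀ ℂ) →ₗ[ℂ] (τ →₀ ℂ)) {i : ZMod 2} {x : Λ σ}
    (h : x ∈ parityPart σ i) : ExteriorAlgebra.map f x ∈ parityPart τ i := by
  rcases zmod_two_cases i with rfl | rfl
  · rw [even_iff, inv_map, inv_of_even h]
  · rw [odd_iff, inv_map, inv_of_odd h, map_neg]

theorem genMap_mem_parity (f : σ → τ) {i : ZMod 2} {x : Λ σ}
    (h : x ∈ parityPart σ i) : genMap f x ∈ parityPart τ i := map_mem_parity _ h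

theorem even_comm {x : Λ τ} (h : x ∈ parityPart τ 0) (y : Λ τ) :
    x * y = y * x := commute_of_even h y

theorem gen_mul (k : τ) (y : Λ τ) : gen k * y = inv y * gen k := by
  induction y using CliffordAlgebra.left_induction with
  | algebraMap r =>
    rw [AlgHom.commutes]; exact (Algebra.commutes _ _).symm
  | add x y hx hy => rw [mul_add, hx, hy, map_add, add_mul]
  | ι_mul x m hx =>
    have h1 := ExteriorAlgebra.ι_add_mul_swap (R := ℂ) (Finsupp.single k (1:ℂ)) m
    have h2 : gen k * ExteriorAlgebra.ι ℂ m = - (ExteriorAlgebra.ι ℂ m * gen k) :=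
      eq_neg_of_add_eq_zero_left h1
    rw [← mul_assoc, map_mul]
    have h3 : inv (CliffordAlgebra.ι (0 : QuadraticForm ℂ (τ →₀ ℂ)) m) =
      - CliffordAlgebra.ι (0 : QuadraticForm ℂ (τ →₀ ℂ)) m := CliffordAlgebra.involute_ι m
    rw [h3]
    change gen k * ExteriorAlgebra.ι ℂ m * x = _
    rw [h2, neg_mul, mul_assoc, hx, neg_mul, neg_mul, mul_assoc]

theorem odd_mul {x : Λ τ} (h : x ∈ parityPart τ 1) (y : Λ τ) :
    x * y = inv y * x := by
  induction x, h using CliffordAlgebra.odd_induction with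
  | ι v =>
    change ExteriorAlgebra.ι ℂ v * y = inv y * ExteriorAlgebra.ι ℂ v
    rw [ι_eq_sum_gen, Finsupp.sum, sum_mul, mul_sum]
    refine sum_congr rfl fun k _ => ?_
    rw [smul_mul_assoc, mul_smul_comm, gen_mul]
  | add x y hx hy h1 h2 => rw [add_mul, mul_add, h1, h2]
  | ι_mul_ι_mul m₁ m₂ x hx h =>
    have he : CliffordAlgebra.ι (0 : QuadraticForm ℂ (τ →₀ ℂ)) m₁ * CliffordAlgebra.ι 0 m₂ ∈
      parityPart τ 0 := CliffordAlgebra.ι_mul_ι_mem_evenOdd_zero _ _ _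
    rw [mul_assoc, h, ← mul_assoc, even_comm he, mul_assoc]

theorem body_odd {x : Λ τ} (h : x ∈ parityPart τ 1) : body x = 0 := by
  have h1 : body.comp (inv (τ := τ)) = body := grassmann_hom_ext fun k => by simp
  have h2 := DFunLike.congr_fun h1 x
  rw [AlgHom.comp_apply, inv_of_odd h, map_neg] at h2
  exact self_eq_neg.1 h2.symm

/-! Nilpotency of souls and the exponential -/

theorem soul_even {x : Λ τ} (h : x ∈ parityPart τ 0) : soul x ∈ parityPart τ 0 :=
  sub_mem h (algebraMap_even _)

theorem body_add_soul (x : Λ τ) : algebraMap ℂ _ (body x) + soul x = x := by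
  simp [soul]

theorem body_soul (x : Λ τ) : body (soul x) = 0 := by simp [soul]

theorem isNilpotent_soul {x : Λ τ} (h : x ∈ parityPart τ 0) : IsNilpotent (soul x) := by
  induction x, h using CliffordAlgebra.even_induction with
  | algebraMap r =>
    rw [soul, show body (algebraMap ℂ (CliffordAlgebra (0 : QuadraticForm ℂ (τ →₀ ℂ))) r) = r from
      body_algebraMap r]
    simp
  | add x y hx hy h1 h2 =>
    have : soul (x + y) = soul x + soul y := by
      simp only [soul, map_add]; abel
    rw [this]
    exact (commute_of_even (soul_even hx) _).isNilpotent_add h1 h2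
  | ι_mul_ι_mul m₁ m₂ x hx h =>
    have he : CliffordAlgebra.ι (0 : QuadraticForm ℂ (τ →₀ ℂ)) m₁ * CliffordAlgebra.ι 0 m₂ ∈
      parityPart τ 0 := CliffordAlgebra.ι_mul_ι_mem_evenOdd_zero _ _ _
    have h0 : soul (CliffordAlgebra.ι (0 : QuadraticForm ℂ (τ →₀ ℂ)) m₁ *
        CliffordAlgebra.ι 0 m₂ * x) =
        CliffordAlgebra.ι (0 : QuadraticForm ℂ (τ →₀ ℂ)) m₁ * CliffordAlgebra.ι 0 m₂ * x := by
      have : body (CliffordAlgebra.ι (0 : QuadraticForm ℂ (τ →₀ ℂ)) m₁) = 0 := body_ι m₁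
      rw [soul, map_mul body, map_mul body, this]; simp
    rw [h0]
    refine (commute_of_even he x).isNilpotent_mul_right ⟨2, ?_⟩
    set a := CliffordAlgebra.ι (0 : QuadraticForm ℂ (τ →₀ ℂ)) m₁
    set b := CliffordAlgebra.ι (0 : QuadraticForm ℂ (τ →₀ ℂ)) m₂
    have hb : b * b = 0 := ExteriorAlgebra.ι_sq_zero m₂
    rw [pow_two, mul_assoc, ← even_comm he b, mul_assoc a b b, hb, mul_zero, mul_zero]

theorem isNilpotent_of_even {x : Λ τ} (h : x ∈ parityPart τ 0) (hb : body x = 0) :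
    IsNilpotent x := by
  have := isNilpotent_soul h
  rwa [soul, hb, map_zero, sub_zero] at this

theorem gexp_eq (a : Λ τ) :
    gexp a = Complex.exp (body a) • IsNilpotent.exp (soul a) := rfl

theorem gexp_add {a b : Λ τ} (ha : a ∈ parityPart τ 0) (hb : b ∈ parityPart τ 0) :
    gexp (a + b) = gexp a * gexp b := by
  have : soul (a + b) = soul a + soul b := by simp only [soul, map_add]; abel
  rw [gexp_eq, gexp_eq, gexp_eq, this, map_add, Complex.exp_add,
    IsNilpotent.exp_add_of_commute (commute_of_even (soul_even ha) _) (isNilpotent_soul ha)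
      (isNilpotent_soul hb), smul_mul_smul_comm]

@[simp] theorem gexp_zero : gexp (0 : Λ τ) = 1 := by simp [gexp]

theorem gexp_algebraMap (r : ℂ) :
    gexp (algebraMap ℂ (Λ τ) r) = algebraMap ℂ _ (Complex.exp r) := by
  simp [gexp, Algebra.algebraMap_eq_smul_one]

theorem gexp_of_body {a : Λ τ} (h : body a = 0) : gexp a = IsNilpotent.exp a := by
  rw [gexp_eq, soul, h]; simp

theorem rat_smul_mem {s : Submodule ℂ (Λ τ)} (q : ℚ) {x : Λ τ} (h : x ∈ s) :
    q • x ∈ s := by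
  rw [← Rat.cast_smul_eq_qsmul ℂ]; exact s.smul_mem _ h

theorem gexp_even {a : Λ τ} (ha : a ∈ parityPart τ 0) : gexp a ∈ parityPart τ 0 := by
  refine smul_mem _ _ (sum_mem fun i _ => rat_smul_mem _ ?_)
  exact Subalgebra.pow_mem (GEven τ) (soul_even ha) i

theorem body_gexp {a : Λ τ} (ha : a ∈ parityPart τ 0) :
    body (gexp a) = Complex.exp (body a) := by
  rw [gexp_eq, map_smul, IsNilpotent.map_exp (isNilpotent_soul ha), body_soul]
  simp

theorem gexp_mul_neg {a : Λ τ} (ha : a ∈ parityPart τ 0) : gexp a * gexp (-a) = 1 := by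
  rw [← gexp_add ha (neg_mem ha), add_neg_cancel, gexp_zero]

theorem map_gexp (f : (σ →₀ ℂ) →ₗ[ℂ] (τ →₀ ℂ)) {a : Λ σ} (ha : a ∈ parityPart σ 0) :
    ExteriorAlgebra.map f (gexp a) = gexp (ExteriorAlgebra.map f a) := by
  rw [gexp_eq, gexp_eq, map_smul, IsNilpotent.map_exp (isNilpotent_soul ha), body_map]
  congr 2
  simp [soul]

theorem genMap_gexp (f : σ → τ) {a : Λ σ} (ha : a ∈ parityPart σ 0) :
    genMap f (gexp a) = gexp (genMap f a) := map_gexp _ ha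

/-- A linear map that satisfies the Leibniz rule at an even element `a` satisfies the chain rule
for the exponential of `a`. -/
theorem deriv_gexp (D : Λ τ →ₗ[ℂ] Λ τ) {a : Λ τ}
    (ha : a ∈ parityPart τ 0) (h1 : D 1 = 0) (hD : ∀ b, D (a * b) = D a * b + a * D b) :
    D (gexp a) = D a * gexp a := by
  have hC : ∀ r : ℂ, D (algebraMap ℂ _ r) = 0 := fun r => by
    rw [Algebra.algebraMap_eq_smul_one, map_smul, h1, smul_zero]
  have hs : D (soul a) = D a := by rw [soul, map_sub, hC, sub_zero]
  have hD' : ∀ b, D (soul a * b) = D a * b + soul a * D b := fun b => by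
    rw [soul, sub_mul, map_sub, hD, ← Algebra.smul_def, map_smul, Algebra.smul_def, sub_mul]
    abel
  have hpow : ∀ n : ℕ, D (soul a ^ (n + 1)) = ((n + 1 : ℕ) : ℂ) • (D a * soul a ^ n) := by
    intro n
    induction n with
    | zero => simp [hs]
    | succ n ih =>
      rw [pow_succ' (soul a) (n + 1), hD', ih, mul_smul_comm, ← mul_assoc,
        even_comm (soul_even ha) (D a), mul_assoc, ← pow_succ', Nat.cast_succ (n + 1), add_smul,
        one_smul, add_comm]
  obtain ⟨k, hk⟩ := isNilpotent_soul ha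
  have hk' : soul a ^ (k + 1) = 0 := by rw [pow_succ, hk, zero_mul]
  rw [gexp_eq, map_smul, mul_smul_comm, IsNilpotent.exp_eq_sum hk']
  conv_rhs => rw [← IsNilpotent.exp_eq_sum hk', IsNilpotent.exp_eq_sum hk]
  rw [Finset.sum_range_succ', map_add, map_sum, mul_sum]
  simp only [pow_zero, Nat.factorial_zero, Nat.cast_one, inv_one, one_smul, h1, add_zero]
  congr 1
  refine sum_congr rfl fun i _ => ?_
  rw [← Rat.cast_smul_eq_qsmul ℂ, map_smul, hpow, ← Rat.cast_smul_eq_qsmul ℂ, mul_smul_comm,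
    smul_smul]
  congr 1
  rw [Nat.factorial_succ]
  push_cast
  field_simp

/-! Odd derivatives -/

@[simp] theorem oddDeriv_algebraMap (k : τ) (r : ℂ) : oddDeriv k (algebraMap ℂ _ r) = 0 :=
  CliffordAlgebra.contractLeft_algebraMap _ _ _

@[simp] theorem oddDeriv_one (k : τ) : oddDeriv k 1 = 0 := CliffordAlgebra.contractLeft_one _ _

theorem oddDeriv_ι_mul (k : τ) (v : τ →₀ ℂ) (y : Λ τ) :
    oddDeriv k (ExteriorAlgebra.ι ℂ v * y) = v k • y - ExteriorAlgebra.ι ℂ v * oddDeriv k y :=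
  CliffordAlgebra.contractLeft_ι_mul _ _ _

theorem oddDeriv_gen_mul [DecidableEq τ] (k j : τ) (y : Λ τ) :
    oddDeriv k (gen j * y) = (if j = k then y else 0) - gen j * oddDeriv k y := by
  rw [gen_def, oddDeriv_ι_mul, Finsupp.single_apply]
  split_ifs <;> simp

theorem oddDeriv_gen [DecidableEq τ] (k j : τ) :
    oddDeriv k (gen j) = if j = k then 1 else 0 := by
  have := oddDeriv_gen_mul k j 1
  simpa using this

theorem oddDeriv_mul (k : τ) (x y : Λ τ) :
    oddDeriv k (x * y) = oddDeriv k x * y + inv x * oddDeriv k y := by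
  induction x using CliffordAlgebra.left_induction with
  | algebraMap r =>
    rw [AlgHom.commutes]
    change oddDeriv k (algebraMap ℂ (Λ τ) r * y) = oddDeriv k (algebraMap ℂ (Λ τ) r) * y
      + algebraMap ℂ (Λ τ) r * oddDeriv k y
    rw [oddDeriv_algebraMap, zero_mul, zero_add, ← Algebra.smul_def, map_smul, Algebra.smul_def]
  | add a b ha hb => rw [add_mul, map_add, ha, hb, map_add, map_add, add_mul, add_mul]; abel
  | ι_mul x m hx =>
    change oddDeriv k (ExteriorAlgebra.ι ℂ m * x * y) = oddDeriv k (ExteriorAlgebra.ι ℂ m * x) * y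
      + inv (ExteriorAlgebra.ι ℂ m * x) * oddDeriv k y
    have h3 : inv (ExteriorAlgebra.ι ℂ m) = - ExteriorAlgebra.ι ℂ m :=
      CliffordAlgebra.involute_ι m
    rw [mul_assoc, oddDeriv_ι_mul, hx, oddDeriv_ι_mul, map_mul, h3, sub_mul, smul_mul_assoc]
    simp only [mul_add, neg_mul, mul_assoc]
    abel

theorem oddDeriv_even_mul (k : τ) {x : Λ τ} (hx : x ∈ parityPart τ 0) (y : Λ τ) :
    oddDeriv k (x * y) = oddDeriv k x * y + x * oddDeriv k y := by
  rw [oddDeriv_mul, inv_of_even hx]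

theorem oddDeriv_gexp (k : τ) {a : Λ τ} (ha : a ∈ parityPart τ 0) :
    oddDeriv k (gexp a) = oddDeriv k a * gexp a :=
  deriv_gexp _ ha (oddDeriv_one k) (oddDeriv_even_mul k ha)

theorem oddDeriv_comm (j k : τ) (x : Λ τ) :
    oddDeriv j (oddDeriv k x) = - oddDeriv k (oddDeriv j x) :=
  CliffordAlgebra.contractLeft_comm _ _ _

@[simp] theorem oddDeriv_self (k : τ) (x : Λ τ) : oddDeriv k (oddDeriv k x) = 0 :=
  CliffordAlgebra.contractLeft_contractLeft _ _

theorem inv_oddDeriv (k : τ) (x : Λ τ) : inv (oddDeriv k x) = - oddDeriv k (inv x) := by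
  induction x using CliffordAlgebra.left_induction with
  | algebraMap r =>
    change inv (oddDeriv k (algebraMap ℂ (Λ τ) r)) =
      - oddDeriv k (inv (algebraMap ℂ (Λ τ) r))
    rw [AlgHom.commutes, oddDeriv_algebraMap]; simp
  | add a b ha hb => simp only [map_add, ha, hb, neg_add]
  | ι_mul x m hx =>
    change inv (oddDeriv k (ExteriorAlgebra.ι ℂ m * x)) =
      - oddDeriv k (inv (ExteriorAlgebra.ι ℂ m * x))
    have h3 : inv (ExteriorAlgebra.ι ℂ m) = - ExteriorAlgebra.ι ℂ m :=
      CliffordAlgebra.involute_ι m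
    rw [oddDeriv_ι_mul, map_sub, map_mul, map_mul, hx, map_smul, h3, neg_mul, neg_mul,
      map_neg, oddDeriv_ι_mul]
    simp only [mul_neg]; abel

/-- Derivatives commute with maps of the generators. -/
theorem oddDeriv_map (f : (σ →₀ ℂ) →ₗ[ℂ] (τ →₀ ℂ)) {k : σ} {k' : τ} {c : ℂ}
    (h : ∀ v, f v k' = c * v k) (x : Λ σ) :
    oddDeriv k' (ExteriorAlgebra.map f x) = c • ExteriorAlgebra.map f (oddDeriv k x) := by
  induction x using CliffordAlgebra.left_induction with
  | algebraMap r =>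
    change oddDeriv k' (ExteriorAlgebra.map f (algebraMap ℂ (Λ σ) r)) =
      c • ExteriorAlgebra.map f (oddDeriv k (algebraMap ℂ (Λ σ) r))
    rw [AlgHom.commutes, oddDeriv_algebraMap, oddDeriv_algebraMap]; simp
  | add a b ha hb => simp only [map_add, ha, hb, smul_add]
  | ι_mul x m hx =>
    change oddDeriv k' (ExteriorAlgebra.map f (ExteriorAlgebra.ι ℂ m * x)) =
      c • ExteriorAlgebra.map f (oddDeriv k (ExteriorAlgebra.ι ℂ m * x))
    rw [map_mul, ExteriorAlgebra.map_apply_ι, oddDeriv_ι_mul, oddDeriv_ι_mul, hx, map_sub,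
      map_smul, map_mul, ExteriorAlgebra.map_apply_ι, h, smul_sub, mul_smul, mul_smul_comm]

end Basics

section Euler

variable {σ τ : Type} [Fintype σ] [Fintype τ]

/-- The derivation that multiplies each generator `gen k` by the weight `ω k`. -/
noncomputable def euler (ω : τ → ℂ) : Λ τ →ₗ[ℂ] Λ τ :=
  ∑ k, ω k • (LinearMap.mulLeft ℂ (gen k) ∘ₗ oddDeriv k)

theorem euler_apply (ω : τ → ℂ) (x : Λ τ) :
    euler ω x = ∑ k, ω k • (gen k * oddDeriv k x) := by
  simp [euler, LinearMap.sum_apply]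

theorem euler_mul (ω : τ → ℂ) (x y : Λ τ) :
    euler ω (x * y) = euler ω x * y + x * euler ω y := by
  simp only [euler_apply, sum_mul, mul_sum, ← sum_add_distrib]
  refine sum_congr rfl fun k _ => ?_
  have h : gen k * inv x = x * gen k := by
    rw [gen_mul, show inv (inv x) = x from CliffordAlgebra.involute_involute x]
  rw [oddDeriv_mul, mul_add, ← mul_assoc (gen k) (inv x), h, smul_add, smul_mul_assoc,
    mul_smul_comm, mul_assoc, mul_assoc]

@[simp] theorem euler_algebraMap (ω : τ → ℂ) (r : ℂ) : euler ω (algebraMap ℂ _ r) = 0 := by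
  simp [euler_apply]

@[simp] theorem euler_one (ω : τ → ℂ) : euler ω 1 = 0 := by
  simp [euler_apply]

theorem euler_gen (ω : τ → ℂ) (k : τ) : euler ω (gen k) = ω k • gen k := by
  classical
  rw [euler_apply, Finset.sum_eq_single k]
  · rw [oddDeriv_gen, if_pos rfl, mul_one]
  · intro j _ hj
    rw [oddDeriv_gen, if_neg hj.symm, mul_zero, smul_zero]
  · simp

theorem euler_gexp (ω : τ → ℂ) {a : Λ τ} (ha : a ∈ parityPart τ 0) :
    euler ω (gexp a) = euler ω a * gexp a :=
  deriv_gexp _ ha (euler_one ω) (euler_mul ω a)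

theorem euler_map (f : (σ →₀ ℂ) →ₗ[ℂ] (τ →₀ ℂ)) (ω : σ → ℂ) (ω' : τ → ℂ)
    (h : ∀ k, euler ω' (ExteriorAlgebra.map f (gen k)) = ω k • ExteriorAlgebra.map f (gen k))
    (x : Λ σ) :
    euler ω' (ExteriorAlgebra.map f x) = ExteriorAlgebra.map f (euler ω x) := by
  induction x using grassmann_induction with
  | hC r => simp
  | hadd x y hx hy => simp only [map_add, hx, hy]
  | hgen k x hx =>
    rw [map_mul, euler_mul, euler_mul, h, hx, euler_gen, map_add, map_mul, map_mul, map_smul]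

theorem euler_genMap (f : σ → τ) (ω : σ → ℂ) (ω' : τ → ℂ) (h : ∀ k, ω' (f k) = ω k)
    (x : Λ σ) : euler ω' (genMap f x) = genMap f (euler ω x) := by
  refine euler_map _ _ _ (fun k => ?_) x
  have := genMap_gen f k
  rw [genMap] at this
  rw [this, euler_gen, h]

theorem inv_euler (ω : τ → ℂ) (x : Λ τ) : inv (euler ω x) = euler ω (inv x) := by
  simp only [euler_apply, map_sum, map_smul, map_mul, inv_gen, inv_oddDeriv, neg_mul_neg]

theorem euler_mem_parity (ω : τ → ℂ) {i : ZMod 2} {x : Λ τ} (h : x ∈ parityPart τ i) :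
    euler ω x ∈ parityPart τ i := by
  rcases zmod_two_cases i with rfl | rfl
  · rw [even_iff, inv_euler, inv_of_even h]
  · rw [odd_iff, inv_euler, inv_of_odd h, map_neg]

theorem oddDeriv_euler (ω : τ → ℂ) {j : τ} (hj : ω j = 0) (x : Λ τ) :
    oddDeriv j (euler ω x) = euler ω (oddDeriv j x) := by
  classical
  simp only [euler_apply, map_sum, map_smul]
  refine sum_congr rfl fun k _ => ?_
  by_cases h : k = j
  · subst h; simp [hj]
  · rw [oddDeriv_gen_mul, if_neg h, zero_sub, oddDeriv_comm j k, mul_neg, neg_neg]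

theorem euler_exteriorPower {n : ℕ} {x : Λ τ} (h : x ∈ ⋀[ℂ]^n (τ →₀ ℂ)) :
    euler (fun _ => 1) x = (n : ℂ) • x := by
  induction h using Submodule.pow_induction_on_left' with
  | algebraMap r => simp
  | add x y i hx hy ihx ihy => rw [map_add, ihx, ihy, smul_add]
  | mem_mul m hm i x hx ih =>
    obtain ⟨v, rfl⟩ := hm
    have : euler (fun _ => 1) (ExteriorAlgebra.ι ℂ v) = ExteriorAlgebra.ι ℂ v := by
      rw [ι_eq_sum_gen, Finsupp.sum, map_sum]
      refine sum_congr rfl fun k _ => ?_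
      rw [map_smul, euler_gen, one_smul]
    rw [euler_mul, this, ih, mul_smul_comm, Nat.cast_succ, add_smul, one_smul, add_comm]

theorem eq_body_of_euler_eq_zero {x : Λ τ} (h : euler (fun _ => 1) x = 0) :
    x = algebraMap ℂ _ (body x) := by
  classical
  have hx := DirectSum.sum_support_decompose (fun i : ℕ => ⋀[ℂ]^i (τ →₀ ℂ)) x
  have hn : ∀ n, ((DirectSum.decompose (fun i : ℕ => ⋀[ℂ]^i (τ →₀ ℂ)) (euler (fun _ => 1) x) n :
      ⋀[ℂ]^n (τ →₀ ℂ)) : Λ τ) =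
      (n : ℂ) • (DirectSum.decompose (fun i : ℕ => ⋀[ℂ]^i (τ →₀ ℂ)) x n : Λ τ) := by
    intro n
    conv_lhs => rw [← hx, map_sum, DirectSum.decompose_sum]
    rw [DFinsupp.finsetSum_apply, AddSubmonoidClass.coe_finsetSum]
    have : ∀ i, euler (fun _ => 1) (DirectSum.decompose (fun i : ℕ => ⋀[ℂ]^i (τ →₀ ℂ)) x i :
        Λ τ) = (i : ℂ) • (DirectSum.decompose (fun i : ℕ => ⋀[ℂ]^i (τ →₀ ℂ)) x i :
        Λ τ) := fun i => euler_exteriorPower (Subtype.prop _)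
    simp only [this]
    rw [Finset.sum_eq_single n]
    · rw [← Submodule.coe_smul, DirectSum.decompose_coe, DirectSum.of_eq_same]
    · intro i _ hi
      rw [← Submodule.coe_smul, DirectSum.decompose_coe, DirectSum.of_eq_of_ne _ _ _ hi.symm]
      rfl
    · intro hi
      rw [DFinsupp.notMem_support_iff.1 hi]
      simp
  have h0 : ∀ n, n ≠ 0 →
      ((DirectSum.decompose (fun i : ℕ => ⋀[ℂ]^i (τ →₀ ℂ)) x n : ⋀[ℂ]^n (τ →₀ ℂ)) : Λ τ)
        = 0 := by
    intro n hn0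
    have := hn n
    rw [h, DirectSum.decompose_zero] at this
    exact (smul_eq_zero.1 this.symm).resolve_left (Nat.cast_ne_zero.2 hn0)
  have h1 : x ∈ ⋀[ℂ]^0 (τ →₀ ℂ) := by
    rw [← hx]
    refine sum_mem fun i _ => ?_
    by_cases hi : i = 0
    · subst hi; exact Subtype.prop _
    · rw [h0 i hi]; exact zero_mem _
  obtain ⟨r, hr⟩ := (Submodule.mem_one (R := ℂ) (A := Λ τ)).1 (by simpa using h1)
  rw [← hr]; simp

end Euler

section Berezin

variable {σ σ' : Type} {m : ℕ} (ħ : ℝ)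

/-- The projection that sends the integrated odd variables to zero. -/
noncomputable def dropOdd (σ : Type) (m : ℕ) : (σ ⧺ m →₀ ℂ) →ₗ[ℂ] (σ →₀ ℂ) :=
  Finsupp.linearCombination ℂ (elim (fun k : σ => Finsupp.single k (1 : ℂ)) fun _ => 0)

/-- The second-order operator of integration over one conjugate pair of odd variables. -/
noncomputable def berezinPair (ħ : ℝ) (σ : Type) {m : ℕ} (j : Fin m) :
    Module.End ℂ (Λ (σ ⧺ m)) :=
  (Complex.I * ħ) • (oddDeriv (inr (inr j)) ∘ₗ oddDeriv (inr (inl j)))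

theorem berezinPair_apply (j : Fin m) (x : Λ (σ ⧺ m)) :
    berezinPair ħ σ j x =
      (Complex.I * ħ) • oddDeriv (inr (inr j)) (oddDeriv (inr (inl j)) x) := rfl

theorem berezin_apply (x : Λ (σ ⧺ m)) :
    berezin ħ m x = ExteriorAlgebra.map (dropOdd σ m)
      (((List.finRange m).map (berezinPair ħ σ)).prod x) := by
  rw [berezin, List.ofFn_eq_map]; rfl

theorem list_prod_intertwine {ι M M' : Type*} [AddCommGroup M] [Module ℂ M] [AddCommGroup M']
    [Module ℂ M'] (A : ι → Module.End ℂ M) (A' : ι → Module.End ℂ M') (X : M →ₗ[ℂ] M')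
    (h : ∀ i x, X (A i x) = A' i (X x)) (L : List ι) (x : M) :
    X ((L.map A).prod x) = (L.map A').prod (X x) := by
  induction L with
  | nil => simp
  | cons i L ih => simp only [List.map_cons, List.prod_cons, Module.End.mul_apply, h, ih]

/-- Linear maps that commute with the odd derivatives and the projection commute with the
Berezin integral. -/
theorem berezin_comm (X' : Λ (σ ⧺ m) →ₗ[ℂ] Λ (σ' ⊕ (Fin m ⊕ Fin m)))
    (X : Λ σ →ₗ[ℂ] Λ σ')
    (h : ∀ j x, X' (berezinPair ħ σ j x) = berezinPair ħ σ' j (X' x))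
    (hX : ∀ x, X (ExteriorAlgebra.map (dropOdd σ m) x) = ExteriorAlgebra.map (dropOdd σ' m) (X' x))
    (x : Λ (σ ⧺ m)) :
    berezin ħ m (X' x) = X (berezin ħ m x) := by
  rw [berezin_apply, berezin_apply, hX, list_prod_intertwine _ (berezinPair ħ σ') X' h]

theorem dropOdd_inl (x : Λ σ) :
    ExteriorAlgebra.map (dropOdd σ m) (genMap inl x) = x := by
  have : (ExteriorAlgebra.map (dropOdd σ m)).comp (genMap inl) = AlgHom.id ℂ (Λ σ) :=
    grassmann_hom_ext fun k => by
      rw [AlgHom.comp_apply, genMap_gen, map_gen, dropOdd, Finsupp.linearCombination_single]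
      simp [gen_def]
  exact DFunLike.congr_fun this x

theorem dropOdd_gen_inl (k : σ) : ExteriorAlgebra.map (dropOdd σ m) (gen (inl k)) = gen k := by
  simp [dropOdd, gen_def]

theorem dropOdd_gen_inr (k : Fin m ⊕ Fin m) :
    ExteriorAlgebra.map (dropOdd σ m) (gen (inr k)) = 0 := by
  simp [map_gen, dropOdd]

theorem oddDeriv_genMap_of_notMem {τ υ : Type} (f : τ → υ) (k : υ) (h : ∀ j, f j ≠ k)
    (x : Λ τ) : oddDeriv k (genMap f x) = 0 := by
  classical
  induction x using grassmann_induction with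
  | hC r => simp
  | hadd x y hx hy => simp only [map_add, hx, hy, add_zero]
  | hgen j x hx => rw [map_mul, genMap_gen, oddDeriv_gen_mul, if_neg (h j), hx]; simp

theorem berezin_mul_left (a : Λ σ) (x : Λ (σ ⧺ m)) :
    berezin ħ m (genMap inl a * x) = a * berezin ħ m x := by
  refine berezin_comm ħ (LinearMap.mulLeft ℂ (genMap inl a)) (LinearMap.mulLeft ℂ a) ?_ ?_ x
  · intro j x
    have h1 : ∀ (k : Fin m ⊕ Fin m) (a : Λ σ) (y : Λ (σ ⧺ m)),
        oddDeriv (inr k) (genMap inl a * y) =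
          genMap inl (inv a) * oddDeriv (inr k) y := by
      intro k a y
      rw [oddDeriv_mul, oddDeriv_genMap_of_notMem _ _ (by simp), zero_mul, zero_add]
      congr 1; exact inv_map _ _
    simp only [LinearMap.mulLeft_apply, berezinPair_apply, h1,
      show inv (inv a) = a from CliffordAlgebra.involute_involute a, mul_smul_comm]
  · intro x
    simp only [LinearMap.mulLeft_apply, map_mul, dropOdd_inl]

theorem berezin_mul_right (x : Λ (σ ⧺ m)) (a : Λ σ) :
    berezin ħ m (x * genMap inl a) = berezin ħ m x * a := by
  refine berezin_comm ħ (LinearMap.mulRight ℂ (genMap inl a)) (LinearMap.mulRight ℂ a) ?_ ?_ x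
  · intro j x
    have h1 : ∀ (k : Fin m ⊕ Fin m) (a : Λ σ) (y : Λ (σ ⧺ m)),
        oddDeriv (inr k) (y * genMap inl a) = oddDeriv (inr k) y * genMap inl a := by
      intro k a y
      rw [oddDeriv_mul, oddDeriv_genMap_of_notMem _ _ (by simp), mul_zero, add_zero]
    simp only [LinearMap.mulRight_apply, berezinPair_apply, h1, smul_mul_assoc]
  · intro x
    simp only [LinearMap.mulRight_apply, map_mul, dropOdd_inl]

theorem berezin_inv (x : Λ (σ ⧺ m)) :
    berezin ħ m (inv x) = inv (berezin ħ m x) := by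
  refine berezin_comm ħ (inv (τ := σ ⧺ m)).toLinearMap (inv (τ := σ)).toLinearMap
    ?_ ?_ x
  · intro j x
    simp [berezinPair_apply, inv_oddDeriv]
  · intro x
    simp [inv_map]

theorem berezin_euler [Fintype σ] (ω : σ → ℂ) (x : Λ (σ ⧺ m)) :
    berezin ħ m (euler (elim ω 0) x) = euler ω (berezin ħ m x) := by
  refine berezin_comm ħ _ _ ?_ ?_ x
  · intro j x
    simp only [berezinPair_apply, map_smul]
    rw [oddDeriv_euler _ (by simp), oddDeriv_euler _ (by simp)]
  · refine euler_map _ _ _ ?_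
    rintro (k | k)
    · rw [dropOdd_gen_inl, euler_gen]; rfl
    · rw [dropOdd_gen_inr]; simp

/-- The Berezin integral of a derivative vanishes. -/
theorem berezin_oddDeriv (k : Fin m ⊕ Fin m) (x : Λ (σ ⧺ m)) :
    berezin ħ m (oddDeriv (inr k) x) = 0 := by
  have hcomm : ∀ (j : Fin m) (x : Λ (σ ⧺ m)),
      oddDeriv (inr k) (berezinPair ħ σ j x) =
        berezinPair ħ σ j (oddDeriv (inr k) x) := by
    intro j x
    rw [berezinPair_apply, berezinPair_apply, map_smul, oddDeriv_comm, oddDeriv_comm (inr k),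
      map_neg, neg_neg]
  have hzero : ∃ j : Fin m, ∀ x, berezinPair ħ σ j (oddDeriv (inr k) x) = 0 := by
    rcases k with j | j
    · exact ⟨j, fun x => by simp [berezinPair_apply]⟩
    · refine ⟨j, fun x => ?_⟩
      rw [berezinPair_apply, oddDeriv_comm, oddDeriv_self]; simp
  obtain ⟨j, hj⟩ := hzero
  obtain ⟨L₁, L₂, hL⟩ := List.append_of_mem (List.mem_finRange j)
  rw [berezin_apply, hL]
  simp only [List.map_append, List.map_cons, List.prod_append, List.prod_cons,
    Module.End.mul_apply]
  rw [← list_prod_intertwine (berezinPair ħ σ) (berezinPair ħ σ) _ (fun i x => hcomm i x) L₂, hj]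
  simp

end Berezin

section SuperIntegral

variable {ħ : ℝ} {σ σ' : Type} {n m : ℕ}

/-- Linear maps act on oscillatory integrals. -/
theorem HasSuperIntegral.map (X : Λ σ →ₗ[ℂ] Λ σ')
    {f : (Fin n → ℝ) → (Fin n → ℝ) → Λ (σ ⧺ m)} {I : Λ σ}
    (h : HasSuperIntegral ħ n m f I)
    {f' : (Fin n → ℝ) → (Fin n → ℝ) → Λ (σ' ⊕ (Fin m ⊕ Fin m))}
    (hf : ∀ y q, berezin ħ m (f' y q) = X (berezin ħ m (f y q))) :
    HasSuperIntegral ħ n m f' (X I) := by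
  intro l
  have := h (l ∘ₗ X)
  simpa only [hf, LinearMap.comp_apply] using this

theorem HasSuperIntegral.unique
    {f : (Fin n → ℝ) → (Fin n → ℝ) → Λ (σ ⧺ m)} {I J : Λ σ}
    (h : HasSuperIntegral ħ n m f I) (h' : HasSuperIntegral ħ n m f J) : I = J := by
  rw [← sub_eq_zero, ← Module.forall_dual_apply_eq_zero_iff ℂ]
  intro l
  rw [map_sub, sub_eq_zero]
  exact tendsto_nhds_unique (h l).2 (h' l).2

theorem HasSuperIntegral.add
    {f g : (Fin n → ℝ) → (Fin n → ℝ) → Λ (σ ⧺ m)} {I J : Λ σ}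
    (h : HasSuperIntegral ħ n m f I) (h' : HasSuperIntegral ħ n m g J) :
    HasSuperIntegral ħ n m (fun y q => f y q + g y q) (I + J) := by
  intro l
  simp only [map_add, mul_add]
  refine ⟨fun ε hε => ((h l).1 ε hε).add ((h' l).1 ε hε), ?_⟩
  refine Tendsto.congr' ?_ ((h l).2.add (h' l).2)
  filter_upwards [self_mem_nhdsWithin] with ε hε
  rw [integral_add ((h l).1 ε hε) ((h' l).1 ε hε), mul_add]

theorem HasSuperIntegral.zero :
    HasSuperIntegral ħ n m (fun _ _ => (0 : Λ (σ ⧺ m))) 0 := by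
  intro l
  simp

theorem HasSuperIntegral.sum {ι : Type*} (s : Finset ι)
    {f : ι → (Fin n → ℝ) → (Fin n → ℝ) → Λ (σ ⧺ m)} {I : ι → Λ σ}
    (h : ∀ i ∈ s, HasSuperIntegral ħ n m (f i) (I i)) :
    HasSuperIntegral ħ n m (fun y q => ∑ i ∈ s, f i y q) (∑ i ∈ s, I i) := by
  classical
  induction s using Finset.induction_on with
  | empty => simpa using HasSuperIntegral.zero
  | insert i s hi ih =>
    simp only [Finset.sum_insert hi]
    exact (h i (Finset.mem_insert_self i s)).add
      (ih fun j hj => h j (Finset.mem_insert_of_mem hj))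

theorem HasSuperIntegral.smul (c : ℂ)
    {f : (Fin n → ℝ) → (Fin n → ℝ) → Λ (σ ⧺ m)} {I : Λ σ}
    (h : HasSuperIntegral ħ n m f I) : HasSuperIntegral ħ n m (fun y q => c • f y q) (c • I) :=
  h.map (Module.toModuleEnd ℂ (S := ℂ) (Λ σ) c) fun _ _ => map_smul _ _ _

theorem HasSuperIntegral.mul_left (a : Λ σ)
    {f : (Fin n → ℝ) → (Fin n → ℝ) → Λ (σ ⧺ m)} {I : Λ σ}
    (h : HasSuperIntegral ħ n m f I) :
    HasSuperIntegral ħ n m (fun y q => genMap inl a * f y q) (a * I) :=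
  h.map (LinearMap.mulLeft ℂ a) fun _ _ => berezin_mul_left ħ a _

theorem HasSuperIntegral.mul_right (a : Λ σ)
    {f : (Fin n → ℝ) → (Fin n → ℝ) → Λ (σ ⧺ m)} {I : Λ σ}
    (h : HasSuperIntegral ħ n m f I) :
    HasSuperIntegral ħ n m (fun y q => f y q * genMap inl a) (I * a) :=
  h.map (LinearMap.mulRight ℂ a) fun _ _ => berezin_mul_right ħ _ a

end SuperIntegral

section Signs

/-- The integer sign `(-1)^(i j)`. -/
def sgZ (i j : ZMod 2) : ℤ := if i = 1 ∧ j = 1 then -1 else 1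

/-- The sign `(-1)^(i j)` as a complex number. -/
def sg (i j : ZMod 2) : ℂ := (sgZ i j : ℂ)

variable {α β α' β' : Type}

theorem sgn_eq_sg (i : α ⊕ β) : sgn i = sg (par i) (par i) := by
  rcases i with i | i <;> simp [sgn, par, sg, sgZ]

theorem sgn₂_eq_sg (i j : α ⊕ β) : sgn₂ i j = sg (par i) (par j) := by
  rcases i with i | i <;> rcases j with j | j <;> simp [sgn₂, par, sg, sgZ]

theorem sg_mul_self (i j : ZMod 2) : sg i j * sg i j = 1 := by
  have : ∀ i j, sgZ i j * sgZ i j = 1 := by decide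
  rw [sg]; exact_mod_cast this i j

theorem sg_symm (i j : ZMod 2) : sg i j = sg j i := by
  have : ∀ i j, sgZ i j = sgZ j i := by decide
  rw [sg, sg]; exact_mod_cast this i j

theorem sgn_mul_self (i : α ⊕ β) : sgn i * sgn i = 1 := by rw [sgn_eq_sg, sg_mul_self]

theorem sg_eq_one_or (i j : ZMod 2) : sg i j = 1 ∨ sg i j = -1 := by
  have : ∀ i j, sgZ i j = 1 ∨ sgZ i j = -1 := by decide
  rcases this i j with h | h <;> simp [sg, h]

theorem par_add_self (i : ZMod 2) : i + i = 0 := by revert i; decide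

theorem par_add_add (i j k : ZMod 2) : i + j + (j + k) = i + k := by revert i j k; decide

end Signs

variable {τ : Type}

/-- Homogeneous elements commute up to sign. -/
theorem mul_comm_sg {i j : ZMod 2} {x y : Λ τ} (hx : x ∈ parityPart τ i)
    (hy : y ∈ parityPart τ j) : x * y = sg i j • (y * x) := by
  rcases zmod_two_cases i with rfl | rfl
  · rw [even_comm hx]; simp [sg, sgZ]
  · rw [odd_mul hx]
    rcases zmod_two_cases j with rfl | rfl
    · rw [inv_of_even hy]; simp [sg, sgZ]
    · rw [inv_of_odd hy]; simp [sg, sgZ]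

section SuperMatrix

open Matrix

variable {α β α' β' α'' β'' : Type}

/-- The diagonal matrix of the signs `(-1)^ĩ`. -/
noncomputable def sgm (τ : Type) (ι : Type) [DecidableEq ι] (s : ι → ℂ) :
    Matrix ι ι (Λ τ) :=
  diagonal fun i => algebraMap ℂ _ (s i)

/-- The supertranspose of a rectangular matrix. -/
noncomputable def st (X : Matrix (α ⊕ β) (α' ⊕ β') (Λ τ)) :
    Matrix (α' ⊕ β') (α ⊕ β) (Λ τ) :=
  of fun i j => sg (par i) (par j) • X j i

/-- Matrices with entries from a graded family. -/
def MatIn (P : ZMod 2 → Submodule ℝ (Λ τ)) (X : Matrix (α ⊕ β) (α' ⊕ β') (Λ τ)) :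
    Prop := ∀ i j, X i j ∈ P (par i + par j)

/-- Vectors with entries from a graded family. -/
def VecIn (P : ZMod 2 → Submodule ℝ (Λ τ)) (v : α ⊕ β → Λ τ) : Prop :=
  ∀ i, v i ∈ P (par i)

/-- The parity grading, over the reals. -/
noncomputable def parityR (τ : Type) (i : ZMod 2) : Submodule ℝ (Λ τ) :=
  (parityPart τ i).restrictScalars ℝ

/-- The parity grading of the real elements. -/
noncomputable def realParity (τ : Type) (i : ZMod 2) : Submodule ℝ (Λ τ) :=
  parityR τ i ⊓ Subalgebra.toSubmodule (realPart τ)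

instance : SetLike.GradedMonoid (parityR τ) where
  one_mem := one_even
  mul_mem _ _ _ _ hx hy := mul_mem_parity hx hy

instance : SetLike.GradedMonoid (realParity τ) where
  one_mem := ⟨one_even, (realPart τ).one_mem⟩
  mul_mem _ _ _ _ hx hy := ⟨mul_mem_parity hx.1 hy.1, (realPart τ).mul_mem hx.2 hy.2⟩

variable {P : ZMod 2 → Submodule ℝ (Λ τ)}

theorem sg_smul_mem {i j k : ZMod 2} {x : Λ τ} (h : x ∈ P k) : sg i j • x ∈ P k := by
  rcases sg_eq_one_or i j with h' | h' <;> rw [h']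
  · simpa using h
  · simpa using h

theorem MatIn.st {X : Matrix (α ⊕ β) (α' ⊕ β') (Λ τ)} (h : MatIn P X) :
    MatIn P (st X) := fun i j => sg_smul_mem (add_comm (par j) (par i) ▸ h j i)

theorem MatIn.add {X Y : Matrix (α ⊕ β) (α' ⊕ β') (Λ τ)} (h : MatIn P X)
    (h' : MatIn P Y) : MatIn P (X + Y) := fun i j => (P _).add_mem (h i j) (h' i j)

theorem MatIn.sub {X Y : Matrix (α ⊕ β) (α' ⊕ β') (Λ τ)} (h : MatIn P X)
    (h' : MatIn P Y) : MatIn P (X - Y) := fun i j => (P _).sub_mem (h i j) (h' i j)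

theorem VecIn.add {v w : α ⊕ β → Λ τ} (h : VecIn P v)
    (h' : VecIn P w) : VecIn P (v + w) := fun i => (P _).add_mem (h i) (h' i)

variable [Fintype α] [Fintype β] [Fintype α'] [Fintype β'] [DecidableEq α] [DecidableEq β]
  [DecidableEq α'] [DecidableEq β']

theorem MatIn.mul [SetLike.GradedMonoid P] {X : Matrix (α'' ⊕ β'') (α' ⊕ β') (Λ τ)}
    {Y : Matrix (α' ⊕ β') (α ⊕ β) (Λ τ)} (h : MatIn P X) (h' : MatIn P Y) :
    MatIn P (X * Y) := fun i j => by
  rw [mul_apply]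
  refine (P _).sum_mem fun k _ => ?_
  rw [← par_add_add (par i) (par k) (par j)]
  exact SetLike.mul_mem_graded (h i k) (h' k j)

theorem MatIn.mulVec [SetLike.GradedMonoid P] {X : Matrix (α'' ⊕ β'') (α' ⊕ β') (Λ τ)}
    {v : α' ⊕ β' → Λ τ} (h : MatIn P X) (h' : VecIn P v) : VecIn P (X *ᵥ v) := fun i => by
  refine (P _).sum_mem fun k _ => ?_
  have : par i = par i + par k + par k := by rw [add_assoc, par_add_self, add_zero]
  rw [this]
  exact SetLike.mul_mem_graded (h i k) (h' k)

theorem MatIn.one [SetLike.GradedMonoid P] :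
    MatIn P (1 : Matrix (α ⊕ β) (α ⊕ β) (Λ τ)) := fun i j => by
  rw [one_apply]
  split_ifs with h
  · rw [h, par_add_self]; exact SetLike.one_mem_graded P
  · exact (P _).zero_mem

theorem MatIn.sgm [SetLike.GradedMonoid P] :
    MatIn P (sgm τ (α ⊕ β) sgn) := fun i j => by
  rw [SuperThick.sgm, diagonal_apply]
  split_ifs with h
  · rw [h, par_add_self, Algebra.algebraMap_eq_smul_one, sgn_eq_sg]
    exact sg_smul_mem (SetLike.one_mem_graded P)
  · exact (P _).zero_mem

theorem sgm_mul_sgm : sgm τ (α ⊕ β) sgn * sgm τ (α ⊕ β) sgn = 1 := by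
  rw [sgm, diagonal_mul_diagonal, ← diagonal_one]
  congr 1
  funext i
  rw [← map_mul, sgn_mul_self, map_one]

theorem sgm_mul_sgm_mul {ι : Type} (X : Matrix (α ⊕ β) ι (Λ τ)) :
    sgm τ (α ⊕ β) sgn * (sgm τ (α ⊕ β) sgn * X) = X := by
  rw [← Matrix.mul_assoc, sgm_mul_sgm, Matrix.one_mul]

theorem st_st (X : Matrix (α ⊕ β) (α' ⊕ β') (Λ τ)) : st (st X) = X := by
  ext i j
  simp only [st, of_apply, smul_smul]
  rw [sg_symm (par i), sg_mul_self, one_smul]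

theorem st_add (X Y : Matrix (α ⊕ β) (α' ⊕ β') (Λ τ)) : st (X + Y) = st X + st Y := by
  ext i j
  simp [st]

theorem st_one : st (1 : Matrix (α ⊕ β) (α ⊕ β) (Λ τ)) = sgm τ (α ⊕ β) sgn := by
  ext i j
  simp only [st, of_apply, sgm, diagonal_apply, one_apply]
  by_cases h : i = j
  · subst h; simp [sgn_eq_sg, Algebra.algebraMap_eq_smul_one]
  · simp [h, Ne.symm h]

theorem st_mul {X : Matrix (α'' ⊕ β'') (α' ⊕ β') (Λ τ)}
    {Y : Matrix (α' ⊕ β') (α ⊕ β) (Λ τ)} (hX : MatIn (parityR τ) X)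
    (hY : MatIn (parityR τ) Y) : st (X * Y) = st Y * sgm τ (α' ⊕ β') sgn * st X := by
  ext i j
  rw [mul_apply, st, of_apply, mul_apply, smul_sum]
  refine sum_congr rfl fun k _ => ?_
  rw [mul_comm_sg (hX j k) (hY k i), sgm, mul_diagonal]
  simp only [st, of_apply]
  rw [smul_mul_assoc, smul_mul_assoc, mul_smul_comm, ← Algebra.commutes, ← Algebra.smul_def,
    smul_mul_assoc, smul_smul, smul_smul, smul_smul, sgn_eq_sg]
  congr 1
  have : ∀ i j k, sgZ i j * sgZ (j + k) (k + i) = sgZ i k * sgZ k j * sgZ k k := by decide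
  have := this (par i) (par j) (par k)
  simp only [sg]
  exact_mod_cast this

theorem st_mul_sgm (X : Matrix (α'' ⊕ β'') (α ⊕ β) (Λ τ)) :
    st (X * sgm τ (α ⊕ β) sgn) = sgm τ (α ⊕ β) sgn * st X := by
  ext i j
  rw [st, of_apply, sgm, mul_diagonal, diagonal_mul, st, of_apply, ← Algebra.commutes,
    mul_smul_comm]

theorem vecMul_eq {A : Matrix (α ⊕ β) (α' ⊕ β') (Λ τ)} (hA : MatIn (parityR τ) A)
    {x : α ⊕ β → Λ τ} (hx : VecIn (parityR τ) x) :
    x ᵥ* A = (st A * sgm τ (α ⊕ β) sgn) *ᵥ x := by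
  funext i
  simp only [vecMul, mulVec, dotProduct]
  refine sum_congr rfl fun a _ => ?_
  rw [mul_comm_sg (hx a) (hA a i), sgm, mul_diagonal, st, of_apply, ← Algebra.commutes,
    ← Algebra.smul_def, smul_smul, smul_mul_assoc, sgn_eq_sg]
  congr 1
  have : ∀ a i, sgZ a (a + i) = sgZ a a * sgZ i a := by decide
  have := this (par a) (par i)
  simp only [sg]
  exact_mod_cast this

/-- Symmetry of the bilinear form of a supersymmetric matrix with lower indices. -/
theorem dot_symm_lower {T : Matrix (α ⊕ β) (α ⊕ β) (Λ τ)}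
    (hs : st T = T) {u v : α ⊕ β → Λ τ} (hu : VecIn (parityR τ) u)
    (hv : VecIn (parityR τ) v) : u ⬝ᵥ (v ᵥ* T) = v ⬝ᵥ (u ᵥ* T) := by
  simp only [dotProduct, vecMul, mul_sum]
  rw [sum_comm]
  refine sum_congr rfl fun b _ => sum_congr rfl fun a _ => ?_
  have h1 : T b a = sg (par b) (par a) • T a b := by
    conv_lhs => rw [← hs]
    rfl
  rw [← mul_assoc, ← mul_assoc, mul_comm_sg (hu a) (hv b), h1, smul_mul_assoc, mul_smul_comm,
    smul_smul, sg_symm (par a), sg_mul_self, one_smul]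

/-- Symmetry of the bilinear form of a supersymmetric matrix with upper indices. -/
theorem dot_symm_upper {S : Matrix (α ⊕ β) (α ⊕ β) (Λ τ)}
    (hs : st S = S) {u v : α ⊕ β → Λ τ} (hu : VecIn (parityR τ) u)
    (hv : VecIn (parityR τ) v) : (S *ᵥ u) ⬝ᵥ v = (S *ᵥ v) ⬝ᵥ u := by
  simp only [dotProduct, mulVec, sum_mul]
  rw [sum_comm]
  refine sum_congr rfl fun b _ => sum_congr rfl fun a _ => ?_
  have h1 : S a b = sg (par a) (par b) • S b a := by
    conv_lhs => rw [← hs]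
    rfl
  rw [mul_assoc, mul_assoc, mul_comm_sg (hu b) (hv a), h1, smul_mul_assoc, mul_smul_comm,
    smul_smul, sg_symm (par b), sg_mul_self, one_smul]

end SuperMatrix

section Inverse

open Matrix

instance [Finite τ] : Module.Finite ℂ (Λ τ) := by
  classical
  have := Fintype.ofFinite τ
  let : LinearOrder τ := LinearOrder.lift' (Fintype.equivFin τ) (Fintype.equivFin τ).injective
  exact Module.Finite.of_basis
    (Module.Basis.ExteriorAlgebra (R := ℂ) (Finsupp.basisSingleOne (R := ℂ) (ι := τ)))

instance [Finite τ] : Module.Finite ℝ (Λ τ) := Module.Finite.trans ℂ _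

variable [Finite τ] {ι : Type} [Fintype ι] [DecidableEq ι]

/-- Multiplication by a matrix as a linear map. -/
noncomputable def mulVecMap (K : Type) [CommSemiring K] [Algebra K (Λ τ)]
    (M : Matrix ι ι (Λ τ)) : (ι → Λ τ) →ₗ[K] (ι → Λ τ) where
  toFun v := M *ᵥ v
  map_add' v w := mulVec_add M v w
  map_smul' c v := mulVec_smul M c v

/-- A subspace that is invariant under an invertible matrix is invariant under its inverse. -/
theorem mulVec_inv_mem {M N : Matrix ι ι (Λ τ)} (h : N * M = 1)
    {W : Submodule ℝ (ι → Λ τ)} (hW : ∀ v ∈ W, M *ᵥ v ∈ W) :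
    ∀ v ∈ W, N *ᵥ v ∈ W := by
  intro v hv
  let f : W →ₗ[ℝ] W := (mulVecMap ℝ M).restrict hW
  have hf : Function.Injective f := by
    intro a b hab
    have : M *ᵥ (a : ι → Λ τ) = M *ᵥ (b : ι → Λ τ) := congrArg Subtype.val hab
    have := congrArg (N *ᵥ ·) this
    simp only [mulVec_mulVec, h, one_mulVec] at this
    exact Subtype.ext this
  obtain ⟨w, hw⟩ := LinearMap.injective_iff_surjective.1 hf ⟨v, hv⟩
  have hw' : M *ᵥ (w : ι → Λ τ) = v := congrArg Subtype.val hw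
  rw [← hw', mulVec_mulVec, h, one_mulVec]
  exact w.2

theorem isUnit_of_mulVec_injective {M : Matrix ι ι (Λ τ)}
    (h : ∀ v, M *ᵥ v = 0 → v = 0) : IsUnit M := by
  have hinj : Function.Injective (mulVecMap ℂ M) :=
    (injective_iff_map_eq_zero (mulVecMap ℂ M)).2 h
  have hsurj := LinearMap.injective_iff_surjective.1 hinj
  choose N hN using fun j => hsurj (Pi.single j 1)
  have h1 : M * (of fun i j => N j i) = 1 := by
    ext i j
    have := congrFun (hN j) i
    rw [mul_apply, one_apply]
    simp only [of_apply]
    rw [Pi.single_apply] at this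
    exact this
  have h2 : (of fun i j => N j i) * M = 1 := by
    have h3 : M * ((of fun i j => N j i) * M - 1) = 0 := by
      rw [mul_sub, ← mul_assoc, h1, one_mul, mul_one, sub_self]
    rw [← sub_eq_zero]
    ext i j
    exact congrFun (h (((of fun i j => N j i) * M - 1).col j) (funext fun i => by
      have := congrFun (congrFun h3 i) j
      rw [mul_apply] at this
      exact this)) i
  exact ⟨⟨M, _, h1, h2⟩, rfl⟩

variable {α β : Type} [Fintype α] [Fintype β] [DecidableEq α] [DecidableEq β]

theorem MatIn.inverse {P : ZMod 2 → Submodule ℝ (Λ τ)} [SetLike.GradedMonoid P]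
    {M N : Matrix (α ⊕ β) (α ⊕ β) (Λ τ)} (h : N * M = 1) (hM : MatIn P M) : MatIn P N := by
  intro i j
  let W : Submodule ℝ (α ⊕ β → Λ τ) :=
    { carrier := {v | ∀ i, v i ∈ P (par i + par j)}
      add_mem' := fun h h' i => (P _).add_mem (h i) (h' i)
      zero_mem' := fun i => (P _).zero_mem
      smul_mem' := fun c v h i => (P _).smul_mem c (h i) }
  have hW : ∀ v ∈ W, M *ᵥ v ∈ W := by
    intro v hv i
    refine (P _).sum_mem fun k _ => ?_
    rw [← par_add_add (par i) (par k) (par j)]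
    exact SetLike.mul_mem_graded (hM i k) (hv k)
  have h1 : Pi.single j 1 ∈ W := fun i => MatIn.one (P := P) i j |> fun h => by
    rw [one_apply] at h; rw [Pi.single_apply]; exact h
  have := mulVec_inv_mem h hW _ h1 i
  rwa [mulVec_single_one] at this

end Inverse

end SuperThick

namespace SuperThick

open Matrix

section MatrixMap

variable {σ τ : Type} {α β α' β' α'' β'' : Type} (f : σ → τ)

/-- The image of a matrix under a map of the generators. -/
noncomputable def mmap {ι ι' : Type} (f : σ → τ) (X : Matrix ι ι' (Λ σ)) :
    Matrix ι ι' (Λ τ) := X.map (genMap f)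

/-- The image of a vector under a map of the generators. -/
noncomputable def vmap {ι : Type} (f : σ → τ) (v : ι → Λ σ) : ι → Λ τ :=
  fun i => genMap f (v i)

theorem mmap_add {ι ι' : Type} (X Y : Matrix ι ι' (Λ σ)) :
    mmap f (X + Y) = mmap f X + mmap f Y := by ext i j; simp [mmap]

theorem mmap_sub {ι ι' : Type} (X Y : Matrix ι ι' (Λ σ)) :
    mmap f (X - Y) = mmap f X - mmap f Y := by ext i j; simp [mmap]

theorem mmap_mul {ι ι' ι'' : Type} [Fintype ι'] (X : Matrix ι ι' (Λ σ))
    (Y : Matrix ι' ι'' (Λ σ)) : mmap f (X * Y) = mmap f X * mmap f Y := by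
  ext i j; simp [mmap, mul_apply]

theorem mmap_one {ι : Type} [DecidableEq ι] :
    mmap f (1 : Matrix ι ι (Λ σ)) = 1 := by
  ext i j; simp only [mmap, map_apply, one_apply]; split_ifs <;> simp

theorem vmap_add {ι : Type} (v w : ι → Λ σ) : vmap f (v + w) = vmap f v + vmap f w := by
  ext i; simp [vmap]

theorem vmap_mulVec {ι ι' : Type} [Fintype ι'] (X : Matrix ι ι' (Λ σ))
    (v : ι' → Λ σ) : vmap f (X *ᵥ v) = mmap f X *ᵥ vmap f v := by
  ext i; simp [vmap, mmap, mulVec, dotProduct]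

theorem mmap_st (X : Matrix (α ⊕ β) (α' ⊕ β') (Λ σ)) :
    mmap f (st X) = st (mmap f X) := by
  ext i j; simp [mmap, st]

theorem mmap_sgm {ι : Type} [DecidableEq ι] (s : ι → ℂ) : mmap f (sgm σ ι s) = sgm τ ι s := by
  ext i j
  simp only [mmap, map_apply, sgm, diagonal_apply]
  split_ifs
  · exact AlgHom.commutes _ _
  · exact map_zero _

theorem MatIn.mmap {X : Matrix (α ⊕ β) (α' ⊕ β') (Λ σ)} (h : MatIn (parityR σ) X) :
    MatIn (parityR τ) (mmap f X) := fun i j => genMap_mem_parity f (h i j)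

theorem VecIn.vmap {v : α ⊕ β → Λ σ} (h : VecIn (parityR σ) v) :
    VecIn (parityR τ) (vmap f v) := fun i => genMap_mem_parity f (h i)

theorem MatIn.of_real {X : Matrix (α ⊕ β) (α' ⊕ β') (Λ σ)} (h : MatIn (realParity σ) X) :
    MatIn (parityR σ) X := fun i j => (h i j).1

theorem VecIn.of_real {v : α ⊕ β → Λ σ} (h : VecIn (realParity σ) v) :
    VecIn (parityR σ) v := fun i => (h i).1

theorem dotProduct_even [Fintype α] [Fintype β] {v w : α ⊕ β → Λ σ}
    (h : VecIn (parityR σ) v) (h' : VecIn (parityR σ) w) : v ⬝ᵥ w ∈ parityPart σ 0 := by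
  refine sum_mem fun i _ => ?_
  rw [← par_add_self (par i)]
  exact mul_mem_parity (h i) (h' i)

theorem genMap_dotProduct {ι : Type} [Fintype ι] (v w : ι → Λ σ) :
    genMap f (v ⬝ᵥ w) = vmap f v ⬝ᵥ vmap f w := by
  simp [dotProduct, vmap]

end MatrixMap

/-- The sign matrix of a super vector space. -/
noncomputable abbrev Sg (τ : Type) (V : SuperSpace) : Matrix V.Idx V.Idx (Λ τ) :=
  sgm τ V.Idx sgn

namespace QuadAction

variable {κ τ : Type} {V₁ V₂ V₃ V₄ : SuperSpace} (f : κ → τ)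

theorem isPoint_iff {V : SuperSpace} {x : V.Idx → Λ τ} :
    IsPoint x ↔ VecIn (parityR τ) x := Iff.rfl

theorem xx_in (S : QuadAction κ V₁ V₂) : MatIn (realParity κ) (of S.xx) :=
  fun i j => ⟨S.xx_parity i j, S.xx_real i j⟩
theorem xq_in (S : QuadAction κ V₁ V₂) : MatIn (realParity κ) (of S.xq) :=
  fun i j => ⟨S.xq_parity i j, S.xq_real i j⟩
theorem qq_in (S : QuadAction κ V₁ V₂) : MatIn (realParity κ) (of S.qq) :=
  fun i j => ⟨S.qq_parity i j, S.qq_real i j⟩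
theorem linX_in (S : QuadAction κ V₁ V₂) : VecIn (realParity κ) S.linX :=
  fun i => ⟨S.linX_parity i, S.linX_real i⟩
theorem linQ_in (S : QuadAction κ V₁ V₂) : VecIn (realParity κ) S.linQ :=
  fun i => ⟨S.linQ_parity i, S.linQ_real i⟩

theorem st_xx (S : QuadAction κ V₁ V₂) : st (of S.xx) = of S.xx := by
  ext i j; exact (sgn₂_eq_sg i j ▸ S.xx_symm i j).symm
theorem st_qq (S : QuadAction κ V₁ V₂) : st (of S.qq) = of S.qq := by
  ext i j; exact (sgn₂_eq_sg i j ▸ S.qq_symm i j).symm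

theorem derivX_eq_vecMul (S : QuadAction κ V₁ V₂) (x : V₁.Idx → Λ τ)
    (q : V₂.Idx → Λ τ) :
    S.derivX (genMap f) x q =
      vmap f S.linX + x ᵥ* mmap f (of S.xx) + mmap f (of S.xq) *ᵥ q := rfl

theorem derivQ_eq_vecMul (S : QuadAction κ V₁ V₂) (x : V₁.Idx → Λ τ)
    (q : V₂.Idx → Λ τ) :
    S.derivQ (genMap f) x q =
      vmap f S.linQ + x ᵥ* mmap f (of S.xq) + mmap f (of S.qq) *ᵥ q := rfl

theorem derivX_eq (S : QuadAction κ V₁ V₂) {x : V₁.Idx → Λ τ} (hx : IsPoint x)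
    (q : V₂.Idx → Λ τ) :
    S.derivX (genMap f) x q =
      vmap f S.linX + (mmap f (of S.xx) * Sg τ V₁) *ᵥ x + mmap f (of S.xq) *ᵥ q := by
  rw [derivX_eq_vecMul, vecMul_eq (S.xx_in.of_real.mmap f) hx, ← mmap_st, S.st_xx]

theorem derivQ_eq (S : QuadAction κ V₁ V₂) {x : V₁.Idx → Λ τ} (hx : IsPoint x)
    (q : V₂.Idx → Λ τ) :
    S.derivQ (genMap f) x q =
      vmap f S.linQ + (st (mmap f (of S.xq)) * Sg τ V₁) *ᵥ x + mmap f (of S.qq) *ᵥ q := by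
  rw [derivQ_eq_vecMul, vecMul_eq (S.xq_in.of_real.mmap f) hx]

/-- Euler's formula for the values of a quadratic function. -/
theorem eval_eq (S : QuadAction κ V₁ V₂) (φ : Λ κ →ₐ[ℂ] Λ τ)
    (x : V₁.Idx → Λ τ) (q : V₂.Idx → Λ τ) :
    S.eval φ x q = φ S.const
      + (1 / 2 : ℂ) • (x ⬝ᵥ fun a => φ (S.linX a) + S.derivX φ x q a)
      + (1 / 2 : ℂ) • ((fun i => φ (S.linQ i) + S.derivQ φ x q i) ⬝ᵥ q) := by
  have h1 : (x ⬝ᵥ fun a => φ (S.linX a) + S.derivX φ x q a) =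
      (2 : ℂ) • ∑ a, x a * φ (S.linX a) + ∑ a, ∑ b, x a * x b * φ (S.xx b a)
        + ∑ a, ∑ i, x a * φ (S.xq a i) * q i := by
    simp only [dotProduct, derivX, two_smul, mul_add, sum_add_distrib, mul_sum,
      mul_assoc]
    abel
  have h2 : ((fun i => φ (S.linQ i) + S.derivQ φ x q i) ⬝ᵥ q) =
      (2 : ℂ) • ∑ i, φ (S.linQ i) * q i + ∑ a, ∑ i, x a * φ (S.xq a i) * q i
        + ∑ i, ∑ j, φ (S.qq i j) * q j * q i := by
    rw [sum_comm (f := fun a i => x a * φ (S.xq a i) * q i)]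
    simp only [dotProduct, derivQ, two_smul, add_mul, sum_add_distrib, sum_mul,
      mul_assoc]
    abel
  rw [h1, h2, eval]
  module

theorem derivX_point (S : QuadAction κ V₁ V₂) {x : V₁.Idx → Λ τ} (hx : IsPoint x)
    {q : V₂.Idx → Λ τ} (hq : IsPoint q) : IsPoint (S.derivX (genMap f) x q) := by
  rw [S.derivX_eq f hx]
  exact ((S.linX_in.of_real.vmap f).add
    (((S.xx_in.of_real.mmap f).mul MatIn.sgm).mulVec hx)).add
    ((S.xq_in.of_real.mmap f).mulVec hq)

theorem derivQ_point (S : QuadAction κ V₁ V₂) {x : V₁.Idx → Λ τ} (hx : IsPoint x)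
    {q : V₂.Idx → Λ τ} (hq : IsPoint q) : IsPoint (S.derivQ (genMap f) x q) := by
  rw [S.derivQ_eq f hx]
  exact ((S.linQ_in.of_real.vmap f).add
    (((S.xq_in.of_real.mmap f).st.mul MatIn.sgm).mulVec hx)).add
    ((S.qq_in.of_real.mmap f).mulVec hq)

theorem eval_even (S : QuadAction κ V₁ V₂) {x : V₁.Idx → Λ τ} (hx : IsPoint x)
    {q : V₂.Idx → Λ τ} (hq : IsPoint q) : S.eval (genMap f) x q ∈ parityPart τ 0 := by
  rw [eval_eq]
  refine add_mem (add_mem (genMap_mem_parity f S.const.2) ?_) ?_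
  · exact smul_mem _ _ (dotProduct_even hx
      ((S.linX_in.of_real.vmap f).add (S.derivX_point f hx hq)))
  · exact smul_mem _ _ (dotProduct_even
      ((S.linQ_in.of_real.vmap f).add (S.derivQ_point f hx hq)) hq)

end QuadAction

theorem tsMatrix_eq {κ : Type} {V : SuperSpace} (T S : V.Idx → V.Idx → Λ κ) :
    tsMatrix T S = of T * Sg κ V * of S := by
  ext i j
  rw [tsMatrix, of_apply, mul_apply]
  refine sum_congr rfl fun k _ => ?_
  simp only [Sg, sgm]
  rw [mul_diagonal, of_apply, ← Algebra.commutes, ← Algebra.smul_def, smul_mul_assoc]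
  rfl

section Propagator

variable {κ τ : Type} [Finite κ] {V : SuperSpace} {T S N : Matrix V.Idx V.Idx (Λ κ)}

theorem propagator_mem {P : ZMod 2 → Submodule ℝ (Λ κ)} [SetLike.GradedMonoid P]
    (hT : MatIn P T) (hS : MatIn P S) (hN : N * (1 - T * Sg κ V * S) = 1) : MatIn P N :=
  MatIn.inverse hN (MatIn.one.sub ((hT.mul MatIn.sgm).mul hS))

theorem inverse_eq_left (hN : N * (1 - T * Sg κ V * S) = 1) : N = 1 + N * T * Sg κ V * S := by
  rw [mul_sub, mul_one, sub_eq_iff_eq_add] at hN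
  rw [mul_assoc, mul_assoc, ← mul_assoc T]
  exact hN

theorem inverse_eq_right (hN : (1 - T * Sg κ V * S) * N = 1) : N = 1 + T * Sg κ V * S * N := by
  rw [sub_mul, one_mul, sub_eq_iff_eq_add] at hN
  exact hN

/-- `N T` is supersymmetric. -/
theorem st_mul_lower (hT : MatIn (parityR κ) T) (hS : MatIn (parityR κ) S) (sT : st T = T)
    (sS : st S = S) (hN : N * (1 - T * Sg κ V * S) = 1) (hN' : (1 - T * Sg κ V * S) * N = 1) :
    st (N * T) = N * T := by
  have hNT := (propagator_mem hT hS hN).mul hT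
  have e1 := inverse_eq_left hN
  have e2 := inverse_eq_right hN'
  have h1 : st (N * T) = T + st (N * T) * Sg κ V * (S * T) := by
    have : N * T = T + T * Sg κ V * S * (N * T) := by
      conv_lhs => rw [e2, add_mul, one_mul, mul_assoc]
    conv_lhs => rw [this, st_add, sT, st_mul ((hT.mul MatIn.sgm).mul hS) hNT,
      st_mul (hT.mul MatIn.sgm) hS, st_mul_sgm, sT, sS, mul_assoc S, ← mul_assoc (Sg κ V) (Sg κ V),
      sgm_mul_sgm, one_mul]
  have h2 : N * T = T + N * T * Sg κ V * (S * T) := by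
    conv_lhs => rw [e1, add_mul, one_mul, mul_assoc _ S T]
  have h3 : (1 - Sg κ V * S * T) * (1 + Sg κ V * S * (N * T)) = 1 := by
    have : N * T = T + T * Sg κ V * S * N * T := by
      conv_lhs => rw [e2, add_mul, one_mul]
    have h4 : (1 - Sg κ V * S * T) * (1 + Sg κ V * S * (N * T)) =
        1 + Sg κ V * S * (N * T - (T + T * Sg κ V * S * N * T)) := by noncomm_ring
    rw [h4, ← this, sub_self, mul_zero, add_zero]
  have h5 : (st (N * T) - N * T) * (1 - Sg κ V * S * T) = 0 := by
    have : (st (N * T) - N * T) * (1 - Sg κ V * S * T) =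
      st (N * T) - st (N * T) * Sg κ V * (S * T) - (N * T - N * T * Sg κ V * (S * T)) := by
        noncomm_ring
    rw [this, sub_eq_zero, sub_eq_iff_eq_add.2 h1, sub_eq_iff_eq_add.2 h2]
  rw [← sub_eq_zero, ← mul_one (st (N * T) - N * T), ← h3, ← mul_assoc, h5, zero_mul]

/-- `S N` is supersymmetric. -/
theorem st_mul_upper (hT : MatIn (parityR κ) T) (hS : MatIn (parityR κ) S) (sT : st T = T)
    (sS : st S = S) (hN : N * (1 - T * Sg κ V * S) = 1) (hN' : (1 - T * Sg κ V * S) * N = 1) :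
    st (S * N) = S * N := by
  have hSN := hS.mul (propagator_mem hT hS hN)
  have e1 := inverse_eq_left hN
  have e2 := inverse_eq_right hN'
  have h1 : st (S * N) = S + S * T * Sg κ V * st (S * N) := by
    have : S * N = S + S * N * T * Sg κ V * S := by
      conv_lhs => rw [e1, mul_add, mul_one]
      simp only [mul_assoc]
    conv_lhs => rw [this, st_add, sS, st_mul ((hSN.mul hT).mul MatIn.sgm) hS, st_mul_sgm,
      sS, mul_assoc S, ← mul_assoc (Sg κ V), sgm_mul_sgm, one_mul, st_mul hSN hT, sT]
    simp only [mul_assoc]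
  have h2 : S * N = S + S * T * Sg κ V * (S * N) := by
    conv_lhs => rw [e2, mul_add, mul_one]
    simp only [mul_assoc]
  have h3 : (1 + S * N * T * Sg κ V) * (1 - S * T * Sg κ V) = 1 := by
    have h4 : (1 + S * N * T * Sg κ V) * (1 - S * T * Sg κ V) =
        1 + S * (N - (1 + N * T * Sg κ V * S)) * T * Sg κ V := by noncomm_ring
    rw [h4, ← e1, sub_self, mul_zero, zero_mul, zero_mul, add_zero]
  have h5 : (1 - S * T * Sg κ V) * (st (S * N) - S * N) = 0 := by
    have : (1 - S * T * Sg κ V) * (st (S * N) - S * N) =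
      st (S * N) - S * T * Sg κ V * st (S * N) - (S * N - S * T * Sg κ V * (S * N)) := by
        noncomm_ring
    rw [this, sub_eq_zero, sub_eq_iff_eq_add.2 h1, sub_eq_iff_eq_add.2 h2]
  rw [← sub_eq_zero, ← one_mul (st (S * N) - S * N), ← h3, mul_assoc, h5, mul_zero]

theorem st_inverse_mul_sgm (hT : MatIn (parityR κ) T) (hS : MatIn (parityR κ) S) (sT : st T = T)
    (sS : st S = S) (hN : N * (1 - T * Sg κ V * S) = 1) (hN' : (1 - T * Sg κ V * S) * N = 1) :
    st N * Sg κ V = 1 + S * (N * T) * Sg κ V := by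
  have hNT := (propagator_mem hT hS hN).mul hT
  conv_lhs => rw [inverse_eq_left hN, st_add, st_one, st_mul (hNT.mul MatIn.sgm) hS, st_mul_sgm,
    st_mul_lower hT hS sT sS hN hN', sS, add_mul, sgm_mul_sgm, mul_assoc S, ← mul_assoc (Sg κ V),
    sgm_mul_sgm, one_mul]

end Propagator

namespace QuadAction

variable {κ τ : Type} {V₁ V₂ V₃ V₄ : SuperSpace}

/-- The equations of a critical point `(y, q)` of `S₃₂(y,r) + S₂₁(x,q) - yⁱ q_i`. -/
def IsCrit (S₃₂ : QuadAction κ V₂ V₃) (S₂₁ : QuadAction κ V₁ V₂) (f : κ → τ)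
    (x : V₁.Idx → Λ τ) (r : V₃.Idx → Λ τ) (y q : V₂.Idx → Λ τ) : Prop :=
  q = S₃₂.derivX (genMap f) y r ∧ y = S₂₁.derivQ (genMap f) x q

variable [Finite κ] (S₃₂ : QuadAction κ V₂ V₃) (S₂₁ : QuadAction κ V₁ V₂)

/-- The matrix `δ - T S (-1)^k̃`. -/
noncomputable def compM : Matrix V₂.Idx V₂.Idx (Λ κ) :=
  1 - of S₃₂.xx * Sg κ V₂ * of S₂₁.qq

/-- The inverse of the matrix `δ - T S (-1)^k̃`. -/
noncomputable def compN : Matrix V₂.Idx V₂.Idx (Λ κ) := Ring.inverse (compM S₃₂ S₂₁)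

variable {S₃₂ S₂₁}

theorem composable_iff : Composable S₃₂ S₂₁ ↔ IsUnit (compM S₃₂ S₂₁) := by
  rw [Composable, tsMatrix_eq]; rfl

theorem compN_mul (h : Composable S₃₂ S₂₁) : compN S₃₂ S₂₁ * compM S₃₂ S₂₁ = 1 :=
  Ring.inverse_mul_cancel _ (composable_iff.1 h)

theorem mul_compN (h : Composable S₃₂ S₂₁) : compM S₃₂ S₂₁ * compN S₃₂ S₂₁ = 1 :=
  Ring.mul_inverse_cancel _ (composable_iff.1 h)

theorem compN_in (h : Composable S₃₂ S₂₁) : MatIn (realParity κ) (compN S₃₂ S₂₁) :=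
  propagator_mem S₃₂.xx_in S₂₁.qq_in (compN_mul h)

variable (S₃₂ S₂₁)

/-- The momentum of the critical point for `x = 0`, `r = 0`. -/
noncomputable def compQ₀ : V₂.Idx → Λ κ :=
  compN S₃₂ S₂₁ *ᵥ (S₃₂.linX + (of S₃₂.xx * Sg κ V₂) *ᵥ S₂₁.linQ)

/-- The position of the critical point for `x = 0`, `r = 0`. -/
noncomputable def compY₀ : V₂.Idx → Λ κ := S₂₁.linQ + of S₂₁.qq *ᵥ compQ₀ S₃₂ S₂₁

variable {S₃₂ S₂₁}

section

variable (h : Composable S₃₂ S₂₁)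
include h

theorem compQ₀_in : VecIn (realParity κ) (compQ₀ S₃₂ S₂₁) :=
  (compN_in h).mulVec (S₃₂.linX_in.add ((S₃₂.xx_in.mul MatIn.sgm).mulVec S₂₁.linQ_in))

theorem compY₀_in : VecIn (realParity κ) (compY₀ S₃₂ S₂₁) :=
  S₂₁.linQ_in.add (S₂₁.qq_in.mulVec (compQ₀_in h))

theorem comp_xx_in : MatIn (realParity κ)
    (of S₂₁.xx + of S₂₁.xq * (compN S₃₂ S₂₁ * of S₃₂.xx) * Sg κ V₂ * st (of S₂₁.xq)) :=
  S₂₁.xx_in.add (((S₂₁.xq_in.mul ((compN_in h).mul S₃₂.xx_in)).mul MatIn.sgm).mul S₂₁.xq_in.st)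

theorem comp_xq_in : MatIn (realParity κ)
    (of S₂₁.xq * compN S₃₂ S₂₁ * of S₃₂.xq) :=
  (S₂₁.xq_in.mul (compN_in h)).mul S₃₂.xq_in

theorem comp_qq_in : MatIn (realParity κ)
    (of S₃₂.qq + st (of S₃₂.xq) * Sg κ V₂ * ((of S₂₁.qq * compN S₃₂ S₂₁) * of S₃₂.xq)) :=
  S₃₂.qq_in.add ((S₃₂.xq_in.st.mul MatIn.sgm).mul ((S₂₁.qq_in.mul (compN_in h)).mul S₃₂.xq_in))

theorem comp_linX_in : VecIn (realParity κ)
    (S₂₁.linX + of S₂₁.xq *ᵥ compQ₀ S₃₂ S₂₁) :=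
  S₂₁.linX_in.add (S₂₁.xq_in.mulVec (compQ₀_in h))

theorem comp_linQ_in : VecIn (realParity κ)
    (S₃₂.linQ + (st (of S₃₂.xq) * Sg κ V₂) *ᵥ compY₀ S₃₂ S₂₁) :=
  S₃₂.linQ_in.add ((S₃₂.xq_in.st.mul MatIn.sgm).mulVec (compY₀_in h))

theorem st_lower :
    st (compN S₃₂ S₂₁ * of S₃₂.xx) = compN S₃₂ S₂₁ * of S₃₂.xx :=
  st_mul_lower S₃₂.xx_in.of_real S₂₁.qq_in.of_real S₃₂.st_xx S₂₁.st_qq (compN_mul h) (mul_compN h)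

theorem st_upper :
    st (of S₂₁.qq * compN S₃₂ S₂₁) = of S₂₁.qq * compN S₃₂ S₂₁ :=
  st_mul_upper S₃₂.xx_in.of_real S₂₁.qq_in.of_real S₃₂.st_xx S₂₁.st_qq (compN_mul h) (mul_compN h)

theorem comp_xx_symm :
    st (of S₂₁.xx + of S₂₁.xq * (compN S₃₂ S₂₁ * of S₃₂.xx) * Sg κ V₂ * st (of S₂₁.xq)) =
    of S₂₁.xx + of S₂₁.xq * (compN S₃₂ S₂₁ * of S₃₂.xx) * Sg κ V₂ * st (of S₂₁.xq) := by
  have h1 := S₂₁.xq_in.of_real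
  have h2 := ((compN_in h).mul S₃₂.xx_in).of_real
  rw [st_add, st_xx, st_mul ((h1.mul h2).mul MatIn.sgm) h1.st, st_st, st_mul_sgm, st_mul h1 h2,
    st_lower h]
  simp only [Matrix.mul_assoc, sgm_mul_sgm_mul]

theorem comp_qq_symm :
    st (of S₃₂.qq + st (of S₃₂.xq) * Sg κ V₂ * ((of S₂₁.qq * compN S₃₂ S₂₁) * of S₃₂.xq)) =
    of S₃₂.qq + st (of S₃₂.xq) * Sg κ V₂ * ((of S₂₁.qq * compN S₃₂ S₂₁) * of S₃₂.xq) := by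
  have h1 := S₃₂.xq_in.of_real
  have h2 := (S₂₁.qq_in.mul (compN_in h)).of_real
  rw [st_add, st_qq, st_mul (h1.st.mul MatIn.sgm) (h2.mul h1), st_mul_sgm, st_st, st_mul h2 h1,
    st_upper h]
  simp only [Matrix.mul_assoc, sgm_mul_sgm_mul]

end

variable (S₃₂ S₂₁)

/-- The classical composition. -/
noncomputable def comp (h : Composable S₃₂ S₂₁) : QuadAction κ V₁ V₃ where
  const := S₃₂.const + S₂₁.const + ⟨(1 / 2 : ℂ) • (compY₀ S₃₂ S₂₁ ⬝ᵥ S₃₂.linX) +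
    (1 / 2 : ℂ) • (S₂₁.linQ ⬝ᵥ compQ₀ S₃₂ S₂₁), Submodule.add_mem (parityPart κ 0)
      (smul_mem _ _ (dotProduct_even (compY₀_in h).of_real S₃₂.linX_in.of_real))
      (smul_mem _ _ (dotProduct_even S₂₁.linQ_in.of_real (compQ₀_in h).of_real))⟩
  linX := S₂₁.linX + of S₂₁.xq *ᵥ compQ₀ S₃₂ S₂₁
  linQ := S₃₂.linQ + (st (of S₃₂.xq) * Sg κ V₂) *ᵥ compY₀ S₃₂ S₂₁
  xx := of S₂₁.xx + of S₂₁.xq * (compN S₃₂ S₂₁ * of S₃₂.xx) * Sg κ V₂ * st (of S₂₁.xq)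
  xq := of S₂₁.xq * compN S₃₂ S₂₁ * of S₃₂.xq
  qq := of S₃₂.qq + st (of S₃₂.xq) * Sg κ V₂ * ((of S₂₁.qq * compN S₃₂ S₂₁) * of S₃₂.xq)
  linX_parity i := (comp_linX_in h i).1
  linQ_parity i := (comp_linQ_in h i).1
  xx_parity i j := (comp_xx_in h i j).1
  xq_parity i j := (comp_xq_in h i j).1
  qq_parity i j := (comp_qq_in h i j).1
  xx_symm i j := by
    conv_lhs => rw [← comp_xx_symm h]
    rw [sgn₂_eq_sg]; rfl
  qq_symm i j := by
    conv_lhs => rw [← comp_qq_symm h]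
    rw [sgn₂_eq_sg]; rfl
  linX_real i := (comp_linX_in h i).2
  linQ_real i := (comp_linQ_in h i).2
  xx_real i j := (comp_xx_in h i j).2
  xq_real i j := (comp_xq_in h i j).2
  qq_real i j := (comp_qq_in h i j).2

variable {S₃₂ S₂₁} (f : κ → τ) {x : V₁.Idx → Λ τ} {r : V₃.Idx → Λ τ}
  {y q : V₂.Idx → Λ τ}

theorem vmap_compQ₀ : vmap f (compQ₀ S₃₂ S₂₁) = mmap f (compN S₃₂ S₂₁) *ᵥ
    (vmap f S₃₂.linX + (mmap f (of S₃₂.xx) * Sg τ V₂) *ᵥ vmap f S₂₁.linQ) := by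
  rw [compQ₀, vmap_mulVec, vmap_add, vmap_mulVec, mmap_mul, mmap_sgm]

theorem vmap_compY₀ : vmap f (compY₀ S₃₂ S₂₁) =
    vmap f S₂₁.linQ + mmap f (of S₂₁.qq) *ᵥ vmap f (compQ₀ S₃₂ S₂₁) := by
  rw [compY₀, vmap_add, vmap_mulVec]

variable (h : Composable S₃₂ S₂₁)
include h

theorem mmap_compN_mul : mmap f (compN S₃₂ S₂₁) *
      (1 - mmap f (of S₃₂.xx) * Sg τ V₂ * mmap f (of S₂₁.qq)) = 1 := by
  have := congrArg (mmap f) (compN_mul h)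
  rwa [compM, mmap_mul, mmap_sub, mmap_mul, mmap_mul, mmap_sgm, mmap_one] at this

theorem mmap_mul_compN :
    (1 - mmap f (of S₃₂.xx) * Sg τ V₂ * mmap f (of S₂₁.qq)) *
      mmap f (compN S₃₂ S₂₁) = 1 := by
  have := congrArg (mmap f) (mul_compN h)
  rwa [compM, mmap_mul, mmap_sub, mmap_mul, mmap_mul, mmap_sgm, mmap_one] at this

/-- The critical point in terms of `x` and `r`. -/
theorem isCrit_iff (hx : IsPoint x) (hy : IsPoint y) :
    IsCrit S₃₂ S₂₁ f x r y q ↔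
      q = mmap f (compN S₃₂ S₂₁) *ᵥ (vmap f S₃₂.linX + (mmap f (of S₃₂.xx) * Sg τ V₂) *ᵥ
        (vmap f S₂₁.linQ + (st (mmap f (of S₂₁.xq)) * Sg τ V₁) *ᵥ x) + mmap f (of S₃₂.xq) *ᵥ r) ∧
      y = vmap f S₂₁.linQ + (st (mmap f (of S₂₁.xq)) * Sg τ V₁) *ᵥ x + mmap f (of S₂₁.qq) *ᵥ q := by
  rw [IsCrit, derivX_eq f S₃₂ hy, derivQ_eq f S₂₁ hx]
  have hN := mmap_compN_mul f h
  have hN' := mmap_mul_compN f h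
  refine and_congr_left fun hyq => ?_
  generalize vmap f S₂₁.linQ + (st (mmap f (of S₂₁.xq)) * Sg τ V₁) *ᵥ x = u at *
  generalize mmap f (of S₃₂.xx) * Sg τ V₂ = T at *
  generalize mmap f (compN S₃₂ S₂₁) = N at *
  generalize mmap f (of S₃₂.xq) *ᵥ r = b at *
  generalize mmap f (of S₂₁.qq) = S at *
  rw [hyq, mulVec_add]
  have key : ∀ q : V₂.Idx → Λ τ, (1 - T * S) *ᵥ q = q - T *ᵥ (S *ᵥ q) := fun q => by
    rw [sub_mulVec, one_mulVec, mulVec_mulVec]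
  constructor
  · intro h1
    have h2 : (1 - T * S) *ᵥ q = vmap f S₃₂.linX + T *ᵥ u + b := by
      rw [key, sub_eq_iff_eq_add]
      conv_lhs => rw [h1]
      abel
    rw [← h2, mulVec_mulVec, hN, one_mulVec]
  · intro h1
    have h2 : (1 - T * S) *ᵥ q = vmap f S₃₂.linX + T *ᵥ u + b := by
      rw [h1, mulVec_mulVec, hN', one_mulVec]
    rw [key, sub_eq_iff_eq_add] at h2
    rw [← add_assoc]
    conv_lhs => rw [h2]
    abel

theorem exists_crit (hx : IsPoint x) (hr : IsPoint r) :
    ∃ y q : V₂.Idx → Λ τ, IsPoint y ∧ IsPoint q ∧ IsCrit S₃₂ S₂₁ f x r y q := by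
  have hu := (S₂₁.linQ_in.of_real.vmap f).add
    (((S₂₁.xq_in.of_real.mmap f).st.mul MatIn.sgm).mulVec (isPoint_iff.1 hx))
  have hq := ((compN_in h).of_real.mmap f).mulVec (((S₃₂.linX_in.of_real.vmap f).add
    (((S₃₂.xx_in.of_real.mmap f).mul MatIn.sgm).mulVec hu)).add
      ((S₃₂.xq_in.of_real.mmap f).mulVec (isPoint_iff.1 hr)))
  have hy := hu.add ((S₂₁.qq_in.of_real.mmap f).mulVec hq)
  exact ⟨_, _, hy, hq, (isCrit_iff f h hx hy).2 ⟨rfl, rfl⟩⟩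

theorem crit_unique (hx : IsPoint x) {y' q' : V₂.Idx → Λ τ}
    (hy : IsPoint y) (hy' : IsPoint y')
    (hc : IsCrit S₃₂ S₂₁ f x r y q) (hc' : IsCrit S₃₂ S₂₁ f x r y' q') : y = y' ∧ q = q' := by
  rw [isCrit_iff f h hx hy] at hc
  rw [isCrit_iff f h hx hy'] at hc'
  have hq : q = q' := hc.1.trans hc'.1.symm
  exact ⟨by rw [hc.2, hc'.2, hq], hq⟩

theorem comp_derivX (hx : IsPoint x) (hy : IsPoint y)
    (hc : IsCrit S₃₂ S₂₁ f x r y q) :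
    (comp S₃₂ S₂₁ h).derivX (genMap f) x r = S₂₁.derivX (genMap f) x q := by
  rw [isCrit_iff f h hx hy] at hc
  rw [derivX_eq f _ hx, derivX_eq f _ hx]
  simp only [comp]
  change vmap f (S₂₁.linX + of S₂₁.xq *ᵥ compQ₀ S₃₂ S₂₁) + (mmap f (of S₂₁.xx + of S₂₁.xq *
    (compN S₃₂ S₂₁ * of S₃₂.xx) * Sg κ V₂ * st (of S₂₁.xq)) * Sg τ V₁) *ᵥ x +
    mmap f (of S₂₁.xq * compN S₃₂ S₂₁ * of S₃₂.xq) *ᵥ r = _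
  rw [vmap_add, vmap_mulVec, vmap_compQ₀, hc.1]
  simp only [mmap_add, mmap_mul, mmap_sgm, mmap_st, add_mul, add_mulVec, mulVec_add, mulVec_mulVec,
    Matrix.mul_assoc]
  abel

theorem comp_derivQ (hx : IsPoint x) (hy : IsPoint y)
    (hc : IsCrit S₃₂ S₂₁ f x r y q) :
    (comp S₃₂ S₂₁ h).derivQ (genMap f) x r = S₃₂.derivQ (genMap f) y r := by
  rw [isCrit_iff f h hx hy] at hc
  rw [derivQ_eq f _ hx, derivQ_eq f _ hy]
  change vmap f (S₃₂.linQ + (st (of S₃₂.xq) * Sg κ V₂) *ᵥ compY₀ S₃₂ S₂₁) +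
    (st (mmap f (of S₂₁.xq * compN S₃₂ S₂₁ * of S₃₂.xq)) * Sg τ V₁) *ᵥ x +
    mmap f (of S₃₂.qq + st (of S₃₂.xq) * Sg κ V₂ * ((of S₂₁.qq * compN S₃₂ S₂₁) * of S₃₂.xq)) *ᵥ r
    = _
  have key : st (of S₂₁.xq * compN S₃₂ S₂₁ * of S₃₂.xq) = st (of S₃₂.xq) * Sg κ V₂ *
      ((1 + of S₂₁.qq * (compN S₃₂ S₂₁ * of S₃₂.xx) * Sg κ V₂) * st (of S₂₁.xq)) := by
    have hs := st_inverse_mul_sgm S₃₂.xx_in.of_real S₂₁.qq_in.of_real S₃₂.st_xx S₂₁.st_qq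
      (compN_mul h) (mul_compN h)
    rw [st_mul (S₂₁.xq_in.mul (compN_in h)).of_real S₃₂.xq_in.of_real,
      st_mul S₂₁.xq_in.of_real (compN_in h).of_real, hs]
  rw [vmap_add, vmap_mulVec, vmap_compY₀, vmap_compQ₀, ← mmap_st, key, hc.2, hc.1]
  simp only [mmap_add, mmap_mul, mmap_sgm, mmap_st, Matrix.add_mul, add_mulVec, mulVec_add, mulVec_mulVec,
    Matrix.mul_assoc, Matrix.one_mul, Matrix.mul_add]
  abel

theorem comp_eval (hx : IsPoint x) (hy : IsPoint y)
    (hq : IsPoint q) (hc : IsCrit S₃₂ S₂₁ f x r y q) :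
    (comp S₃₂ S₂₁ h).eval (genMap f) x r =
      S₃₂.eval (genMap f) y r + S₂₁.eval (genMap f) x q - pairing y q := by
  have hq₀ := (compQ₀_in h).of_real.vmap f
  have hy₀ := (compY₀_in h).of_real.vmap f
  have e1 : vmap f (compQ₀ S₃₂ S₂₁) =
      vmap f S₃₂.linX + vmap f (compY₀ S₃₂ S₂₁) ᵥ* mmap f (of S₃₂.xx) := by
    have h0 : IsCrit S₃₂ S₂₁ f (0 : V₁.Idx → Λ τ) (0 : V₃.Idx → Λ τ)
        (vmap f (compY₀ S₃₂ S₂₁)) (vmap f (compQ₀ S₃₂ S₂₁)) := by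
      have hz : IsPoint (0 : V₁.Idx → Λ τ) := fun i => zero_mem _
      rw [isCrit_iff f h hz hy₀]
      simp only [mulVec_zero, add_zero, vmap_compQ₀, vmap_compY₀, and_self]
    have := h0.1
    rw [derivX_eq_vecMul, mulVec_zero, add_zero] at this
    exact this
  have e2 : vmap f (compY₀ S₃₂ S₂₁) =
    vmap f S₂₁.linQ + mmap f (of S₂₁.qq) *ᵥ vmap f (compQ₀ S₃₂ S₂₁) := vmap_compY₀ f
  have e3 := hc.1
  have e4 := hc.2
  rw [derivX_eq_vecMul] at e3
  rw [derivQ_eq_vecMul] at e4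
  rw [eval_eq, eval_eq, eval_eq, comp_derivX f h hx hy hc, comp_derivQ f h hx hy hc, ← hc.1, ← hc.2]
  have c1 : (fun a => genMap f ((comp S₃₂ S₂₁ h).linX a) + S₂₁.derivX (genMap f) x q a) =
      (fun a => genMap f (S₂₁.linX a) + S₂₁.derivX (genMap f) x q a) +
        mmap f (of S₂₁.xq) *ᵥ vmap f (compQ₀ S₃₂ S₂₁) := by
    rw [← vmap_mulVec]
    funext a
    simp only [comp, Pi.add_apply, map_add, vmap]
    abel
  have c2 : (fun i => genMap f ((comp S₃₂ S₂₁ h).linQ i) + S₃₂.derivQ (genMap f) y r i) =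
      (fun i => genMap f (S₃₂.linQ i) + S₃₂.derivQ (genMap f) y r i) +
        vmap f (compY₀ S₃₂ S₂₁) ᵥ* mmap f (of S₃₂.xq) := by
    rw [vecMul_eq (S₃₂.xq_in.of_real.mmap f) hy₀, ← mmap_st, ← mmap_sgm f, ← mmap_mul,
      ← vmap_mulVec]
    funext a
    simp only [comp, Pi.add_apply, map_add, vmap]
    abel
  have c0 : genMap f ((comp S₃₂ S₂₁ h).const : Λ κ) = genMap f S₃₂.const +
      genMap f S₂₁.const + (1 / 2 : ℂ) • (vmap f (compY₀ S₃₂ S₂₁) ⬝ᵥ vmap f S₃₂.linX) +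
      (1 / 2 : ℂ) • (vmap f S₂₁.linQ ⬝ᵥ vmap f (compQ₀ S₃₂ S₂₁)) := by
    simp only [comp, Subalgebra.coe_add, map_add, map_smul, genMap_dotProduct]
    abel
  rw [c0, c1, c2, dotProduct_add, add_dotProduct]
  have c3 : (fun a => genMap f (S₃₂.linX a) + q a) = vmap f S₃₂.linX + q := rfl
  have c4 : (fun a => genMap f (S₂₁.linQ a) + y a) = vmap f S₂₁.linQ + y := rfl
  rw [c3, c4, dotProduct_add, add_dotProduct, show pairing y q = y ⬝ᵥ q from rfl]
  have hT := mmap_st f (of S₃₂.xx)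
  have hS := mmap_st f (of S₂₁.qq)
  rw [st_xx] at hT
  rw [st_qq] at hS
  set q₀ := vmap f (compQ₀ S₃₂ S₂₁)
  set y₀ := vmap f (compY₀ S₃₂ S₂₁)
  set l := vmap f S₃₂.linX
  set m := vmap f S₂₁.linQ
  set T := mmap f (of S₃₂.xx)
  set S := mmap f (of S₂₁.qq)
  set A := mmap f (of S₂₁.xq)
  set B := mmap f (of S₃₂.xq)
  have k1 : y₀ ⬝ᵥ q = y₀ ⬝ᵥ l + y₀ ⬝ᵥ (y ᵥ* T) + (y₀ ᵥ* B) ⬝ᵥ r := by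
    conv_lhs => rw [e3]
    rw [dotProduct_add, dotProduct_add, dotProduct_mulVec]
  have k2 : y ⬝ᵥ q₀ = y ⬝ᵥ l + y ⬝ᵥ (y₀ ᵥ* T) := by
    conv_lhs => rw [e1]
    rw [dotProduct_add]
  have k3 : y ⬝ᵥ q₀ = m ⬝ᵥ q₀ + x ⬝ᵥ (A *ᵥ q₀) + (S *ᵥ q) ⬝ᵥ q₀ := by
    conv_lhs => rw [e4]
    rw [add_dotProduct, add_dotProduct, dotProduct_mulVec]
  have k4 : y₀ ⬝ᵥ q = m ⬝ᵥ q + (S *ᵥ q₀) ⬝ᵥ q := by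
    conv_lhs => rw [e2]
    rw [add_dotProduct]
  have k5 := dot_symm_lower hT.symm (isPoint_iff.1 hy) hy₀
  have k6 := dot_symm_upper hS.symm (isPoint_iff.1 hq) hq₀
  have k7 : y ⬝ᵥ l + m ⬝ᵥ q = y₀ ⬝ᵥ l + m ⬝ᵥ q₀ + x ⬝ᵥ (A *ᵥ q₀) + (y₀ ᵥ* B) ⬝ᵥ r := by
    have i1 : y ⬝ᵥ l = y ⬝ᵥ q₀ - y ⬝ᵥ (y₀ ᵥ* T) := by rw [k2]; abel
    have i2 : m ⬝ᵥ q = y₀ ⬝ᵥ q - (S *ᵥ q₀) ⬝ᵥ q := by rw [k4]; abel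
    rw [i1, i2, k1, k3, k5, k6]; abel
  have k8 : y ⬝ᵥ l = y₀ ⬝ᵥ l + m ⬝ᵥ q₀ + x ⬝ᵥ (A *ᵥ q₀) + (y₀ ᵥ* B) ⬝ᵥ r - m ⬝ᵥ q := by
    rw [← k7]; abel
  rw [k8]
  module

end QuadAction

/-- Coefficients of a quadratic polynomial are determined by its values. -/
theorem quadratic_coeff_eq_zero {J E : Type*} [Fintype J] [DecidableEq J] [AddCommGroup E]
    [Module ℂ E] (L : J → E) (Q : J → J → E) (K : E)
    (h : ∀ u : J → ℝ, K + ∑ j, (u j : ℂ) • L j +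
      ∑ j, ∑ k, ((u j : ℂ) * (u k : ℂ)) • Q j k = 0) :
    K = 0 ∧ (∀ j, L j = 0) ∧ ∀ j k, Q j k + Q k j = 0 := by
  have key : ∀ j k (a b : ℝ), K + ((a : ℂ) • L j + (b : ℂ) • L k) + (((a * a : ℝ) : ℂ) • Q j j +
      ((a * b : ℝ) : ℂ) • (Q j k + Q k j) + ((b * b : ℝ) : ℂ) • Q k k) = 0 := by
    intro j k a b
    rw [← h (Pi.single j a + Pi.single k b)]
    have hs : ∀ (F : J → E), ∑ i, (((Pi.single j a + Pi.single k b : J → ℝ) i : ℝ) : ℂ) • F i =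
        (a : ℂ) • F j + (b : ℂ) • F k := by
      intro F
      simp only [Pi.add_apply, Complex.ofReal_add, add_smul, sum_add_distrib]
      congr 1
      · rw [Finset.sum_eq_single j] <;> simp +contextual
      · rw [Finset.sum_eq_single k] <;> simp +contextual
    simp only [mul_smul, ← smul_sum]
    rw [hs, hs, hs, hs]
    push_cast
    module
  have hK : K = 0 := by
    rcases isEmpty_or_nonempty J with hJ | ⟨⟨j⟩⟩
    · simpa using h 0
    · simpa using key j j 0 0
  have hL : ∀ j, L j + Q j j = 0 := fun j => by simpa [hK] using key j j 1 0
  have hL' : ∀ j, -L j + Q j j = 0 := fun j => by simpa [hK] using key j j (-1) 0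
  have hQ : ∀ j, Q j j = 0 := fun j => by
    have h2 : (2 : ℂ) • Q j j = (L j + Q j j) + (-L j + Q j j) := by module
    rw [hL, hL', add_zero] at h2
    exact (smul_eq_zero.1 h2).resolve_left two_ne_zero
  have hL0 : ∀ j, L j = 0 := fun j => by simpa [hQ] using hL j
  exact ⟨hK, hL0, fun j k => by simpa [hK, hL0, hQ] using key j k 1 1⟩

section Scale

variable {κ τ υ : Type}

/-- Rescaling of the generators. -/
noncomputable def scale (s : τ → ℂ) : Λ τ →ₐ[ℂ] Λ τ :=
  ExteriorAlgebra.map (Finsupp.linearCombination ℂ fun k => Finsupp.single k (s k))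

theorem scale_gen (s : τ → ℂ) (k : τ) : scale s (gen k) = s k • gen k := by
  rw [scale, map_gen, Finsupp.linearCombination_single, one_smul, gen_def, ← map_smul,
    Finsupp.smul_single, smul_eq_mul, mul_one]

theorem scale_genMap (s : υ → ℂ) (f : κ → υ) (h : ∀ k, s (f k) = 1) (x : Λ κ) :
    scale s (genMap f x) = genMap f x := by
  have : (scale s).comp (genMap f) = genMap f := grassmann_hom_ext fun k => by
    rw [AlgHom.comp_apply, genMap_gen, scale_gen, h, one_smul]
  exact DFunLike.congr_fun this x

theorem gen_injective : Function.Injective (gen : τ → Λ τ) := by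
  classical
  intro i j h
  by_contra hne
  have h1 := congrArg (oddDeriv i) h
  rw [oddDeriv_gen, oddDeriv_gen, if_pos rfl, if_neg (Ne.symm hne)] at h1
  have := congrArg body h1
  simp at this

theorem mul_left_cancel_free {u y : Λ τ} (hu : u = 1 ∨ ∃ k, u = gen k ∧ oddDeriv k y = 0)
    (h : u * y = 0) : y = 0 := by
  classical
  rcases hu with rfl | ⟨k, rfl, hk⟩
  · rwa [one_mul] at h
  · have := congrArg (oddDeriv k) h
    rwa [oddDeriv_gen_mul, if_pos rfl, hk, mul_zero, sub_zero, map_zero] at this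

end Scale

theorem coords_point {τ : Type} {V : SuperSpace} (e : Fin V.even → ℝ) (o : Fin V.odd → τ) :
    IsPoint (coords e o) := by
  rintro (a | a)
  · exact algebraMap_even _
  · exact gen_odd _

namespace QuadAction

variable {κ τ υ : Type} {V₁ V₂ V₃ V₄ : SuperSpace}

theorem map_eval (S : QuadAction κ V₁ V₂) (ψ : Λ τ →ₐ[ℂ] Λ υ)
    (φ : Λ κ →ₐ[ℂ] Λ τ) (x : V₁.Idx → Λ τ) (q : V₂.Idx → Λ τ) :
    ψ (S.eval φ x q) = S.eval (ψ.comp φ) (fun a => ψ (x a)) (fun i => ψ (q i)) := by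
  simp [eval, map_sum]

/-- Values at rescaled arguments. -/
theorem eval_smul (S : QuadAction κ V₁ V₂) (φ : Λ κ →ₐ[ℂ] Λ τ)
    (x : V₁.Idx → Λ τ) (q : V₂.Idx → Λ τ) (u : V₁.Idx ⊕ V₂.Idx → ℂ) :
    S.eval φ (fun a => u (.inl a) • x a) (fun i => u (.inr i) • q i) = φ S.const +
      ∑ j, u j • elim (fun a => x a * φ (S.linX a)) (fun i => φ (S.linQ i) * q i) j +
      ∑ j, ∑ k, (u j * u k) • elim
        (fun a => elim (fun b => (1 / 2 : ℂ) • (x a * x b * φ (S.xx b a)))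
          (fun i => x a * φ (S.xq a i) * q i))
        (fun i => elim (fun _ => 0) fun j => (1 / 2 : ℂ) • (φ (S.qq i j) * q j * q i)) j k := by
  have hsum : ∀ F : V₁.Idx ⊕ V₂.Idx → Λ τ,
      ∑ j, F j = ∑ a, F (.inl a) + ∑ i, F (.inr i) := fun F => Fintype.sum_sum_type F
  simp only [eval, hsum, elim_inl, elim_inr, smul_zero,
    sum_const_zero, zero_add, sum_add_distrib, smul_sum]
  simp only [smul_mul_assoc, mul_smul_comm, smul_smul]
  simp only [mul_comm]
  abel

theorem eval_addConst (S : QuadAction κ V₁ V₂) (c : GEven κ) (φ : Λ κ →ₐ[ℂ] Λ τ)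
    (x : V₁.Idx → Λ τ) (q : V₂.Idx → Λ τ) :
    (S.addConst c).eval φ x q = S.eval φ x q + φ c := by
  simp only [eval, addConst, Subalgebra.coe_add, map_add]
  abel

/-- The difference of two actions. -/
noncomputable def diff (S S' : QuadAction κ V₁ V₂) : QuadAction κ V₁ V₂ where
  const := S.const - S'.const
  linX a := S.linX a - S'.linX a
  linQ i := S.linQ i - S'.linQ i
  xx a b := S.xx a b - S'.xx a b
  xq a i := S.xq a i - S'.xq a i
  qq i j := S.qq i j - S'.qq i j
  linX_parity a := sub_mem (S.linX_parity a) (S'.linX_parity a)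
  linQ_parity i := sub_mem (S.linQ_parity i) (S'.linQ_parity i)
  xx_parity a b := sub_mem (S.xx_parity a b) (S'.xx_parity a b)
  xq_parity a i := sub_mem (S.xq_parity a i) (S'.xq_parity a i)
  qq_parity i j := sub_mem (S.qq_parity i j) (S'.qq_parity i j)
  xx_symm a b := by rw [S.xx_symm, S'.xx_symm, smul_sub]
  qq_symm i j := by rw [S.qq_symm, S'.qq_symm, smul_sub]
  linX_real a := sub_mem (S.linX_real a) (S'.linX_real a)
  linQ_real i := sub_mem (S.linQ_real i) (S'.linQ_real i)
  xx_real a b := sub_mem (S.xx_real a b) (S'.xx_real a b)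
  xq_real a i := sub_mem (S.xq_real a i) (S'.xq_real a i)
  qq_real i j := sub_mem (S.qq_real i j) (S'.qq_real i j)

theorem eval_diff (S S' : QuadAction κ V₁ V₂) (φ : Λ κ →ₐ[ℂ] Λ τ)
    (x : V₁.Idx → Λ τ) (q : V₂.Idx → Λ τ) :
    (S.diff S').eval φ x q = S.eval φ x q - S'.eval φ x q := by
  simp only [eval, diff, AddSubgroupClass.coe_sub, map_sub, mul_sub, sub_mul,
    Finset.sum_sub_distrib, smul_sub]
  abel

theorem smul_coords_one {V : SuperSpace} (s : τ → ℂ) (e : Fin V.even → ℝ) (o : Fin V.odd → τ) :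
    (fun a => scale s (coords e o a)) =
      fun a => elim (fun a => (e a : ℂ)) (s ∘ o) a • coords (V := V) 1 o a := by
  funext a
  rcases a with a | a
  · simp [coords, ← Algebra.algebraMap_eq_smul_one]
  · simp [coords, scale_gen]

/-- The values of an action at real even and free odd coordinates. -/
noncomputable def freeEval (S : QuadAction κ V₁ V₂) (v : (Fin V₁.even → ℝ) × (Fin V₂.even → ℝ)) :
    Λ (κ ⊕ (Fin V₁.odd ⊕ Fin V₂.odd)) :=
  S.eval (genMap inl) (coords v.1 (inr ∘ inl)) (coords v.2 (inr ∘ inr))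

/-- The coefficients of an action are determined by its values at free coordinates. -/
theorem eval_ext {S S' : QuadAction κ V₁ V₂} (h : ∀ v, S.freeEval v = S'.freeEval v) : S = S' := by
  classical
  let υ := κ ⊕ (Fin V₁.odd ⊕ Fin V₂.odd)
  let φ : Λ κ →ₐ[ℂ] Λ υ := genMap inl
  let Z : V₁.Idx ⊕ V₂.Idx → Λ υ := elim (coords 1 (inr ∘ inl)) (coords 1 (inr ∘ inr))
  obtain ⟨D, hD⟩ : ∃ D, D = S.diff S' := ⟨_, rfl⟩
  have hval : ∀ u : V₁.Idx ⊕ V₂.Idx → ℝ, D.eval φ (fun a => (u (.inl a) : ℂ) • Z (.inl a))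
      (fun i => (u (.inr i) : ℂ) • Z (.inr i)) = 0 := fun u => by
    let s : υ → ℂ := elim (fun _ => 1)
      (elim (fun a => (u (.inl (.inr a)) : ℂ)) (fun a => (u (.inr (.inr a)) : ℂ)))
    have h0 := congrArg (scale s) (sub_eq_zero.2
      (h (fun a => u (.inl (.inl a)), fun a => u (.inr (.inl a)))))
    have hφ : (scale s).comp φ = φ := AlgHom.ext (scale_genMap s _ fun _ => rfl)
    rw [freeEval, freeEval, ← eval_diff, ← hD, map_eval, map_zero, smul_coords_one, smul_coords_one, hφ] at h0
    convert h0 using 2 <;> funext a <;> rcases a with a | a <;> rfl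
  have gen_ne_one : ∀ k : υ, gen k ≠ 1 := fun k h1 => by simpa using congrArg body h1
  have hZ : ∀ j, Z j = 1 ∨ ∃ k, Z j = gen (.inr k) ∧ j = Sum.map inr inr k := by
    rintro ((a | a) | (a | a))
    exacts [.inl (by simp [Z, coords]), .inr ⟨.inl a, rfl, rfl⟩, .inl (by simp [Z, coords]),
      .inr ⟨.inr a, rfl, rfl⟩]
  have hZne : ∀ j k, j ≠ k → Z j = 1 ∨ Z j ≠ Z k := fun j k hjk => by
    refine (hZ j).imp id fun ⟨a, ha, ja⟩ h => ?_
    rcases hZ k with hk | ⟨b, hb, kb⟩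
    · exact gen_ne_one _ (ha.symm.trans (h.trans hk))
    · rw [ja, kb, Sum.inr.inj (gen_injective (ha.symm.trans (h.trans hb)))] at hjk
      exact hjk rfl
  have hp : (∀ a, Z (.inl a) ∈ parityPart υ (par a)) ∧ ∀ i, Z (.inr i) ∈ parityPart υ (par i) :=
    ⟨coords_point _ _, coords_point _ _⟩
  have hfree : ∀ k y, oddDeriv (inr k) (φ y) = 0 := fun k y =>
    oddDeriv_genMap_of_notMem _ _ (fun _ => Sum.inl_ne_inr) y
  have hinj : ∀ y, φ y = 0 → y = 0 := fun y hy => by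
    have h2 : (ExteriorAlgebra.map (Finsupp.linearCombination ℂ (elim
      (fun k : κ => Finsupp.single k (1 : ℂ)) fun _ : (Fin V₁.odd ⊕ Fin V₂.odd) => 0))).comp φ =
        AlgHom.id ℂ _ := grassmann_hom_ext fun k => by
      rw [AlgHom.comp_apply, genMap_gen, map_gen]
      simp [gen_def]
    rw [← AlgHom.id_apply (R := ℂ) y, ← h2, AlgHom.comp_apply, hy, map_zero]
  have c1 : ∀ j y, Z j * φ y = 0 → y = 0 := fun j y h =>
    hinj _ (mul_left_cancel_free ((hZ j).imp id fun ⟨k, hk, _⟩ => ⟨_, hk, hfree k y⟩) h)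
  have c2 : ∀ j k y, (Z j = 1 ∨ Z j ≠ Z k) → Z j * (Z k * φ y) = 0 → y = 0 := fun j k y hjk h => by
    refine c1 k y (mul_left_cancel_free ((hZ j).imp id fun ⟨i, hi, _⟩ => ⟨_, hi, ?_⟩) h)
    rcases hZ k with hk | ⟨l, hk, -⟩
    · rw [hk, one_mul, hfree]
    · rw [hk, oddDeriv_gen_mul, hfree, mul_zero, sub_zero, if_neg]
      exact fun e => hjk.elim (fun h1 => gen_ne_one _ (hi.symm.trans h1)) fun h1 =>
        h1 (hi.trans (e ▸ hk.symm))
  obtain ⟨h0, hL, hQ⟩ := quadratic_coeff_eq_zero _ _ _ fun u =>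
    (D.eval_smul φ _ _ fun j => (u j : ℂ)).symm.trans (hval u)
  have smul_sg : ∀ {i j : ZMod 2} {y : Λ υ}, sg i j • y = 0 → y = 0 := fun {i j y} hy => by
    rcases sg_eq_one_or i j with h' | h' <;> rw [h'] at hy <;> simpa using hy
  have odd_diag : ∀ {V : SuperSpace} {B : V.Idx → V.Idx → Λ κ}
      (_ : ∀ a b, B a b = sgn₂ a b • B b a) (k : Fin V.odd), B (.inr k) (.inr k) = 0 := by
    intro V B hB k
    have := hB (.inr k) (.inr k)
    rw [sgn₂, neg_one_smul, eq_neg_iff_add_eq_zero, ← two_smul ℂ] at this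
    exact (smul_eq_zero.1 this).resolve_left two_ne_zero
  have half : ∀ y : Λ υ, (1 / 2 : ℂ) • y + (1 / 2 : ℂ) • y = y := fun y => by
    rw [← add_smul, add_halves, one_smul]
  have e1 : ∀ a, D.linX a = 0 := fun a => c1 _ _ (hL (.inl a))
  have e2 : ∀ i, D.linQ i = 0 := fun i => by
    have h1 := hL (.inr i)
    rw [elim_inr, mul_comm_sg (genMap_mem_parity _ (D.linQ_parity i)) (hp.2 i)] at h1
    exact c1 _ _ (smul_sg h1)
  have e4 : ∀ a i, D.xq a i = 0 := fun a i => by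
    have h1 := hQ (.inl a) (.inr i)
    rw [elim_inl, elim_inr, elim_inr, elim_inl, add_zero, mul_assoc,
      mul_comm_sg (genMap_mem_parity _ (D.xq_parity a i)) (hp.2 i), mul_smul_comm] at h1
    exact c2 _ _ _ (hZne _ _ Sum.inl_ne_inr) (smul_sg h1)
  have e3 : ∀ b a, D.xx b a = 0 := fun b a => by
    rcases eq_or_ne a b with rfl | hab
    · rcases a with a | a
      · have h1 := hQ (.inl (.inl a)) (.inl (.inl a))
        simp only [elim_inl, half, mul_assoc] at h1
        exact c2 _ _ _ (.inl (by simp [Z, coords])) h1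
      · exact odd_diag D.xx_symm a
    · have h1 := hQ (.inl a) (.inl b)
      have hs : Z (.inl b) * Z (.inl a) * φ (D.xx a b) = Z (.inl a) * Z (.inl b) * φ (D.xx b a) := by
        rw [mul_comm_sg (hp.1 b) (hp.1 a), D.xx_symm a b, map_smul, sgn₂_eq_sg, smul_mul_assoc,
          mul_smul_comm, smul_smul, sg_symm (par b), sg_mul_self, one_smul]
      simp only [elim_inl] at h1
      rw [hs, half, mul_assoc] at h1
      exact c2 _ _ _ (hZne _ _ fun h => hab (Sum.inl.inj h)) h1
  have e5 : ∀ b a, D.qq b a = 0 := fun b a => by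
    have hc := fun h => c2 (.inr a) (.inr b) (D.qq b a) h
    have h1 := hQ (.inr b) (.inr a)
    have hs : φ (D.qq a b) * Z (.inr b) * Z (.inr a) = φ (D.qq b a) * Z (.inr a) * Z (.inr b) := by
      rw [mul_assoc, mul_comm_sg (hp.2 b) (hp.2 a), D.qq_symm a b, map_smul, sgn₂_eq_sg,
        smul_mul_assoc, mul_smul_comm, smul_smul, sg_symm (par b), sg_mul_self, one_smul, mul_assoc]
    simp only [elim_inr] at h1
    rw [hs, half, mul_assoc, mul_comm_sg (genMap_mem_parity _ (D.qq_parity b a))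
      (mul_mem_parity (hp.2 a) (hp.2 b)), mul_assoc] at h1
    rcases eq_or_ne a b with rfl | hab
    · rcases a with a | a
      · exact hc (.inl (by simp [Z, coords])) (smul_sg h1)
      · exact odd_diag D.qq_symm a
    · exact hc (hZne _ _ fun h => hab (Sum.inr.inj h)) (smul_sg h1)
  subst hD
  have h00 := hinj _ h0
  simp only [diff, sub_eq_zero, AddSubgroupClass.coe_sub] at e1 e2 e3 e4 e5 h00
  exact QuadAction.ext (Subtype.ext h00) (funext e1) (funext e2) (funext fun _ => funext (e3 _))
    (funext fun _ => funext (e4 _)) (funext fun _ => funext (e5 _))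

end QuadAction

theorem genMap_coords {σ τ : Type} {V : SuperSpace} (f : σ → τ) (e : Fin V.even → ℝ)
    (o : Fin V.odd → σ) : (fun a => genMap f (coords e o a)) = coords e (f ∘ o) := by
  funext a
  rcases a with a | a
  · exact AlgHom.commutes _ _
  · exact genMap_gen f _

theorem genMap_comp {σ τ υ : Type} (g : τ → υ) (f : σ → τ) :
    (genMap g).comp (genMap f) = genMap (g ∘ f) :=
  AlgHom.ext fun x => genMap_genMap g f x

theorem isUnit_iff_mulVec {τ ι : Type} [Finite τ] [Fintype ι] [DecidableEq ι]
    {M : Matrix ι ι (Λ τ)} : IsUnit M ↔ ∀ v, M *ᵥ v = 0 → v = 0 := by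
  refine ⟨?_, isUnit_of_mulVec_injective⟩
  rintro ⟨u, rfl⟩ v hv
  have := congrArg ((↑u⁻¹ : Matrix ι ι (Λ τ)) *ᵥ ·) hv
  simpa only [mulVec_mulVec, Units.inv_mul, one_mulVec, mulVec_zero] using this

namespace QuadAction

variable {κ τ : Type} {V₁ V₂ V₃ V₄ : SuperSpace}

/-- A quadratic action is determined by its values at points. -/
theorem ext_of_eval {S S' : QuadAction κ V₁ V₂}
    (h : ∀ (M : ℕ) (x : V₁.Idx → Λ (κ ⊕ Fin M)) (r : V₂.Idx → Λ (κ ⊕ Fin M)),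
      IsPoint x → IsPoint r → S.eval (genMap inl) x r = S'.eval (genMap inl) x r) :
    S = S' := by
  refine eval_ext fun ⟨xe, re⟩ => ?_
  let e : Fin V₁.odd ⊕ Fin V₂.odd → Fin (V₁.odd + V₂.odd) := finSumFinEquiv
  have h1 := congrArg (genMap (Sum.map (id : κ → κ) finSumFinEquiv.symm))
    (h (V₁.odd + V₂.odd) (coords xe (inr ∘ e ∘ inl)) (coords re (inr ∘ e ∘ inr))
      (coords_point _ _) (coords_point _ _))
  have e1 : Sum.map (id : κ → κ) (finSumFinEquiv (m := V₁.odd) (n := V₂.odd)).symm ∘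
      (inr ∘ e ∘ inl) = inr ∘ inl := by
    funext a; simp [e, Function.comp]
  have e2 : Sum.map (id : κ → κ) (finSumFinEquiv (m := V₁.odd) (n := V₂.odd)).symm ∘
      (inr ∘ e ∘ inr) = inr ∘ inr := by
    funext a; simp [e, Function.comp]
  rw [map_eval, map_eval, genMap_coords, genMap_coords, genMap_comp, e1, e2] at h1
  exact h1

section Comp

variable [Finite κ] {S₃₂ : QuadAction κ V₂ V₃} {S₂₁ : QuadAction κ V₁ V₂}

theorem isClassicalComposite_comp (h : Composable S₃₂ S₂₁) :
    IsClassicalComposite S₃₂ S₂₁ (comp S₃₂ S₂₁ h) := by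
  intro M x r hx hr
  refine ⟨?_, fun y q hy hq h1 h2 => comp_eval _ h hx hy hq ⟨funext h1, funext h2⟩⟩
  obtain ⟨y, q, hy, hq, hc⟩ := exists_crit (S₃₂ := S₃₂) inl h hx hr
  refine ⟨(y, q), ⟨hy, hq, congrFun hc.1, congrFun hc.2⟩, ?_⟩
  rintro ⟨y', q'⟩ ⟨hy', hq', h1, h2⟩
  obtain ⟨rfl, rfl⟩ := crit_unique inl h hx hy' hy ⟨funext h1, funext h2⟩ hc
  rfl

theorem isClassicalComposite_iff (h : Composable S₃₂ S₂₁) (S : QuadAction κ V₁ V₃) :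
    IsClassicalComposite S₃₂ S₂₁ S ↔ S = comp S₃₂ S₂₁ h := by
  refine ⟨fun hS => ext_of_eval fun M x r hx hr => ?_, fun hS => hS ▸ isClassicalComposite_comp h⟩
  obtain ⟨y, q, hy, hq, hc⟩ := exists_crit (S₃₂ := S₃₂) inl h hx hr
  rw [comp_eval _ h hx hy hq hc]
  exact (hS M x r hx hr).2 y q hy hq (congrFun hc.1) (congrFun hc.2)

theorem mem_rel_comp (h : Composable S₃₂ S₂₁) (M : ℕ)
    (P : ((V₁.Idx → Λ (κ ⊕ Fin M)) × (V₁.Idx → Λ (κ ⊕ Fin M))) ×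
      ((V₃.Idx → Λ (κ ⊕ Fin M)) × (V₃.Idx → Λ (κ ⊕ Fin M)))) :
    P ∈ (comp S₃₂ S₂₁ h).rel M ↔ ∃ Y, (P.1, Y) ∈ S₂₁.rel M ∧ (Y, P.2) ∈ S₃₂.rel M := by
  obtain ⟨⟨x, p⟩, ⟨z, r⟩⟩ := P
  constructor
  · rintro ⟨hx, hp, hz, hr, h1, h2⟩
    obtain ⟨y, q, hy, hq, hc⟩ := exists_crit (S₃₂ := S₃₂) inl h hx hr
    have h1' := comp_derivX _ h hx hy hc
    have h2' := comp_derivQ _ h hx hy hc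
    exact ⟨(y, q), ⟨hx, hp, hy, hq, fun a => (h1 a).trans (congrFun h1' a), congrFun hc.2⟩,
      ⟨hy, hq, hz, hr, congrFun hc.1, fun a => (h2 a).trans (congrFun h2' a)⟩⟩
  · rintro ⟨⟨y, q⟩, ⟨hx, hp, hy, hq, h1, h2⟩, ⟨-, -, hz, hr, h3, h4⟩⟩
    have hc : IsCrit S₃₂ S₂₁ inl x r y q := ⟨funext h3, funext h2⟩
    have h1' := comp_derivX _ h hx hy hc
    have h2' := comp_derivQ _ h hx hy hc
    exact ⟨hx, hp, hz, hr, fun a => (h1 a).trans (congrFun h1' a).symm,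
      fun a => (h4 a).trans (congrFun h2' a).symm⟩

end Comp

/-- A quadratic action is determined by its canonical relation and its constant term. -/
theorem ext_of_rel {S S' : QuadAction κ V₁ V₂} (h0 : S.const = S'.const)
    (h : ∀ M, S.rel M = S'.rel M) : S = S' := by
  have key : ∀ (M : ℕ) (x : V₁.Idx → Λ (κ ⊕ Fin M)) (q : V₂.Idx → Λ (κ ⊕ Fin M)),
      IsPoint x → IsPoint q → S.derivX (genMap inl) x q = S'.derivX (genMap inl) x q ∧
        S.derivQ (genMap inl) x q = S'.derivQ (genMap inl) x q := by
    intro M x q hx hq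
    have hmem : (((x, S.derivX (genMap inl) x q), (S.derivQ (genMap inl) x q, q)) :
        ((V₁.Idx → Λ (κ ⊕ Fin M)) × (V₁.Idx → Λ (κ ⊕ Fin M))) ×
      ((V₂.Idx → Λ (κ ⊕ Fin M)) × (V₂.Idx → Λ (κ ⊕ Fin M)))) ∈ S.rel M :=
      ⟨hx, S.derivX_point _ hx hq, S.derivQ_point _ hx hq, hq, fun _ => rfl, fun _ => rfl⟩
    rw [h M] at hmem
    obtain ⟨-, -, -, -, h1, h2⟩ := hmem
    exact ⟨funext h1, funext h2⟩
  refine ext_of_eval fun M x q hx hq => ?_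
  obtain ⟨h1, h2⟩ := key M x q hx hq
  obtain ⟨h3, h4⟩ := key M 0 0 (fun _ => zero_mem _) (fun _ => zero_mem _)
  have h3' : ∀ a, genMap (inl : κ → κ ⊕ Fin M) (S.linX a) = genMap inl (S'.linX a) :=
    fun a => by simpa [derivX] using congrFun h3 a
  have h4' : ∀ a, genMap (inl : κ → κ ⊕ Fin M) (S.linQ a) = genMap inl (S'.linQ a) :=
    fun a => by simpa [derivQ] using congrFun h4 a
  rw [eval_eq, eval_eq, h0, h1, h2]
  simp only [h3', h4']

section Identity

variable {V : SuperSpace} (φ : Λ κ →ₐ[ℂ] Λ τ) (x q : V.Idx → Λ τ)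

theorem idAction_eval : (idAction κ V).eval φ x q = pairing x q := by
  simp [eval, idAction, pairing, apply_ite φ]

theorem idAction_derivX : (idAction κ V).derivX φ x q = q := by
  funext a; simp [derivX, idAction, apply_ite φ]

theorem idAction_derivQ : (idAction κ V).derivQ φ x q = x := by
  funext a; simp [derivQ, idAction, apply_ite φ]

theorem tsMatrix_zero_right (T : V.Idx → V.Idx → Λ κ) : tsMatrix T (fun _ _ => 0) = 0 := by
  ext i j; simp [tsMatrix]

theorem tsMatrix_zero_left (T : V.Idx → V.Idx → Λ κ) : tsMatrix (fun _ _ => 0) T = 0 := by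
  ext i j; simp [tsMatrix]

theorem composable_idAction_right (S : QuadAction κ V₁ V₂) :
    Composable S (idAction κ V₁) := by
  rw [Composable, show (idAction κ V₁).qq = fun _ _ => 0 from rfl, tsMatrix_zero_right, sub_zero]
  exact isUnit_one

theorem composable_idAction_left (S : QuadAction κ V₁ V₂) :
    Composable (idAction κ V₂) S := by
  rw [Composable, show (idAction κ V₂).xx = fun _ _ => 0 from rfl, tsMatrix_zero_left, sub_zero]
  exact isUnit_one

theorem isClassicalComposite_idAction_right (S : QuadAction κ V₁ V₂) :
    IsClassicalComposite S (idAction κ V₁) S := by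
  intro M x r hx hr
  simp only [idAction_derivQ, idAction_eval]
  refine ⟨⟨(x, S.derivX (genMap inl) x r), ⟨hx, S.derivX_point _ hx hr, fun _ => rfl, fun _ => rfl⟩, ?_⟩, ?_⟩
  · rintro ⟨y, q⟩ ⟨-, -, h1, h2⟩
    have h2 : y = x := funext h2
    subst h2
    exact Prod.ext rfl (funext h1)
  · rintro y q - - h1 h2
    rw [← show y = x from funext h2]; abel

theorem isClassicalComposite_idAction_left (S : QuadAction κ V₁ V₂) :
    IsClassicalComposite (idAction κ V₂) S S := by
  intro M x r hx hr
  simp only [idAction_derivX, idAction_eval]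
  refine ⟨⟨(S.derivQ (genMap inl) x r, r), ⟨S.derivQ_point _ hx hr, hr, fun _ => rfl, fun _ => rfl⟩, ?_⟩, ?_⟩
  · rintro ⟨y, q⟩ ⟨-, -, h1, h2⟩
    have h1 : q = r := funext h1
    subst h1
    exact Prod.ext (funext h2) rfl
  · rintro y q - - h1 h2
    rw [← show q = r from funext h1]; abel

end Identity

section Assoc

variable [Finite κ] {S₄₃ : QuadAction κ V₃ V₄} {S₃₂ : QuadAction κ V₂ V₃} {S₂₁ : QuadAction κ V₁ V₂}

theorem composable_iff_mulVec : Composable S₃₂ S₂₁ ↔ ∀ v,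
    v = (of S₃₂.xx * Sg κ V₂) *ᵥ (of S₂₁.qq *ᵥ v) → v = 0 := by
  rw [composable_iff, isUnit_iff_mulVec]
  simp only [compM, sub_mulVec, one_mulVec, mulVec_mulVec, sub_eq_zero]

theorem eq_compN_mulVec_iff (h : Composable S₃₂ S₂₁) {v w : V₂.Idx → Λ κ} :
    v = compN S₃₂ S₂₁ *ᵥ w ↔ v = (of S₃₂.xx * Sg κ V₂) *ᵥ (of S₂₁.qq *ᵥ v) + w := by
  have key : compM S₃₂ S₂₁ *ᵥ v = v - (of S₃₂.xx * Sg κ V₂) *ᵥ (of S₂₁.qq *ᵥ v) := by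
    simp only [compM, sub_mulVec, one_mulVec, mulVec_mulVec]
  rw [← sub_eq_iff_eq_add', ← key]
  constructor
  · intro hv
    rw [hv, mulVec_mulVec, mul_compN h, one_mulVec]
  · intro hv
    rw [← hv, mulVec_mulVec, compN_mul h, one_mulVec]

theorem comp_qq_mulVec (h : Composable S₃₂ S₂₁) (r : V₃.Idx → Λ κ) :
    of (comp S₃₂ S₂₁ h).qq *ᵥ r = of S₃₂.qq *ᵥ r + (st (of S₃₂.xq) * Sg κ V₂) *ᵥ
      (of S₂₁.qq *ᵥ (compN S₃₂ S₂₁ *ᵥ (of S₃₂.xq *ᵥ r))) := by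
  change (of S₃₂.qq + st (of S₃₂.xq) * Sg κ V₂ * ((of S₂₁.qq * compN S₃₂ S₂₁) * of S₃₂.xq)) *ᵥ r = _
  simp only [add_mulVec, mulVec_mulVec, Matrix.mul_assoc]

theorem comp_xx_mulVec (h : Composable S₄₃ S₃₂) (y : V₂.Idx → Λ κ) :
    (of (comp S₄₃ S₃₂ h).xx * Sg κ V₂) *ᵥ y = (of S₃₂.xx * Sg κ V₂) *ᵥ y + of S₃₂.xq *ᵥ
      (compN S₄₃ S₃₂ *ᵥ ((of S₄₃.xx * Sg κ V₃) *ᵥ ((st (of S₃₂.xq) * Sg κ V₂) *ᵥ y))) := by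
  change ((of S₃₂.xx + of S₃₂.xq * (compN S₄₃ S₃₂ * of S₄₃.xx) * Sg κ V₃ * st (of S₃₂.xq)) *
    Sg κ V₂) *ᵥ y = _
  simp only [Matrix.add_mul, add_mulVec, mulVec_mulVec, Matrix.mul_assoc]

theorem composable_assoc (h₁ : Composable S₃₂ S₂₁) (h₂ : Composable S₄₃ S₃₂) :
    Composable S₄₃ (comp S₃₂ S₂₁ h₁) ↔ Composable (comp S₄₃ S₃₂ h₂) S₂₁ := by
  rw [composable_iff_mulVec, composable_iff_mulVec]
  constructor
  · intro hker q hq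
    rw [comp_xx_mulVec] at hq
    obtain ⟨r, hr⟩ : ∃ r, r = compN S₄₃ S₃₂ *ᵥ ((of S₄₃.xx * Sg κ V₃) *ᵥ
      ((st (of S₃₂.xq) * Sg κ V₂) *ᵥ (of S₂₁.qq *ᵥ q))) := ⟨_, rfl⟩
    rw [← hr, ← eq_compN_mulVec_iff h₁] at hq
    have hr0 : r = 0 := hker r (by
      rw [comp_qq_mulVec, mulVec_add, ← hq]
      exact (eq_compN_mulVec_iff h₂).1 hr)
    rw [hq, hr0, mulVec_zero, mulVec_zero]
  · intro hker r hr
    rw [comp_qq_mulVec, mulVec_add, ← eq_compN_mulVec_iff h₂] at hr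
    have hq := hker (compN S₃₂ S₂₁ *ᵥ (of S₃₂.xq *ᵥ r)) (by
      rw [comp_xx_mulVec, ← hr, ← eq_compN_mulVec_iff h₁])
    rw [hr, hq, mulVec_zero, mulVec_zero, mulVec_zero, mulVec_zero]

theorem comp_assoc (h₁ : Composable S₃₂ S₂₁) (h₂ : Composable S₄₃ S₃₂)
    (h₃ : Composable S₄₃ (comp S₃₂ S₂₁ h₁)) (h₄ : Composable (comp S₄₃ S₃₂ h₂) S₂₁) :
    comp S₄₃ (comp S₃₂ S₂₁ h₁) h₃ = comp (comp S₄₃ S₃₂ h₂) S₂₁ h₄ := by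
  refine ext_of_eval fun M x t hx ht => ?_
  obtain ⟨z, r, hz, hr, hc⟩ := exists_crit (S₃₂ := S₄₃) inl h₃ hx ht
  obtain ⟨y, q, hy, hq, hc'⟩ := exists_crit (S₃₂ := S₃₂) inl h₁ hx hr
  have h5 : IsCrit S₄₃ S₃₂ inl y t z r :=
    ⟨hc.1, hc.2.trans (comp_derivQ _ h₁ hx hy hc')⟩
  have h6 : IsCrit (comp S₄₃ S₃₂ h₂) S₂₁ inl x t y q :=
    ⟨hc'.1.trans (comp_derivX _ h₂ hy hz h5).symm, hc'.2⟩
  rw [comp_eval _ h₃ hx hz hr hc, comp_eval _ h₁ hx hy hq hc', comp_eval _ h₄ hx hy hq h6,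
    comp_eval _ h₂ hy hz hr h5]
  abel

end Assoc

end QuadAction

open QuadAction in
theorem classical_assoc {κ : Type} [Finite κ] {V₁ V₂ V₃ V₄ : SuperSpace}
    {S₄₃ : QuadAction κ V₃ V₄} {S₃₂ : QuadAction κ V₂ V₃} {S₂₁ : QuadAction κ V₁ V₂}
    {S₃₁ : QuadAction κ V₁ V₃} {S₄₂ : QuadAction κ V₂ V₄} {S₄₁ : QuadAction κ V₁ V₄}
    (h₁ : Composable S₃₂ S₂₁) (h₃₁ : IsClassicalComposite S₃₂ S₂₁ S₃₁)
    (h₂ : Composable S₄₃ S₃₂) (h₄₂ : IsClassicalComposite S₄₃ S₃₂ S₄₂) :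
    (Composable S₄₃ S₃₁ ∧ IsClassicalComposite S₄₃ S₃₁ S₄₁) ↔
      (Composable S₄₂ S₂₁ ∧ IsClassicalComposite S₄₂ S₂₁ S₄₁) := by
  rw [isClassicalComposite_iff h₁] at h₃₁
  rw [isClassicalComposite_iff h₂] at h₄₂
  subst h₃₁ h₄₂
  constructor
  · rintro ⟨h, h'⟩
    have h₄ := (composable_assoc h₁ h₂).1 h
    refine ⟨h₄, ?_⟩
    rw [isClassicalComposite_iff h₄, ← comp_assoc h₁ h₂ h h₄, ← isClassicalComposite_iff h]
    exact h'
  · rintro ⟨h, h'⟩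
    have h₃ := (composable_assoc h₁ h₂).2 h
    refine ⟨h₃, ?_⟩
    rw [isClassicalComposite_iff h₃, comp_assoc h₁ h₂ h₃ h, ← isClassicalComposite_iff h]
    exact h'

end SuperThick

namespace SuperThick

section OneDim

open Complex

/-- The moments of a complex Gaussian, relative to its integral. -/
noncomputable def gaussMoment (b c : ℂ) : ℕ → ℂ
  | 0 => 1
  | 1 => c / (2 * b)
  | k + 2 => (c * gaussMoment b c (k + 1) + (k + 1) * gaussMoment b c k) / (2 * b)

/-- The Gaussian integral with purely imaginary linear term. -/
noncomputable def gaussVal (b : ℂ) (β : ℝ) : ℂ :=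
  (π / b) ^ (1 / 2 : ℂ) * cexp (-(β ^ 2 : ℝ) / (4 * b))

theorem integrable_pow_mul_gauss {b : ℂ} (hb : 0 < b.re) (β : ℝ) (k : ℕ) :
    Integrable fun x : ℝ => (x : ℂ) ^ k * cexp (-b * x ^ 2 + I * β * x) := by
  have h := integrable_rpow_mul_exp_neg_mul_sq hb (s := (k : ℝ)) (by
    have : (0 : ℝ) ≤ k := Nat.cast_nonneg k
    linarith)
  refine h.mono (by fun_prop : Continuous _).aestronglyMeasurable (ae_of_all _ fun x => ?_)
  rw [Real.rpow_natCast, norm_mul, norm_pow, norm_real, norm_mul, norm_pow, norm_exp,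
    Real.norm_of_nonneg (Real.exp_pos _).le]
  have : (-b * (x : ℂ) ^ 2 + I * β * x).re = -b.re * x ^ 2 := by
    rw [add_re, ← ofReal_pow, re_mul_ofReal, neg_re, mul_assoc, ← ofReal_mul, I_mul_re, ofReal_im]
    ring
  rw [this]

theorem integral_gauss {b : ℂ} (hb : 0 < b.re) (β : ℝ) :
    ∫ x : ℝ, cexp (-b * x ^ 2 + I * β * x) = gaussVal b β := by
  have h := integral_cexp_quadratic (b := -b) (by simpa using hb) (I * β) 0
  simp only [add_zero] at h
  rw [h, gaussVal, neg_neg]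
  congr 2
  rw [mul_pow, I_sq]
  push_cast
  rw [zero_sub, mul_neg, div_neg, neg_neg, neg_one_mul]

theorem integral_pow_mul_gauss {b : ℂ} (hb : 0 < b.re) (β : ℝ) (k : ℕ) :
    ∫ x : ℝ, (x : ℂ) ^ k * cexp (-b * x ^ 2 + I * β * x) =
      gaussVal b β * gaussMoment b (I * β) k := by
  have hb0 : (2 : ℂ) * b ≠ 0 := mul_ne_zero two_ne_zero fun h => by simp [h] at hb
  -- integration by parts
  have hrec : ∀ k : ℕ, ∫ x : ℝ, (x : ℂ) ^ (k + 1) * cexp (-b * x ^ 2 + I * β * x) =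
      (I * β * (∫ x : ℝ, (x : ℂ) ^ k * cexp (-b * x ^ 2 + I * β * x)) +
        k * (∫ x : ℝ, (x : ℂ) ^ (k - 1) * cexp (-b * x ^ 2 + I * β * x))) / (2 * b) := by
    intro k
    have hi := integrable_pow_mul_gauss hb β
    have h0 := integral_eq_zero_of_hasDerivAt_of_integrable
      (f := fun x : ℝ => (x : ℂ) ^ k * cexp (-b * x ^ 2 + I * β * x))
      (f' := fun x : ℝ => k * ((x : ℂ) ^ (k - 1) * cexp (-b * x ^ 2 + I * β * x)) +
        I * β * ((x : ℂ) ^ k * cexp (-b * x ^ 2 + I * β * x)) -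
        2 * b * ((x : ℂ) ^ (k + 1) * cexp (-b * x ^ 2 + I * β * x)))
      (fun x => by
        have h1 : HasDerivAt (fun x : ℝ => (x : ℂ)) 1 x := ofRealCLM.hasDerivAt
        have h2 := (h1.pow k).mul ((((h1.pow 2).const_mul (-b)).add
          (h1.const_mul (I * β))).cexp)
        refine HasDerivAt.congr_deriv
          (f := fun x : ℝ => (x : ℂ) ^ k * cexp (-b * x ^ 2 + I * β * x)) h2 ?_
        simp only [Pi.pow_apply, Pi.add_apply]
        ring)
      (((((hi (k - 1)).const_mul _)).add ((hi k).const_mul _)).sub ((hi (k + 1)).const_mul _)) (hi k)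
    have hadd : Integrable fun x : ℝ => k * ((x : ℂ) ^ (k - 1) * cexp (-b * x ^ 2 + I * β * x)) +
        I * β * ((x : ℂ) ^ k * cexp (-b * x ^ 2 + I * β * x)) :=
      ((hi (k - 1)).const_mul _).add ((hi k).const_mul _)
    rw [integral_sub hadd ((hi (k + 1)).const_mul _), integral_add ((hi (k - 1)).const_mul _) ((hi k).const_mul _), integral_const_mul,
      integral_const_mul, integral_const_mul, sub_eq_zero] at h0
    rw [eq_div_iff hb0]
    linear_combination -h0
  have h0 : ∫ x : ℝ, (x : ℂ) ^ 0 * cexp (-b * x ^ 2 + I * β * x) = gaussVal b β := by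
    simp only [pow_zero, one_mul]
    exact integral_gauss hb β
  induction k using Nat.twoStepInduction with
  | zero => rw [h0, gaussMoment, mul_one]
  | one =>
    rw [hrec 0, h0, gaussMoment]
    push_cast
    ring
  | more k ih1 ih2 =>
    rw [hrec (k + 1), Nat.add_sub_cancel, ih1, ih2, gaussMoment]
    push_cast
    ring

theorem norm_gaussVal_le {b : ℂ} (hb : 0 < b.re) (β : ℝ) :
    ‖gaussVal b β‖ ≤ 1 + π / ‖b‖ := by
  have h1 : ‖cexp (-(β ^ 2 : ℝ) / (4 * b))‖ ≤ 1 := by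
    rw [norm_exp, Real.exp_le_one_iff, neg_div, neg_re, neg_nonpos, div_eq_mul_inv, re_ofReal_mul]
    refine mul_nonneg (sq_nonneg _) ?_
    rw [inv_re]
    refine div_nonneg ?_ (normSq_nonneg _)
    simp [hb.le]
  have h2 : ‖((π / b : ℂ)) ^ (1 / 2 : ℂ)‖ ^ 2 = π / ‖b‖ := by
    rw [← norm_pow, one_div]
    have := cpow_nat_inv_pow (π / b : ℂ) two_ne_zero
    push_cast at this
    rw [this, norm_div, norm_real, Real.norm_of_nonneg pi_pos.le]
  rw [gaussVal, norm_mul]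
  refine (mul_le_of_le_one_right (norm_nonneg _) h1).trans ?_
  nlinarith [sq_nonneg (‖((π / b : ℂ)) ^ (1 / 2 : ℂ)‖ - 1), norm_nonneg (((π / b : ℂ)) ^ (1 / 2 : ℂ))]

theorem norm_gaussMoment_le (r : ℝ) (k : ℕ) : ∃ C : ℝ, 0 ≤ C ∧ ∀ (b : ℂ) (β : ℝ), r ≤ ‖b‖ → 0 < r →
    ‖gaussMoment b (I * β) k‖ ≤ C * (1 + |β|) ^ k := by
  have hd : ∀ b : ℂ, r ≤ ‖b‖ → 0 < r → ∀ z : ℂ, ‖z / (2 * b)‖ ≤ ‖z‖ * r⁻¹ := by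
    intro b hb hr z
    rw [norm_div, norm_mul, div_eq_mul_inv]
    refine mul_le_mul_of_nonneg_left (inv_anti₀ hr ?_) (norm_nonneg _)
    simp only [Complex.norm_ofNat]
    linarith
  induction k using Nat.twoStepInduction with
  | zero => exact ⟨1, zero_le_one, fun b β _ _ => by simp [gaussMoment]⟩
  | one =>
    refine ⟨|r⁻¹|, abs_nonneg _, fun b β hb hr => ?_⟩
    refine (hd b hb hr _).trans ?_
    rw [norm_mul, norm_I, one_mul, norm_real, Real.norm_eq_abs, pow_one, mul_comm,
      abs_of_pos (inv_pos.2 hr)]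
    exact mul_le_mul_of_nonneg_left (by linarith) (inv_pos.2 hr).le
  | more k ih1 ih2 =>
    obtain ⟨C1, h1, ih1⟩ := ih1
    obtain ⟨C2, h2, ih2⟩ := ih2
    refine ⟨(C2 + (k + 1) * C1) * |r⁻¹|, by positivity, fun b β hb hr => ?_⟩
    rw [gaussMoment]
    refine (hd b hb hr _).trans ?_
    rw [abs_of_pos (inv_pos.2 hr), mul_right_comm _ r⁻¹]
    refine mul_le_mul_of_nonneg_right ?_ (inv_pos.2 hr).le
    have hx : 1 ≤ 1 + |β| := by linarith [abs_nonneg β]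
    have e1 : ‖I * β * gaussMoment b (I * β) (k + 1)‖ ≤ C2 * (1 + |β|) ^ (k + 2) := by
      rw [norm_mul, norm_mul, norm_I, one_mul, norm_real, Real.norm_eq_abs]
      calc |β| * ‖gaussMoment b (I * β) (k + 1)‖ ≤ (1 + |β|) * (C2 * (1 + |β|) ^ (k + 1)) :=
            mul_le_mul (by linarith) (ih2 b β hb hr) (norm_nonneg _) (by linarith)
        _ = _ := by ring
    have e2 : ‖((k : ℂ) + 1) * gaussMoment b (I * β) k‖ ≤ (k + 1) * C1 * (1 + |β|) ^ (k + 2) := by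
      rw [norm_mul]
      have : ‖(k : ℂ) + 1‖ = k + 1 := by
        rw [← Nat.cast_succ, Complex.norm_natCast]; push_cast; ring
      rw [this, mul_assoc]
      refine mul_le_mul_of_nonneg_left ((ih1 b β hb hr).trans ?_) (by positivity)
      exact mul_le_mul_of_nonneg_left (pow_le_pow_right₀ hx (by omega)) h1
    calc _ ≤ _ := norm_add_le _ _
      _ ≤ _ := add_le_add e1 e2
      _ = _ := by ring

theorem continuousAt_gaussMoment {b : ℂ} (hb : b ≠ 0) (c : ℂ) (k : ℕ) :
    ContinuousAt (fun b => gaussMoment b c k) b := by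
  have hb0 : (2 : ℂ) * b ≠ 0 := mul_ne_zero two_ne_zero hb
  induction k using Nat.twoStepInduction with
  | zero => simp only [gaussMoment]; exact continuousAt_const
  | one =>
    simp only [gaussMoment]
    exact continuousAt_const.div (by fun_prop) hb0
  | more k ih1 ih2 =>
    simp only [gaussMoment]
    exact ((continuousAt_const.mul ih2).add (continuousAt_const.mul ih1)).div (by fun_prop) hb0

theorem continuousAt_gaussVal {b : ℂ} (hb : b.im ≠ 0) (β : ℝ) :
    ContinuousAt (fun b => gaussVal b β) b := by
  have hb0 : b ≠ 0 := fun h => by simp [h] at hb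
  have hs : (π / b : ℂ) ∈ slitPlane := by
    rw [mem_slitPlane_iff]
    right
    rw [div_im, ofReal_im, ofReal_re, zero_mul, zero_div, zero_sub, neg_ne_zero]
    exact div_ne_zero (mul_ne_zero pi_ne_zero hb) (normSq_pos.2 hb0).ne'
  refine ContinuousAt.mul (ContinuousAt.cpow (continuousAt_const.div continuousAt_id hb0)
    continuousAt_const hs) ?_
  exact (continuousAt_const.div (by fun_prop) (mul_ne_zero (by norm_num) hb0)).cexp

end OneDim

end SuperThick

namespace SuperThick

open Matrix

section PolyFun

variable {ι ι' : Type} [Fintype ι] [Fintype ι'] {A B : Type*} [AddCommGroup A] [Module ℂ A]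
  [AddCommGroup B] [Module ℂ B]

/-- Polynomial functions on `ℝ^ι` with values in a complex vector space. -/
noncomputable def polyFun (ι : Type) [Fintype ι] (A : Type*) [AddCommGroup A] [Module ℂ A] :
    Submodule ℂ ((ι → ℝ) → A) :=
  Submodule.span ℂ {f | ∃ (m : ι → ℕ) (a : A), f = fun v => (∏ i, (v i : ℂ) ^ m i) • a}

theorem monomial_mem_polyFun (m : ι → ℕ) (a : A) :
    (fun v : ι → ℝ => (∏ i, (v i : ℂ) ^ m i) • a) ∈ polyFun ι A :=
  Submodule.subset_span ⟨m, a, rfl⟩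

theorem const_mem_polyFun (a : A) : (fun _ : ι → ℝ => a) ∈ polyFun ι A := by
  simpa using monomial_mem_polyFun (0 : ι → ℕ) a

theorem coord_smul_mem_polyFun (j : ι) (a : A) : (fun v : ι → ℝ => (v j : ℂ) • a) ∈ polyFun ι A := by
  classical
  have := monomial_mem_polyFun (Pi.single j 1 : ι → ℕ) a
  convert this using 3 with v
  rw [Finset.prod_eq_single j] <;> simp +contextual

theorem polyFun_induction {p : (f : (ι → ℝ) → A) → f ∈ polyFun ι A → Prop}
    (mono : ∀ m a, p _ (monomial_mem_polyFun m a))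
    (add : ∀ f g hf hg, p f hf → p g hg → p _ (add_mem hf hg)) {f : (ι → ℝ) → A}
    (hf : f ∈ polyFun ι A) : p f hf := by
  have key : ∀ {f g} (_ : g = f) {hg hf}, p g hg → p f hf := by
    rintro _ _ rfl _ _ h
    exact h
  induction hf using Submodule.closure_induction with
  | zero => exact key (by funext v; simp) (mono 0 0)
  | add f g hf hg h1 h2 => exact add f g hf hg h1 h2
  | smul_mem c f h =>
    obtain ⟨m, a, rfl⟩ := h
    exact key (funext fun _ => smul_comm _ _ _) (mono m (c • a))

theorem comp_mem_polyFun (l : A →ₗ[ℂ] B) {f : (ι → ℝ) → A} (hf : f ∈ polyFun ι A) :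
    (fun v => l (f v)) ∈ polyFun ι B := by
  induction hf using polyFun_induction with
  | mono m a =>
    simp only [map_smul]
    exact monomial_mem_polyFun m (l a)
  | add f g _ _ h1 h2 => simp only [Pi.add_apply, map_add]; exact add_mem h1 h2

theorem bilin_mem_polyFun {D : Type*} [AddCommGroup D] [Module ℂ D] (l : A →ₗ[ℂ] B →ₗ[ℂ] D)
    {f : (ι → ℝ) → A} {g : (ι → ℝ) → B} (hf : f ∈ polyFun ι A) (hg : g ∈ polyFun ι B) :
    (fun v => l (f v) (g v)) ∈ polyFun ι D := by
  induction hf using polyFun_induction with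
  | mono m a =>
    induction hg using polyFun_induction with
    | mono m' b =>
      simpa only [Pi.add_apply, pow_add, prod_mul_distrib, map_smul, LinearMap.smul_apply,
        smul_smul, mul_comm] using monomial_mem_polyFun (m + m') (l a b)
    | add f g _ _ h1 h2 => simp only [Pi.add_apply, map_add]; exact add_mem h1 h2
  | add f g _ _ h1 h2 => simp only [Pi.add_apply, map_add, LinearMap.add_apply]; exact add_mem h1 h2

theorem smul_mem_polyFun {f : (ι → ℝ) → ℂ} {g : (ι → ℝ) → A} (hf : f ∈ polyFun ι ℂ)
    (hg : g ∈ polyFun ι A) : (fun v => f v • g v) ∈ polyFun ι A :=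
  bilin_mem_polyFun (LinearMap.lsmul ℂ A) hf hg

variable {R : Type*} [Ring R] [Algebra ℂ R]

theorem mul_mem_polyFun {f g : (ι → ℝ) → R} (hf : f ∈ polyFun ι R)
    (hg : g ∈ polyFun ι R) : (fun v => f v * g v) ∈ polyFun ι R :=
  bilin_mem_polyFun (LinearMap.mul ℂ R) hf hg

theorem pow_mem_polyFun {f : (ι → ℝ) → R} (hf : f ∈ polyFun ι R) (k : ℕ) :
    (fun v => f v ^ k) ∈ polyFun ι R := by
  induction k with
  | zero => simpa using const_mem_polyFun (1 : R)
  | succ k ih => simp only [pow_succ]; exact mul_mem_polyFun ih hf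

theorem sum_mem_polyFun {γ : Type*} (s : Finset γ) {f : γ → (ι → ℝ) → A}
    (hf : ∀ i ∈ s, f i ∈ polyFun ι A) : (fun v => ∑ i ∈ s, f i v) ∈ polyFun ι A := by
  have := sum_mem hf
  convert this using 1
  funext v
  simp

theorem prod_mem_polyFun {γ : Type*} (s : Finset γ) {f : γ → (ι → ℝ) → ℂ}
    (hf : ∀ i ∈ s, f i ∈ polyFun ι ℂ) : (fun v => ∏ i ∈ s, f i v) ∈ polyFun ι ℂ := by
  classical
  induction s using Finset.induction_on with
  | empty => simpa using const_mem_polyFun (1 : ℂ)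
  | insert a s ha ih =>
    simp only [Finset.prod_insert ha]
    exact mul_mem_polyFun (hf a (Finset.mem_insert_self _ _))
      (ih fun i hi => hf i (Finset.mem_insert_of_mem hi))

theorem polyFun_comp_mulVec (X : Matrix ι ι' ℝ) {f : (ι → ℝ) → A} (hf : f ∈ polyFun ι A) :
    (fun v : ι' → ℝ => f (X *ᵥ v)) ∈ polyFun ι' A := by
  induction hf using polyFun_induction with
  | mono m a =>
    refine smul_mem_polyFun (prod_mem_polyFun _ fun i _ => pow_mem_polyFun ?_ _)
      (const_mem_polyFun a)
    have : (fun v : ι' → ℝ => (((X *ᵥ v) i : ℝ) : ℂ)) = fun v => ∑ j, (v j : ℂ) • (X i j : ℂ) := by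
      funext v
      rw [mulVec, dotProduct]
      push_cast
      exact sum_congr rfl fun j _ => by rw [smul_eq_mul, mul_comm]
    rw [this]
    exact sum_mem_polyFun _ fun j _ => coord_smul_mem_polyFun j _
  | add f g _ _ h1 h2 => simp only [Pi.add_apply]; exact add_mem h1 h2

theorem continuous_of_mem_polyFun {f : (ι → ℝ) → ℂ} (hf : f ∈ polyFun ι ℂ) : Continuous f := by
  induction hf using polyFun_induction with
  | mono m a => fun_prop
  | add f g _ _ h1 h2 => exact h1.add h2

end PolyFun

section Oscillatory

open Complex

variable {ι : Type} [Fintype ι] [DecidableEq ι]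

/-- The quadratic phase `½ v·Hv + b·v`. -/
noncomputable def phase (H : Matrix ι ι ℝ) (b v : ι → ℝ) : ℝ := v ⬝ᵥ (H *ᵥ v) / 2 + b ⬝ᵥ v

/-- The regularizing factor `exp (-ε |v|²)`. -/
noncomputable def reg (ε : ℝ) (v : ι → ℝ) : ℝ := Real.exp (-ε * ∑ j, v j ^ 2)

theorem continuous_phase (H : Matrix ι ι ℝ) (b : ι → ℝ) : Continuous (phase H b) := by
  unfold phase dotProduct mulVec dotProduct
  fun_prop

theorem continuous_reg (ε : ℝ) : Continuous (reg ε : (ι → ℝ) → ℝ) := by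
  unfold reg
  fun_prop

/-- The complex coefficient of the regularized oscillatory Gaussian. -/
noncomputable def gcoef (ε l : ℝ) : ℂ := ε - I * (l / 2 : ℝ)

theorem gcoef_re (ε l : ℝ) : (gcoef ε l).re = ε := by
  rw [gcoef, sub_re, ofReal_re, I_mul_re, ofReal_im]; ring

theorem gcoef_im (ε l : ℝ) : (gcoef ε l).im = -(l / 2) := by
  rw [gcoef, sub_im, ofReal_im, I_mul_im, ofReal_re]; ring

theorem reg_mul_phase_diagonal (ε : ℝ) (l β w : ι → ℝ) :
    (reg ε w : ℂ) * cexp (I * phase (diagonal l) β w) =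
      ∏ i, cexp (-gcoef ε (l i) * (w i : ℂ) ^ 2 + I * β i * w i) := by
  rw [← Complex.exp_sum, reg, ofReal_exp, ← Complex.exp_add]
  congr 1
  simp only [phase, mulVec_diagonal, dotProduct, gcoef]
  push_cast
  rw [sum_add_distrib, mul_add, mul_sum, Finset.sum_div, mul_sum,
    mul_sum, ← add_assoc, ← sum_add_distrib]
  congr 1
  · exact sum_congr rfl fun i _ => by ring
  · exact sum_congr rfl fun i _ => by ring

theorem integral_monomial_diagonal {ε : ℝ} (hε : 0 < ε) (l β : ι → ℝ) (m : ι → ℕ) :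
    Integrable (fun w : ι → ℝ => (reg ε w : ℂ) * (cexp (I * phase (diagonal l) β w) *
      ∏ i, (w i : ℂ) ^ m i)) ∧
    ∫ w : ι → ℝ, (reg ε w : ℂ) * (cexp (I * phase (diagonal l) β w) * ∏ i, (w i : ℂ) ^ m i) =
      ∏ i, gaussVal (gcoef ε (l i)) (β i) * gaussMoment (gcoef ε (l i)) (I * β i) (m i) := by
  have e : (fun w : ι → ℝ => (reg ε w : ℂ) * (cexp (I * phase (diagonal l) β w) *
      ∏ i, (w i : ℂ) ^ m i)) = fun w => ∏ i, (fun i (x : ℝ) =>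
        (x : ℂ) ^ m i * cexp (-gcoef ε (l i) * (x : ℂ) ^ 2 + I * β i * x)) i (w i) := by
    funext w
    rw [← mul_assoc, reg_mul_phase_diagonal, mul_comm, ← prod_mul_distrib]
  have hre : ∀ i, 0 < (gcoef ε (l i)).re := fun i => by rw [gcoef_re]; exact hε
  rw [e]
  refine ⟨Integrable.fintype_prod fun i => integrable_pow_mul_gauss (hre i) _ _, ?_⟩
  refine (integral_fintype_prod_volume_eq_prod (E := fun _ : ι => ℝ) fun i (x : ℝ) =>
    (x : ℂ) ^ m i * cexp (-gcoef ε (l i) * (x : ℂ) ^ 2 + I * β i * x)).trans ?_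
  exact Finset.prod_congr rfl fun i _ => integral_pow_mul_gauss (hre i) _ _

theorem measurePreserving_orthogonal {O : Matrix ι ι ℝ} (hO : Oᵀ * O = 1) :
    MeasurePreserving (fun w : ι → ℝ => O *ᵥ w) ∧ MeasurableEmbedding fun w : ι → ℝ => O *ᵥ w := by
  have hdet : O.det * O.det = 1 := by
    have := congrArg det hO
    rwa [det_mul, det_transpose, det_one] at this
  have h0 : O.det ≠ 0 := fun h => by rw [h] at hdet; simp at hdet
  have habs : |(O.det)⁻¹| = 1 := by
    rw [abs_inv]
    have : |O.det| * |O.det| = 1 := by rw [abs_mul_abs_self, hdet]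
    rcases mul_self_eq_one_iff.1 this with h | h
    · rw [h, inv_one]
    · have := abs_nonneg O.det; linarith
  constructor
  · refine ⟨(by fun_prop : Continuous fun w : ι → ℝ => O *ᵥ w).measurable, ?_⟩
    have := Real.map_matrix_volume_pi_eq_smul_volume_pi h0
    rw [habs, ENNReal.ofReal_one, one_smul] at this
    exact this
  · have hcont : Continuous fun w : ι → ℝ => O *ᵥ w := by fun_prop
    refine hcont.measurableEmbedding fun v w h => ?_
    have := congrArg (Oᵀ *ᵥ ·) h
    simpa only [mulVec_mulVec, hO, one_mulVec] using this

/-- An orthogonal diagonalization. -/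
structure IsDiag (H O : Matrix ι ι ℝ) (l : ι → ℝ) : Prop where
  orth : Oᵀ * O = 1
  eq : H = O * diagonal l * Oᵀ

namespace IsDiag

variable {H O : Matrix ι ι ℝ} {l : ι → ℝ} (hd : IsDiag H O l)
include hd

theorem phase_eq (b w : ι → ℝ) : phase H b (O *ᵥ w) = phase (diagonal l) (Oᵀ *ᵥ b) w := by
  have h1 : H *ᵥ (O *ᵥ w) = O *ᵥ (diagonal l *ᵥ w) := by
    rw [hd.eq, mulVec_mulVec, mul_assoc, hd.orth, mul_one, mulVec_mulVec]
  have h2 : ∀ u v : ι → ℝ, (O *ᵥ u) ⬝ᵥ (O *ᵥ v) = u ⬝ᵥ v := fun u v => by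
    rw [dotProduct_mulVec, ← mulVec_transpose, mulVec_mulVec, hd.orth, one_mulVec]
  rw [phase, phase, h1, h2, dotProduct_mulVec b, ← mulVec_transpose O b]

theorem reg_eq (ε : ℝ) (w : ι → ℝ) : reg ε (O *ᵥ w) = reg ε w := by
  have h2 : (O *ᵥ w) ⬝ᵥ (O *ᵥ w) = w ⬝ᵥ w := by
    rw [dotProduct_mulVec, ← mulVec_transpose, mulVec_mulVec, hd.orth, one_mulVec]
  simp only [dotProduct, ← sq] at h2
  rw [reg, reg, h2]

theorem integrable_iff (ε : ℝ) (b : ι → ℝ) (g : (ι → ℝ) → ℂ) :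
    Integrable (fun v => (reg ε v : ℂ) * (cexp (I * phase H b v) * g v)) ↔
    Integrable (fun w => (reg ε w : ℂ) * (cexp (I * phase (diagonal l) (Oᵀ *ᵥ b) w) *
      g (O *ᵥ w))) := by
  obtain ⟨h1, h2⟩ := measurePreserving_orthogonal hd.orth
  rw [← h1.integrable_comp_emb h2]
  simp only [Function.comp_def, hd.phase_eq, hd.reg_eq]

theorem integral_eq (ε : ℝ) (b : ι → ℝ) (g : (ι → ℝ) → ℂ) :
    ∫ v, (reg ε v : ℂ) * (cexp (I * phase H b v) * g v) =
    ∫ w, (reg ε w : ℂ) * (cexp (I * phase (diagonal l) (Oᵀ *ᵥ b) w) * g (O *ᵥ w)) := by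
  obtain ⟨h1, h2⟩ := measurePreserving_orthogonal hd.orth
  rw [← h1.integral_comp h2]
  simp only [hd.phase_eq, hd.reg_eq]

theorem integral_one {ε : ℝ} (hε : 0 < ε) (b : ι → ℝ) :
    ∫ v, (reg ε v : ℂ) * cexp (I * phase H b v) =
      ∏ i, gaussVal (gcoef ε (l i)) ((Oᵀ *ᵥ b) i) := by
  have h := hd.integral_eq ε b fun _ => 1
  have h' := (integral_monomial_diagonal hε l (Oᵀ *ᵥ b) 0).2
  simp only [Pi.zero_apply, pow_zero, Finset.prod_const_one, gaussMoment, mul_one] at h h'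
  rw [h, h']

theorem tendsto_one (hl : ∀ i, l i ≠ 0) (b : ι → ℝ) :
    Tendsto (fun ε => ∫ v, (reg ε v : ℂ) * cexp (I * phase H b v)) (𝓝[>] 0)
      (𝓝 (∏ i, gaussVal (gcoef 0 (l i)) ((Oᵀ *ᵥ b) i))) := by
  have h1 : Tendsto (fun ε => ∏ i, gaussVal (gcoef ε (l i)) ((Oᵀ *ᵥ b) i)) (𝓝[>] 0)
      (𝓝 (∏ i, gaussVal (gcoef 0 (l i)) ((Oᵀ *ᵥ b) i))) := by
    refine tendsto_finsetProd _ fun i _ => ?_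
    have him : (gcoef 0 (l i)).im ≠ 0 := by rw [gcoef_im]; simpa using hl i
    have hc : ContinuousAt (fun ε : ℝ => gcoef ε (l i)) 0 := by unfold gcoef; fun_prop
    exact ((continuousAt_gaussVal him _).comp
      (f := fun ε : ℝ => gcoef ε (l i)) hc).tendsto.mono_left nhdsWithin_le_nhds
  exact h1.congr' (eventually_nhdsWithin_of_forall fun ε hε => (hd.integral_one hε b).symm)

end IsDiag

omit [DecidableEq ι] in
theorem abs_mulVec_le (X : Matrix ι ι ℝ) (b : ι → ℝ) (i : ι) :
    |(X *ᵥ b) i| ≤ (∑ i, ∑ j, |X i j|) * ‖b‖ := by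
  calc |(X *ᵥ b) i| ≤ ∑ j, |X i j * b j| := Finset.abs_sum_le_sum_abs _ _
    _ ≤ ∑ j, |X i j| * ‖b‖ := Finset.sum_le_sum fun j _ => by
        rw [abs_mul]
        exact mul_le_mul_of_nonneg_left (norm_le_pi_norm b j) (abs_nonneg _)
    _ = (∑ j, |X i j|) * ‖b‖ := by rw [sum_mul]
    _ ≤ _ := mul_le_mul_of_nonneg_right
        (Finset.single_le_sum (f := fun i => ∑ j, |X i j|)
          (fun _ _ => Finset.sum_nonneg fun _ _ => abs_nonneg _) (mem_univ i)) (norm_nonneg b)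

/-- Oscillatory Gaussian integrals of polynomials: integrability of the regularizations, a bound
that is uniform in the regularization, and convergence. -/
theorem IsDiag.oscillatory {H O : Matrix ι ι ℝ} {l : ι → ℝ} (hd : IsDiag H O l)
    (hl : ∀ i, l i ≠ 0) {g : (ι → ℝ) → ℂ} (hg : g ∈ polyFun ι ℂ) :
    (∀ ε > 0, ∀ b, Integrable fun v => (reg ε v : ℂ) * (cexp (I * phase H b v) * g v)) ∧
    (∃ (C : ℝ) (k : ℕ), 0 ≤ C ∧ ∀ ε > 0, ∀ b : ι → ℝ,
      ‖∫ v, (reg ε v : ℂ) * (cexp (I * phase H b v) * g v)‖ ≤ C * (1 + ‖b‖) ^ k) ∧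
    ∀ b, ∃ L, Tendsto (fun ε => ∫ v, (reg ε v : ℂ) * (cexp (I * phase H b v) * g v)) (𝓝[>] 0)
      (𝓝 L) := by
  have hg' := polyFun_comp_mulVec O hg
  simp only [hd.integrable_iff, hd.integral_eq]
  generalize hf : (fun v => g (O *ᵥ v)) = f at hg'
  simp only [funext_iff] at hf
  simp only [hf]
  clear hf
  induction hg' using polyFun_induction with
  | mono m a =>
    have hval := fun ε (hε : 0 < ε) (b : ι → ℝ) =>
      integral_monomial_diagonal hε l (Oᵀ *ᵥ b) m
    have e : ∀ ε (b w : ι → ℝ), (reg ε w : ℂ) * (cexp (I * phase (diagonal l) (Oᵀ *ᵥ b) w) *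
        (∏ i, (w i : ℂ) ^ m i) • a) = (reg ε w : ℂ) *
          (cexp (I * phase (diagonal l) (Oᵀ *ᵥ b) w) * ∏ i, (w i : ℂ) ^ m i) * a := by
      intro ε b w; rw [smul_eq_mul]; ring
    simp only [e, integral_mul_const]
    refine ⟨fun ε hε b => (hval ε hε b).1.mul_const a, ?_, fun b => ?_⟩
    · choose C hC0 hC using fun i => norm_gaussMoment_le (|l i| / 2) (m i)
      set s := ∑ i, ∑ j, |Oᵀ i j|
      have hs : 0 ≤ s := Finset.sum_nonneg fun _ _ => Finset.sum_nonneg fun _ _ => abs_nonneg _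
      refine ⟨(∏ i, (1 + π / (|l i| / 2)) * (C i * (1 + s) ^ m i)) * ‖a‖, ∑ i, m i, ?_, ?_⟩
      · refine mul_nonneg (Finset.prod_nonneg fun i _ => ?_) (norm_nonneg _)
        have := pi_pos
        have := hC0 i
        positivity
      · intro ε hε b
        rw [norm_mul, (hval ε hε b).2, mul_right_comm, norm_prod, ← Finset.prod_pow_eq_pow_sum,
          ← prod_mul_distrib]
        refine mul_le_mul_of_nonneg_right (Finset.prod_le_prod (fun _ _ => norm_nonneg _)
          fun i _ => ?_) (norm_nonneg _)
        have hli : 0 < |l i| / 2 := by have := abs_pos.2 (hl i); positivity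
        have hn : |l i| / 2 ≤ ‖gcoef ε (l i)‖ := by
          have := Complex.abs_im_le_norm (gcoef ε (l i))
          rwa [gcoef_im, abs_neg, abs_div, abs_two] at this
        have hre : 0 < (gcoef ε (l i)).re := by rw [gcoef_re]; exact hε
        rw [norm_mul, mul_assoc, mul_assoc, ← mul_pow]
        refine mul_le_mul ((norm_gaussVal_le hre _).trans ?_)
          ((hC i _ _ hn hli).trans ?_) (norm_nonneg _) ?_
        · have := pi_pos
          gcongr
        · refine mul_le_mul_of_nonneg_left (pow_le_pow_left₀ (by positivity) ?_ _) (hC0 i)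
          have := abs_mulVec_le Oᵀ b i
          nlinarith [norm_nonneg b]
        · have := pi_pos
          positivity
    · refine ⟨(∏ i, gaussVal (gcoef 0 (l i)) ((Oᵀ *ᵥ b) i) *
        gaussMoment (gcoef 0 (l i)) (I * ((Oᵀ *ᵥ b) i : ℝ)) (m i)) * a, ?_⟩
      refine Tendsto.mul_const a ?_
      have h1 : Tendsto (fun ε => ∏ i, gaussVal (gcoef ε (l i)) ((Oᵀ *ᵥ b) i) *
        gaussMoment (gcoef ε (l i)) (I * ((Oᵀ *ᵥ b) i : ℝ)) (m i)) (𝓝[>] 0)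
          (𝓝 (∏ i, gaussVal (gcoef 0 (l i)) ((Oᵀ *ᵥ b) i) *
        gaussMoment (gcoef 0 (l i)) (I * ((Oᵀ *ᵥ b) i : ℝ)) (m i))) := by
        refine tendsto_finsetProd _ fun i _ => ?_
        have him : (gcoef 0 (l i)).im ≠ 0 := by rw [gcoef_im]; simpa using hl i
        have hne : gcoef 0 (l i) ≠ 0 := fun h => him (by rw [h]; rfl)
        have hc : ContinuousAt (fun ε : ℝ => gcoef ε (l i)) 0 := by unfold gcoef; fun_prop
        exact ((((continuousAt_gaussVal him _).comp (f := fun ε : ℝ => gcoef ε (l i)) hc).mul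
          ((continuousAt_gaussMoment hne _ _).comp
            (f := fun ε : ℝ => gcoef ε (l i)) hc)).tendsto).mono_left nhdsWithin_le_nhds
      exact h1.congr' (eventually_nhdsWithin_of_forall fun ε hε => (hval ε hε b).2.symm)
  | add f g _ _ h1 h2 =>
    obtain ⟨i1, ⟨C1, k1, hC1, b1⟩, l1⟩ := h1
    obtain ⟨i2, ⟨C2, k2, hC2, b2⟩, l2⟩ := h2
    simp only [Pi.add_apply, mul_add]
    refine ⟨fun ε hε b => (i1 ε hε b).add (i2 ε hε b), ⟨C1 + C2, k1 + k2, by positivity,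
      fun ε hε b => ?_⟩, fun b => ?_⟩
    · rw [integral_add (i1 ε hε b) (i2 ε hε b), add_mul]
      have hx : 1 ≤ 1 + ‖b‖ := by linarith [norm_nonneg b]
      refine (norm_add_le _ _).trans (add_le_add ((b1 ε hε b).trans ?_) ((b2 ε hε b).trans ?_))
      · exact mul_le_mul_of_nonneg_left (pow_le_pow_right₀ hx (by omega)) hC1
      · exact mul_le_mul_of_nonneg_left (pow_le_pow_right₀ hx (by omega)) hC2
    · obtain ⟨L1, h1⟩ := l1 b
      obtain ⟨L2, h2⟩ := l2 b
      refine ⟨L1 + L2, (h1.add h2).congr' (eventually_nhdsWithin_of_forall fun ε hε => ?_)⟩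
      exact (integral_add (i1 ε hε b) (i2 ε hε b)).symm

theorem exists_isDiag {H : Matrix ι ι ℝ} (hH : Hᵀ = H) :
    ∃ (O : Matrix ι ι ℝ) (l : ι → ℝ), IsDiag H O l ∧ H.det = ∏ i, l i := by
  have h : H.IsHermitian := by rw [IsHermitian, conjTranspose_eq_transpose_of_trivial, hH]
  refine ⟨h.eigenvectorUnitary, h.eigenvalues, ⟨?_, ?_⟩, ?_⟩
  · have := Unitary.coe_star_mul_self h.eigenvectorUnitary
    rwa [star_eq_conjTranspose, conjTranspose_eq_transpose_of_trivial] at this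
  · have := h.spectral_theorem
    rwa [Unitary.conjStarAlgAut_apply, star_eq_conjTranspose,
      conjTranspose_eq_transpose_of_trivial] at this
  · exact h.det_eq_prod_eigenvalues

end Oscillatory

section Phase

open Complex

variable {n : ℕ} {T S : Matrix (Fin n) (Fin n) ℝ}

/-- The Hessian of `½ y T y + ½ q S q - y q`. -/
noncomputable def hess (T S : Matrix (Fin n) (Fin n) ℝ) : Matrix (Fin n ⊕ Fin n) (Fin n ⊕ Fin n) ℝ :=
  fromBlocks T (-1) (-1) S

theorem hess_transpose (hT : Tᵀ = T) (hS : Sᵀ = S) : (hess T S)ᵀ = hess T S := by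
  rw [hess, fromBlocks_transpose, hT, hS, transpose_neg, transpose_one]

theorem det_hess (T S : Matrix (Fin n) (Fin n) ℝ) :
    (hess T S).det = (-1) ^ n * (1 - T * S).det := by
  have hJ : (fromBlocks 0 (-1) 1 0 : Matrix (Fin n ⊕ Fin n) (Fin n ⊕ Fin n) ℝ).det = 1 := by
    have e : (fromBlocks 0 (-1) 1 0 : Matrix (Fin n ⊕ Fin n) (Fin n ⊕ Fin n) ℝ) =
        fromBlocks 1 (-1) 0 1 * fromBlocks 1 0 1 1 * fromBlocks 1 (-1) 0 1 := by
      simp [fromBlocks_multiply]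
    rw [e, det_mul, det_mul, det_fromBlocks_zero₂₁, det_fromBlocks_zero₁₂]
    simp
  have e : hess T S * fromBlocks 1 0 T 1 * fromBlocks 0 (-1) 1 0 =
      fromBlocks (-1) 0 S (1 - S * T) := by
    rw [hess]
    simp [fromBlocks_multiply, sub_eq_add_neg, add_comm]
  have h := congrArg det e
  rw [det_mul, det_mul, hJ, det_fromBlocks_zero₁₂, det_fromBlocks_zero₁₂] at h
  simp only [det_one, mul_one, det_neg, Fintype.card_fin] at h
  rw [h, det_one_sub_mul_comm]

theorem gaussVal_zero (b : ℂ) : gaussVal b 0 = (π / b) ^ (1 / 2 : ℂ) := by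
  simp [gaussVal]

theorem cpow_half_sq (z : ℂ) : (z ^ (1 / 2 : ℂ)) ^ 2 = z := by
  have := cpow_nat_inv_pow z two_ne_zero
  push_cast at this
  rw [one_div]
  exact this

theorem ofReal_mul_cpow {a : ℝ} (ha : 0 < a) {z : ℂ} (hz : z ≠ 0) (r : ℂ) :
    ((a : ℂ) * z) ^ r = (a : ℂ) ^ r * z ^ r := by
  have ha' : (a : ℂ) ≠ 0 := ofReal_ne_zero.2 ha.ne'
  rw [cpow_def_of_ne_zero (mul_ne_zero ha' hz), cpow_def_of_ne_zero ha', cpow_def_of_ne_zero hz,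
    log_ofReal_mul ha hz, ofReal_log ha.le, ← Complex.exp_add, add_mul]

theorem gaussVal_gcoef_zero {l ħ : ℝ} (hl : l ≠ 0) (hħ : 0 < ħ) (w : ℝ) :
    gaussVal (gcoef 0 (ħ⁻¹ * l)) (-(ħ⁻¹ * l * w)) =
      ((2 * π * ħ : ℝ) : ℂ) ^ (1 / 2 : ℂ) * (I / l) ^ (1 / 2 : ℂ) *
        cexp (-(I * ((ħ⁻¹ * l * w ^ 2 / 2 : ℝ) : ℂ))) := by
  have hl' : (l : ℂ) ≠ 0 := ofReal_ne_zero.2 hl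
  have hħ' : (ħ : ℂ) ≠ 0 := ofReal_ne_zero.2 hħ.ne'
  have e1 : (π / gcoef 0 (ħ⁻¹ * l) : ℂ) = ((2 * π * ħ : ℝ) : ℂ) * (I / l) := by
    rw [gcoef]
    push_cast
    field_simp
    linear_combination (l : ℂ) * I_sq
  have hp : 0 < 2 * π * ħ := by positivity
  rw [gaussVal, e1, ofReal_mul_cpow hp (div_ne_zero I_ne_zero hl')]
  congr 2
  rw [gcoef]
  push_cast
  field_simp
  linear_combination (-4 * (w : ℂ) ^ 2 * l) * I_sq

theorem IsDiag.smul {ι : Type} [Fintype ι] [DecidableEq ι] {H O : Matrix ι ι ℝ} {l : ι → ℝ}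
    (hd : IsDiag H O l) (s : ℝ) : IsDiag (s • H) O fun i => s * l i := by
  refine ⟨hd.orth, ?_⟩
  rw [show (fun i => s * l i) = s • l from rfl, diagonal_smul, mul_smul_comm, smul_mul_assoc, hd.eq]

theorem phase_sub {ι : Type} [Fintype ι] {H : Matrix ι ι ℝ} (hH : Hᵀ = H) (v u : ι → ℝ) :
    phase H 0 (v - u) = phase H (-(H *ᵥ u)) v + phase H 0 u := by
  have h1 : u ⬝ᵥ (H *ᵥ v) = (H *ᵥ u) ⬝ᵥ v := by
    rw [dotProduct_mulVec, ← mulVec_transpose, hH]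
  have h2 : v ⬝ᵥ (H *ᵥ u) = (H *ᵥ u) ⬝ᵥ v := dotProduct_comm _ _
  simp only [phase, mulVec_sub, sub_dotProduct, dotProduct_sub, neg_dotProduct, zero_dotProduct,
    h1, h2]
  ring

theorem hess_path_pos (hpath : ∀ t : ℝ, 0 ≤ t → t ≤ 1 → (1 - t • (T * S)).det ≠ 0) {t : ℝ}
    (h0 : 0 ≤ t) (h1 : t ≤ 1) : 0 < (1 - t • (T * S)).det := by
  by_contra hneg
  have hc : ContinuousOn (fun t : ℝ => (1 - t • (T * S)).det) (Set.Icc 0 t) := by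
    refine Continuous.continuousOn (Continuous.matrix_det ?_)
    fun_prop
  have := intermediate_value_Icc' h0 hc
  obtain ⟨s, hs, hs'⟩ := this ⟨not_lt.1 hneg, by simp⟩
  exact hpath s hs.1 (hs.2.trans h1) hs'

/-- The regularized Gaussian integral. -/
noncomputable def regGauss (H : Matrix (Fin n ⊕ Fin n) (Fin n ⊕ Fin n) ℝ) (ε : ℝ) : ℂ :=
  ∫ v, (reg ε v : ℂ) * cexp (I * phase H 0 v)

/-- The determinant of the regularized Gaussian. -/
noncomputable def regDet (H : Matrix (Fin n ⊕ Fin n) (Fin n ⊕ Fin n) ℝ) (ε : ℝ) : ℂ :=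
  ((ε : ℂ) • 1 - (I / 2) • H.map ofReal).det

theorem regGauss_sq {H : Matrix (Fin n ⊕ Fin n) (Fin n ⊕ Fin n) ℝ} (hH : Hᵀ = H) {ε : ℝ}
    (hε : 0 < ε) : regGauss H ε ^ 2 * regDet H ε = (π : ℂ) ^ (2 * n) := by
  obtain ⟨O, l, hd, -⟩ := exists_isDiag hH
  have hO : O.map (ofReal : ℝ → ℂ) * Oᵀ.map ofReal = 1 := by
    have := congrArg (fun X => X.map ofRealHom) (mul_eq_one_comm.1 hd.orth)
    simp only [Matrix.map_mul] at this
    exact this.trans (Matrix.map_one _ (map_zero _) (map_one _))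
  have h1 : regDet H ε = ∏ i, gcoef ε (l i) := by
    have e : (ε : ℂ) • 1 - (I / 2) • H.map ofReal =
        O.map ofReal * diagonal (fun i => gcoef ε (l i)) * Oᵀ.map ofReal := by
      have hg : diagonal (fun i => gcoef ε (l i)) =
          (ε : ℂ) • (1 : Matrix (Fin n ⊕ Fin n) (Fin n ⊕ Fin n) ℂ) -
            (I / 2) • (diagonal l).map ofReal := by
        ext i j
        by_cases hij : i = j
        · subst hij
          simp [gcoef]
          ring
        · simp [hij]
      have hm : H.map (ofReal : ℝ → ℂ) = O.map ofReal * (diagonal l).map ofReal * Oᵀ.map ofReal := by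
        rw [hd.eq]
        exact (Matrix.map_mul (f := ofRealHom)).trans (congrArg (· * _) Matrix.map_mul)
      rw [hg, mul_sub, sub_mul, mul_smul_comm, mul_smul_comm, smul_mul_assoc, smul_mul_assoc,
        mul_one, hO, hm]
    have hdet : (O.map (ofReal : ℝ → ℂ)).det * (Oᵀ.map (ofReal : ℝ → ℂ)).det = 1 := by
      rw [← det_mul, hO, det_one]
    rw [regDet, e, det_mul, det_mul, det_diagonal, mul_right_comm, hdet, one_mul]
  have h2 : regGauss H ε = ∏ i, (π / gcoef ε (l i) : ℂ) ^ (1 / 2 : ℂ) := by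
    rw [regGauss, hd.integral_one hε]
    simp [gaussVal_zero]
  have hne : ∀ i, gcoef ε (l i) ≠ 0 := fun i h => by
    have := gcoef_re ε (l i)
    rw [h] at this
    exact hε.ne this
  rw [h1, h2, ← Finset.prod_pow, ← prod_mul_distrib]
  simp only [cpow_half_sq, div_mul_cancel₀ _ (hne _), Finset.prod_const, Finset.card_univ,
    Fintype.card_sum, Fintype.card_fin, two_mul]

theorem regDet_zero (T S : Matrix (Fin n) (Fin n) ℝ) :
    regDet (hess T S) 0 = (((1 / 4 : ℝ) ^ n * (1 - T * S).det : ℝ) : ℂ) := by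
  rw [regDet, ofReal_zero, zero_smul, zero_sub, ← neg_smul, det_smul]
  have : ((hess T S).map (ofReal : ℝ → ℂ)).det = ((hess T S).det : ℂ) :=
    (RingHom.map_det ofRealHom _).symm
  rw [this, det_hess, Fintype.card_sum, Fintype.card_fin, ← two_mul, pow_mul]
  push_cast
  rw [← mul_assoc, ← mul_pow]
  congr 2
  linear_combination (-1 / 4 : ℂ) * I_sq

theorem regGauss_zero_pos {ε : ℝ} (hε : 0 < ε) :
    0 < (regGauss (hess (0 : Matrix (Fin n) (Fin n) ℝ) 0) ε).re := by
  have hc : (Real.sqrt (1 / 2)) * (Real.sqrt (1 / 2)) = 1 / 2 := Real.mul_self_sqrt (by norm_num)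
  have hd : IsDiag (hess (0 : Matrix (Fin n) (Fin n) ℝ) 0)
      (Real.sqrt (1 / 2) • fromBlocks 1 1 1 (-1)) (elim (fun _ => -1) fun _ => 1) := by
    constructor
    · rw [transpose_smul, smul_mul_smul_comm, hc, fromBlocks_transpose, fromBlocks_multiply]
      simp only [transpose_one, transpose_neg, mul_one, mul_neg, neg_neg,
        add_neg_cancel, ← two_smul ℝ (1 : Matrix (Fin n) (Fin n) ℝ), fromBlocks_smul, smul_smul]
      rw [show (1 / 2 * 2 : ℝ) = 1 by norm_num, one_smul, smul_zero, fromBlocks_one]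
    · have e : (diagonal (elim (fun _ => -1) fun _ => 1) :
          Matrix (Fin n ⊕ Fin n) (Fin n ⊕ Fin n) ℝ) = fromBlocks (-1) 0 0 1 := by
        rw [← fromBlocks_diagonal, ← diagonal_one, ← diagonal_neg]
      rw [transpose_smul, smul_mul_assoc, smul_mul_smul_comm, hc, e, fromBlocks_transpose,
        fromBlocks_multiply, fromBlocks_multiply]
      simp only [transpose_one, transpose_neg, mul_one, mul_neg, neg_neg, mul_zero,
        add_zero, zero_add, neg_add_cancel, ← neg_add, ← two_smul ℝ (1 : Matrix (Fin n) (Fin n) ℝ),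
        fromBlocks_smul, smul_smul, smul_neg, hess]
      rw [show (1 / 2 * 2 : ℝ) = 1 by norm_num, one_smul, smul_zero]
  rw [regGauss, hd.integral_one hε]
  simp only [mulVec_zero, Pi.zero_apply, gaussVal_zero, Fintype.prod_sum_type, elim_inl,
    elim_inr, Finset.prod_const, Finset.card_univ, Fintype.card_fin, ← mul_pow]
  set z : ℂ := π / gcoef ε (-1) with hz
  have hconj : (π / gcoef ε 1 : ℂ) = (starRingEnd ℂ) z := by
    rw [hz, map_div₀, conj_ofReal]
    congr 1
    simp only [gcoef, map_sub, map_mul, conj_ofReal, conj_I]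
    push_cast
    ring
  have hne : gcoef ε (-1) ≠ 0 := fun h => by
    have := gcoef_re ε (-1)
    rw [h] at this
    exact hε.ne this
  have hz0 : z ≠ 0 := div_ne_zero (ofReal_ne_zero.2 pi_ne_zero) hne
  have harg : z.arg ≠ π := by
    intro h
    rw [arg_eq_pi_iff] at h
    have h1 := h.1
    rw [hz, div_re, ofReal_re, ofReal_im, gcoef_re] at h1
    have := pi_pos
    have := normSq_pos.2 hne
    have : 0 < π * ε / normSq (gcoef ε (-1)) := by positivity
    simp at h1
    linarith
  have hcp : (starRingEnd ℂ z) ^ (1 / 2 : ℂ) = starRingEnd ℂ (z ^ (1 / 2 : ℂ)) := by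
    rw [conj_cpow _ _ harg, map_div₀, map_one, Complex.conj_ofNat]
  rw [hconj, hcp, mul_conj, ← ofReal_pow, ofReal_re]
  exact pow_pos (normSq_pos.2 (by simp [cpow_eq_zero_iff, hz0])) _

theorem continuous_regGauss {ε : ℝ} (hε : 0 < ε) (T S : Matrix (Fin n) (Fin n) ℝ) :
    Continuous fun t : ℝ => regGauss (hess (t • T) (t • S)) ε := by
  have hint : Integrable fun v : 𝕋 n => reg ε v := by
    have h := (integral_monomial_diagonal (ι := Fin n ⊕ Fin n) hε 0 0 0).1.norm
    refine h.congr (Eventually.of_forall fun v => ?_)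
    have h0 : phase (diagonal 0) 0 v = 0 := by simp [phase]
    simp only [h0, Pi.zero_apply, pow_zero, Finset.prod_const_one, mul_one, ofReal_zero, mul_zero,
      Complex.exp_zero, norm_real]
    exact Real.norm_of_nonneg (Real.exp_pos _).le
  refine continuous_of_dominated (bound := fun v => reg ε v) (fun t => ?_) (fun t => ?_) hint ?_
  · exact ((continuous_ofReal.comp (continuous_reg ε)).mul
      (continuous_const.mul (continuous_ofReal.comp (continuous_phase _ _))).cexp).aestronglyMeasurable
  · refine Eventually.of_forall fun v => ?_
    rw [norm_mul, mul_comm I, norm_exp_ofReal_mul_I, mul_one, norm_real, Real.norm_of_nonneg]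
    exact (Real.exp_pos _).le
  · refine Eventually.of_forall fun v => continuous_const.mul ?_
    have : Continuous fun t : ℝ => phase (hess (t • T) (t • S)) 0 v := by
      have hh : Continuous fun t : ℝ => hess (t • T) (t • S) := by
        unfold hess
        exact Continuous.matrix_fromBlocks (by fun_prop) (by fun_prop) (by fun_prop) (by fun_prop)
      unfold phase
      fun_prop
    fun_prop

theorem regGauss_re_pos {ε : ℝ} (hε : 0 < ε) (hT : Tᵀ = T) (hS : Sᵀ = S)
    (hdet : ∀ t : ℝ, 0 ≤ t → t ≤ 1 → 0 < (regDet (hess (t • T) (t • S)) ε).re) :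
    0 < (regGauss (hess T S) ε).re := by
  have hne : ∀ t : ℝ, 0 ≤ t → t ≤ 1 → (regGauss (hess (t • T) (t • S)) ε).re ≠ 0 := by
    intro t h0 h1 h
    have hsq := regGauss_sq (hess_transpose (T := t • T) (S := t • S) (by rw [transpose_smul, hT])
      (by rw [transpose_smul, hS])) hε
    have hz : regGauss (hess (t • T) (t • S)) ε ^ 2 =
        ((-(regGauss (hess (t • T) (t • S)) ε).im ^ 2 : ℝ) : ℂ) := by
      apply Complex.ext
      · simp [sq, h]
      · simp [sq, h]
    rw [hz] at hsq
    have hre := congrArg Complex.re hsq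
    rw [re_ofReal_mul, ← ofReal_pow, ofReal_re] at hre
    have := hdet t h0 h1
    have h3 : 0 < π ^ (2 * n) := pow_pos pi_pos _
    nlinarith [sq_nonneg (regGauss (hess (t • T) (t • S)) ε).im]
  have hc : ContinuousOn (fun t : ℝ => (regGauss (hess (t • T) (t • S)) ε).re) (Set.Icc 0 1) :=
    (continuous_re.comp (continuous_regGauss hε T S)).continuousOn
  by_contra hneg
  obtain ⟨s, hs, hs'⟩ := intermediate_value_Icc' zero_le_one hc
    (show (0 : ℝ) ∈ Set.Icc _ _ from ⟨by simpa using hneg, by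
      simpa using (regGauss_zero_pos (n := n) hε).le⟩)
  exact hne s hs.1 hs.2 hs'

/-- The constant of the oscillatory Gaussian integral. -/
theorem exists_gauss_const (hT : Tᵀ = T) (hS : Sᵀ = S) (hdet : (1 - T * S).det ≠ 0) :
    ∃ ζ : ℂ, ζ ^ 2 * ((1 - T * S).det : ℂ) = 1 ∧
      ((∀ t : ℝ, 0 ≤ t → t ≤ 1 → (1 - t • (T * S)).det ≠ 0) → ∃ r : ℝ, 0 < r ∧ ζ = r) ∧
      ∀ ħ : ℝ, 0 < ħ → ∀ u, Tendsto (fun ε => ((2 * π * ħ : ℝ) : ℂ)⁻¹ ^ n *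
        ∫ v, (reg ε v : ℂ) * cexp (I * phase (ħ⁻¹ • hess T S) 0 (v - u))) (𝓝[>] 0) (𝓝 ζ) := by
  have hH := hess_transpose hT hS
  obtain ⟨O, l, hd, hdl⟩ := exists_isDiag hH
  have hl : ∀ i, l i ≠ 0 := by
    intro i hi
    have h0 : (hess T S).det = 0 := by rw [hdl]; exact Finset.prod_eq_zero (mem_univ i) hi
    rw [det_hess] at h0
    exact hdet ((mul_eq_zero.1 h0).resolve_left (pow_ne_zero _ (by norm_num)))
  have hlim : ∀ ħ : ℝ, 0 < ħ → ∀ u, Tendsto (fun ε => ((2 * π * ħ : ℝ) : ℂ)⁻¹ ^ n *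
        ∫ v, (reg ε v : ℂ) * cexp (I * phase (ħ⁻¹ • hess T S) 0 (v - u))) (𝓝[>] 0)
        (𝓝 (∏ i, (I / l i) ^ (1 / 2 : ℂ))) := by
    intro ħ hħ u
    have hH' : (ħ⁻¹ • hess T S)ᵀ = ħ⁻¹ • hess T S := by rw [transpose_smul, hH]
    have hd' := hd.smul ħ⁻¹
    have e : ∀ v, cexp (I * phase (ħ⁻¹ • hess T S) 0 (v - u)) =
        cexp (I * phase (ħ⁻¹ • hess T S) (-((ħ⁻¹ • hess T S) *ᵥ u)) v) *
          cexp (I * phase (ħ⁻¹ • hess T S) 0 u) := fun v => by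
      rw [phase_sub hH', ← Complex.exp_add]; push_cast; ring_nf
    simp only [e, ← mul_assoc, integral_mul_const]
    have ht := hd'.tendsto_one (fun i => mul_ne_zero (inv_ne_zero hħ.ne') (hl i))
      (-((ħ⁻¹ • hess T S) *ᵥ u))
    obtain ⟨w, rfl⟩ : ∃ w, u = O *ᵥ w := ⟨Oᵀ *ᵥ u, by
      rw [mulVec_mulVec, mul_eq_one_comm.1 hd.orth, one_mulVec]⟩
    have hb : ∀ i, (Oᵀ *ᵥ (-((ħ⁻¹ • hess T S) *ᵥ (O *ᵥ w)))) i = -(ħ⁻¹ * l i * w i) := by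
      intro i
      have e : Oᵀ * (ħ⁻¹ • hess T S) * O = diagonal fun i => ħ⁻¹ * l i := by
        rw [mul_assoc, hd'.eq, mul_assoc, hd.orth, mul_one, ← mul_assoc, hd.orth, one_mul]
      rw [mulVec_neg, mulVec_mulVec, mulVec_mulVec, e, Pi.neg_apply, mulVec_diagonal]
    have hph : phase (ħ⁻¹ • hess T S) 0 (O *ᵥ w) = ∑ i, ħ⁻¹ * l i * w i ^ 2 / 2 := by
      rw [hd'.phase_eq]
      simp only [phase, mulVec_zero, mulVec_diagonal, dotProduct, Pi.zero_apply, zero_mul,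
        sum_const_zero, add_zero]
      rw [Finset.sum_div]
      refine sum_congr rfl fun i _ => ?_
      ring
    simp only [hb, gaussVal_gcoef_zero (hl _) hħ] at ht
    have h2 := (ht.const_mul (((2 * π * ħ : ℝ) : ℂ)⁻¹ ^ n)).mul_const
      (cexp (I * phase (ħ⁻¹ • hess T S) 0 (O *ᵥ w)))
    have hval : ((2 * π * ħ : ℝ) : ℂ)⁻¹ ^ n * (∏ i, ((2 * π * ħ : ℝ) : ℂ) ^ (1 / 2 : ℂ) *
        (I / l i) ^ (1 / 2 : ℂ) * cexp (-(I * ((ħ⁻¹ * l i * w i ^ 2 / 2 : ℝ) : ℂ)))) *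
        cexp (I * phase (ħ⁻¹ • hess T S) 0 (O *ᵥ w)) = ∏ i, (I / l i) ^ (1 / 2 : ℂ) := by
      have hp : ((2 * π * ħ : ℝ) : ℂ) ≠ 0 := ofReal_ne_zero.2 (by positivity)
      rw [prod_mul_distrib, prod_mul_distrib, ← Complex.exp_sum,
        sum_neg_distrib, ← mul_sum, hph, ← ofReal_sum, Finset.prod_const,
        Finset.card_univ, Fintype.card_sum, Fintype.card_fin, ← two_mul, pow_mul, cpow_half_sq,
        ← mul_assoc, ← mul_assoc, ← mul_pow, inv_mul_cancel₀ hp, one_pow, one_mul, mul_assoc,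
        ← Complex.exp_add, neg_add_cancel, Complex.exp_zero, mul_one]
    rw [hval] at h2
    exact h2
  have hsq : (∏ i, (I / l i : ℂ) ^ (1 / 2 : ℂ)) ^ 2 * ((1 - T * S).det : ℂ) = 1 := by
    rw [← Finset.prod_pow]
    simp only [cpow_half_sq]
    rw [Finset.prod_div_distrib, ← ofReal_prod, ← hdl, det_hess, Finset.prod_const,
      Finset.card_univ, Fintype.card_sum, Fintype.card_fin, ← two_mul, pow_mul, I_sq]
    have hdc : ((1 - T * S).det : ℂ) ≠ 0 := ofReal_ne_zero.2 hdet
    push_cast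
    field_simp
  refine ⟨_, hsq, fun hpath => ?_, hlim⟩
  set ζ := ∏ i, (I / l i : ℂ) ^ (1 / 2 : ℂ) with hζ
  have hmul : ∀ t : ℝ, (t • T) * (t • S) = (t * t) • (T * S) := fun t => smul_mul_smul_comm _ _ _ _
  have hpos : ∀ t : ℝ, 0 ≤ t → t ≤ 1 → 0 < (1 - (t • T) * (t • S)).det := fun t h0 h1 => by
    rw [hmul]
    exact hess_path_pos hpath (mul_nonneg h0 h0) (mul_le_one₀ h1 h0 h1)
  have htube : ∀ᶠ ε : ℝ in 𝓝 0, ∀ t ∈ Set.Icc (0 : ℝ) 1,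
      0 < (regDet (hess (t • T) (t • S)) ε).re := by
    refine isCompact_Icc.eventually_forall_of_forall_eventually fun t ht => ?_
    have hc : Continuous fun p : ℝ × ℝ => (regDet (hess (p.2 • T) (p.2 • S)) p.1).re := by
      have hh : Continuous fun p : ℝ × ℝ => (hess (p.2 • T) (p.2 • S)).map ofReal := by
        unfold hess
        refine Continuous.matrix_map (Continuous.matrix_fromBlocks (by fun_prop) (by fun_prop)
          (by fun_prop) (by fun_prop)) continuous_ofReal
      unfold regDet
      refine continuous_re.comp (Continuous.matrix_det ?_)
      fun_prop
    refine hc.continuousAt.eventually (lt_mem_nhds ?_)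
    change 0 < (regDet (hess (t • T) (t • S)) 0).re
    rw [regDet_zero, ofReal_re]
    exact mul_pos (by positivity) (hpos t ht.1 ht.2)
  have hre : 0 ≤ ζ.re := by
    have h1 := hlim 1 one_pos 0
    simp only [inv_one, one_smul, sub_zero, mul_one] at h1
    refine ge_of_tendsto ((continuous_re.tendsto _).comp h1) ?_
    have hev : ∀ᶠ ε : ℝ in 𝓝[>] 0, ∀ t ∈ Set.Icc (0 : ℝ) 1,
      0 < (regDet (hess (t • T) (t • S)) ε).re := htube.filter_mono nhdsWithin_le_nhds
    filter_upwards [hev, self_mem_nhdsWithin] with ε hε hε0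
    have hg := regGauss_re_pos (T := T) (S := S) hε0 hT hS fun t h0 h1 => hε t ⟨h0, h1⟩
    rw [Function.comp_apply, ← ofReal_inv, ← ofReal_pow, re_ofReal_mul]
    exact mul_nonneg (by positivity) hg.le
  have hd0 : 0 < (1 - T * S).det := by simpa using hpos 1 zero_le_one le_rfl
  have him : ζ.im = 0 := by
    have h1 := congrArg Complex.im hsq
    have h2 := congrArg Complex.re hsq
    rw [im_mul_ofReal, one_im, sq, mul_im] at h1
    rw [re_mul_ofReal, one_re, sq, mul_re] at h2
    have h3 : ζ.re * ζ.im = 0 := by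
      have := (mul_eq_zero.1 h1).resolve_right hd0.ne'
      linarith
    rcases mul_eq_zero.1 h3 with h4 | h4
    · rw [h4] at h2
      nlinarith [mul_self_nonneg ζ.im]
    · exact h4
  refine ⟨ζ.re, lt_of_le_of_ne hre fun h => ?_, Complex.ext rfl (by rw [ofReal_im, him])⟩
  have : ζ = 0 := Complex.ext h.symm him
  rw [this] at hsq
  simp at hsq

end Phase

section Log

theorem exists_nilpotent_exp_eq {A : Type*} [Ring A] [Module ℚ A] [IsScalarTower ℚ A A]
    [SMulCommClass ℚ A A] (S : Subring A) (hS : ∀ x ∈ S, ∀ y, Commute x y)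
    (hq : ∀ (q : ℚ), ∀ x ∈ S, q • x ∈ S) (n : ℕ) : ∀ s ∈ S, s ^ n = 0 →
    ∃ c ∈ S, IsNilpotent c ∧ IsNilpotent.exp c = 1 + s := by
  induction n with
  | zero =>
    intro s _ h
    rw [pow_zero] at h
    exact ⟨0, S.zero_mem, IsNilpotent.zero, by rw [IsNilpotent.exp_zero, ← mul_one s, h]; simp⟩
  | succ n ih =>
    intro s hs h
    rcases n with _ | k
    · rw [zero_add, pow_one] at h
      exact ⟨0, S.zero_mem, IsNilpotent.zero, by rw [IsNilpotent.exp_zero, h, add_zero]⟩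
    · set e := ∑ i ∈ Finset.range k, ((i + 2).factorial : ℚ)⁻¹ • (-s) ^ i with he
      have heS : e ∈ S := S.sum_mem fun i _ => hq _ _ (S.pow_mem (S.neg_mem hs) _)
      have hns : (-s) ^ (k + 2) = 0 := by rw [neg_pow, h, mul_zero]
      have hE : IsNilpotent.exp (-s) = 1 - s + s ^ 2 * e := by
        rw [IsNilpotent.exp_eq_sum hns, Finset.sum_range_succ', Finset.sum_range_succ', he,
          mul_sum]
        have : ∀ i, ((i + 1 + 1).factorial : ℚ)⁻¹ • (-s) ^ (i + 1 + 1) =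
            s ^ 2 * (((i + 2).factorial : ℚ)⁻¹ • (-s) ^ i) := fun i => by
          rw [mul_smul_comm, add_assoc, pow_add, neg_sq, ((Commute.refl s).neg_left.pow_pow i 2).eq]
        rw [sum_congr rfl fun i _ => this i]
        simp only [zero_add, Nat.factorial_one, Nat.cast_one, inv_one, one_smul, pow_one,
          Nat.factorial_zero, pow_zero]
        abel
      obtain ⟨c, hc, hcn, hce⟩ := ih (s ^ 2 * (e * (1 + s) - 1))
        (S.mul_mem (S.pow_mem hs _) (S.sub_mem (S.mul_mem heS (S.add_mem S.one_mem hs)) S.one_mem))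
        (by
          rw [((hS s hs _).pow_left 2).mul_pow, ← pow_mul, show 2 * (k + 1) = k + 2 + k by ring,
            pow_add, h, zero_mul, zero_mul])
      refine ⟨s + c, S.add_mem hs hc, (hS s hs c).isNilpotent_add ⟨_, h⟩ hcn, ?_⟩
      have h1 : 1 + s ^ 2 * (e * (1 + s) - 1) = IsNilpotent.exp (-s) * (1 + s) := by
        rw [hE]
        noncomm_ring
      rw [IsNilpotent.exp_add_of_commute (hS s hs c) ⟨_, h⟩ hcn, hce, h1, ← mul_assoc,
        IsNilpotent.exp_mul_exp_neg_self ⟨_, h⟩, one_mul]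

variable {τ : Type}

/-- The even real elements. -/
noncomputable def realEven (τ : Type) : Subalgebra ℝ (Λ τ) :=
  (GEven τ).restrictScalars ℝ ⊓ realPart τ

theorem exists_gexp_eq {S : Subalgebra ℝ (Λ τ)} (hS : ∀ x ∈ S, x ∈ parityPart τ 0)
    {u : Λ τ} (hu : u ∈ S) {β : ℂ} (hβ : Complex.exp β = body u)
    (hβS : algebraMap ℂ _ β ∈ S) (huS : algebraMap ℂ _ (body u)⁻¹ ∈ S) :
    ∃ c ∈ S, body c = β ∧ gexp c = u := by
  have hb : body u ≠ 0 := hβ ▸ Complex.exp_ne_zero β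
  have hs : algebraMap ℂ _ (body u)⁻¹ * u - 1 ∈ S := S.sub_mem (S.mul_mem huS hu) S.one_mem
  obtain ⟨n, hn⟩ := isNilpotent_of_even (hS _ hs) (by simp [hb])
  obtain ⟨c, hc, hcn, hce⟩ := exists_nilpotent_exp_eq S.toSubring
    (fun x hx y => even_comm (hS x hx) y)
    (fun q x hx => by
      rw [← Rat.cast_smul_eq_qsmul ℝ]
      exact S.smul_mem hx _) n _ hs hn
  have hcb : body c = 0 := by
    exact (hcn.map body).eq_zero
  refine ⟨algebraMap ℂ _ β + c, S.add_mem hβS hc, by simp [hcb], ?_⟩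
  rw [gexp_add (algebraMap_even β) (hS c hc), gexp_algebraMap, gexp_of_body hcb, hce, hβ,
    add_sub_cancel, ← mul_assoc, ← map_mul, mul_inv_cancel₀ hb, map_one, one_mul]

theorem body_real {x : Λ τ} (hx : x ∈ realPart τ) : ∃ r : ℝ, body x = r := by
  induction hx using Algebra.adjoin_induction with
  | mem x hx => obtain ⟨k, rfl⟩ := hx; exact ⟨0, by simp⟩
  | algebraMap r =>
    exact ⟨r, by rw [IsScalarTower.algebraMap_apply ℝ ℂ (Λ τ), body_algebraMap]; rfl⟩
  | add x y _ _ hx hy =>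
    obtain ⟨a, ha⟩ := hx; obtain ⟨b, hb⟩ := hy
    exact ⟨a + b, by rw [map_add, ha, hb]; push_cast; rfl⟩
  | mul x y _ _ hx hy =>
    obtain ⟨a, ha⟩ := hx; obtain ⟨b, hb⟩ := hy
    exact ⟨a * b, by rw [map_mul, ha, hb]; push_cast; rfl⟩

theorem algebraMap_realEven (r : ℝ) : algebraMap ℂ (Λ τ) r ∈ realEven τ := by
  have : algebraMap ℂ (Λ τ) r = algebraMap ℝ _ r :=
    (IsScalarTower.algebraMap_apply ℝ ℂ (Λ τ) r).symm
  rw [this]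
  exact (realEven τ).algebraMap_mem r

/-- Logarithms: every invertible even element is an exponential, and it is the exponential of a real
element if it is real with positive body. -/
theorem exists_log {u : Λ τ} (hu : u ∈ realEven τ) {β : ℂ} (hβ : Complex.exp β = body u) :
    ∃ c ∈ parityPart τ 0, body c = β ∧ gexp c = u ∧ ((∃ r : ℝ, β = r) → c ∈ realPart τ) := by
  obtain ⟨b, hb⟩ := body_real hu.2
  have hinv : algebraMap ℂ (Λ τ) (body u)⁻¹ ∈ realEven τ := by
    rw [hb, ← Complex.ofReal_inv]
    exact algebraMap_realEven _
  by_cases hr : ∃ r : ℝ, β = r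
  · obtain ⟨r, rfl⟩ := hr
    obtain ⟨c, hc, h⟩ := exists_gexp_eq (S := realEven τ) (fun x hx => hx.1) hu hβ
      (algebraMap_realEven r) hinv
    exact ⟨c, hc.1, h.1, h.2, fun _ => hc.2⟩
  · obtain ⟨c, hc, h⟩ := exists_gexp_eq (S := (GEven τ).restrictScalars ℝ) (fun x hx => hx) hu.1 hβ
      (algebraMap_even β) hinv.1
    exact ⟨c, hc, h.1, h.2, fun h => (hr h).elim⟩

end Log

section DetDerivation

variable {R : Type*} [CommRing R] {n : Type*} [Fintype n] [DecidableEq n]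

theorem derivation_det (δ : Derivation ℤ R R) {A B : Matrix n n R} (h : A * B = 1) :
    δ A.det = A.det * (B * A.map δ).trace := by
  let F : R →+* DualNumber R :=
    { toFun := fun r => TrivSqZeroExt.inl r + TrivSqZeroExt.inr (δ r)
      map_one' := by simp
      map_zero' := by simp
      map_add' := fun a b => by
        ext <;> simp
      map_mul' := fun a b => by
        ext
        · simp
        · simp [mul_comm] }
  let ι : R →+* DualNumber R := TrivSqZeroExt.inlHom R R
  have hA : A.map F = A.map ι * (1 + (DualNumber.eps : DualNumber R) • (B * A.map δ).map ι) := by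
    rw [mul_add, mul_one, mul_smul_comm, ← Matrix.map_mul, ← mul_assoc, h, one_mul]
    ext i j
    · simp [F, ι]
    · simp [F, ι]
  have h2 := F.map_det A
  rw [RingHom.mapMatrix_apply, hA, det_mul, det_one_add_smul] at h2
  have h3 := congrArg TrivSqZeroExt.snd h2
  have h4 : ((A.map ι).det : DualNumber R) = ι A.det := (ι.map_det A).symm
  have h5 : ((B * A.map δ).map ι).trace = ι (B * A.map δ).trace := by
    rw [trace, trace, map_sum]; rfl
  rw [h4, h5] at h3
  simpa [F, ι, sq] using h3

theorem det_mem_subring (S : Subring R) {A : Matrix n n R} (h : ∀ i j, A i j ∈ S) : A.det ∈ S := by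
  rw [det_apply]
  exact S.sum_mem fun σ _ => by
    rw [Units.smul_def]
    exact S.zsmul_mem (S.prod_mem fun i _ => h _ _) _

theorem adjugate_mem_subring (S : Subring R) {A : Matrix n n R} (h : ∀ i j, A i j ∈ S) (i j : n) :
    A.adjugate i j ∈ S := by
  rw [adjugate_apply]
  refine det_mem_subring S fun a b => ?_
  rw [updateRow_apply]
  split_ifs
  · rw [Pi.single_apply]
    split_ifs
    exacts [S.one_mem, S.zero_mem]
  · exact h _ _

end DetDerivation

section Ber

variable {τ : Type}

theorem evenComponent_val {x : Λ τ} (hx : x ∈ parityPart τ 0) :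
    (evenComponent x : Λ τ) = x :=
  DirectSum.decompose_of_mem_same
    (CliffordAlgebra.evenOdd (0 : QuadraticForm ℂ (τ →₀ ℂ))) hx

theorem isUnit_of_body_ne_zero {x : GEven τ} (h : body (x : Λ τ) ≠ 0) : IsUnit x := by
  have hn : IsNilpotent (x - algebraMap ℂ (GEven τ) (body (x : Λ τ))) := by
    obtain ⟨k, hk⟩ := isNilpotent_soul x.2
    exact ⟨k, Subtype.ext hk⟩
  rw [← sub_add_cancel x (algebraMap ℂ (GEven τ) (body (x : Λ τ)))]
  exact hn.isUnit_add_right_of_commute ((isUnit_iff_ne_zero.2 h).map _) (Commute.all _ _)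

/-- Matrices over the even elements, as matrices over the Grassmann algebra. -/
noncomputable abbrev evenVal {ι ι' : Type} (X : Matrix ι ι' (GEven τ)) :
    Matrix ι ι' (Λ τ) := X.map (GEven τ).val

theorem evenVal_injective {ι ι' : Type} :
    Function.Injective (evenVal : Matrix ι ι' (GEven τ) → Matrix ι ι' (Λ τ)) :=
  Matrix.map_injective Subtype.val_injective

theorem evenVal_mul {ι : Type} [Fintype ι] (X Y : Matrix ι ι (GEven τ)) :
    evenVal (X * Y) = evenVal X * evenVal Y := Matrix.map_mul (f := (GEven τ).val)

theorem evenVal_one {ι : Type} [DecidableEq ι] : evenVal (1 : Matrix ι ι (GEven τ)) = 1 :=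
  Matrix.map_one _ rfl rfl

theorem evenVal_evenComponent {ι ι' : Type} {X : Matrix ι ι' (Λ τ)}
    (h : ∀ i j, X i j ∈ parityPart τ 0) : evenVal (X.map evenComponent) = X := by
  ext i j
  exact evenComponent_val (h i j)

theorem trace_mul_comm_odd {ι ι' : Type} [Fintype ι] [Fintype ι'] {X : Matrix ι ι' (Λ τ)}
    {Y : Matrix ι' ι (Λ τ)} (h : ∀ i j, X i j ∈ parityPart τ 1)
    (h' : ∀ i j, Y i j ∈ parityPart τ 1) :
    (X * Y).trace = -(Y * X).trace := by
  simp only [trace, diag_apply, mul_apply]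
  rw [sum_comm, ← sum_neg_distrib]
  refine sum_congr rfl fun i _ => ?_
  rw [← sum_neg_distrib]
  refine sum_congr rfl fun j _ => ?_
  rw [odd_mul (h _ _), inv_of_odd (h' _ _), neg_mul]

variable {V : SuperSpace} {M N : Matrix V.Idx V.Idx (Λ τ)}

/-- The odd-odd block of an even matrix. -/
noncomputable def berD (M : Matrix V.Idx V.Idx (Λ τ)) :
    Matrix (Fin V.odd) (Fin V.odd) (GEven τ) := M.toBlocks₂₂.map evenComponent

/-- The Schur complement of the odd-odd block. -/
noncomputable def berX (M : Matrix V.Idx V.Idx (Λ τ)) :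
    Matrix (Fin V.even) (Fin V.even) (GEven τ) :=
  (M.toBlocks₁₁ - M.toBlocks₁₂ * evenVal (berD M)⁻¹ * M.toBlocks₂₁).map evenComponent

theorem ber_eq (M : Matrix V.Idx V.Idx (Λ τ)) :
    Ber M = (berX M).det * Ring.inverse (berD M).det := rfl

theorem det_body_ne_zero (hM : MatIn (parityR τ) M) (hN : N * M = 1) :
    (M.toBlocks₁₁.map body).det ≠ 0 ∧ (M.toBlocks₂₂.map body).det ≠ 0 := by
  have h1 : N.map body * M.map body = 1 := by
    have := congrArg (fun X => X.map body) hN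
    simp only [Matrix.map_mul] at this
    exact this.trans (Matrix.map_one _ (map_zero body) (map_one body))
  have h2 : M.map body = fromBlocks (M.toBlocks₁₁.map body) 0 0 (M.toBlocks₂₂.map body) := by
    ext i j
    rcases i with i | i <;> rcases j with j | j
    · rfl
    · exact body_odd (hM (.inl i) (.inr j))
    · exact body_odd (hM (.inr i) (.inl j))
    · rfl
  have h3 := congrArg det h1
  rw [det_mul, det_one, h2, det_fromBlocks_zero₂₁] at h3
  constructor
  · intro h; rw [h] at h3; simp at h3
  · intro h; rw [h] at h3; simp at h3

theorem block22_even (hM : MatIn (parityR τ) M) (i j) : M.toBlocks₂₂ i j ∈ parityPart τ 0 :=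
  hM (.inr i) (.inr j)

theorem evenVal_berD (hM : MatIn (parityR τ) M) : evenVal (berD M) = M.toBlocks₂₂ :=
  evenVal_evenComponent (block22_even hM)

theorem body_det {ι : Type} [Fintype ι] [DecidableEq ι] (X : Matrix ι ι (GEven τ)) :
    body (X.det : Λ τ) = ((evenVal X).map body).det :=
  (body.comp (GEven τ).val).toRingHom.map_det X

theorem body_berD_det (hM : MatIn (parityR τ) M) :
    body ((berD M).det : Λ τ) = (M.toBlocks₂₂.map body).det := by
  rw [body_det, evenVal_berD hM]

theorem isUnit_berD_det (hM : MatIn (parityR τ) M) (hN : N * M = 1) : IsUnit (berD M).det :=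
  isUnit_of_body_ne_zero (by rw [body_berD_det hM]; exact (det_body_ne_zero hM hN).2)

theorem mul_parity {ι ι' ι'' : Type} [Fintype ι'] {X : Matrix ι ι' (Λ τ)}
    {Y : Matrix ι' ι'' (Λ τ)} {a b c : ZMod 2} (hX : ∀ i j, X i j ∈ parityPart τ a)
    (hY : ∀ i j, Y i j ∈ parityPart τ b) (h : a + b = c) (i j) : (X * Y) i j ∈ parityPart τ c := by
  rw [mul_apply, ← h]
  exact sum_mem fun k _ => mul_mem_parity (hX i k) (hY k j)

theorem schur_even (hM : MatIn (parityR τ) M) (i j) :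
    (M.toBlocks₁₁ - M.toBlocks₁₂ * evenVal (berD M)⁻¹ * M.toBlocks₂₁) i j ∈ parityPart τ 0 := by
  exact sub_mem (hM (.inl i) (.inl j)) (mul_parity
    (mul_parity (fun i j => hM (.inl i) (.inr j)) (fun i j => ((berD M)⁻¹ i j).2) (add_zero 1))
    (fun i j => hM (.inr i) (.inl j)) rfl i j)

theorem body_berX_det (hM : MatIn (parityR τ) M) :
    body ((berX M).det : Λ τ) = (M.toBlocks₁₁.map body).det := by
  rw [body_det, berX, evenVal_evenComponent (schur_even hM)]
  congr 1
  ext i j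
  rw [map_apply, map_apply, Matrix.sub_apply, map_sub, mul_apply, map_sum,
    Finset.sum_eq_zero, sub_zero]
  intro k _
  have h0 : body (M.toBlocks₂₁ k j) = 0 := body_odd (hM (.inr k) (.inl j))
  rw [map_mul, h0, mul_zero]

theorem body_ber (hM : MatIn (parityR τ) M) (hN : N * M = 1) :
    body (Ber M : Λ τ) * (M.toBlocks₂₂.map body).det = (M.toBlocks₁₁.map body).det := by
  have hu := isUnit_berD_det hM hN
  have h := congrArg (fun x : GEven τ => body (x : Λ τ))
    (mul_assoc (berX M).det (Ring.inverse (berD M).det) (berD M).det)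
  rw [Ring.inverse_mul_cancel _ hu, mul_one] at h
  simp only [Subalgebra.coe_mul, map_mul] at h
  rw [body_berX_det hM, body_berD_det hM] at h
  rw [ber_eq, Subalgebra.coe_mul, map_mul, body_berX_det hM, h]

theorem ber_realEven [Finite τ] (hM : MatIn (realParity τ) M) (hN : N * M = 1) :
    (Ber M : Λ τ) ∈ realEven τ := by
  have hM' := MatIn.of_real hM
  have hu := isUnit_berD_det hM' hN
  let R : Subring (GEven τ) := (realPart τ).toSubring.comap (GEven τ).val.toRingHom
  have hD : ∀ i j, berD M i j ∈ R := fun i j => by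
    change evenVal (berD M) i j ∈ realPart τ
    rw [evenVal_berD hM']
    exact (hM (.inr i) (.inr j)).2
  have hinv : Ring.inverse (berD M).det ∈ R := by
    have h0 := Ring.inverse_mul_cancel _ hu
    generalize Ring.inverse (berD M).det = w at h0
    have h1 : (of fun _ _ : Unit => (w : Λ τ)) *
        (of fun _ _ : Unit => ((berD M).det : Λ τ)) = 1 := by
      ext i j
      rw [mul_apply]
      simpa using congrArg Subtype.val h0
    have h2 := mulVec_inv_mem h1 (W := (Submodule.pi Set.univ fun _ =>
      Subalgebra.toSubmodule (realPart τ))) (fun v hv i _ => by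
        simpa [mulVec, dotProduct] using
          (realPart τ).mul_mem (det_mem_subring R hD) (hv () trivial))
      (fun _ => 1) (fun i _ => (realPart τ).one_mem)
    have h3 := h2 () trivial
    change (w : Λ τ) ∈ realPart τ
    simpa [mulVec, dotProduct] using h3
  have hDi : ∀ i j, (berD M)⁻¹ i j ∈ R := fun i j => by
    rw [inv_def, Matrix.smul_apply]
    exact R.mul_mem hinv (adjugate_mem_subring R hD i j)
  have hX : ∀ i j, berX M i j ∈ R := fun i j => by
    change evenVal (berX M) i j ∈ realPart τ
    rw [berX, evenVal_evenComponent (schur_even hM')]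
    refine (realPart τ).sub_mem (hM (.inl i) (.inl j)).2 ?_
    rw [mul_apply]
    refine (realPart τ).sum_mem fun k _ => (realPart τ).mul_mem ?_ (hM (.inr k) (.inl j)).2
    rw [mul_apply]
    exact (realPart τ).sum_mem fun l _ => (realPart τ).mul_mem (hM (.inl i) (.inr l)).2 (hDi l k)
  exact ⟨(Ber M).2, R.mul_mem (det_mem_subring R hX) hinv⟩

section Variation

variable [Fintype τ]

/-- The Euler derivation. -/
noncomputable abbrev deg : Λ τ →ₗ[ℂ] Λ τ := euler fun _ => 1

/-- The Euler derivation of the even subalgebra. -/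
noncomputable def degEven (τ : Type) [Fintype τ] : Derivation ℤ (GEven τ) (GEven τ) :=
  Derivation.mk' (AddMonoidHom.toIntLinearMap
    { toFun := fun x => ⟨deg (x : Λ τ), euler_mem_parity _ x.2⟩
      map_zero' := Subtype.ext (map_zero _)
      map_add' := fun x y => Subtype.ext (map_add _ _ _) }) fun x y => by
    apply Subtype.ext
    change deg ((x : Λ τ) * (y : Λ τ)) =
      (x : Λ τ) * deg (y : Λ τ) + (y : Λ τ) * deg (x : Λ τ)
    rw [euler_mul, add_comm, even_comm y.2]

theorem map_deg_mul {ι ι' ι'' : Type} [Fintype ι'] (X : Matrix ι ι' (Λ τ))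
    (Y : Matrix ι' ι'' (Λ τ)) :
    (X * Y).map deg = X.map deg * Y + X * Y.map deg := by
  ext i j
  simp only [map_apply, mul_apply, map_sum, euler_mul, sum_add_distrib, Matrix.add_apply]

theorem deg_det {ι : Type} [Fintype ι] [DecidableEq ι] {A B : Matrix ι ι (GEven τ)}
    (h : A * B = 1) : deg (A.det : Λ τ) =
      A.det * (evenVal B * (evenVal A).map deg).trace := by
  have h1 : deg (A.det : Λ τ) = A.det * ((B * A.map (degEven τ)).trace : GEven τ) :=
    congrArg Subtype.val (derivation_det (degEven τ) h)
  rw [h1]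
  congr 1
  simp only [trace, diag_apply, mul_apply]
  rw [AddSubmonoidClass.coe_finsetSum]
  refine sum_congr rfl fun i _ => ?_
  rw [AddSubmonoidClass.coe_finsetSum]
  rfl

theorem supertrace_fromBlocks_mul {m n : Type} [Fintype m] [Fintype n] (P A : Matrix m m (Λ τ))
    (Q B : Matrix m n (Λ τ)) (R C : Matrix n m (Λ τ))
    (S D : Matrix n n (Λ τ)) :
    ∑ i, sgn i • (fromBlocks P Q R S * fromBlocks A B C D) i i =
      (P * A + Q * C).trace - (R * B + S * D).trace := by
  rw [fromBlocks_multiply, Fintype.sum_sum_type]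
  simp only [sgn, elim_inl, elim_inr, one_smul, neg_smul, fromBlocks_apply₁₁,
    fromBlocks_apply₂₂, sum_neg_distrib, ← sub_eq_add_neg]
  rfl

set_option maxHeartbeats 800000 in
/-- The logarithmic variation of the Berezinian is a supertrace. -/
theorem deg_ber (hM : MatIn (parityR τ) M) (hN : N * M = 1) (hN' : M * N = 1) :
    deg (Ber M : Λ τ) = (∑ i, sgn i • (N * M.map deg) i i) * Ber M := by
  have hPe : ∀ i j, N.toBlocks₁₁ i j ∈ parityPart τ 0 :=
    fun i j => MatIn.inverse hN hM (.inl i) (.inl j)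
  have hu := isUnit_berD_det hM hN
  have hDD := evenVal_berD hM
  have hX : evenVal (berX M) = _ := evenVal_evenComponent (schur_even hM)
  have hBo : ∀ i j, M.toBlocks₁₂ i j ∈ parityPart τ 1 := fun i j => hM (.inl i) (.inr j)
  have hCo : ∀ i j, M.toBlocks₂₁ i j ∈ parityPart τ 1 := fun i j => hM (.inr i) (.inl j)
  have hDe := block22_even hM
  have hMb := (fromBlocks_toBlocks M).symm
  have hNb := (fromBlocks_toBlocks N).symm
  have hMd := (congrArg (fun X => X.map deg) hMb).trans (fromBlocks_map _ _ _ _ _)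
  have hb := hN
  have hb' := hN'
  rw [hMb, hNb, fromBlocks_multiply, ← fromBlocks_one, fromBlocks_inj] at hb hb'
  set D' := evenVal (berD M)⁻¹ with hD'
  generalize M.toBlocks₁₁ = A, M.toBlocks₁₂ = B, M.toBlocks₂₁ = C, M.toBlocks₂₂ = D at *
  generalize N.toBlocks₁₁ = P, N.toBlocks₁₂ = Q, N.toBlocks₂₁ = R, N.toBlocks₂₂ = S at *
  obtain ⟨-, b2, -, b4⟩ := hb
  obtain ⟨a1, -, a3, -⟩ := hb'
  have h1 : D * D' = 1 := by
    rw [← hDD, hD', ← evenVal_mul, mul_nonsing_inv _ hu, evenVal_one]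
  have h2 : D' * D = 1 := by
    rw [← hDD, hD', ← evenVal_mul, nonsing_inv_mul _ hu, evenVal_one]
  have hQ' : Q = -(P * B * D') := by
    rw [← Matrix.mul_one Q, ← h1, ← Matrix.mul_assoc, eq_neg_of_add_eq_zero_right b2, Matrix.neg_mul]
  have hS' : S = D' - R * B * D' := by
    rw [← Matrix.mul_one S, ← h1, ← Matrix.mul_assoc, eq_sub_of_add_eq' b4, Matrix.sub_mul,
      Matrix.one_mul]
  have hR' : R = -(D' * C * P) := by
    rw [← Matrix.one_mul R, ← h2, Matrix.mul_assoc, eq_neg_of_add_eq_zero_right a3, Matrix.mul_neg,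
      Matrix.mul_assoc]
  have hXP : berX M * P.map evenComponent = 1 := by
    refine evenVal_injective ?_
    rw [evenVal_mul, evenVal_one, evenVal_evenComponent hPe, ← a1, hR', hX, Matrix.sub_mul,
      Matrix.mul_neg, sub_eq_add_neg]
    simp only [Matrix.mul_assoc]
  have dX := deg_det hXP
  have dD := deg_det (mul_nonsing_inv _ hu)
  rw [evenVal_evenComponent hPe, hX] at dX
  rw [hDD, ← hD'] at dD
  set r := Ring.inverse (berD M).det with hr
  have hdr : ((berD M).det : Λ τ) * r = 1 :=
    congrArg Subtype.val (Ring.mul_inverse_cancel _ hu)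
  have hrd : (r : Λ τ) * (berD M).det = 1 := by rw [even_comm r.2, hdr]
  have dr : deg (r : Λ τ) = -((D' * D.map deg).trace * r) := by
    have h5 := congrArg deg hdr
    rw [euler_mul, dD, euler_one] at h5
    have h6 := congrArg ((r : Λ τ) * ·) h5
    simp only [mul_add, ← mul_assoc, hrd, one_mul, mul_zero] at h6
    exact eq_neg_of_add_eq_zero_right h6
  have dD' : D'.map deg = -(D' * D.map deg * D') := by
    have h5 := congrArg (fun X => X.map deg * D') h2
    have h6 : (1 : Matrix (Fin V.odd) (Fin V.odd) (Λ τ)).map deg = 0 := by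
      ext i j
      rw [map_apply, one_apply]
      split_ifs <;> simp
    simp only [map_deg_mul, h6, Matrix.add_mul, Matrix.zero_mul] at h5
    rw [Matrix.mul_assoc _ D D', h1, Matrix.mul_one] at h5
    exact eq_neg_of_add_eq_zero_left h5
  have hdS : (A - B * D' * C).map deg = A.map deg - (B.map deg * D' * C -
      B * D' * D.map deg * D' * C + B * D' * C.map deg) := by
    have h5 : ∀ X Y : Matrix (Fin V.even) (Fin V.even) (Λ τ),
      (X - Y).map deg = X.map deg - Y.map deg := fun X Y => by ext i j; simp
    rw [h5, map_deg_mul, map_deg_mul, dD', Matrix.add_mul, Matrix.mul_neg, Matrix.neg_mul]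
    simp only [Matrix.mul_assoc, sub_eq_add_neg]
  have hD'e : ∀ i j, D' i j ∈ parityPart τ 0 := fun i j => ((berD M)⁻¹ i j).2
  have hDCo := mul_parity hD'e hCo (zero_add 1)
  have t1 : (P * (B.map deg * D' * C)).trace = -(D' * C * (P * B.map deg)).trace := by
    rw [Matrix.mul_assoc (B.map deg), ← Matrix.mul_assoc P]
    exact trace_mul_comm_odd 
      (mul_parity hPe (fun i j => euler_mem_parity _ (hBo i j)) (zero_add 1)) hDCo
  have t2 : (P * (B * D' * D.map deg * D' * C)).trace =
      -(D' * C * (P * (B * D' * D.map deg))).trace := by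
    rw [Matrix.mul_assoc (B * D' * D.map deg), ← Matrix.mul_assoc P]
    exact trace_mul_comm_odd (mul_parity hPe (mul_parity (mul_parity hBo hD'e (add_zero 1))
      (fun i j => euler_mem_parity _ (hDe i j)) (add_zero 1)) (zero_add 1)) hDCo
  have hfin : (P * (A - B * D' * C).map deg).trace - (D' * D.map deg).trace =
      ∑ i, sgn i • (N * M.map deg) i i := by
    rw [hNb, hMd, supertrace_fromBlocks_mul, hdS, hQ', hS', hR']
    simp only [Matrix.mul_sub, Matrix.mul_add, Matrix.sub_mul, Matrix.neg_mul, trace_add, trace_sub,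
      trace_neg, t1, t2]
    simp only [Matrix.mul_assoc]
    abel
  rw [ber_eq, Subalgebra.coe_mul, euler_mul, dX, ← hr, dr, ← hfin]
  generalize (P * (A - B * D' * C).map deg).trace = x
  generalize (D' * D.map deg).trace = y
  rw [sub_mul, mul_neg, even_comm (berX M).det.2 x, ← mul_assoc _ y, even_comm (berX M).det.2 y,
    mul_assoc, mul_assoc, sub_eq_add_neg]

end Variation

end Ber

section Nilpotency

variable {τ : Type} [Finite τ]

theorem pow_finrank_eq_zero {x : Λ τ} (h : x ∈ parityPart τ 0) (hb : body x = 0) :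
    x ^ Module.finrank ℂ (Λ τ) = 0 := by
  have hn : IsNilpotent (Algebra.lmul ℂ (Λ τ) x) := (isNilpotent_of_even h hb).map _
  have h1 := hn.charpoly_eq_X_pow_finrank
  have h2 := LinearMap.aeval_self_charpoly (Algebra.lmul ℂ (Λ τ) x)
  rw [h1, map_pow, Polynomial.aeval_X, ← map_pow] at h2
  simpa using DFunLike.congr_fun h2 1

theorem exp_eq_sum_complex {x : Λ τ} {K : ℕ} (h : x ^ K = 0) :
    IsNilpotent.exp x = ∑ k ∈ Finset.range K, ((k.factorial : ℂ)⁻¹) • x ^ k := by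
  rw [IsNilpotent.exp_eq_sum h]
  refine sum_congr rfl fun k _ => ?_
  rw [← Rat.cast_smul_eq_qsmul ℂ]
  push_cast
  rfl

end Nilpotency

section Curves

variable {A B C : Type*} [AddCommGroup A] [Module ℂ A] [AddCommGroup B] [Module ℂ B]
  [AddCommGroup C] [Module ℂ C] {t : ℝ}

/-- Coordinatewise differentiability of a curve in a complex vector space. -/
def HasD (g : ℝ → A) (g' : A) (t : ℝ) : Prop :=
  ∀ l : Module.Dual ℂ A, HasDerivAt (fun s => l (g s)) (l g') t

theorem HasD.const (a : A) : HasD (fun _ => a) 0 t := fun l => by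
  simpa using hasDerivAt_const t (l a)

theorem HasD.map (X : A →ₗ[ℂ] B) {g : ℝ → A} {g' : A} (h : HasD g g' t) :
    HasD (fun s => X (g s)) (X g') t := fun l => h (l ∘ₗ X)

theorem HasD.add {f g : ℝ → A} {f' g' : A} (hf : HasD f f' t) (hg : HasD g g' t) :
    HasD (fun s => f s + g s) (f' + g') t := fun l => by
  simpa using (hf l).fun_add (hg l)

theorem HasD.sum {ι : Type*} (s : Finset ι) {f : ι → ℝ → A} {f' : ι → A}
    (hf : ∀ i ∈ s, HasD (f i) (f' i) t) : HasD (fun r => ∑ i ∈ s, f i r) (∑ i ∈ s, f' i) t := by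
  classical
  induction s using Finset.induction_on with
  | empty => simpa using HasD.const (0 : A)
  | insert i s hi ih =>
    simp only [Finset.sum_insert hi]
    exact (hf i (Finset.mem_insert_self i s)).add (ih fun j hj => hf j (Finset.mem_insert_of_mem hj))

theorem HasD.smul {φ : ℝ → ℂ} {φ' : ℂ} {g : ℝ → A} {g' : A} (hφ : HasDerivAt φ φ' t)
    (hg : HasD g g' t) : HasD (fun s => φ s • g s) (φ' • g t + φ t • g') t := fun l => by
  simpa using hφ.fun_mul (hg l)

theorem HasD.const_smul (c : ℂ) {g : ℝ → A} {g' : A} (hg : HasD g g' t) :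
    HasD (fun s => c • g s) (c • g') t := hg.map (c • LinearMap.id)

theorem HasD.bilin [Module.Finite ℂ A] (X : A →ₗ[ℂ] B →ₗ[ℂ] C) {f : ℝ → A} {f' : A} {g : ℝ → B}
    {g' : B} (hf : HasD f f' t) (hg : HasD g g' t) :
    HasD (fun s => X (f s) (g s)) (X f' (g t) + X (f t) g') t := by
  let b := Module.finBasis ℂ A
  have e : ∀ a c, X a c = ∑ i, b.coord i a • X (b i) c := fun a c => by
    conv_lhs => rw [← b.sum_repr a]
    simp only [map_sum, map_smul, LinearMap.sum_apply, LinearMap.smul_apply, Module.Basis.coord_apply]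
  have h := HasD.sum univ fun i _ => HasD.smul (hf (b.coord i)) (hg.map (X (b i)))
  simp only [sum_add_distrib, ← e] at h
  exact h

end Curves

section GrassmannCurves

variable {τ : Type} [Finite τ] {t : ℝ}

theorem HasD.mul {f g : ℝ → Λ τ} {f' g' : Λ τ} (hf : HasD f f' t)
    (hg : HasD g g' t) : HasD (fun s => f s * g s) (f' * g t + f t * g') t :=
  HasD.bilin (LinearMap.mul ℂ (Λ τ)) hf hg

theorem HasD.pow {f : ℝ → Λ τ} {f' : Λ τ} (hf : HasD f f' t)
    (he : f t ∈ parityPart τ 0) (k : ℕ) :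
    HasD (fun s => f s ^ k) ((k : ℂ) • (f' * f t ^ (k - 1))) t := by
  induction k with
  | zero => simpa using HasD.const (1 : Λ τ)
  | succ k ih =>
    simp only [pow_succ]
    convert! ih.mul hf using 1
    rw [Nat.add_sub_cancel, ← even_comm (Subalgebra.pow_mem (GEven τ) he k) f']
    rcases k with _ | k
    · simp
    · rw [Nat.add_sub_cancel, smul_mul_assoc, mul_assoc, ← pow_succ,
        ← even_comm (Subalgebra.pow_mem (GEven τ) he (k + 1)) f', Nat.cast_succ, add_smul, one_smul]

theorem HasD.gexp {f : ℝ → Λ τ} {f' : Λ τ} (hf : HasD f f' t)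
    (he : ∀ s, f s ∈ parityPart τ 0) :
    HasD (fun s => gexp (f s)) (f' * SuperThick.gexp (f t)) t := by
  set K := Module.finrank ℂ (Λ τ)
  have hK : ∀ s, soul (f s) ^ K = 0 := fun s =>
    pow_finrank_eq_zero (soul_even (he s)) (body_soul _)
  have hK1 : ∀ s, soul (f s) ^ (K + 1) = 0 := fun s => by rw [pow_succ, hK, zero_mul]
  let X : Λ τ →ₗ[ℂ] Λ τ :=
    LinearMap.id - Algebra.linearMap ℂ (Λ τ) ∘ₗ body.toLinearMap
  have hsoul : HasD (fun s => soul (f s)) (soul f') t := hf.map X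
  have hbody : HasDerivAt (fun s => body (f s)) (body f') t := hf body.toLinearMap
  have h1 : HasD (fun s => IsNilpotent.exp (soul (f s)))
      (soul f' * IsNilpotent.exp (soul (f t))) t := by
    have e : (fun s => IsNilpotent.exp (soul (f s))) = fun s =>
        ∑ k ∈ Finset.range (K + 1), ((k.factorial : ℂ)⁻¹) • soul (f s) ^ k :=
      funext fun s => exp_eq_sum_complex (hK1 s)
    rw [e]
    have h := HasD.sum (Finset.range (K + 1)) fun k _ =>
      (hsoul.pow (soul_even (he t)) k).const_smul ((k.factorial : ℂ)⁻¹)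
    convert! h using 1
    rw [exp_eq_sum_complex (hK t), Finset.sum_range_succ', mul_sum]
    simp only [Nat.cast_zero, zero_smul, smul_zero, add_zero, Nat.add_sub_cancel]
    refine sum_congr rfl fun k _ => ?_
    rw [smul_smul, mul_smul_comm]
    congr 1
    rw [Nat.factorial_succ]
    push_cast
    have h0 : ((k : ℂ) + 1) ≠ 0 := Nat.cast_add_one_ne_zero k
    have h1 : (k.factorial : ℂ) ≠ 0 := Nat.cast_ne_zero.2 (Nat.factorial_ne_zero k)
    field_simp
  have h2 := HasD.smul hbody.cexp h1
  convert! h2 using 1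
  rw [gexp_eq]
  conv_lhs => rw [← body_add_soul f', add_mul, ← Algebra.smul_def]
  rw [mul_smul_comm, smul_smul, mul_comm (body f')]

end GrassmannCurves

section PartialDerivative

variable {σ : Type} [Finite σ] {n m : ℕ}

/-- `F'` is the left partial derivative of `F` in the even direction `inl j` or with respect to the
odd variable `inr j`. -/
def PD : (Fin n ⊕ Fin n) ⊕ (Fin m ⊕ Fin m) →
    (𝕋 n → Λ (σ ⧺ m)) →
    (𝕋 n → Λ (σ ⧺ m)) → Prop
  | .inl j, F, F' => ∀ v, HasD (fun t : ℝ => F (v + t • Pi.single j 1)) (F' v) 0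
  | .inr j, F, F' => ∀ v, F' v = oddDeriv (.inr j) (F v)

/-- The sign twist in the Leibniz rule. -/
noncomputable def tw {τ : Type} {α β : Type} : α ⊕ β → Λ τ → Λ τ
  | .inl _, x => x
  | .inr _, x => inv x

theorem tw_eq {τ α β : Type} (k : α ⊕ β) {p : ZMod 2} {x : Λ τ} (hx : x ∈ parityPart τ p) :
    tw k x = sg (par k) p • x := by
  rcases k with k | k <;> rcases zmod_two_cases p with rfl | rfl
  · simp [tw, par, sg, sgZ]
  · simp [tw, par, sg, sgZ]
  · simp [tw, par, sg, sgZ, inv_of_even hx]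
  · simp [tw, par, sg, sgZ, inv_of_odd hx]

variable {k : (Fin n ⊕ Fin n) ⊕ (Fin m ⊕ Fin m)}
  {F F' G G' : 𝕋 n → Λ (σ ⧺ m)}

theorem PD.const (a : Λ σ) :
    PD (n := n) (m := m) k (fun _ => genMap inl a) (fun _ => 0) := by
  rcases k with j | j
  · exact fun v => HasD.const _
  · exact fun v => (oddDeriv_genMap_of_notMem _ _ (by simp) _).symm

theorem PD.add (hF : PD k F F') (hG : PD k G G') :
    PD k (fun v => F v + G v) (fun v => F' v + G' v) := by
  rcases k with j | j
  · exact fun v => (hF v).add (hG v)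
  · exact fun v => by beta_reduce; rw [hF v, hG v, map_add]

theorem PD.sum {ι : Type*} (s : Finset ι)
    {F F' : ι → 𝕋 n → Λ (σ ⧺ m)}
    (h : ∀ i ∈ s, PD k (F i) (F' i)) :
    PD k (fun v => ∑ i ∈ s, F i v) (fun v => ∑ i ∈ s, F' i v) := by
  rcases k with j | j
  · exact fun v => HasD.sum s fun i hi => h i hi v
  · exact fun v => by rw [map_sum]; exact sum_congr rfl fun i hi => h i hi v

theorem PD.smul (c : ℂ) (hF : PD k F F') : PD k (fun v => c • F v) (fun v => c • F' v) := by
  rcases k with j | j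
  · exact fun v => (hF v).const_smul c
  · exact fun v => by beta_reduce; rw [hF v, map_smul]

theorem PD.mul (hF : PD k F F') (hG : PD k G G') :
    PD k (fun v => F v * G v) (fun v => F' v * G v + tw k (F v) * G' v) := by
  rcases k with j | j
  · intro v
    have := (hF v).mul (hG v)
    simpa [tw] using this
  · exact fun v => by beta_reduce; rw [hF v, hG v, oddDeriv_mul]; rfl

theorem PD.gexp (hF : PD k F F') (he : ∀ v, F v ∈ parityPart _ 0) :
    PD k (fun v => gexp (F v)) (fun v => F' v * SuperThick.gexp (F v)) := by
  rcases k with j | j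
  · intro v
    have := (hF v).gexp fun s => he _
    simpa using this
  · exact fun v => by beta_reduce; rw [hF v, oddDeriv_gexp _ (he v)]

theorem PD.congr (hF : PD k F F') (h : ∀ v, F v = G v) (h' : ∀ v, F' v = G' v) : PD k G G' := by
  rw [← funext h, ← funext h']
  exact hF

end PartialDerivative

section Existence

open Complex

variable {σ : Type} {n m : ℕ} {ħ : ℝ}

theorem hasSuperIntegral_iff {F : 𝕋 n → Λ (σ ⧺ m)}
    {J : Λ σ} :
    HasSuperIntegral ħ n m (fun y q => F (elim y q)) J ↔ ∀ l : Module.Dual ℂ (Λ σ),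
      (∀ ε : ℝ, 0 < ε → Integrable fun v => (reg ε v : ℂ) * l (berezin ħ m (F v))) ∧
      Tendsto (fun ε : ℝ => ((2 * π * ħ : ℝ) : ℂ)⁻¹ ^ n *
        ∫ v, (reg ε v : ℂ) * l (berezin ħ m (F v))) (𝓝[>] 0) (𝓝 (l J)) := by
  have hm := (volume_measurePreserving_sumPiEquivProdPi fun _ : Fin n ⊕ Fin n => ℝ)
  have he : ∀ v : 𝕋 n, elim (MeasurableEquiv.sumPiEquivProdPi
      (fun _ : Fin n ⊕ Fin n => ℝ) v).1 (MeasurableEquiv.sumPiEquivProdPi (fun _ => ℝ) v).2 = v :=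
    fun v => by
      funext i
      rcases i with i | i <;> rfl
  have hr : ∀ (ε : ℝ) (v : 𝕋 n), reg ε v =
      Real.exp (-ε * ∑ j, ((MeasurableEquiv.sumPiEquivProdPi (fun _ => ℝ) v).1 j ^ 2 +
        (MeasurableEquiv.sumPiEquivProdPi (fun _ => ℝ) v).2 j ^ 2)) := fun ε v => by
    rw [reg, Fintype.sum_sum_type, sum_add_distrib]
    rfl
  refine forall_congr' fun l => and_congr (forall₂_congr fun ε hε => ?_) ?_
  · rw [← hm.integrable_comp_emb (MeasurableEquiv.measurableEmbedding _)]
    refine integrable_congr (Eventually.of_forall fun v => ?_)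
    simp only [Function.comp_apply, he, hr]
  · refine tendsto_congr fun ε => ?_
    rw [← hm.integral_comp (MeasurableEquiv.measurableEmbedding _)]
    simp only [he, hr]

/-- Oscillatory functions: polynomials times the exponential of a quadratic phase. -/
def IsOsc {ι : Type} {A : Type*} [Fintype ι] [DecidableEq ι] [AddCommGroup A] [Module ℂ A] (H : Matrix ι ι ℝ) (b : ι → ℝ)
    (F : (ι → ℝ) → A) : Prop := ∃ p ∈ polyFun ι A, ∀ v, F v = cexp (I * phase H b v) • p v

section Osc

variable {ι : Type} [Fintype ι] [DecidableEq ι] {A B : Type*} [AddCommGroup A] [Module ℂ A]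
  [AddCommGroup B] [Module ℂ B] {H : Matrix ι ι ℝ} {b : ι → ℝ} {F G : (ι → ℝ) → A}

theorem IsOsc.add (hF : IsOsc H b F) (hG : IsOsc H b G) : IsOsc H b fun v => F v + G v := by
  obtain ⟨p, hp, hF⟩ := hF
  obtain ⟨q, hq, hG⟩ := hG
  exact ⟨_, add_mem hp hq, fun v => by beta_reduce; rw [hF, hG, Pi.add_apply, smul_add]⟩

theorem IsOsc.map (X : A →ₗ[ℂ] B) (hF : IsOsc H b F) : IsOsc H b fun v => X (F v) := by
  obtain ⟨p, hp, hF⟩ := hF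
  exact ⟨_, comp_mem_polyFun X hp, fun v => by beta_reduce; rw [hF, map_smul]⟩

theorem IsOsc.mul_right {R : Type*} [Ring R] [Algebra ℂ R] {F p : (ι → ℝ) → R} (hF : IsOsc H b F)
    (hp : p ∈ polyFun ι R) : IsOsc H b fun v => F v * p v := by
  obtain ⟨q, hq, hF⟩ := hF
  exact ⟨_, mul_mem_polyFun hq hp, fun v => by beta_reduce; rw [hF, smul_mul_assoc]⟩

theorem IsOsc.mul_left {R : Type*} [Ring R] [Algebra ℂ R] {F p : (ι → ℝ) → R} (hF : IsOsc H b F)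
    (hp : p ∈ polyFun ι R) : IsOsc H b fun v => p v * F v := by
  obtain ⟨q, hq, hF⟩ := hF
  exact ⟨_, mul_mem_polyFun hp hq, fun v => by beta_reduce; rw [hF, mul_smul_comm]⟩

theorem exists_gexp_poly {τ : Type} [Finite τ] {E : (ι → ℝ) → Λ τ}
    (hE : E ∈ polyFun ι (Λ τ)) (he : ∀ v, E v ∈ parityPart τ 0) :
    ∃ p ∈ polyFun ι (Λ τ), ∀ v, gexp (E v) = cexp (body (E v)) • p v := by
  set K := Module.finrank ℂ (Λ τ)
  have hs : (fun v => soul (E v)) ∈ polyFun ι (Λ τ) :=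
    comp_mem_polyFun (LinearMap.id - Algebra.linearMap ℂ (Λ τ) ∘ₗ body.toLinearMap) hE
  refine ⟨fun v => ∑ k ∈ Finset.range K, (k.factorial : ℂ)⁻¹ • soul (E v) ^ k,
    sum_mem_polyFun _ fun k _ => smul_mem _ _ (pow_mem_polyFun hs k), fun v => ?_⟩
  rw [gexp_eq, exp_eq_sum_complex (pow_finrank_eq_zero (soul_even (he v)) (body_soul _))]

theorem isOsc_gexp {τ : Type} [Finite τ] {E : (ι → ℝ) → Λ τ} (hE : E ∈ polyFun ι (Λ τ))
    (he : ∀ v, E v ∈ parityPart τ 0) {c : ℂ} (hb : ∀ v, body (E v) = I * phase H b v + c) :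
    IsOsc H b fun v => gexp (E v) := by
  obtain ⟨p, hp, h⟩ := exists_gexp_poly hE he
  refine ⟨fun v => cexp c • p v, smul_mem _ _ hp, fun v => ?_⟩
  beta_reduce
  rw [h, hb, Complex.exp_add, mul_smul]

end Osc

variable {H : Matrix (Fin n ⊕ Fin n) (Fin n ⊕ Fin n) ℝ} {b : 𝕋 n}
  {F F' : 𝕋 n → Λ (σ ⧺ m)}

theorem IsOsc.oscillatory (hH : Hᵀ = H) (hdet : H.det ≠ 0) {g : 𝕋 n → ℂ}
    (hg : IsOsc H b g) :
    (∀ ε > 0, Integrable fun v => (reg ε v : ℂ) * g v) ∧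
    ∃ L, Tendsto (fun ε => ∫ v, (reg ε v : ℂ) * g v) (𝓝[>] 0) (𝓝 L) := by
  obtain ⟨O, l, hd, hdl⟩ := exists_isDiag hH
  have hl : ∀ i, l i ≠ 0 := fun i hi =>
    hdet (by rw [hdl]; exact Finset.prod_eq_zero (mem_univ i) hi)
  obtain ⟨p, hp, hg⟩ := hg
  obtain ⟨h1, -, h2⟩ := hd.oscillatory hl hp
  simp only [hg, smul_eq_mul]
  exact ⟨fun ε hε => h1 ε hε b, h2 b⟩

theorem IsOsc.exists_integral [Finite σ] (hH : Hᵀ = H) (hdet : H.det ≠ 0) (hF : IsOsc H b F) :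
    ∃ J, HasSuperIntegral ħ n m (fun y q => F (elim y q)) J := by
  have h : ∀ l : Module.Dual ℂ (Λ σ),
      (∀ ε > 0, Integrable fun v => (reg ε v : ℂ) * l (berezin ħ m (F v))) ∧
      ∃ L, Tendsto (fun ε => ∫ v, (reg ε v : ℂ) * l (berezin ħ m (F v))) (𝓝[>] 0) (𝓝 L) :=
    fun l => (hF.map (l ∘ₗ berezin ħ m)).oscillatory hH hdet
  choose h1 X hX using h
  let Y : Module.Dual ℂ (Module.Dual ℂ (Λ σ)) :=
    { toFun := X
      map_add' := fun l l' => by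
        refine tendsto_nhds_unique (hX (l + l')) (((hX l).add (hX l')).congr' ?_)
        filter_upwards [self_mem_nhdsWithin] with ε hε
        rw [← integral_add (h1 l ε hε) (h1 l' ε hε)]
        simp only [LinearMap.add_apply, mul_add]
      map_smul' := fun c l => by
        refine tendsto_nhds_unique (hX (c • l)) (((hX l).const_mul c).congr fun ε => ?_)
        rw [← integral_const_mul]
        simp only [LinearMap.smul_apply, smul_eq_mul, mul_left_comm] }
  refine ⟨(((2 * π * ħ : ℝ) : ℂ)⁻¹ ^ n) • (Module.evalEquiv ℂ (Λ σ)).symm Y,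
    hasSuperIntegral_iff.2 fun l => ⟨h1 l, ?_⟩⟩
  rw [map_smul, smul_eq_mul, Module.apply_evalEquiv_symm_apply]
  exact (hX l).const_mul _

theorem hasLineDerivAt_reg (ε : ℝ) (v : 𝕋 n) (j : Fin n ⊕ Fin n) :
    HasLineDerivAt ℝ (fun v => (reg ε v : ℂ)) ((-(2 * ε * v j) * reg ε v : ℝ) : ℂ) v
      (Pi.single j 1) := by
  have h1 : HasDerivAt (fun t : ℝ => ∑ i, (v + t • (Pi.single j 1 : 𝕋 n)) i ^ 2)
      (2 * v j) 0 := by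
    have : ∀ i ∈ univ, HasDerivAt
        (fun t : ℝ => (v + t • (Pi.single j 1 : 𝕋 n)) i ^ 2)
        (2 * v i * (Pi.single j 1 : 𝕋 n) i) 0 := fun i _ => by
      have h0 : HasDerivAt (fun t : ℝ => v i + t * (Pi.single j 1 : 𝕋 n) i)
          ((Pi.single j 1 : 𝕋 n) i) 0 := by
        simpa using ((hasDerivAt_id (0 : ℝ)).mul_const _).const_add (v i)
      simpa using h0.fun_pow 2
    have h2 := HasDerivAt.fun_sum this
    simpa [Pi.single_apply] using h2
  have h2 := ((h1.const_mul (-ε)).exp).ofReal_comp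
  unfold HasLineDerivAt
  convert! h2 using 1
  simp only [reg, zero_smul, add_zero]
  push_cast
  ring

/-- Integrals of partial derivatives vanish. -/
theorem PD.integral_eq_zero [Finite σ] {k : (Fin n ⊕ Fin n) ⊕ (Fin m ⊕ Fin m)} (h : PD k F F')
    (hH : Hᵀ = H) (hdet : H.det ≠ 0) (hF : IsOsc H b F) (hF' : IsOsc H b F') :
    HasSuperIntegral ħ n m (fun y q => F' (elim y q)) 0 := by
  rw [hasSuperIntegral_iff]
  intro l
  rcases k with j | j
  · set g := fun v => l (berezin ħ m (F v)) with hg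
    set g' := fun v => l (berezin ħ m (F' v)) with hg'
    have o1 : IsOsc H b g := hF.map (l ∘ₗ berezin ħ m)
    have o2 : IsOsc H b g' := hF'.map (l ∘ₗ berezin ħ m)
    have hj : (fun v : 𝕋 n => (v j : ℂ)) ∈ polyFun (Fin n ⊕ Fin n) ℂ := by
      simpa using coord_smul_mem_polyFun j (1 : ℂ)
    obtain ⟨i1, -⟩ := o1.oscillatory hH hdet
    obtain ⟨i2, -⟩ := o2.oscillatory hH hdet
    obtain ⟨i3, L, hL⟩ := (o1.mul_left hj).oscillatory hH hdet
    have key : ∀ ε > 0, ∫ v, (reg ε v : ℂ) * g' v = 2 * ε * ∫ v, (reg ε v : ℂ) * (v j * g v) := by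
      intro ε hε
      have hd : ∀ v, HasLineDerivAt ℝ (fun v => (reg ε v : ℂ) * g v)
          (-(2 * ε) * ((reg ε v : ℂ) * (v j * g v)) + reg ε v * g' v) v (Pi.single j 1) := by
        intro v
        have hgd : HasLineDerivAt ℝ g (g' v) v (Pi.single j 1) := h v (l ∘ₗ berezin ħ m)
        have := HasDerivAt.fun_mul (hasLineDerivAt_reg ε v j) hgd
        simp only [zero_smul, add_zero] at this
        unfold HasLineDerivAt
        convert! this using 1
        push_cast
        ring
      have h0 := integral_bilinear_hasLineDerivAt_right_eq_neg_left_of_integrable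
        (μ := (volume : Measure 𝕋 n)) (B := ContinuousLinearMap.mul ℝ ℂ)
        (f := fun _ => (1 : ℂ)) (f' := fun _ => 0) (g := fun v => (reg ε v : ℂ) * g v)
        (g' := fun v => -(2 * ε) * ((reg ε v : ℂ) * (v j * g v)) + reg ε v * g' v)
        (v := Pi.single j 1) (by simp)
        (by simpa using ((i3 ε hε).const_mul (-(2 * (ε : ℂ)))).fun_add (i2 ε hε)) (by simpa using i1 ε hε)
        (fun x _ => hasDerivAt_const _ _) (fun x _ => hd x)
      simp only [ContinuousLinearMap.mul_apply', one_mul, zero_mul, integral_zero, neg_zero] at h0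
      rw [integral_add ((i3 ε hε).const_mul _) (i2 ε hε), integral_const_mul] at h0
      linear_combination h0
    refine ⟨i2, ?_⟩
    have ht : Tendsto (fun ε : ℝ => 2 * (ε : ℂ) * ∫ v, (reg ε v : ℂ) * (v j * g v)) (𝓝[>] 0)
        (𝓝 (2 * ((0 : ℝ) : ℂ) * L)) :=
      (((continuous_ofReal.tendsto 0).mono_left nhdsWithin_le_nhds).const_mul 2).mul hL
    have h3 := ht.const_mul (((2 * π * ħ : ℝ) : ℂ)⁻¹ ^ n)
    rw [ofReal_zero, mul_zero, zero_mul, mul_zero] at h3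
    rw [map_zero]
    refine h3.congr' ?_
    filter_upwards [self_mem_nhdsWithin] with ε hε
    rw [key ε hε]
  · have h0 : ∀ v, l (berezin ħ m (F' v)) = 0 := fun v => by rw [h v, berezin_oddDeriv, map_zero]
    simp [h0]

end Existence

theorem sg_add_right (i j k : ZMod 2) : sg i (j + k) = sg i j * sg i k := by
  have : ∀ i j k : ZMod 2, sgZ i (j + k) = sgZ i j * sgZ i k := by decide
  rw [sg, this]
  push_cast
  rfl

section Coordinates

variable {σ : Type} {n m : ℕ}

/-- The coordinate functions on `T*V`. -/
noncomputable def cv (v : 𝕋 n) :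
    (Fin n ⊕ Fin n) ⊕ (Fin m ⊕ Fin m) → Λ (σ ⧺ m)
  | .inl j => algebraMap ℂ _ (v j : ℂ)
  | .inr j => gen (.inr j)

theorem cv_mem_polyFun (c : (Fin n ⊕ Fin n) ⊕ (Fin m ⊕ Fin m)) :
    (fun v => cv (σ := σ) v c) ∈ polyFun (Fin n ⊕ Fin n) (Λ (σ ⧺ m)) := by
  rcases c with j | j
  · simpa [cv, Algebra.algebraMap_eq_smul_one] using
      coord_smul_mem_polyFun j (1 : Λ (σ ⧺ m))
  · exact const_mem_polyFun _

theorem cv_mem_parity (v : 𝕋 n) (c : (Fin n ⊕ Fin n) ⊕ (Fin m ⊕ Fin m)) :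
    cv (σ := σ) v c ∈ parityPart _ (par c) := by
  rcases c with j | j
  · exact algebraMap_even _
  · exact gen_odd _

theorem PD_cv [Finite σ] (k c : (Fin n ⊕ Fin n) ⊕ (Fin m ⊕ Fin m)) :
    PD k (fun v => cv (σ := σ) v c) (fun _ => if c = k then 1 else 0) := by
  classical
  rcases k with j | j <;> rcases c with c | c
  · intro v l
    have h : HasDerivAt (fun t : ℝ => ((v c + t * (Pi.single j 1 : 𝕋 n) c : ℝ) : ℂ))
        (((Pi.single j 1 : 𝕋 n) c : ℝ) : ℂ) 0 := by
      have := (((hasDerivAt_id (0 : ℝ)).mul_const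
        ((Pi.single j 1 : 𝕋 n) c)).const_add (v c)).ofReal_comp
      simpa using this
    have h2 := h.mul_const (l 1)
    convert! h2 using 1
    · funext t
      simp [cv, Algebra.algebraMap_eq_smul_one]
    · by_cases hc : c = j
      · subst hc; simp
      · simp [hc]
  · intro v
    simp only [reduceCtorEq, if_false]
    exact HasD.const (gen (inr c : σ ⧺ m))
  · intro v
    simp [cv]
  · intro v
    simp only [cv]
    rw [oddDeriv_gen]
    simp

end Coordinates

/-- Data of a Gaussian superintegral over `T*V`: matrices of the quadratic form `½ y y T + ½ S q q - y q`
with an inverse of `1 - T S`, and the position of the critical point. -/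
structure GaussData (σ : Type) (V : SuperSpace) where
  T : Matrix V.Idx V.Idx (Λ σ)
  S : Matrix V.Idx V.Idx (Λ σ)
  N : Matrix V.Idx V.Idx (Λ σ)
  ys : V.Idx → Λ σ
  qs : V.Idx → Λ σ
  T_in : MatIn (realParity σ) T
  S_in : MatIn (realParity σ) S
  st_T : st T = T
  st_S : st S = S
  left : N * (1 - T * Sg σ V * S) = 1
  right : (1 - T * Sg σ V * S) * N = 1
  ys_point : IsPoint ys
  qs_point : IsPoint qs
  ys_real : ∀ i, ∃ r : ℝ, body (ys (.inl i)) = r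
  qs_real : ∀ i, ∃ r : ℝ, body (qs (.inl i)) = r

namespace GaussData

variable {σ : Type} {V : SuperSpace} (D : GaussData σ V)

/-- The index of a position coordinate on `T*V`. -/
def yk (V : SuperSpace) : V.Idx → (Fin V.even ⊕ Fin V.even) ⊕ (Fin V.odd ⊕ Fin V.odd) :=
  Sum.map .inl .inl

/-- The index of a momentum coordinate on `T*V`. -/
def qk (V : SuperSpace) : V.Idx → (Fin V.even ⊕ Fin V.even) ⊕ (Fin V.odd ⊕ Fin V.odd) :=
  Sum.map .inr .inr

theorem par_yk (i : V.Idx) : par (yk V i) = par i := by rcases i with i | i <;> rfl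

theorem par_qk (i : V.Idx) : par (qk V i) = par i := by rcases i with i | i <;> rfl

theorem yk_inj {a i : V.Idx} : yk V a = yk V i ↔ a = i :=
  (Sum.map_injective.2 ⟨Sum.inl_injective, Sum.inl_injective⟩).eq_iff

theorem qk_inj {a i : V.Idx} : qk V a = qk V i ↔ a = i :=
  (Sum.map_injective.2 ⟨Sum.inr_injective, Sum.inr_injective⟩).eq_iff

theorem yk_ne_qk (a i : V.Idx) : yk V a ≠ qk V i := by
  rcases a with a | a <;> rcases i with i | i <;> simp [yk, qk]

/-- The position relative to the critical point. -/
noncomputable def Y (v : 𝕋 V.even) :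
    V.Idx → Λ (σ ⧺ V.odd) :=
  fun a => cv v (yk V a) + genMap inl (-D.ys a)

/-- The momentum relative to the critical point. -/
noncomputable def Q (v : 𝕋 V.even) :
    V.Idx → Λ (σ ⧺ V.odd) :=
  fun a => cv v (qk V a) + genMap inl (-D.qs a)

/-- The matrix `T` over the algebra of the integrand. -/
noncomputable abbrev T' : Matrix V.Idx V.Idx (Λ (σ ⧺ V.odd)) :=
  mmap inl D.T

/-- The matrix `S` over the algebra of the integrand. -/
noncomputable abbrev S' : Matrix V.Idx V.Idx (Λ (σ ⧺ V.odd)) :=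
  mmap inl D.S

/-- The quadratic form `½ y y T + ½ S q q - y q`. -/
noncomputable def E (v : 𝕋 V.even) : Λ (σ ⧺ V.odd) :=
  (1 / 2 : ℂ) • (D.Y v ⬝ᵥ (D.Y v ᵥ* D.T')) + (1 / 2 : ℂ) • ((D.S' *ᵥ D.Q v) ⬝ᵥ D.Q v) +
    (-1 : ℂ) • (D.Y v ⬝ᵥ D.Q v)

theorem Y_point (v) : VecIn (parityR (σ ⧺ V.odd)) (D.Y v) := fun a =>
  add_mem (par_yk a ▸ cv_mem_parity v (yk V a))
    (genMap_mem_parity _ (neg_mem (D.ys_point a)))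

theorem Q_point (v) : VecIn (parityR (σ ⧺ V.odd)) (D.Q v) := fun a =>
  add_mem (par_qk a ▸ cv_mem_parity v (qk V a))
    (genMap_mem_parity _ (neg_mem (D.qs_point a)))

theorem T'_in : MatIn (parityR (σ ⧺ V.odd)) D.T' := (MatIn.of_real D.T_in).mmap _

theorem S'_in : MatIn (parityR (σ ⧺ V.odd)) D.S' := (MatIn.of_real D.S_in).mmap _

theorem st_T' : st D.T' = D.T' := by rw [← mmap_st, D.st_T]

theorem st_S' : st D.S' = D.S' := by rw [← mmap_st, D.st_S]

theorem vecMul_T' (v) : D.Y v ᵥ* D.T' = (D.T' * Sg _ V) *ᵥ D.Y v := by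
  rw [vecMul_eq D.T'_in (D.Y_point v), D.st_T']

theorem E_even (v) : D.E v ∈ parityPart _ 0 := by
  have h : VecIn (parityR (σ ⧺ V.odd)) (D.Y v ᵥ* D.T') := by
    rw [D.vecMul_T']
    exact (D.T'_in.mul MatIn.sgm).mulVec (D.Y_point v)
  exact add_mem (Submodule.add_mem _
    (smul_mem _ _ (dotProduct_even (D.Y_point v) h))
    (smul_mem _ _ (dotProduct_even (D.S'_in.mulVec (D.Q_point v)) (D.Q_point v))))
    (smul_mem _ _ (dotProduct_even (D.Y_point v) (D.Q_point v)))

theorem Y_poly (a : V.Idx) : (fun v => D.Y v a) ∈ polyFun _ _ :=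
  add_mem (cv_mem_polyFun _) (const_mem_polyFun _)

theorem Q_poly (a : V.Idx) : (fun v => D.Q v a) ∈ polyFun _ _ :=
  add_mem (cv_mem_polyFun _) (const_mem_polyFun _)

theorem vecMul_poly (a : V.Idx) : (fun v => (D.Y v ᵥ* D.T') a) ∈ polyFun _ _ :=
  sum_mem_polyFun univ (f := fun b v => D.Y v b * D.T' b a) fun b _ =>
    mul_mem_polyFun (D.Y_poly b) (const_mem_polyFun _)

theorem mulVec_poly (a : V.Idx) : (fun v => (D.S' *ᵥ D.Q v) a) ∈ polyFun _ _ :=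
  sum_mem_polyFun univ (f := fun b v => D.S' a b * D.Q v b) fun b _ =>
    mul_mem_polyFun (const_mem_polyFun _) (D.Q_poly b)

theorem E_poly : D.E ∈ polyFun _ _ :=
  add_mem (Submodule.add_mem _
    (smul_mem _ _ (sum_mem_polyFun _ fun a _ => mul_mem_polyFun (D.Y_poly a) (D.vecMul_poly a)))
    (smul_mem _ _ (sum_mem_polyFun _ fun a _ => mul_mem_polyFun (D.mulVec_poly a) (D.Q_poly a))))
    (smul_mem _ _ (sum_mem_polyFun _ fun a _ => mul_mem_polyFun (D.Y_poly a) (D.Q_poly a)))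

section PartialDerivatives

variable [Finite σ] (i a : V.Idx)

theorem PD_Y_y : PD (yk V i) (fun v => D.Y v a) (fun _ => if a = i then 1 else 0) :=
  ((PD_cv (yk V i) (yk V a)).add (PD.const _)).congr (fun _ => rfl) fun _ => by
    simp only [yk_inj, add_zero]

theorem PD_Q_y : PD (yk V i) (fun v => D.Q v a) (fun _ => 0) :=
  ((PD_cv (yk V i) (qk V a)).add (PD.const _)).congr (fun _ => rfl) fun _ => by
    simp only [(yk_ne_qk i a).symm, if_false, add_zero]

theorem PD_Y_q : PD (qk V i) (fun v => D.Y v a) (fun _ => 0) :=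
  ((PD_cv (qk V i) (yk V a)).add (PD.const _)).congr (fun _ => rfl) fun _ => by
    simp only [yk_ne_qk a i, if_false, add_zero]

theorem PD_Q_q : PD (qk V i) (fun v => D.Q v a) (fun _ => if a = i then 1 else 0) :=
  ((PD_cv (qk V i) (qk V a)).add (PD.const _)).congr (fun _ => rfl) fun _ => by
    simp only [qk_inj, add_zero]

theorem PD_E_y : PD (yk V i) D.E (fun v => (D.Y v ᵥ* D.T') i - D.Q v i) := by
  have h1 : ∀ a, PD (yk V i) (fun v => (D.Y v ᵥ* D.T') a) (fun _ => D.T' i a) := fun a =>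
    (PD.sum univ fun b _ => (D.PD_Y_y i b).mul (PD.const (D.T b a))).congr (fun _ => rfl)
      fun _ => by simp [mmap]
  have h2 : ∀ a, PD (yk V i) (fun v => (D.S' *ᵥ D.Q v) a) (fun _ => 0) := fun a =>
    (PD.sum univ fun b _ => (PD.const (D.S a b)).mul (D.PD_Q_y i b)).congr (fun _ => rfl)
      fun _ => by simp
  have h3 := PD.sum univ fun a _ => (D.PD_Y_y i a).mul (h1 a)
  have h4 := PD.sum univ fun a _ => (h2 a).mul (D.PD_Q_y i a)
  have h5 := PD.sum univ fun a _ => (D.PD_Y_y i a).mul (D.PD_Q_y i a)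
  refine (((h3.smul (1 / 2)).add (h4.smul (1 / 2))).add (h5.smul (-1))).congr (fun _ => rfl)
    fun v => ?_
  have h6 : ∑ a, tw (yk V i) (D.Y v a) * D.T' i a = (D.Y v ᵥ* D.T') i := by
    refine sum_congr rfl fun a _ => ?_
    have e : D.T' i a = sg (par i) (par a) • D.T' a i := by
      conv_lhs => rw [← D.st_T']
      rw [st, of_apply]
    rw [tw_eq _ (D.Y_point v a), par_yk, e, smul_mul_smul_comm, sg_mul_self, one_smul]
  simp only [sum_add_distrib, h6, ite_mul, one_mul, zero_mul, Finset.sum_ite_eq',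
    mem_univ, if_true, mul_zero, sum_const_zero, add_zero, smul_zero, ← two_smul ℂ
    ((D.Y v ᵥ* D.T') i), smul_smul, neg_smul, one_smul]
  norm_num
  rw [sub_eq_add_neg]

theorem PD_E_q : PD (qk V i) D.E (fun v => sgn i • ((D.S' *ᵥ D.Q v) i - D.Y v i)) := by
  have h1 : ∀ a, PD (qk V i) (fun v => (D.Y v ᵥ* D.T') a) (fun _ => 0) := fun a =>
    (PD.sum univ fun b _ => (D.PD_Y_q i b).mul (PD.const (D.T b a))).congr (fun _ => rfl)
      fun _ => by simp
  have h2 : ∀ a, PD (qk V i) (fun v => (D.S' *ᵥ D.Q v) a) (fun _ => tw (qk V i) (D.S' a i)) :=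
    fun a => (PD.sum univ fun b _ => (PD.const (D.S a b)).mul (D.PD_Q_q i b)).congr
      (fun _ => rfl) fun _ => by simp [mmap]
  have h3 := PD.sum univ fun a _ => (D.PD_Y_q i a).mul (h1 a)
  have h4 := PD.sum univ fun a _ => (h2 a).mul (D.PD_Q_q i a)
  have h5 := PD.sum univ fun a _ => (D.PD_Y_q i a).mul (D.PD_Q_q i a)
  refine (((h3.smul (1 / 2)).add (h4.smul (1 / 2))).add (h5.smul (-1))).congr (fun _ => rfl)
    fun v => ?_
  have h6 : ∑ a, tw (qk V i) (D.S' a i) * D.Q v a = sgn i • (D.S' *ᵥ D.Q v) i := by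
    rw [mulVec, dotProduct, smul_sum]
    refine sum_congr rfl fun a _ => ?_
    have e : D.S' a i = sg (par a) (par i) • D.S' i a := by
      conv_lhs => rw [← D.st_S']
      rw [st, of_apply]
    rw [tw_eq _ (D.S'_in a i), par_qk, e, smul_smul, smul_mul_assoc, sg_add_right, sgn_eq_sg,
      mul_right_comm, sg_symm (par a), sg_mul_self, one_mul]
  have h7 : tw (qk V i) ((D.S' *ᵥ D.Q v) i) = sgn i • (D.S' *ᵥ D.Q v) i := by
    rw [tw_eq _ (D.S'_in.mulVec (D.Q_point v) i), par_qk, sgn_eq_sg]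
  have h8 : tw (qk V i) (D.Y v i) = sgn i • D.Y v i := by
    rw [tw_eq _ (D.Y_point v i), par_qk, sgn_eq_sg]
  simp only [sum_add_distrib, h6, mul_ite, mul_one, zero_mul, Finset.sum_ite_eq',
    mem_univ, if_true, mul_zero, sum_const_zero, zero_add, smul_zero, h7, h8,
    ← two_smul ℂ (sgn i • (D.S' *ᵥ D.Q v) i), smul_smul, smul_sub]
  rw [show (1 / 2 * (2 * sgn i) : ℂ) = sgn i by ring, neg_mul, one_mul, neg_smul, sub_eq_add_neg]

end PartialDerivatives

end GaussData

section

variable {ħ : ℝ} {σ : Type} {n m : ℕ}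
  {f g : (Fin n → ℝ) → (Fin n → ℝ) → Λ (σ ⧺ m)} {J : Λ σ}

theorem HasSuperIntegral.congr (h : HasSuperIntegral ħ n m f J) (e : ∀ y q, f y q = g y q) :
    HasSuperIntegral ħ n m g J := by
  rw [← funext fun y => funext fun q => e y q]
  exact h

theorem HasSuperIntegral.mem_parity (h : HasSuperIntegral ħ n m f J) {p : ZMod 2}
    (hp : ∀ y q, f y q ∈ parityPart _ p) : J ∈ parityPart σ p := by
  rcases zmod_two_cases p with rfl | rfl
  · exact even_iff.2 ((h.map inv.toLinearMap fun y q => by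
      conv_lhs => rw [← inv_of_even (hp y q), berezin_inv]
      rfl).unique h)
  · have h1 : HasSuperIntegral ħ n m f (-inv J) := h.map (-inv.toLinearMap) fun y q => by
      have := inv_of_odd (hp y q)
      rw [LinearMap.neg_apply, AlgHom.toLinearMap_apply, ← berezin_inv, this, map_neg, neg_neg]
    rw [odd_iff, eq_neg_iff_add_eq_zero, ← eq_neg_iff_add_eq_zero, eq_comm, neg_eq_iff_eq_neg]
    exact (h1.unique h).symm

end

namespace GaussData

open Complex

variable {σ : Type} {V : SuperSpace} (D : GaussData σ V)

/-- The matrix of `1 - T S`. -/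
noncomputable abbrev M : Matrix V.Idx V.Idx (Λ σ) := 1 - D.T * Sg σ V * D.S

theorem T_par : MatIn (parityR σ) D.T := MatIn.of_real D.T_in

theorem S_par : MatIn (parityR σ) D.S := MatIn.of_real D.S_in

theorem M_in : MatIn (realParity σ) D.M := MatIn.one.sub ((D.T_in.mul MatIn.sgm).mul D.S_in)

theorem M_par : MatIn (parityR σ) D.M := MatIn.of_real D.M_in

/-- The body of the even-even block. -/
noncomputable def blockE (X : Matrix V.Idx V.Idx (Λ σ)) :
    Matrix (Fin V.even) (Fin V.even) ℝ := of fun i j => (body (X (.inl i) (.inl j))).re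

/-- The body of the odd-odd block. -/
noncomputable def blockO (X : Matrix V.Idx V.Idx (Λ σ)) :
    Matrix (Fin V.odd) (Fin V.odd) ℝ := of fun i j => (body (X (.inr i) (.inr j))).re

theorem blockE_coe {X : Matrix V.Idx V.Idx (Λ σ)} (h : MatIn (realParity σ) X) (i j) :
    body (X (.inl i) (.inl j)) = (blockE X i j : ℂ) := by
  obtain ⟨r, hr⟩ := body_real (h (.inl i) (.inl j)).2
  rw [blockE, of_apply, hr, ofReal_re]

theorem blockO_coe {X : Matrix V.Idx V.Idx (Λ σ)} (h : MatIn (realParity σ) X) (i j) :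
    body (X (.inr i) (.inr j)) = (blockO X i j : ℂ) := by
  obtain ⟨r, hr⟩ := body_real (h (.inr i) (.inr j)).2
  rw [blockO, of_apply, hr, ofReal_re]

theorem body_eo {X : Matrix V.Idx V.Idx (Λ σ)} (h : MatIn (realParity σ) X) (i j) :
    body (X (.inl i) (.inr j)) = 0 := body_odd (h (.inl i) (.inr j)).1

theorem body_oe {X : Matrix V.Idx V.Idx (Λ σ)} (h : MatIn (realParity σ) X) (i j) :
    body (X (.inr i) (.inl j)) = 0 := body_odd (h (.inr i) (.inl j)).1

theorem mul_Sg_mul_apply (X Y : Matrix V.Idx V.Idx (Λ σ)) (i j) :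
    (X * Sg σ V * Y) i j = ∑ k, sgn k • (X i k * Y k j) :=
  (congrFun (congrFun (tsMatrix_eq X Y) i) j).symm

theorem body_M₁₁ : D.M.toBlocks₁₁.map body = (1 - blockE D.T * blockE D.S).map ofReal := by
  ext i j
  change body ((1 : Matrix V.Idx V.Idx (Λ σ)) (.inl i) (.inl j) - (D.T * Sg σ V * D.S) (.inl i) (.inl j)) = _
  rw [mul_Sg_mul_apply, map_sub, map_sum, Fintype.sum_sum_type]
  simp only [map_smul, map_mul, sgn, elim_inl, elim_inr, one_smul, body_eo D.T_in, zero_mul,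
    smul_zero, sum_const_zero, add_zero, blockE_coe D.T_in, blockE_coe D.S_in, map_apply,
    Matrix.sub_apply, mul_apply, one_apply, Sum.inl.injEq]
  split_ifs <;> simp

theorem body_M₂₂ : D.M.toBlocks₂₂.map body = (1 + blockO D.T * blockO D.S).map ofReal := by
  ext i j
  change body ((1 : Matrix V.Idx V.Idx (Λ σ)) (.inr i) (.inr j) - (D.T * Sg σ V * D.S) (.inr i) (.inr j)) = _
  rw [mul_Sg_mul_apply, map_sub, map_sum, Fintype.sum_sum_type]
  simp only [map_mul, sgn, elim_inl, elim_inr, body_oe D.T_in, zero_mul,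
    sum_const_zero, zero_add, blockO_coe D.T_in, blockO_coe D.S_in, map_apply,
    Matrix.add_apply, mul_apply, one_apply, Sum.inr.injEq, neg_smul, one_smul, map_neg,
    sum_neg_distrib, sub_neg_eq_add]
  split_ifs <;> simp

theorem det_ofReal {ι : Type} [Fintype ι] [DecidableEq ι] (X : Matrix ι ι ℝ) :
    (X.map ofReal).det = (X.det : ℂ) := (RingHom.map_det ofRealHom X).symm

theorem det_blockE_ne_zero : (1 - blockE D.T * blockE D.S).det ≠ 0 := by
  have := (det_body_ne_zero D.M_par D.left).1
  rw [D.body_M₁₁, det_ofReal] at this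
  exact ofReal_ne_zero.1 this

theorem det_blockO_ne_zero : (1 + blockO D.T * blockO D.S).det ≠ 0 := by
  have := (det_body_ne_zero D.M_par D.left).2
  rw [D.body_M₂₂, det_ofReal] at this
  exact ofReal_ne_zero.1 this

theorem blockE_symm {X : Matrix V.Idx V.Idx (Λ σ)} (h : st X = X) :
    (blockE X)ᵀ = blockE X := by
  ext i j
  rw [transpose_apply, blockE, of_apply, of_apply]
  conv_lhs => rw [← h]
  simp [st, par, sg, sgZ]

/-- The body of the position of the critical point. -/
noncomputable def center : 𝕋 V.even :=
  elim (fun i => (body (D.ys (.inl i))).re) fun i => (body (D.qs (.inl i))).re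

theorem body_Y_inl (v) (i : Fin V.even) : body (D.Y v (.inl i)) = ((v - D.center) (.inl i) : ℝ) := by
  obtain ⟨r, hr⟩ := D.ys_real i
  simp [Y, yk, cv, center, hr, sub_eq_add_neg]

theorem body_Q_inl (v) (i : Fin V.even) : body (D.Q v (.inl i)) = ((v - D.center) (.inr i) : ℝ) := by
  obtain ⟨r, hr⟩ := D.qs_real i
  simp [Q, qk, cv, center, hr, sub_eq_add_neg]

theorem body_Y_inr (v) (i : Fin V.odd) : body (D.Y v (.inr i)) = 0 := body_odd (D.Y_point v (.inr i))

theorem body_Q_inr (v) (i : Fin V.odd) : body (D.Q v (.inr i)) = 0 := body_odd (D.Q_point v (.inr i))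

theorem body_E (v) :
    body (D.E v) = (phase (hess (blockE D.T) (blockE D.S)) 0 (v - D.center) : ℝ) := by
  have hT : ∀ i j, body (D.T' (.inl i) (.inl j)) = (blockE D.T i j : ℂ) := fun i j => by
    rw [← blockE_coe D.T_in]; exact body_genMap _ _
  have hS : ∀ i j, body (D.S' (.inl i) (.inl j)) = (blockE D.S i j : ℂ) := fun i j => by
    rw [← blockE_coe D.S_in]; exact body_genMap _ _
  have hsT := fun i j => congrFun (congrFun (blockE_symm D.st_T) i) j
  simp only [transpose_apply] at hsT
  rw [E]
  simp only [map_add, map_smul, dotProduct, map_sum, map_mul, Fintype.sum_sum_type, D.body_Y_inl,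
    D.body_Q_inl, D.body_Y_inr, D.body_Q_inr, zero_mul, mul_zero, sum_const_zero, add_zero,
    vecMul, mulVec, hT, hS, phase, hess, fromBlocks_apply₁₁, fromBlocks_apply₁₂, fromBlocks_apply₂₁,
    fromBlocks_apply₂₂, Pi.zero_apply, Matrix.neg_apply, one_apply]
  generalize v - D.center = w
  have e1 : ∑ x, ((w (.inl x) : ℝ) : ℂ) * ∑ y, (w (.inl y) : ℂ) * (blockE D.T y x : ℂ) =
      ∑ x, (w (.inl x) : ℂ) * ∑ y, (blockE D.T x y : ℂ) * (w (.inl y) : ℂ) :=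
    sum_congr rfl fun x _ => by
      congr 1
      exact sum_congr rfl fun y _ => by rw [mul_comm, hsT]
  have e2 : ∑ x, (∑ y, (blockE D.S x y : ℂ) * (w (.inr y) : ℂ)) * ((w (.inr x) : ℝ) : ℂ) =
      ∑ x, (w (.inr x) : ℂ) * ∑ y, (blockE D.S x y : ℂ) * (w (.inr y) : ℂ) :=
    sum_congr rfl fun x _ => mul_comm _ _
  have e3 : ∑ x, (w (.inr x) : ℂ) * ((w (.inl x) : ℝ) : ℂ) =
      ∑ x, (w (.inl x) : ℂ) * (w (.inr x) : ℂ) := sum_congr rfl fun x _ => mul_comm _ _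
  rw [e1, e2]
  simp only [neg_mul, ite_mul, one_mul, zero_mul, sum_neg_distrib, Finset.sum_ite_eq,
    mem_univ, if_true, mul_add, mul_neg, sum_add_distrib, smul_eq_mul]
  push_cast
  rw [e3]
  ring

/-- The oscillating Gaussian. -/
noncomputable def g (ħ : ℝ) (v : 𝕋 V.even) :
    Λ (σ ⧺ V.odd) := gexp ((I / ħ) • D.E v)

theorem g_even (ħ : ℝ) (v) : D.g ħ v ∈ parityPart _ 0 := gexp_even (smul_mem _ _ (D.E_even v))

/-- The real Hessian of the exponent. -/
noncomputable abbrev H (ħ : ℝ) : Matrix (Fin V.even ⊕ Fin V.even) (Fin V.even ⊕ Fin V.even) ℝ :=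
  ħ⁻¹ • hess (blockE D.T) (blockE D.S)

theorem H_symm (ħ : ℝ) : (D.H ħ)ᵀ = D.H ħ := by
  rw [transpose_smul, hess_transpose (blockE_symm D.st_T) (blockE_symm D.st_S)]

theorem H_det {ħ : ℝ} (hħ : 0 < ħ) : (D.H ħ).det ≠ 0 := by
  rw [det_smul, det_hess]
  exact mul_ne_zero (pow_ne_zero _ (inv_ne_zero hħ.ne'))
    (mul_ne_zero (pow_ne_zero _ (by norm_num)) D.det_blockE_ne_zero)

theorem body_smul_E (ħ : ℝ) (v) :
    body ((I / ħ : ℂ) • D.E v) = I * phase (D.H ħ) 0 (v - D.center) := by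
  rw [map_smul, D.body_E, phase, phase, smul_mulVec, dotProduct_smul]
  simp
  ring

theorem isOsc_g [Finite σ] (ħ : ℝ) :
    IsOsc (D.H ħ) (-(D.H ħ *ᵥ D.center)) (D.g ħ) :=
  isOsc_gexp (smul_mem _ _ D.E_poly) (fun v => smul_mem _ _ (D.E_even v))
    (c := I * phase (D.H ħ) 0 D.center) fun v => by
      rw [D.body_smul_E, phase_sub (D.H_symm ħ)]
      push_cast
      ring

/-- Superintegrals over `T*V`, as functions of a single real vector variable. -/
abbrev SInt (ħ : ℝ) (V : SuperSpace)
    (F : 𝕋 V.even → Λ (σ ⧺ V.odd))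
    (J : Λ σ) : Prop :=
  HasSuperIntegral ħ V.even V.odd (fun y q => F (elim y q)) J

section Wick

variable [Finite σ] {ħ : ℝ} (hħ : 0 < ħ) {i : V.Idx}
  {R R' : 𝕋 V.even → Λ (σ ⧺ V.odd)}
  {η ξ : V.Idx → Λ σ} {ρ : Λ σ}

include hħ in
theorem exists_SInt {F : 𝕋 V.even → Λ (σ ⧺ V.odd)}
    (hF : IsOsc (D.H ħ) (-(D.H ħ *ᵥ D.center)) F) : ∃ J, SInt ħ V F J :=
  hF.exists_integral (D.H_symm ħ) (D.H_det hħ)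

include hħ in
theorem ibp {k : (Fin V.even ⊕ Fin V.even) ⊕ (Fin V.odd ⊕ Fin V.odd)}
    {A : 𝕋 V.even → Λ (σ ⧺ V.odd)} {α : Λ σ}
    (hE : PD k D.E A) (hR : PD k R R') (pA : A ∈ polyFun _ _) (pR : R ∈ polyFun _ _)
    (pR' : R' ∈ polyFun _ _) (hα : SInt ħ V (fun v => A v * (D.g ħ v * R v)) α)
    (hρ : SInt ħ V (fun v => D.g ħ v * R' v) ρ) : α = -(I / ħ : ℂ)⁻¹ • ρ := by
  have hg := D.isOsc_g ħ
  have h1 : PD k (fun v => D.g ħ v * R v)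
      (fun v => (I / ħ : ℂ) • (A v * (D.g ħ v * R v)) + D.g ħ v * R' v) :=
    (((hE.smul (I / ħ)).gexp fun v => smul_mem _ _ (D.E_even v)).mul hR).congr
      (fun _ => rfl) fun v => by
        have h0 : tw k (gexp ((I / ħ : ℂ) • D.E v)) = D.g ħ v := by
          change tw k (D.g ħ v) = D.g ħ v
          rw [tw_eq k (D.g_even ħ v)]
          simp [sg, sgZ]
        rw [h0, smul_mul_assoc, smul_mul_assoc, mul_assoc]
        rfl
  have o1 := hg.mul_right pR
  have o2 := (o1.mul_left pA).map ((I / ħ : ℂ) • LinearMap.id)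
  have h2 := h1.integral_eq_zero (ħ := ħ) (D.H_symm ħ) (D.H_det hħ) o1 (o2.add (hg.mul_right pR'))
  have h3 := ((hα.smul (I / ħ : ℂ)).add hρ).unique h2
  have hI : (I / ħ : ℂ) ≠ 0 := div_ne_zero I_ne_zero (ofReal_ne_zero.2 hħ.ne')
  have h4 := congrArg ((I / ħ : ℂ)⁻¹ • ·) h3
  simp only [smul_add, smul_smul, inv_mul_cancel₀ hI, one_smul, smul_zero] at h4
  rw [neg_smul]
  exact eq_neg_of_add_eq_zero_left h4

include hħ in
theorem wick_y (hR : PD (yk V i) R R') (pR : R ∈ polyFun _ _) (pR' : R' ∈ polyFun _ _)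
    (hη : ∀ a, SInt ħ V (fun v => D.Y v a * (D.g ħ v * R v)) (η a))
    (hξ : ∀ a, SInt ħ V (fun v => D.Q v a * (D.g ħ v * R v)) (ξ a))
    (hρ : SInt ħ V (fun v => D.g ħ v * R' v) ρ) :
    ((D.T * Sg σ V) *ᵥ η) i - ξ i = -(I / ħ : ℂ)⁻¹ • ρ := by
  have h0 : SInt ħ V (fun v => ((D.Y v ᵥ* D.T') i - D.Q v i) * (D.g ħ v * R v))
      (((D.T * Sg σ V) *ᵥ η) i - ξ i) := by
    have h := (HasSuperIntegral.sum univ fun a _ =>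
      (hη a).mul_left ((D.T * Sg σ V) i a)).add ((hξ i).smul (-1))
    have e : ∑ a, (D.T * Sg σ V) i a * η a + (-1 : ℂ) • ξ i = ((D.T * Sg σ V) *ᵥ η) i - ξ i := by
      rw [neg_one_smul, ← sub_eq_add_neg]; rfl
    rw [e] at h
    refine h.congr fun y q => ?_
    beta_reduce
    rw [vecMul_T', sub_mul, mulVec, dotProduct, sum_mul, sub_eq_add_neg, neg_one_smul]
    congr 1
    refine sum_congr rfl fun a _ => ?_
    rw [← mul_assoc (genMap _ _)]
    congr 2
    have e' : mmap inl (D.T * Sg σ V) = D.T' * Sg _ V := by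
      rw [mmap_mul, mmap_sgm]
    exact congrFun (congrFun e' i) a
  exact D.ibp hħ (D.PD_E_y i) hR (sub_mem (D.vecMul_poly i) (D.Q_poly i)) pR pR' h0 hρ

include hħ in
theorem wick_q (hR : PD (qk V i) R R') (pR : R ∈ polyFun _ _) (pR' : R' ∈ polyFun _ _)
    (hη : ∀ a, SInt ħ V (fun v => D.Y v a * (D.g ħ v * R v)) (η a))
    (hξ : ∀ a, SInt ħ V (fun v => D.Q v a * (D.g ħ v * R v)) (ξ a))
    (hρ : SInt ħ V (fun v => D.g ħ v * R' v) ρ) :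
    sgn i • ((D.S *ᵥ ξ) i - η i) = -(I / ħ : ℂ)⁻¹ • ρ := by
  have h0 : SInt ħ V (fun v => (sgn i • ((D.S' *ᵥ D.Q v) i - D.Y v i)) * (D.g ħ v * R v))
      (sgn i • ((D.S *ᵥ ξ) i - η i)) := by
    have h := ((HasSuperIntegral.sum univ fun a _ => (hξ a).mul_left (D.S i a)).add
      ((hη i).smul (-1))).smul (sgn i)
    have e : ∑ a, D.S i a * ξ a + (-1 : ℂ) • η i = (D.S *ᵥ ξ) i - η i := by
      rw [neg_one_smul, ← sub_eq_add_neg]; rfl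
    rw [e] at h
    refine h.congr fun y q => ?_
    beta_reduce
    rw [smul_mul_assoc, sub_mul, mulVec, dotProduct, sum_mul, sub_eq_add_neg, neg_one_smul]
    congr 2
    exact sum_congr rfl fun a _ => (mul_assoc _ _ _).symm
  exact D.ibp hħ (D.PD_E_q i) hR (smul_mem _ _
    (sub_mem (D.mulVec_poly i) (D.Y_poly i))) pR pR' h0 hρ

end Wick

end GaussData

section Supertrace

variable {τ : Type} {α β α' β' : Type} [Fintype α] [Fintype β] [DecidableEq α] [DecidableEq β]
  [Fintype α'] [Fintype β'] [DecidableEq α'] [DecidableEq β']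

theorem supertrace_mul_comm {X : Matrix (α ⊕ β) (α' ⊕ β') (Λ τ)}
    {Y : Matrix (α' ⊕ β') (α ⊕ β) (Λ τ)}
    (hX : MatIn (parityR τ) X) (hY : MatIn (parityR τ) Y) :
    ∑ i, sgn i • (X * Y) i i = ∑ j, sgn j • (Y * X) j j := by
  simp only [mul_apply, smul_sum]
  rw [sum_comm]
  refine sum_congr rfl fun j _ => sum_congr rfl fun i _ => ?_
  have hY' : Y j i ∈ parityPart τ (par i + par j) := add_comm (par j) (par i) ▸ hY j i
  rw [mul_comm_sg (hX i j) hY', smul_smul]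
  congr 1
  have : ∀ i j : ZMod 2, sgZ i i * sgZ (i + j) (i + j) = sgZ j j := by decide
  rw [sgn_eq_sg, sgn_eq_sg, sg, sg, sg]
  exact_mod_cast this _ _

theorem supertrace_sgm_mul (X : Matrix (α ⊕ β) (α ⊕ β) (Λ τ)) :
    ∑ i, sgn i • (sgm τ (α ⊕ β) sgn * X) i i = X.trace := by
  refine sum_congr rfl fun i _ => ?_
  have : (sgm τ (α ⊕ β) sgn * X) i i = sgn i • X i i := by
    simp [sgm, diagonal_mul, Algebra.smul_def]
  rw [this, smul_smul, sgn_mul_self, one_smul, diag_apply]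

end Supertrace

namespace GaussData

open Complex

variable {σ : Type} {V : SuperSpace} (D : GaussData σ V)

section WickFormula

variable [Finite σ] {ħ : ℝ} (hħ : 0 < ħ)

include hħ in
theorem wick {R : 𝕋 V.even → Λ (σ ⧺ V.odd)}
    {A B : V.Idx → 𝕋 V.even → Λ (σ ⧺ V.odd)}
    {α β : V.Idx → Λ σ} (pR : R ∈ polyFun _ _)
    (hA : ∀ i, PD (yk V i) R (A i)) (hB : ∀ i, PD (qk V i) R (B i)) (pA : ∀ i, A i ∈ polyFun _ _)
    (pB : ∀ i, B i ∈ polyFun _ _) (hα : ∀ i, SInt ħ V (fun v => D.g ħ v * A i v) (α i))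
    (hβ : ∀ i, SInt ħ V (fun v => D.g ħ v * B i v) (β i)) (a : V.Idx) :
    SInt ħ V (fun v => D.Q v a * (D.g ħ v * R v))
        ((I / ħ : ℂ)⁻¹ • (D.N *ᵥ (α + D.T *ᵥ β)) a) ∧
      SInt ħ V (fun v => D.Y v a * (D.g ħ v * R v))
        ((I / ħ : ℂ)⁻¹ • ((D.S *ᵥ (D.N *ᵥ (α + D.T *ᵥ β))) a + sgn a • β a)) := by
  have o1 := (D.isOsc_g ħ).mul_right pR
  choose η hη using fun a => D.exists_SInt hħ (o1.mul_left (D.Y_poly a))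
  choose ξ hξ using fun a => D.exists_SInt hħ (o1.mul_left (D.Q_poly a))
  set l := (I / ħ : ℂ)⁻¹
  have e1 : (D.T * Sg σ V) *ᵥ η - ξ = -(l • α) := funext fun i => by
    have h := D.wick_y hħ (hA i) pR (pA i) hη hξ (hα i)
    rwa [neg_smul] at h
  have e2 : η = D.S *ᵥ ξ + l • (Sg σ V *ᵥ β) := funext fun i => by
    have h := congrArg (sgn i • ·) (D.wick_q hħ (hB i) pR (pB i) hη hξ (hβ i))
    simp only [smul_smul, sgn_mul_self, one_smul] at h
    have h2 : (Sg σ V *ᵥ β) i = sgn i • β i := by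
      simp [sgm, mulVec_diagonal, Algebra.smul_def]
    rw [Pi.add_apply, Pi.smul_apply, h2, smul_smul, mul_comm l, ← sub_eq_iff_eq_add', ← neg_sub, h]
    simp [l]
  have e3 : ξ = l • (D.N *ᵥ (α + D.T *ᵥ β)) := by
    have h : D.M *ᵥ ξ = l • (α + D.T *ᵥ β) := by
      rw [e2, mulVec_add, mulVec_smul, mulVec_mulVec, mulVec_mulVec, Matrix.mul_assoc D.T (Sg σ V) (Sg σ V),
        sgm_mul_sgm, Matrix.mul_one] at e1
      rw [M, sub_mulVec, one_mulVec, smul_add, ← neg_inj, neg_sub, neg_add, ← e1]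
      abel
    rw [← one_mulVec ξ, ← D.left, ← mulVec_mulVec, h, mulVec_smul]
  constructor
  · have := hξ a
    rw [e3] at this
    exact this
  · have := hη a
    rw [e2, e3] at this
    have h2 : (Sg σ V *ᵥ β) a = sgn a • β a := by
      simp [sgm, mulVec_diagonal, Algebra.smul_def]
    rw [Pi.add_apply, Pi.smul_apply, h2, mulVec_smul, Pi.smul_apply, ← smul_add] at this
    exact this

variable {z : Λ σ} (hz : SInt ħ V (D.g ħ) z)

include hz hħ

theorem int_Q (a) : SInt ħ V (fun v => D.Q v a * D.g ħ v) 0 := by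
  have h := (D.wick hħ (R := fun _ => genMap inl 1) (A := fun _ _ => 0) (B := fun _ _ => 0)
    (α := 0) (β := 0) (const_mem_polyFun _) (fun _ => PD.const 1) (fun _ => PD.const 1)
    (fun _ => const_mem_polyFun _) (fun _ => const_mem_polyFun _)
    (fun _ => HasSuperIntegral.zero.congr fun _ _ => (mul_zero _).symm)
    (fun _ => HasSuperIntegral.zero.congr fun _ _ => (mul_zero _).symm) a).1
  simp only [mulVec_zero, add_zero, Pi.zero_apply, smul_zero, map_one, mul_one] at h
  exact h

theorem int_Y (a) : SInt ħ V (fun v => D.Y v a * D.g ħ v) 0 := by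
  have h := (D.wick hħ (R := fun _ => genMap inl 1) (A := fun _ _ => 0) (B := fun _ _ => 0)
    (α := 0) (β := 0) (const_mem_polyFun _) (fun _ => PD.const 1) (fun _ => PD.const 1)
    (fun _ => const_mem_polyFun _) (fun _ => const_mem_polyFun _)
    (fun _ => HasSuperIntegral.zero.congr fun _ _ => (mul_zero _).symm)
    (fun _ => HasSuperIntegral.zero.congr fun _ _ => (mul_zero _).symm) a).2
  simp only [mulVec_zero, add_zero, Pi.zero_apply, smul_zero, map_one, mul_one] at h
  exact h

theorem int_ite (a i : V.Idx) : SInt ħ V (fun v => D.g ħ v * if a = i then 1 else 0)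
    (Pi.single (M := fun _ => Λ σ) a z i) := by
  by_cases h : a = i
  · subst h
    simpa using hz
  · have h0 : SInt ħ V (fun v => D.g ħ v * (0 : Λ (σ ⧺ V.odd)))
      (0 : Λ σ) := HasSuperIntegral.zero.congr fun _ _ => (mul_zero _).symm
    simpa [h, Pi.single_eq_of_ne (Ne.symm h)] using h0

theorem int_YY (a b) : SInt ħ V (fun v => D.Y v a * (D.g ħ v * D.Y v b))
    ((I / ħ : ℂ)⁻¹ • ((D.S * D.N) a b * z)) := by
  have h := (D.wick hħ (A := fun i _ => if b = i then 1 else 0) (B := fun _ _ => 0)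
    (α := Pi.single b z) (β := 0) (D.Y_poly b) (fun i => D.PD_Y_y i b) (fun i => D.PD_Y_q i b)
    (fun _ => const_mem_polyFun _) (fun _ => const_mem_polyFun _)
    (D.int_ite hħ hz b)
    (fun _ => HasSuperIntegral.zero.congr fun _ _ => (mul_zero _).symm) a).2
  rw [mulVec_zero, add_zero, Pi.zero_apply, smul_zero, add_zero, mulVec_mulVec, mulVec_single] at h
  exact h

theorem int_QQ (a b) : SInt ħ V (fun v => D.Q v a * (D.g ħ v * D.Q v b))
    ((I / ħ : ℂ)⁻¹ • ((D.N * D.T) a b * z)) := by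
  have h := (D.wick hħ (A := fun _ _ => 0) (B := fun i _ => if b = i then 1 else 0)
    (α := 0) (β := Pi.single b z) (D.Q_poly b) (fun i => D.PD_Q_y i b) (fun i => D.PD_Q_q i b)
    (fun _ => const_mem_polyFun _) (fun _ => const_mem_polyFun _)
    (fun _ => HasSuperIntegral.zero.congr fun _ _ => (mul_zero _).symm)
    (D.int_ite hħ hz b) a).1
  rw [zero_add, mulVec_mulVec, mulVec_single] at h
  exact h

end WickFormula

section Variation

variable [Fintype σ]

/-- The derivation counting the parameters. -/
noncomputable abbrev pdeg (σ : Type) [Fintype σ] (m : ℕ) :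
    Λ (σ ⧺ m) →ₗ[ℂ] Λ (σ ⧺ m) :=
  euler (elim (fun _ => 1) 0)

theorem pdeg_inl {m : ℕ} (x : Λ σ) :
    pdeg σ m (genMap inl x) = genMap inl (deg x) :=
  euler_genMap _ _ _ (fun _ => rfl) x

theorem pdeg_cv {m : ℕ} (v : 𝕋 V.even) (c) :
    pdeg σ m (cv v c) = 0 := by
  rcases c with c | c
  · exact euler_algebraMap _ _
  · rw [cv, euler_gen]
    simp

theorem pdeg_Y (v) (a) : pdeg σ V.odd (D.Y v a) = genMap inl (deg (-D.ys a)) := by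
  rw [Y, map_add, pdeg_cv, zero_add, pdeg_inl]

theorem pdeg_Q (v) (a) : pdeg σ V.odd (D.Q v a) = genMap inl (deg (-D.qs a)) := by
  rw [Q, map_add, pdeg_cv, zero_add, pdeg_inl]

theorem pdeg_dot {ι : Type} [Fintype ι] {m : ℕ} (u w : ι → Λ (σ ⧺ m)) :
    pdeg σ m (u ⬝ᵥ w) = (fun a => pdeg σ m (u a)) ⬝ᵥ w + u ⬝ᵥ fun a => pdeg σ m (w a) := by
  simp only [dotProduct, map_sum, euler_mul, sum_add_distrib]

theorem pdeg_vecMul (v) : (fun a => pdeg σ V.odd ((D.Y v ᵥ* D.T') a)) =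
    vmap inl (fun a => deg (-D.ys a)) ᵥ* D.T' + D.Y v ᵥ* mmap inl (D.T.map deg) := by
  funext a
  rw [vecMul, pdeg_dot, Pi.add_apply]
  congr 1
  · exact congrArg (· ⬝ᵥ _) (funext fun b => D.pdeg_Y v b)
  · exact congrArg (D.Y v ⬝ᵥ ·) (funext fun b => pdeg_inl _)

theorem pdeg_mulVec (v) : (fun a => pdeg σ V.odd ((D.S' *ᵥ D.Q v) a)) =
    mmap inl (D.S.map deg) *ᵥ D.Q v + D.S' *ᵥ vmap inl (fun a => deg (-D.qs a)) := by
  funext a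
  rw [mulVec, pdeg_dot, Pi.add_apply]
  congr 1
  · exact congrArg (· ⬝ᵥ _) (funext fun b => pdeg_inl _)
  · exact congrArg (_ ⬝ᵥ ·) (funext fun b => D.pdeg_Q v b)

theorem pdeg_E (v) : pdeg σ V.odd (D.E v) =
    (1 / 2 : ℂ) • (D.Y v ⬝ᵥ (D.Y v ᵥ* mmap inl (D.T.map deg))) +
    (1 / 2 : ℂ) • ((mmap inl (D.S.map deg) *ᵥ D.Q v) ⬝ᵥ D.Q v) +
    (D.Y v ⬝ᵥ vmap inl (((fun a => deg (-D.ys a)) ᵥ* D.T) - fun a => deg (-D.qs a)) +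
    vmap inl ((D.S *ᵥ fun a => deg (-D.qs a)) - fun a => deg (-D.ys a)) ⬝ᵥ D.Q v) := by
  have hα : VecIn (parityR (σ ⧺ V.odd)) (vmap inl fun a => deg (-D.ys a)) :=
    fun a => genMap_mem_parity _ (euler_mem_parity _ (neg_mem (D.ys_point a)))
  have hβ : VecIn (parityR (σ ⧺ V.odd)) (vmap inl fun a => deg (-D.qs a)) :=
    fun a => genMap_mem_parity _ (euler_mem_parity _ (neg_mem (D.qs_point a)))
  have eα : (fun a => pdeg σ V.odd (D.Y v a)) = vmap inl fun a => deg (-D.ys a) :=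
    funext fun a => D.pdeg_Y v a
  have eβ : (fun a => pdeg σ V.odd (D.Q v a)) = vmap inl fun a => deg (-D.qs a) :=
    funext fun a => D.pdeg_Q v a
  have e1 : vmap (inl (β := Fin V.odd ⊕ Fin V.odd)) (((fun a => deg (-D.ys a)) ᵥ* D.T) - fun a => deg (-D.qs a)) =
      vmap inl (fun a => deg (-D.ys a)) ᵥ* D.T' - vmap inl fun a => deg (-D.qs a) := by
    funext a
    simp [vmap, vecMul, dotProduct, mmap, T', -map_neg]
  have e2 : vmap (inl (β := Fin V.odd ⊕ Fin V.odd)) ((D.S *ᵥ fun a => deg (-D.qs a)) - fun a => deg (-D.ys a)) =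
      D.S' *ᵥ vmap inl (fun a => deg (-D.qs a)) - vmap inl fun a => deg (-D.ys a) := by
    funext a
    simp [vmap, mulVec, dotProduct, mmap, S', -map_neg]
  rw [e1, e2, E, map_add, map_add, map_smul, map_smul, map_smul, pdeg_dot, pdeg_dot, pdeg_dot,
    D.pdeg_vecMul, D.pdeg_mulVec, eα, eβ]
  simp only [dotProduct_add, add_dotProduct, dotProduct_sub, sub_dotProduct]
  rw [dot_symm_lower D.st_T' hα (D.Y_point v), dot_symm_upper D.st_S' hβ (D.Q_point v)]
  module

variable {ħ : ℝ} (hħ : 0 < ħ) {z : Λ σ} (hz : SInt ħ V (D.g ħ) z)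

/-- The logarithmic derivative of the Gaussian integral. -/
noncomputable def dlog : Λ σ :=
  (D.S * D.N * D.T.map deg).trace + (D.S.map deg * (D.N * D.T)).trace

include hz hħ

theorem deg_integral : deg z = (1 / 2 : ℂ) • (D.dlog * z) := by
  have hI : (I / ħ : ℂ) ≠ 0 := div_ne_zero I_ne_zero (ofReal_ne_zero.2 hħ.ne')
  have h1 : SInt ħ V (fun v => pdeg σ V.odd (D.g ħ v)) (deg z) :=
    hz.map deg fun y q => berezin_euler ħ _ _
  have z_even : z ∈ parityPart σ 0 := hz.mem_parity fun y q => D.g_even ħ _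
  have hYY : SInt ħ V (fun v => (D.Y v ⬝ᵥ (D.Y v ᵥ* mmap inl (D.T.map deg))) * D.g ħ v)
      ((I / ħ : ℂ)⁻¹ • ((D.S * D.N * D.T.map deg).trace * z)) := by
    have h := HasSuperIntegral.sum univ fun a _ => HasSuperIntegral.sum univ fun b _ =>
      (D.int_YY hħ hz a b).mul_right (deg (D.T b a))
    have e : ∑ a, ∑ b, (I / ħ : ℂ)⁻¹ • ((D.S * D.N) a b * z) * deg (D.T b a) =
        (I / ħ : ℂ)⁻¹ • ((D.S * D.N * D.T.map deg).trace * z) := by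
      simp only [trace, diag_apply, mul_apply (M := D.S * D.N), map_apply, sum_mul, smul_sum]
      refine sum_congr rfl fun a _ => sum_congr rfl fun b _ => ?_
      rw [smul_mul_assoc, mul_assoc, even_comm z_even, mul_assoc]
    rw [e] at h
    refine h.congr fun y q => ?_
    beta_reduce
    simp only [dotProduct, vecMul, sum_mul, mul_sum]
    refine sum_congr rfl fun a _ => sum_congr rfl fun b _ => ?_
    simp only [mul_assoc, even_comm (D.g_even ħ (elim y q))]
    rfl
  have hQQ : SInt ħ V (fun v => ((mmap inl (D.S.map deg) *ᵥ D.Q v) ⬝ᵥ D.Q v) * D.g ħ v)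
      ((I / ħ : ℂ)⁻¹ • ((D.S.map deg * (D.N * D.T)).trace * z)) := by
    have h := HasSuperIntegral.sum univ fun a _ => HasSuperIntegral.sum univ fun b _ =>
      (D.int_QQ hħ hz b a).mul_left (deg (D.S a b))
    have e : ∑ a, ∑ b, deg (D.S a b) * (I / ħ : ℂ)⁻¹ • ((D.N * D.T) b a * z) =
        (I / ħ : ℂ)⁻¹ • ((D.S.map deg * (D.N * D.T)).trace * z) := by
      simp only [trace, diag_apply, mul_apply (M := D.S.map deg), map_apply, sum_mul, smul_sum]
      refine sum_congr rfl fun a _ => sum_congr rfl fun b _ => ?_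
      rw [mul_smul_comm, mul_assoc]
    rw [e] at h
    refine h.congr fun y q => ?_
    beta_reduce
    simp only [dotProduct, mulVec, sum_mul]
    refine sum_congr rfl fun a _ => sum_congr rfl fun b _ => ?_
    simp only [mul_assoc, even_comm (D.g_even ħ (elim y q))]
    rfl
  have hYc : ∀ c : V.Idx → Λ σ, SInt ħ V (fun v => (D.Y v ⬝ᵥ vmap inl c) * D.g ħ v) 0 := by
    intro c
    have h := HasSuperIntegral.sum univ fun a _ => (D.int_Y hħ hz a).mul_right (c a)
    simp only [zero_mul, sum_const_zero] at h
    refine h.congr fun y q => ?_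
    beta_reduce
    simp only [dotProduct, sum_mul]
    refine sum_congr rfl fun a _ => ?_
    simp only [mul_assoc, even_comm (D.g_even ħ (elim y q))]
    rfl
  have hcQ : ∀ c : V.Idx → Λ σ, SInt ħ V (fun v => (vmap inl c ⬝ᵥ D.Q v) * D.g ħ v) 0 := by
    intro c
    have h := HasSuperIntegral.sum univ fun a _ => (D.int_Q hħ hz a).mul_left (c a)
    simp only [mul_zero, sum_const_zero] at h
    refine h.congr fun y q => ?_
    beta_reduce
    simp only [dotProduct, sum_mul]
    exact sum_congr rfl fun a _ => (mul_assoc _ _ _).symm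
  have h2 := (((hYY.smul (1 / 2)).add (hQQ.smul (1 / 2))).add 
    ((hYc (((fun a => deg (-D.ys a)) ᵥ* D.T) - fun a => deg (-D.qs a))).add
      (hcQ ((D.S *ᵥ fun a => deg (-D.qs a)) - fun a => deg (-D.ys a))))).smul (I / ħ)
  rw [h1.unique (h2.congr fun y q => ?_)]
  · simp only [add_zero, smul_add, smul_smul, dlog, add_mul, mul_comm (I / ħ : ℂ), mul_assoc,
      inv_mul_cancel₀ hI, mul_one]
  · beta_reduce
    rw [g, euler_gexp _ (smul_mem _ _ (D.E_even _)), map_smul, D.pdeg_E, smul_mul_assoc]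
    simp only [add_mul, smul_mul_assoc]

omit hz hħ

theorem deg_ber_M : deg (Ber D.M : Λ σ) = -D.dlog * (Ber D.M : Λ σ) := by
  have hN := MatIn.inverse (P := parityR σ) D.left D.M_par
  have hdeg : ∀ {X : Matrix V.Idx V.Idx (Λ σ)}, MatIn (parityR σ) X →
    MatIn (parityR σ) (X.map deg) := fun h i j => euler_mem_parity _ (h i j)
  rw [deg_ber D.M_par D.left D.right]
  congr 1
  have e : D.M.map deg = -(D.T.map deg * (Sg σ V * D.S) + D.T * (Sg σ V * D.S.map deg)) := by
    have h0 : (Sg σ V).map deg = 0 := by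
      ext i j
      change deg (sgm σ (Fin V.even ⊕ Fin V.odd) sgn i j) = 0
      rw [sgm, diagonal_apply]
      split_ifs <;> simp
    have h1 : (1 : Matrix V.Idx V.Idx (Λ σ)).map deg = 0 := by
      ext i j
      rw [map_apply, one_apply]
      split_ifs <;> simp
    have h2 : D.M.map deg = (1 : Matrix V.Idx V.Idx (Λ σ)).map deg -
        (D.T * Sg σ V * D.S).map deg := Matrix.ext fun i j => map_sub deg _ _
    rw [h2, h1, map_deg_mul, map_deg_mul, h0, Matrix.mul_zero, add_zero, zero_sub, Matrix.mul_assoc,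
      Matrix.mul_assoc]
  have e2 : ∑ i, sgn i • (D.N * (D.T.map deg * (Sg σ V * D.S))) i i =
      (D.S * D.N * D.T.map deg).trace := by
    rw [← Matrix.mul_assoc, supertrace_mul_comm (hN.mul (hdeg D.T_par)) (MatIn.sgm.mul D.S_par),
      Matrix.mul_assoc, supertrace_sgm_mul, Matrix.mul_assoc]
  have e3 : ∑ i, sgn i • (D.N * (D.T * (Sg σ V * D.S.map deg))) i i =
      (D.S.map deg * (D.N * D.T)).trace := by
    rw [← Matrix.mul_assoc, supertrace_mul_comm (hN.mul D.T_par) (MatIn.sgm.mul (hdeg D.S_par)),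
      Matrix.mul_assoc, supertrace_sgm_mul]
  rw [e, dlog, ← e2, ← e3, ← sum_add_distrib, ← sum_neg_distrib]
  refine sum_congr rfl fun i _ => ?_
  rw [Matrix.mul_neg, Matrix.mul_add, Matrix.neg_apply, Matrix.add_apply, smul_neg, smul_add]

end Variation

end GaussData

section BerezinMap

variable {σ σ' : Type} {m : ℕ} (ħ : ℝ)

theorem berezin_map (f : (σ ⧺ m →₀ ℂ) →ₗ[ℂ] (σ' ⊕ (Fin m ⊕ Fin m) →₀ ℂ))
    (f₀ : (σ →₀ ℂ) →ₗ[ℂ] (σ' →₀ ℂ)) (h : ∀ v k, f v (.inr k) = v (.inr k))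
    (h₀ : f₀ ∘ₗ dropOdd σ m = dropOdd σ' m ∘ₗ f) (x : Λ (σ ⧺ m)) :
    berezin ħ m (ExteriorAlgebra.map f x) = ExteriorAlgebra.map f₀ (berezin ħ m x) := by
  refine berezin_comm ħ (ExteriorAlgebra.map f).toLinearMap (ExteriorAlgebra.map f₀).toLinearMap
    (fun j x => ?_) (fun x => ?_) x
  · have h' : ∀ v k, f v (.inr k) = 1 * v (.inr k) := fun v k => by rw [h, one_mul]
    simp only [AlgHom.toLinearMap_apply, berezinPair_apply, map_smul]
    rw [oddDeriv_map f (h' · (.inl j)), one_smul, oddDeriv_map f (h' · (.inr j)), one_smul]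
  · simp only [AlgHom.toLinearMap_apply]
    rw [← AlgHom.comp_apply, ← AlgHom.comp_apply, ExteriorAlgebra.map_comp_map,
      ExteriorAlgebra.map_comp_map, h₀]

theorem berezin_genMap (f : σ → σ') (x : Λ (σ ⧺ m)) :
    berezin ħ m (genMap (Sum.map f id) x) = genMap f (berezin ħ m x) := by
  classical
  refine berezin_map ħ _ _ (fun v k => ?_) ?_ x
  · induction v using Finsupp.induction_linear with
    | zero => simp
    | add v w hv hw => simp only [map_add, Finsupp.add_apply, hv, hw]
    | single i c => rcases i with i | i <;> simp [Finsupp.single_apply]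
  · ext i
    rcases i with i | i <;> simp [dropOdd]

/-- The substitution of zero for all parameters. -/
noncomputable def killParams (σ : Type) (m : ℕ) :
    Λ (σ ⧺ m) →ₐ[ℂ] Λ (Empty ⊕ (Fin m ⊕ Fin m)) :=
  ExteriorAlgebra.map (Finsupp.linearCombination ℂ
    (elim (fun _ => 0) fun k => Finsupp.single (.inr k) 1))

theorem body_berezin_killParams (x : Λ (σ ⧺ m)) :
    body (berezin ħ m (killParams σ m x)) = body (berezin ħ m x) := by
  classical
  rw [killParams, berezin_map ħ _ 0 ?_ ?_ x, body_map]
  · intro v k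
    induction v using Finsupp.induction_linear with
    | zero => simp
    | add v w hv hw => simp only [map_add, Finsupp.add_apply, hv, hw]
    | single i c => rcases i with i | i <;> simp [Finsupp.single_apply]
  · ext i
    rcases i with i | i <;> simp [dropOdd]

theorem killParams_gen (k : Fin m ⊕ Fin m) : killParams σ m (gen (.inr k)) = gen (.inr k) := by
  rw [killParams, map_gen]
  simp [gen_def]

theorem killParams_inl (x : Λ σ) :
    killParams σ m (genMap inl x) = algebraMap ℂ _ (body x) := by
  have : (killParams σ m).comp (genMap inl) = (Algebra.ofId ℂ _).comp body :=
    grassmann_hom_ext fun k => by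
      rw [AlgHom.comp_apply, genMap_gen, killParams, map_gen]
      simp
  exact congrArg (fun F => F x) this

theorem eq_algebraMap_body (x : Λ Empty) : x = algebraMap ℂ _ (body x) :=
  eq_body_of_euler_eq_zero (by simp [euler_apply])

end BerezinMap

section OddGaussian

variable {σ : Type} {m : ℕ}

/-- The odd position coordinates. -/
noncomputable def oy (σ : Type) {m : ℕ} (i : Fin m) : Λ (σ ⧺ m) :=
  gen (.inr (.inl i))

/-- The odd momentum coordinates. -/
noncomputable def oq (σ : Type) {m : ℕ} (i : Fin m) : Λ (σ ⧺ m) :=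
  gen (.inr (.inr i))

/-- The quadratic form in the odd positions and in the odd momenta. -/
noncomputable def oddQuad (σ : Type) {m : ℕ} (a b : Matrix (Fin m) (Fin m) ℝ) :
    Λ (σ ⧺ m) :=
  (1 / 2 : ℂ) • ∑ i, ∑ j, (a j i : ℂ) • (oy σ i * oy σ j) +
    (1 / 2 : ℂ) • ∑ i, ∑ j, (b i j : ℂ) • (oq σ j * oq σ i)

/-- A partial sum of the odd part of the pairing. -/
noncomputable def oddPair (σ : Type) {m : ℕ} (s : Finset (Fin m)) :
    Λ (σ ⧺ m) := ∑ i ∈ s, oy σ i * oq σ i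

theorem gen_mul_gen_even {τ : Type} (i j : τ) : (gen i * gen j : Λ τ) ∈ parityPart τ 0 :=
  par_add_self 1 ▸ mul_mem_parity (gen_odd i) (gen_odd j)

theorem oddQuad_even (a b : Matrix (Fin m) (Fin m) ℝ) : oddQuad σ a b ∈ parityPart _ 0 :=
  Submodule.add_mem _
    (smul_mem _ _ (sum_mem fun _ _ => sum_mem fun _ _ =>
      smul_mem _ _ (gen_mul_gen_even _ _)))
    (smul_mem _ _ (sum_mem fun _ _ => sum_mem fun _ _ =>
      smul_mem _ _ (gen_mul_gen_even _ _)))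

theorem oddPair_even (s : Finset (Fin m)) : oddPair σ s ∈ parityPart _ 0 :=
  sum_mem fun _ _ => gen_mul_gen_even _ _

theorem body_oddQuad (a b : Matrix (Fin m) (Fin m) ℝ) : body (oddQuad σ a b) = 0 := by
  simp [oddQuad, oy, oq, -Complex.coe_smul]

theorem body_oddPair (s : Finset (Fin m)) : body (oddPair σ s) = 0 := by
  simp [oddPair, oy, oq]

theorem genMap_oddQuad {σ' : Type} (f : σ → σ') (a b : Matrix (Fin m) (Fin m) ℝ) :
    genMap (Sum.map f id) (oddQuad σ a b) = oddQuad σ' a b := by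
  simp [oddQuad, oy, oq, -Complex.coe_smul]

theorem genMap_oddPair {σ' : Type} (f : σ → σ') (s : Finset (Fin m)) :
    genMap (Sum.map f id) (oddPair σ s) = oddPair σ' s := by
  simp [oddPair, oy, oq]

theorem oddDeriv_oddPair {s : Finset (Fin m)} {j : Fin m} (hj : j ∉ s) :
    oddDeriv (.inr (.inl j)) (oddPair σ s) = 0 ∧ oddDeriv (.inr (.inr j)) (oddPair σ s) = 0 := by
  classical
  have h : ∀ i ∈ s, i ≠ j := fun i hi e => hj (e ▸ hi)
  constructor <;> rw [oddPair, map_sum] <;> refine Finset.sum_eq_zero fun i hi => ?_ <;>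
    rw [oy, oq, oddDeriv_gen_mul, oddDeriv_gen] <;> simp [h i hi]

theorem berezinPair_eq_zero (ħ : ℝ) {j : Fin m} {X : Λ (σ ⧺ m)}
    (h : oddDeriv (.inr (.inl j)) X = 0) : berezinPair ħ σ j X = 0 := by
  rw [berezinPair_apply, h, map_zero, smul_zero]

theorem berezinPair_mul (ħ : ℝ) {j : Fin m} {X : Λ (σ ⧺ m)}
    (he : X ∈ parityPart _ 0) (h : oddDeriv (.inr (.inl j)) X = 0)
    (h' : oddDeriv (.inr (.inr j)) X = 0) :
    berezinPair ħ σ j (X * (oy σ j * oq σ j)) = (Complex.I * ħ) • X := by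
  classical
  rw [berezinPair_apply, oddDeriv_even_mul _ he, h, zero_mul, zero_add, oy, oq, oddDeriv_gen_mul,
    oddDeriv_gen]
  simp only [if_true, reduceCtorEq, Sum.inr.injEq, if_false, mul_zero, sub_zero]
  rw [oddDeriv_even_mul _ he, h', oddDeriv_gen]
  simp

theorem oy_mul_oq_sq (j : Fin m) : (oy σ j * oq σ j) * (oy σ j * oq σ j) = 0 := by
  have h : oq σ j * (oy σ j * oq σ j) = 0 := by
    rw [← even_comm (x := oy σ j * oq σ j) (gen_mul_gen_even _ _), mul_assoc, oq, gen_def,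
      ExteriorAlgebra.ι_sq_zero, mul_zero]
  rw [mul_assoc, h, mul_zero]

theorem oddPair_pow_ne_zero (s : Finset (Fin m)) : oddPair σ s ^ s.card ≠ 0 := by
  classical
  induction s using Finset.induction_on with
  | empty =>
    have : Nontrivial (Λ (σ ⧺ m)) :=
      (body (τ := σ ⧺ m)).toRingHom.domain_nontrivial
    simp
  | insert j s hj ih =>
    have hpow : ∀ k, oddPair σ (insert j s) ^ (k + 1) =
        oddPair σ s ^ (k + 1) + ((k + 1 : ℕ) : ℂ) • (oddPair σ s ^ k * (oy σ j * oq σ j)) := by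
      intro k
      have e : oddPair σ (insert j s) = oy σ j * oq σ j + oddPair σ s := by
        rw [oddPair, Finset.sum_insert hj]; rfl
      have hc := even_comm (oddPair_even (σ := σ) s) (oy σ j * oq σ j)
      rw [e]
      induction k with
      | zero => simp [add_comm]
      | succ k ihk =>
        have hs := oy_mul_oq_sq (σ := σ) j
        generalize oy σ j * oq σ j = p at *
        rw [pow_succ, ihk, add_mul, mul_add, mul_add, smul_mul_assoc, smul_mul_assoc,
          mul_assoc _ p p, hs, mul_assoc _ p, ← hc, ← mul_assoc, ← pow_succ, ← pow_succ]
        push_cast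
        simp only [mul_zero, smul_zero, add_smul, one_smul]
        abel
    intro h0
    rw [Finset.card_insert_of_notMem hj, hpow] at h0
    have h1 := congrArg (berezinPair 1 σ j) h0
    have hd := oddDeriv_oddPair (σ := σ) hj
    have hdp : ∀ k' ∈ ({.inr (.inl j), .inr (.inr j)} : Set (σ ⧺ m)), ∀ k,
        oddDeriv k' (oddPair σ s ^ k) = 0 := by
      intro k' hk' k
      have hk : oddDeriv k' (oddPair σ s) = 0 := by
        rcases hk' with rfl | rfl
        exacts [hd.1, hd.2]
      induction k with
      | zero => simp
      | succ k ihk => rw [pow_succ', oddDeriv_even_mul _ (oddPair_even s), hk, ihk]; simp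
    rw [map_add, map_smul, map_zero, berezinPair_eq_zero 1 (hdp _ (by simp) _),
      berezinPair_mul 1 (pow_mem (S := GEven _) (oddPair_even s) _) (hdp _ (by simp) _)
        (hdp _ (by simp) _), zero_add, smul_smul] at h1
    refine ih ((smul_eq_zero.1 h1).resolve_left (mul_ne_zero (Nat.cast_ne_zero.2 (by omega)) ?_))
    simp

theorem berezin_gexp_oddPair {ħ : ℝ} (hħ : ħ ≠ 0) :
    berezin ħ m (gexp ((Complex.I / ħ) • -oddPair σ univ)) = 1 := by
  classical
  have hħ' : (ħ : ℂ) ≠ 0 := Complex.ofReal_ne_zero.2 hħ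
  have hev : ∀ s : Finset (Fin m), (Complex.I / ħ : ℂ) • -oddPair σ s ∈ parityPart _ 0 :=
    fun s => smul_mem _ _ (neg_mem (oddPair_even s))
  have step : ∀ (s : Finset (Fin m)) (j : Fin m), j ∉ s →
      berezinPair ħ σ j (gexp ((Complex.I / ħ) • -oddPair σ (insert j s))) =
        gexp ((Complex.I / ħ) • -oddPair σ s) := by
    intro s j hj
    have e : (Complex.I / ħ : ℂ) • -oddPair σ (insert j s) =
        (Complex.I / ħ : ℂ) • -oddPair σ s + (Complex.I / ħ : ℂ) • -(oy σ j * oq σ j) := by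
      rw [oddPair, Finset.sum_insert hj, ← smul_add, neg_add_rev]; rfl
    have hj2 : (Complex.I / ħ : ℂ) • -(oy σ j * oq σ j) ∈ parityPart _ 0 :=
      smul_mem _ _ (neg_mem (gen_mul_gen_even _ _))
    have e2 : gexp ((Complex.I / ħ : ℂ) • -(oy σ j * oq σ j)) =
        1 + (-(Complex.I / ħ) : ℂ) • (oy σ j * oq σ j) := by
      rw [gexp_of_body (by simp [oy, oq]), IsNilpotent.exp_eq_sum (k := 2) (by
        rw [sq, smul_mul_smul_comm, neg_mul_neg, oy_mul_oq_sq, smul_zero])]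
      simp [Finset.sum_range_succ]
    have hd := oddDeriv_oddPair (σ := σ) hj
    have h1 : oddDeriv (.inr (.inl j)) (gexp ((Complex.I / ħ : ℂ) • -oddPair σ s)) = 0 := by
      rw [oddDeriv_gexp _ (hev s), map_smul, map_neg, hd.1]; simp
    have h2 : oddDeriv (.inr (.inr j)) (gexp ((Complex.I / ħ : ℂ) • -oddPair σ s)) = 0 := by
      rw [oddDeriv_gexp _ (hev s), map_smul, map_neg, hd.2]; simp
    rw [e, gexp_add (hev s) hj2, e2, mul_add, mul_one, map_add, berezinPair_eq_zero ħ h1, zero_add,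
      mul_smul_comm, map_smul, berezinPair_mul ħ (gexp_even (hev s)) h1 h2, smul_smul]
    have : -(Complex.I / ħ) * (Complex.I * ħ) = 1 := by
      field_simp
      simp
    rw [this, one_smul]
  have main : ∀ (L : List (Fin m)) (s : Finset (Fin m)), L.Nodup → (∀ j ∈ L, j ∉ s) →
      (L.map (berezinPair ħ σ)).prod (gexp ((Complex.I / ħ) • -oddPair σ (s ∪ L.toFinset))) =
        gexp ((Complex.I / ħ) • -oddPair σ s) := by
    intro L
    induction L with
    | nil => intro s _ _; simp
    | cons j L ih =>
      intro s hn hs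
      rw [List.nodup_cons] at hn
      have e : s ∪ (j :: L).toFinset = insert j s ∪ L.toFinset := by
        ext x; simp
      rw [e, List.map_cons, List.prod_cons, Module.End.mul_apply, ih (insert j s) hn.2, step s j]
      · exact hs j (by simp)
      · intro i hi hi'
        rcases Finset.mem_insert.1 hi' with rfl | hi'
        · exact hn.1 hi
        · exact hs i (by simp [hi]) hi'
  have h := main (List.finRange m) ∅ (List.nodup_finRange m) (by simp)
  have e : (∅ : Finset (Fin m)) ∪ (List.finRange m).toFinset = univ := by
    ext x; simp
  rw [e] at h
  rw [berezin_apply, h]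
  simp [oddPair]

/-- The odd Gaussian integral, as a polynomial in the coupling constant. -/
noncomputable def oddPoly (ħ : ℝ) {m : ℕ} (a b : Matrix (Fin m) (Fin m) ℝ) : Polynomial ℂ :=
  ∑ k ∈ Finset.range (Module.finrank ℂ (Λ (Empty ⊕ (Fin m ⊕ Fin m)))),
    Polynomial.C (body (berezin ħ m (((k.factorial : ℂ)⁻¹) • ((Complex.I / ħ) • oddQuad Empty a b) ^ k *
      gexp ((Complex.I / ħ) • -oddPair Empty univ)))) * Polynomial.X ^ k

theorem berezin_eq_aeval [Finite σ] (ħ : ℝ) (a b : Matrix (Fin m) (Fin m) ℝ) {η : Λ σ}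
    (hη : η ∈ parityPart σ 0) :
    berezin ħ m (gexp ((Complex.I / ħ) • (genMap inl η * oddQuad σ a b - oddPair σ univ))) =
      Polynomial.aeval η (oddPoly ħ a b) := by
  have hη' : genMap (inl (β := Fin m ⊕ Fin m)) η ∈ parityPart _ 0 := genMap_mem_parity _ hη
  have hq : genMap inl η * oddQuad σ a b ∈ parityPart _ 0 := by
    simpa using mul_mem_parity hη' (oddQuad_even (σ := σ) a b)
  set K := Module.finrank ℂ (Λ (Empty ⊕ (Fin m ⊕ Fin m)))
  have hK : ((Complex.I / ħ : ℂ) • oddQuad Empty a b) ^ K = 0 :=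
    pow_finrank_eq_zero (smul_mem _ _ (oddQuad_even a b)) (by
      rw [map_smul, body_oddQuad, smul_zero])
  have hg : genMap (Sum.map Empty.elim id) ((Complex.I / ħ : ℂ) • oddQuad Empty a b) =
      (Complex.I / ħ : ℂ) • oddQuad σ a b := by rw [map_smul, genMap_oddQuad]
  have hg2 : genMap (Sum.map Empty.elim id) (gexp ((Complex.I / ħ : ℂ) • -oddPair Empty univ)) =
      gexp ((Complex.I / ħ : ℂ) • -oddPair σ (univ : Finset (Fin m))) := by
    rw [genMap_gexp _ (smul_mem _ _ (neg_mem (oddPair_even _))), map_smul,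
      map_neg, genMap_oddPair]
  have hpow : ∀ k, ((Complex.I / ħ : ℂ) • (genMap inl η * oddQuad σ a b)) ^ k =
      genMap inl (η ^ k) * genMap (Sum.map Empty.elim id)
        (((Complex.I / ħ : ℂ) • oddQuad Empty a b) ^ k) := fun k => by
    rw [map_pow, map_pow, hg, ← mul_smul_comm]
    exact (commute_of_even hη' _).mul_pow k
  rw [sub_eq_add_neg, smul_add, gexp_add (smul_mem _ _ hq)
    (smul_mem _ _ (neg_mem (oddPair_even _))), gexp_of_body (by simp [body_oddQuad]),
    exp_eq_sum_complex (K := K) (by rw [hpow, hK, map_zero, mul_zero]), ← hg2, sum_mul, map_sum,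
    oddPoly, map_sum]
  refine sum_congr rfl fun k _ => ?_
  rw [hpow, smul_mul_assoc, mul_assoc, ← mul_smul_comm, ← map_mul (genMap _), ← map_smul,
    berezin_mul_left, berezin_genMap, ← smul_mul_assoc, map_mul (Polynomial.aeval η),
    Polynomial.aeval_C, map_pow (Polynomial.aeval η), Polynomial.aeval_X]
  conv_lhs => rw [eq_algebraMap_body (berezin ħ m _), AlgHom.commutes]
  exact (Algebra.commutes _ _).symm

theorem oddPoly_eval_zero {ħ : ℝ} (hħ : ħ ≠ 0) (a b : Matrix (Fin m) (Fin m) ℝ) :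
    (oddPoly ħ a b).eval 0 = 1 := by
  have h := berezin_eq_aeval (σ := Empty) ħ a b (zero_mem _)
  rw [map_zero, zero_mul, zero_sub, berezin_gexp_oddPair hħ] at h
  have h2 := congrArg body h
  rw [map_one, ← Polynomial.aeval_algHom_apply, map_zero, Polynomial.coe_aeval_eq_eval] at h2
  exact h2.symm

end OddGaussian

end SuperThick

namespace SuperThick

open Matrix Complex

theorem hasSuperIntegral_zero_dim (ħ : ℝ) {σ : Type} {m : ℕ}
    (f : (Fin 0 → ℝ) → (Fin 0 → ℝ) → Λ (σ ⧺ m)) :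
    HasSuperIntegral ħ 0 m f (berezin ħ m (f default default)) := by
  intro l
  have hv : (volume : Measure ((Fin 0 → ℝ) × (Fin 0 → ℝ))).real Set.univ = 1 := by
    rw [Measure.real, ← Set.univ_prod_univ, Measure.volume_eq_prod, Measure.prod_prod,
      Measure.volume_pi_eq_dirac default]
    simp
  have hf : IsFiniteMeasure (volume : Measure ((Fin 0 → ℝ) × (Fin 0 → ℝ))) := ⟨by
    rw [lt_top_iff_ne_top]
    intro h
    rw [Measure.real, h] at hv
    simp at hv⟩
  refine ⟨fun ε _ => ?_, ?_⟩
  · rw [show (fun v : (Fin 0 → ℝ) × (Fin 0 → ℝ) => (Real.exp (-ε * (∑ j, (v.1 j ^ 2 + v.2 j ^ 2))) : ℂ) *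
        l (berezin ħ m (f v.1 v.2))) = fun _ => l (berezin ħ m (f default default)) from
        funext fun v => by rw [Subsingleton.elim v (default, default)]; simp]
    exact integrable_const _
  · simp only [pow_zero, one_mul]
    refine tendsto_const_nhds.congr fun ε => ?_
    rw [show (fun v : (Fin 0 → ℝ) × (Fin 0 → ℝ) => (Real.exp (-ε * (∑ j, (v.1 j ^ 2 + v.2 j ^ 2))) : ℂ) *
        l (berezin ħ m (f v.1 v.2))) = fun _ => l (berezin ħ m (f default default)) from
        funext fun v => by rw [Subsingleton.elim v (default, default)]; simp, integral_const, hv,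
      one_smul]

namespace GaussData

variable {σ : Type} {V : SuperSpace} (D : GaussData σ V)

theorem _root_.SuperThick.deg_sq_mul [Fintype σ] {z B d : Λ σ} (hz : z ∈ parityPart σ 0)
    (h1 : deg z = (1 / 2 : ℂ) • (d * z)) (h2 : deg B = -d * B) : deg (z * z * B) = 0 := by
  have e1 : z * (d * z) = d * (z * z) := by rw [even_comm hz (d * z), mul_assoc]
  have e2 : z * z * (d * B) = d * (z * z * B) := by
    rw [mul_assoc, ← mul_assoc z d, even_comm hz d, mul_assoc d, ← mul_assoc z d, even_comm hz d]
    simp only [mul_assoc]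
  have e3 : (d * z) * z = d * (z * z) := mul_assoc _ _ _
  rw [deg, euler_mul, euler_mul, ← deg, h1, h2, smul_mul_assoc, mul_smul_comm, e1, e3, neg_mul, mul_neg, e2,
    ← add_smul, smul_mul_assoc, mul_assoc d (z * z)]
  norm_num

theorem sq_mul_ber [Fintype σ] {ħ : ℝ} (hħ : 0 < ħ) {z : Λ σ} (hz : SInt ħ V (D.g ħ) z) :
    z * z * (Ber D.M : Λ σ) = algebraMap ℂ _ (body z ^ 2 * body (Ber D.M : Λ σ)) := by
  have he : z ∈ parityPart σ 0 := hz.mem_parity fun y q => D.g_even ħ _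
  rw [eq_body_of_euler_eq_zero (deg_sq_mul he (D.deg_integral hħ hz) D.deg_ber_M), map_mul body, map_mul body, sq]

theorem killParams_Y_inl (v) (i) :
    killParams σ V.odd (D.Y v (.inl i)) = algebraMap ℂ _ (body (D.Y v (.inl i))) := by
  change killParams σ V.odd (algebraMap ℂ _ _ + genMap inl _) =
    algebraMap ℂ _ (body (algebraMap ℂ _ _ + genMap inl _))
  rw [map_add, killParams_inl, map_add body, body_genMap, map_add, AlgHom.commutes, body_algebraMap]

theorem killParams_Q_inl (v) (i) :
    killParams σ V.odd (D.Q v (.inl i)) = algebraMap ℂ _ (body (D.Q v (.inl i))) := by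
  change killParams σ V.odd (algebraMap ℂ _ _ + genMap inl _) =
    algebraMap ℂ _ (body (algebraMap ℂ _ _ + genMap inl _))
  rw [map_add, killParams_inl, map_add body, body_genMap, map_add, AlgHom.commutes, body_algebraMap]

theorem killParams_Y_inr (v) (i) : killParams σ V.odd (D.Y v (.inr i)) = oy Empty i := by
  have h : D.ys (.inr i) ∈ parityPart σ 1 := D.ys_point (.inr i)
  change killParams σ V.odd (gen _ + genMap inl (-_)) = _
  rw [map_add, killParams_inl, map_neg, body_odd h, neg_zero, map_zero, add_zero, killParams_gen]
  rfl

theorem killParams_Q_inr (v) (i) : killParams σ V.odd (D.Q v (.inr i)) = oq Empty i := by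
  have h : D.qs (.inr i) ∈ parityPart σ 1 := D.qs_point (.inr i)
  change killParams σ V.odd (gen _ + genMap inl (-_)) = _
  rw [map_add, killParams_inl, map_neg, body_odd h, neg_zero, map_zero, add_zero, killParams_gen]
  rfl

theorem killParams_T' (i j) : killParams σ V.odd (D.T' i j) = algebraMap ℂ _ (body (D.T i j)) :=
  killParams_inl _

theorem killParams_S' (i j) : killParams σ V.odd (D.S' i j) = algebraMap ℂ _ (body (D.S i j)) :=
  killParams_inl _

theorem killParams_E (v) : killParams σ V.odd (D.E v) = algebraMap ℂ _ (body (D.E v)) +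
      (oddQuad Empty (blockO D.T) (blockO D.S) - oddPair Empty univ) := by
  have hT : ∀ i j, body (D.T' i j) = body (D.T i j) := fun i j => body_genMap _ _
  have hS : ∀ i j, body (D.S' i j) = body (D.S i j) := fun i j => body_genMap _ _
  have e1 : killParams σ V.odd (D.Y v ⬝ᵥ (D.Y v ᵥ* D.T')) =
      algebraMap ℂ _ (body (D.Y v ⬝ᵥ (D.Y v ᵥ* D.T'))) +
        ∑ i, ∑ j, (blockO D.T j i : ℂ) • (oy Empty i * oy Empty j) := by
    simp only [dotProduct, vecMul, map_add, map_sum, map_mul, Fintype.sum_sum_type,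
      killParams_Y_inl, killParams_Y_inr, killParams_T', body_eo D.T_in, body_oe D.T_in,
      blockO_coe D.T_in, D.body_Y_inr, map_zero, zero_mul, mul_zero, hT,
      sum_const_zero, add_zero, zero_add]
    congr 1
    refine sum_congr rfl fun i _ => ?_
    rw [mul_sum]
    refine sum_congr rfl fun j _ => ?_
    rw [← mul_assoc, ← Algebra.commutes, Algebra.smul_def]
  have e2 : killParams σ V.odd ((D.S' *ᵥ D.Q v) ⬝ᵥ D.Q v) =
      algebraMap ℂ _ (body ((D.S' *ᵥ D.Q v) ⬝ᵥ D.Q v)) +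
        ∑ i, ∑ j, (blockO D.S i j : ℂ) • (oq Empty j * oq Empty i) := by
    simp only [dotProduct, mulVec, map_add, map_sum, map_mul, Fintype.sum_sum_type,
      killParams_Q_inl, killParams_Q_inr, killParams_S', body_eo D.S_in, body_oe D.S_in,
      blockO_coe D.S_in, D.body_Q_inr, map_zero, zero_mul, mul_zero, hS,
      sum_const_zero, add_zero, zero_add]
    congr 1
    refine sum_congr rfl fun i _ => ?_
    rw [sum_mul]
    refine sum_congr rfl fun j _ => ?_
    rw [mul_assoc, Algebra.smul_def]
  have e3 : killParams σ V.odd (D.Y v ⬝ᵥ D.Q v) =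
      algebraMap ℂ _ (body (D.Y v ⬝ᵥ D.Q v)) + oddPair Empty univ := by
    simp only [dotProduct, map_add, map_sum, map_mul, Fintype.sum_sum_type,
      killParams_Y_inl, killParams_Q_inl, killParams_Y_inr, killParams_Q_inr, D.body_Y_inr,
      zero_mul, sum_const_zero, add_zero, oddPair]
  rw [E]
  simp only [map_add, map_smul, e1, e2, e3, oddQuad, Algebra.algebraMap_eq_smul_one]
  module

theorem body_integral {ħ : ℝ} {z : Λ σ} (hz : SInt ħ V (D.g ħ) z) {ζ : ℂ}
    (hζ : ∀ u, Tendsto (fun ε => ((2 * π * ħ : ℝ) : ℂ)⁻¹ ^ V.even *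
        ∫ v, (reg ε v : ℂ) * cexp (I * phase (ħ⁻¹ • hess (blockE D.T) (blockE D.S)) 0 (v - u)))
        (𝓝[>] 0) (𝓝 ζ)) :
    body z = ζ * (oddPoly ħ (blockO D.T) (blockO D.S)).eval 1 := by
  have hO : (oddPoly ħ (blockO D.T) (blockO D.S)).eval 1 = body (berezin ħ V.odd (gexp ((I / ħ : ℂ) •
      (oddQuad Empty (blockO D.T) (blockO D.S) - oddPair Empty univ)))) := by
    have h := berezin_eq_aeval (σ := Empty) ħ (blockO D.T) (blockO D.S) one_even
    rw [map_one, one_mul] at h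
    rw [h, ← Polynomial.aeval_algHom_apply, map_one, Polynomial.coe_aeval_eq_eval]
  have hg : ∀ v, body (berezin ħ V.odd (D.g ħ v)) = cexp (I * phase (D.H ħ) 0 (v - D.center)) *
      (oddPoly ħ (blockO D.T) (blockO D.S)).eval 1 := by
    intro v
    have hev : (oddQuad Empty (blockO D.T) (blockO D.S) - oddPair Empty univ) ∈ parityPart _ 0 :=
      sub_mem (oddQuad_even _ _) (oddPair_even _)
    have hk : killParams σ V.odd (D.g ħ v) = cexp (I * phase (D.H ħ) 0 (v - D.center)) •
        gexp ((I / ħ : ℂ) • (oddQuad Empty (blockO D.T) (blockO D.S) - oddPair Empty univ)) := by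
      rw [g, killParams, map_gexp _ (smul_mem _ _ (D.E_even v)), ← killParams, map_smul,
        D.killParams_E, smul_add, gexp_add (smul_mem _ _ (algebraMap_even _))
        (smul_mem _ _ hev), Algebra.algebraMap_eq_smul_one, smul_smul,
        ← Algebra.algebraMap_eq_smul_one, gexp_algebraMap, ← Algebra.smul_def, ← D.body_smul_E,
        map_smul, smul_eq_mul]
    rw [← body_berezin_killParams, hk, map_smul, map_smul, smul_eq_mul, hO]
  have h1 := ((hasSuperIntegral_iff.1 hz) (body (τ := σ)).toLinearMap).2
  have h2 := (hζ D.center).mul_const ((oddPoly ħ (blockO D.T) (blockO D.S)).eval 1)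
  refine tendsto_nhds_unique h1 (h2.congr fun ε => ?_)
  rw [mul_assoc, ← integral_mul_const]
  simp only [AlgHom.toLinearMap_apply, hg, mul_assoc]

end GaussData

section OddDeterminant

variable {m : ℕ}

/-- A polynomial annihilated by even nilpotent elements of arbitrarily high order vanishes. -/
theorem polynomial_eq_zero {p : Polynomial ℂ} (h : ∀ (n : ℕ), Polynomial.aeval
    (oddPair Empty (univ : Finset (Fin n))) p = 0) : p = 0 := by
  by_contra hp
  obtain ⟨q, hq, hd⟩ := Polynomial.exists_eq_pow_rootMultiplicity_mul_and_not_dvd p hp 0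
  set k := p.rootMultiplicity 0
  set η : GEven (Empty ⊕ (Fin k ⊕ Fin k)) := ⟨oddPair Empty univ, oddPair_even _⟩ with hη
  have h1 : Polynomial.aeval η p = 0 := by
    apply Subtype.ext
    exact (Polynomial.aeval_algHom_apply (GEven _).val η p).symm.trans (h k)
  have hb : body ((Polynomial.aeval η q : GEven (Empty ⊕ (Fin k ⊕ Fin k))) :
      Λ (Empty ⊕ (Fin k ⊕ Fin k))) ≠ 0 := by
    have : body ((Polynomial.aeval η q : GEven (Empty ⊕ (Fin k ⊕ Fin k))) :
        Λ (Empty ⊕ (Fin k ⊕ Fin k))) = q.eval 0 := by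
      have e := Polynomial.aeval_algHom_apply ((body (τ := Empty ⊕ (Fin k ⊕ Fin k))).comp (GEven _).val) η q
      rw [AlgHom.comp_apply, AlgHom.comp_apply] at e
      refine e.symm.trans ?_
      have e2 : body ((GEven _).val η) = 0 :=
        body_oddPair (σ := Empty) (univ : Finset (Fin k))
      rw [e2, Polynomial.coe_aeval_eq_eval]
    rw [this]
    exact fun h0 => hd (Polynomial.dvd_iff_isRoot.2 h0)
  rw [hq, map_mul, map_pow, map_zero, sub_zero, Polynomial.aeval_X] at h1
  have h2 := (isUnit_of_body_ne_zero hb).mul_left_eq_zero.1 h1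
  have h3 := congrArg (Subtype.val : GEven _ → _) h2
  refine oddPair_pow_ne_zero (σ := Empty) (univ : Finset (Fin k)) ?_
  rw [Finset.card_univ, Fintype.card_fin]
  exact h3

/-- The space with `m` odd coordinates. -/
abbrev oddSpace (m : ℕ) : SuperSpace := ⟨0, m⟩

/-- A matrix of numbers over the odd coordinates. -/
noncomputable def oddMatrix (σ : Type) (a : Matrix (Fin m) (Fin m) ℝ) :
    Matrix (oddSpace m).Idx (oddSpace m).Idx (Λ σ) :=
  fromBlocks 0 0 0 (a.map fun r => algebraMap ℂ _ (r : ℂ))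

theorem scalar_mul_oddMatrix_in {σ : Type} {η : Λ σ} (hη : η ∈ realEven σ)
    (a : Matrix (Fin m) (Fin m) ℝ) :
    MatIn (realParity σ) (scalar (oddSpace m).Idx η * oddMatrix σ a) := by
  rintro (i | i) (j | j)
  · exact i.elim0
  · exact i.elim0
  · exact j.elim0
  · rw [scalar_apply, diagonal_mul, oddMatrix, fromBlocks_apply₂₂, map_apply]
    have h := (realEven σ).mul_mem hη (algebraMap_realEven (a i j))
    exact ⟨(par_add_self 1).symm ▸ h.1, h.2⟩

theorem st_scalar_mul_oddMatrix {σ : Type} (η : Λ σ) {a : Matrix (Fin m) (Fin m) ℝ}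
    (ha : aᵀ = -a) : st (scalar (oddSpace m).Idx η * oddMatrix σ a) =
      scalar (oddSpace m).Idx η * oddMatrix σ a := by
  ext i j
  rcases i with i | i
  · exact i.elim0
  rcases j with j | j
  · exact j.elim0
  have h : a j i = -a i j := congrFun (congrFun ha i) j
  have hs : sg (par (inr i : (oddSpace m).Idx)) (par (inr j : (oddSpace m).Idx)) = -1 := by
    simp [sg, sgZ, par]
  change sg _ _ • (scalar (oddSpace m).Idx η * oddMatrix σ a) (.inr j) (.inr i) = _
  rw [hs, scalar_apply, diagonal_mul, diagonal_mul, oddMatrix, fromBlocks_apply₂₂,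
    fromBlocks_apply₂₂, map_apply, map_apply, h]
  simp

theorem exists_formal_gaussData {σ : Type} {η : Λ σ} (hη : η ∈ realEven σ) (hb : body η = 0)
    {a b : Matrix (Fin m) (Fin m) ℝ} (ha : aᵀ = -a) (hb' : bᵀ = -b) :
    ∃ D : GaussData σ (oddSpace m), D.T = scalar _ η * oddMatrix σ a ∧
      D.S = scalar _ η * oddMatrix σ b ∧ D.ys = 0 ∧ D.qs = 0 := by
  obtain ⟨u, hu⟩ : IsUnit (1 - scalar (oddSpace m).Idx η * oddMatrix σ a * Sg σ (oddSpace m) *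
      (scalar (oddSpace m).Idx η * oddMatrix σ b)) := by
    rw [Matrix.mul_assoc, Matrix.mul_assoc]
    refine IsNilpotent.isUnit_one_sub (Commute.isNilpotent_mul_right ?_ ?_)
    · exact scalar_commute _ (fun r => even_comm hη.1 r) _
    · exact (isNilpotent_of_even hη.1 hb).map (scalar (oddSpace m).Idx)
  exact ⟨{
    T := scalar _ η * oddMatrix σ a
    S := scalar _ η * oddMatrix σ b
    N := ↑u⁻¹
    ys := 0
    qs := 0
    T_in := scalar_mul_oddMatrix_in hη a
    S_in := scalar_mul_oddMatrix_in hη b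
    st_T := st_scalar_mul_oddMatrix η ha
    st_S := st_scalar_mul_oddMatrix η hb'
    left := by rw [← hu, Units.inv_mul]
    right := by rw [← hu, Units.mul_inv]
    ys_point := fun _ => zero_mem _
    qs_point := fun _ => zero_mem _
    ys_real := fun i => i.elim0
    qs_real := fun i => i.elim0 }, rfl, rfl, rfl, rfl⟩

theorem formal_E {σ : Type} {η : Λ σ} (hη : η ∈ parityPart σ 0)
    {a b : Matrix (Fin m) (Fin m) ℝ} {D : GaussData σ (oddSpace m)}
    (hT : D.T = scalar _ η * oddMatrix σ a)
    (hS : D.S = scalar _ η * oddMatrix σ b) (hy : D.ys = 0) (hq : D.qs = 0) (v) :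
    D.E v = genMap inl η * oddQuad σ a b - oddPair σ univ := by
  have hη' : genMap (inl (β := Fin m ⊕ Fin m)) η ∈ parityPart _ 0 := genMap_mem_parity _ hη
  have eY : ∀ i, D.Y v (.inr i) = oy σ i := fun i => by
    change gen _ + genMap inl (-D.ys _) = _
    rw [hy, Pi.zero_apply, neg_zero, map_zero, add_zero]
    rfl
  have eQ : ∀ i, D.Q v (.inr i) = oq σ i := fun i => by
    change gen _ + genMap inl (-D.qs _) = _
    rw [hq, Pi.zero_apply, neg_zero, map_zero, add_zero]
    rfl
  have eT : ∀ i j, D.T' (.inr i) (.inr j) = (a i j : ℂ) • genMap inl η := fun i j => by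
    change genMap inl (D.T _ _) = _
    rw [hT, scalar_apply, diagonal_mul, oddMatrix, fromBlocks_apply₂₂, map_apply, ← Algebra.commutes,
      ← Algebra.smul_def, map_smul]
  have eS : ∀ i j, D.S' (.inr i) (.inr j) = (b i j : ℂ) • genMap inl η := fun i j => by
    change genMap inl (D.S _ _) = _
    rw [hS, scalar_apply, diagonal_mul, oddMatrix, fromBlocks_apply₂₂, map_apply, ← Algebra.commutes,
      ← Algebra.smul_def, map_smul]
  rw [GaussData.E, oddQuad, oddPair]
  simp only [dotProduct, vecMul, mulVec, Fintype.sum_sum_type, Finset.univ_eq_empty,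
    Finset.sum_empty, zero_add, eY, eQ, eT, eS, mul_add, mul_smul_comm, smul_mul_assoc,
    mul_sum, sum_mul, neg_smul, one_smul, ← sub_eq_add_neg]
  refine congrArg₂ (· - ·) (congrArg₂ (· + ·) (congrArg _ ?_) (congrArg _ ?_)) rfl
  · refine sum_congr rfl fun i _ => sum_congr rfl fun j _ => ?_
    rw [← even_comm hη', ← mul_assoc, ← even_comm hη', mul_assoc]
  · refine sum_congr rfl fun i _ => sum_congr rfl fun j _ => ?_
    rw [mul_assoc]

/-- The characteristic matrix `1 + t² a b`. -/
noncomputable def oddChar (a b : Matrix (Fin m) (Fin m) ℝ) : Matrix (Fin m) (Fin m) (Polynomial ℂ) :=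
  of fun i j => Polynomial.C ((1 : Matrix (Fin m) (Fin m) ℂ) i j) +
    Polynomial.C (((a * b) i j : ℝ) : ℂ) * Polynomial.X ^ 2

theorem oddChar_eval (a b : Matrix (Fin m) (Fin m) ℝ) (t : ℝ) :
    (oddChar a b).det.eval (t : ℂ) = ((1 + t ^ 2 • (a * b)).det : ℝ) := by
  rw [← GaussData.det_ofReal, ← Polynomial.coe_evalRingHom, RingHom.map_det]
  congr 1
  ext i j
  simp only [RingHom.mapMatrix_apply, map_apply, oddChar, of_apply, Polynomial.coe_evalRingHom,
    Polynomial.eval_add, Polynomial.eval_C, Polynomial.eval_mul, Polynomial.eval_pow,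
    Polynomial.eval_X, Matrix.add_apply, Matrix.smul_apply, smul_eq_mul, ofReal_add, ofReal_mul,
    ofReal_pow, one_apply]
  split_ifs <;> simp [mul_comm]

theorem aeval_oddPoly_sq {σ : Type} [Fintype σ] {η : Λ σ} (hη : η ∈ realEven σ)
    (hb : body η = 0) {a b : Matrix (Fin m) (Fin m) ℝ} (ha : aᵀ = -a) (hb' : bᵀ = -b) {ħ : ℝ}
    (hħ : 0 < ħ) :
    Polynomial.aeval η (oddPoly ħ a b ^ 2) = Polynomial.aeval η (oddChar a b).det := by
  obtain ⟨D, hT, hS, hy, hq⟩ := exists_formal_gaussData hη hb ha hb'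
  set z := Polynomial.aeval η (oddPoly ħ a b) with hz
  have hE := formal_E hη.1 hT hS hy hq
  have h1 : GaussData.SInt ħ (oddSpace m) (D.g ħ) z := by
    have h := hasSuperIntegral_zero_dim ħ (fun y q : Fin 0 → ℝ => D.g ħ (elim y q))
    rw [GaussData.g, hE, berezin_eq_aeval ħ a b hη.1] at h
    exact h
  have hbz : body z = 1 := by
    rw [hz, ← Polynomial.aeval_algHom_apply, hb, Polynomial.coe_aeval_eq_eval,
      oddPoly_eval_zero hħ.ne']
  have hM : ∀ i j, D.M (.inr i) (.inr j) = algebraMap ℂ _ ((1 : Matrix (Fin m) (Fin m) ℂ) i j) +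
      algebraMap ℂ _ (((a * b) i j : ℝ) : ℂ) * η ^ 2 := by
    intro i j
    change (1 : Matrix (oddSpace m).Idx (oddSpace m).Idx (Λ σ)) (.inr i) (.inr j) -
      (D.T * Sg σ (oddSpace m) * D.S) (.inr i) (.inr j) = _
    rw [GaussData.mul_Sg_mul_apply, Fintype.sum_sum_type, Finset.univ_eq_empty, Finset.sum_empty, zero_add,
      sub_eq_add_neg, hT, hS, ← sum_neg_distrib]
    congr 1
    · simp only [one_apply, Sum.inr.injEq]
      split_ifs <;> simp
    · rw [mul_apply, ofReal_sum, map_sum, sum_mul]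
      refine sum_congr rfl fun k _ => ?_
      rw [scalar_apply, diagonal_mul, diagonal_mul, oddMatrix, oddMatrix, fromBlocks_apply₂₂,
        fromBlocks_apply₂₂, map_apply, map_apply, ← Algebra.commutes, ← Algebra.commutes,
        ← Algebra.smul_def, ← Algebra.smul_def, smul_mul_smul_comm, ← Algebra.smul_def, sq]
      simp [sgn]
  have hM2 : ∀ i j, body (D.M.toBlocks₂₂ i j) = (1 : Matrix (Fin m) (Fin m) ℂ) i j := by
    intro i j
    change body (D.M (.inr i) (.inr j)) = _
    rw [hM, map_add, map_mul, map_pow, hb, body_algebraMap]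
    simp
  have hbB : body (Ber D.M : Λ σ) = 1 := by
    have h := body_ber D.M_par D.left
    have e : D.M.toBlocks₂₂.map body = (1 : Matrix (Fin m) (Fin m) ℂ) := Matrix.ext hM2
    rw [e, det_one, mul_one, det_isEmpty] at h
    exact h
  have hzz := D.sq_mul_ber hħ h1
  rw [hbz, hbB, one_pow, one_mul, map_one] at hzz
  have hX : (berX D.M).det = 1 := det_isEmpty
  have hD : ((berD D.M).det : Λ σ) = Polynomial.aeval η (oddChar a b).det := by
    have e0 : ∀ p : Polynomial ℂ, ((Polynomial.aeval (⟨η, hη.1⟩ : GEven σ) p : GEven σ) : Λ σ) =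
      Polynomial.aeval η p := fun p => (Polynomial.aeval_algHom_apply (GEven σ).val _ p).symm
    rw [← e0, AlgHom.map_det]
    congr 2
    refine evenVal_injective ?_
    rw [evenVal_berD D.M_par]
    ext i j
    rw [evenVal, map_apply, AlgHom.mapMatrix_apply, map_apply]
    refine (hM i j).trans ?_
    refine Eq.trans ?_ (e0 _).symm
    rw [oddChar, of_apply, map_add, map_mul, map_pow, Polynomial.aeval_C, Polynomial.aeval_C,
      Polynomial.aeval_X]
  have hinv : ((berD D.M).det : Λ σ) * (Ber D.M : Λ σ) = 1 := by
    have e : (berD D.M).det * Ber D.M = 1 := by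
      rw [ber_eq, hX, one_mul, Ring.mul_inverse_cancel _ (isUnit_berD_det D.M_par D.left)]
    exact congrArg Subtype.val e
  have hinv' : (Ber D.M : Λ σ) * ((berD D.M).det : Λ σ) = 1 := by
    rw [even_comm (Ber D.M).2, hinv]
  rw [map_pow, ← hz, sq, ← hD]
  calc z * z = z * z * ((Ber D.M : Λ σ) * ((berD D.M).det : Λ σ)) := by
        rw [hinv', mul_one]
    _ = _ := by rw [← mul_assoc, hzz, one_mul]

variable {a b : Matrix (Fin m) (Fin m) ℝ} {ħ : ℝ}

theorem oddPair_real (s : Finset (Fin m)) : oddPair Empty s ∈ realEven (Empty ⊕ (Fin m ⊕ Fin m)) :=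
  ⟨oddPair_even s, Subalgebra.sum_mem _ fun _ _ => Subalgebra.mul_mem _
    (Algebra.subset_adjoin ⟨_, rfl⟩) (Algebra.subset_adjoin ⟨_, rfl⟩)⟩

theorem oddPoly_sq (ha : aᵀ = -a) (hb : bᵀ = -b) (hħ : 0 < ħ) :
    oddPoly ħ a b ^ 2 = (oddChar a b).det :=
  sub_eq_zero.1 (polynomial_eq_zero fun n => by
    rw [map_sub, aeval_oddPoly_sq (oddPair_real _) (body_oddPair _) ha hb hħ, sub_self])

theorem oddPoly_congr (ha : aᵀ = -a) (hb : bᵀ = -b) (hħ : 0 < ħ) : oddPoly ħ a b = oddPoly 1 a b := by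
  have h : (oddPoly ħ a b - oddPoly 1 a b) * (oddPoly ħ a b + oddPoly 1 a b) = 0 := by
    have := (oddPoly_sq ha hb hħ).trans (oddPoly_sq ha hb one_pos).symm
    linear_combination this
  rcases mul_eq_zero.1 h with h | h
  · exact sub_eq_zero.1 h
  · have := congrArg (Polynomial.eval 0) h
    rw [Polynomial.eval_add, oddPoly_eval_zero hħ.ne', oddPoly_eval_zero one_ne_zero] at this
    norm_num at this

theorem oddPoly_one_sq (ha : aᵀ = -a) (hb : bᵀ = -b) :
    (oddPoly 1 a b).eval 1 ^ 2 = ((1 + a * b).det : ℝ) := by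
  have h := oddChar_eval a b 1
  rw [ofReal_one, one_pow, one_smul] at h
  rw [← h, ← oddPoly_sq ha hb one_pos, Polynomial.eval_pow]

theorem oddPoly_one_pos (ha : aᵀ = -a) (hb : bᵀ = -b)
    (hpath : ∀ t : ℝ, 0 ≤ t → t ≤ 1 → (1 + t • (a * b)).det ≠ 0) :
    ∃ r : ℝ, 0 < r ∧ (oddPoly 1 a b).eval 1 = r := by
  have hsq : ∀ t : ℝ, ((oddPoly 1 a b).eval (t : ℂ)) ^ 2 = ((1 + t ^ 2 • (a * b)).det : ℝ) := fun t => by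
    rw [← oddChar_eval, ← oddPoly_sq ha hb one_pos, Polynomial.eval_pow]
  have hpos : ∀ t : ℝ, 0 ≤ t → t ≤ 1 → 0 < (1 + t • (a * b)).det := fun t h0 h1 => by
    have h := hess_path_pos (T := -a) (S := b) (fun t h0 h1 => by
      rw [Matrix.neg_mul, smul_neg, sub_neg_eq_add]; exact hpath t h0 h1) h0 h1
    rwa [Matrix.neg_mul, smul_neg, sub_neg_eq_add] at h
  have hre : ∀ t : ℝ, 0 ≤ t → t ≤ 1 → ((oddPoly 1 a b).eval (t : ℂ)).im = 0 ∧
      ((oddPoly 1 a b).eval (t : ℂ)).re ≠ 0 := fun t h0 h1 => by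
    have h := hsq t
    have hp := hpos (t ^ 2) (sq_nonneg t) (pow_le_one₀ h0 h1)
    set w := (oddPoly 1 a b).eval (t : ℂ)
    have h2 := congrArg re h
    have h3 := congrArg im h
    rw [sq, mul_re, ofReal_re] at h2
    rw [sq, mul_im, ofReal_im] at h3
    have hr : w.re ≠ 0 := fun h0 => by
      rw [h0] at h2
      nlinarith [mul_self_nonneg w.im]
    refine ⟨?_, hr⟩
    have : w.re * w.im = 0 := by linarith
    exact (mul_eq_zero.1 this).resolve_left hr
  have hc : Continuous fun t : ℝ => ((oddPoly 1 a b).eval (t : ℂ)).re :=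
    continuous_re.comp ((oddPoly 1 a b).continuous.comp continuous_ofReal)
  have h1 := hre 1 zero_le_one le_rfl
  rw [ofReal_one] at h1
  refine ⟨((oddPoly 1 a b).eval 1).re, ?_, Complex.ext (by simp) (by simpa using h1.1)⟩
  by_contra hneg
  obtain ⟨t, ht, ht'⟩ := intermediate_value_Icc' (zero_le_one' ℝ) hc.continuousOn
    (show (0 : ℝ) ∈ _ from ⟨by simpa using not_lt.1 hneg, by
      simp [oddPoly_eval_zero]⟩)
  exact (hre t ht.1 ht.2).2 ht'

end OddDeterminant

namespace GaussData

variable {κ σ : Type} {V : SuperSpace}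

theorem blockO_antisymm {X : Matrix V.Idx V.Idx (Λ σ)} (h : st X = X) :
    (blockO X)ᵀ = -blockO X := by
  ext i j
  rw [transpose_apply, Matrix.neg_apply, blockO, of_apply, of_apply]
  conv_lhs => rw [← h]
  simp [st, par, sg, sgZ]

theorem blockE_mmap (f : κ → σ) (X : Matrix V.Idx V.Idx (Λ κ)) :
    blockE (mmap f X) = blockE X := by
  ext i j
  simp [blockE, mmap]

theorem blockO_mmap (f : κ → σ) (X : Matrix V.Idx V.Idx (Λ κ)) :
    blockO (mmap f X) = blockO X := by
  ext i j
  simp [blockO, mmap]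

theorem det_path_ne_zero (D : GaussData κ V) {t : ℝ}
    (h : IsUnit (1 - (t : ℂ) • (D.T * Sg κ V * D.S))) :
    (1 - t • (blockE D.T * blockE D.S)).det ≠ 0 ∧ (1 + t • (blockO D.T * blockO D.S)).det ≠ 0 := by
  obtain ⟨u, hu⟩ := h
  set Mt := 1 - (t : ℂ) • (D.T * Sg κ V * D.S) with hMt
  have hin : MatIn (parityR κ) Mt := fun i j => by
    refine sub_mem (MatIn.one i j) ?_
    exact smul_mem (parityPart κ _) _ (((D.T_par.mul MatIn.sgm).mul D.S_par) i j)
  have hb : ∀ i j, body (Mt i j) =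
      (1 : Matrix V.Idx V.Idx ℂ) i j - t * ((1 : Matrix V.Idx V.Idx ℂ) i j - body (D.M i j)) := by
    intro i j
    have e : body ((1 : Matrix V.Idx V.Idx (Λ κ)) i j) = (1 : Matrix V.Idx V.Idx ℂ) i j := by
      simp only [one_apply]
      split_ifs <;> simp
    rw [hMt, M, Matrix.sub_apply, Matrix.sub_apply, Matrix.smul_apply, map_sub, map_sub, map_smul, e,
      smul_eq_mul, sub_sub_cancel]
  have h0 := det_body_ne_zero hin (N := ↑u⁻¹) (by rw [← hu, Units.inv_mul])
  have e1 : Mt.toBlocks₁₁.map body = (1 - t • (blockE D.T * blockE D.S)).map ofReal := by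
    ext i j
    have h1 := congrFun (congrFun D.body_M₁₁ i) j
    change body (D.M (.inl i) (.inl j)) = _ at h1
    change body (Mt (.inl i) (.inl j)) = _
    rw [hb, h1]
    simp only [one_apply, Sum.inl.injEq, map_apply, Matrix.sub_apply, Matrix.smul_apply, smul_eq_mul]
    split_ifs <;> push_cast <;> ring
  have e2 : Mt.toBlocks₂₂.map body = (1 + t • (blockO D.T * blockO D.S)).map ofReal := by
    ext i j
    have h1 := congrFun (congrFun D.body_M₂₂ i) j
    change body (D.M (.inr i) (.inr j)) = _ at h1
    change body (Mt (.inr i) (.inr j)) = _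
    rw [hb, h1]
    simp only [one_apply, Sum.inr.injEq, map_apply, Matrix.add_apply, Matrix.smul_apply, smul_eq_mul]
    split_ifs <;> push_cast <;> ring
  rw [e1, e2, det_ofReal, det_ofReal] at h0
  exact ⟨ofReal_ne_zero.1 h0.1, ofReal_ne_zero.1 h0.2⟩

theorem dlog_mmap [Fintype κ] [Fintype σ] (f : κ → σ) {D₀ : GaussData κ V} {D : GaussData σ V}
    (hT : D.T = mmap f D₀.T) (hS : D.S = mmap f D₀.S) : D.dlog = genMap f D₀.dlog := by
  have hN : D.N = mmap f D₀.N := by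
    have h1 : mmap f D₀.N * D.M = 1 := by
      have h := congrArg (mmap f) D₀.left
      rw [mmap_mul, mmap_sub, mmap_one, mmap_mul, mmap_mul, mmap_sgm, ← hT, ← hS] at h
      exact h
    calc D.N = mmap f D₀.N * D.M * D.N := by rw [h1, Matrix.one_mul]
      _ = _ := by rw [Matrix.mul_assoc, D.right, Matrix.mul_one]
  have hd : ∀ X : Matrix V.Idx V.Idx (Λ κ), (mmap f X).map deg = mmap f (X.map deg) :=
    fun X => Matrix.ext fun i j => euler_genMap _ _ _ (fun _ => rfl) _
  have ht : ∀ X : Matrix V.Idx V.Idx (Λ κ), (mmap f X).trace = genMap f X.trace :=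
    fun X => (map_sum (genMap f) _ _).symm
  rw [dlog, dlog, hN, hT, hS, hd, hd, ← mmap_mul, ← mmap_mul, ← mmap_mul, ← mmap_mul, ht, ht, map_add]

/-- The Gaussian superintegral is `exp (-c)`, where `c` is a half of a logarithm of the Berezinian. -/
theorem exists_multiplier [Fintype κ] (D₀ : GaussData κ V) : ∃ c : GEven κ,
    gexp ((2 : ℂ) • (c : Λ κ)) = (Ber D₀.M : Λ κ) ∧
    ((∀ t : ℝ, 0 ≤ t → t ≤ 1 → IsUnit (1 - (t : ℂ) • (D₀.T * Sg κ V * D₀.S))) →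
      (c : Λ κ) ∈ realPart κ) ∧
    ∀ (σ : Type) [Fintype σ] (f : κ → σ) (D : GaussData σ V), D.T = mmap f D₀.T → D.S = mmap f D₀.S →
      ∀ ħ : ℝ, 0 < ħ → SInt ħ V (D.g ħ) (genMap f (gexp (-(c : Λ κ)))) := by
  obtain ⟨ζ, hζ, hζp, hlim⟩ := exists_gauss_const (blockE_symm D₀.st_T) (blockE_symm D₀.st_S)
    D₀.det_blockE_ne_zero
  have aT := blockO_antisymm D₀.st_T
  have aS := blockO_antisymm D₀.st_S
  set o := (oddPoly 1 (blockO D₀.T) (blockO D₀.S)).eval 1 with ho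
  have ho2 := oddPoly_one_sq aT aS
  rw [← ho] at ho2
  have hdE : ((1 - blockE D₀.T * blockE D₀.S).det : ℂ) ≠ 0 := ofReal_ne_zero.2 D₀.det_blockE_ne_zero
  have hdO : ((1 + blockO D₀.T * blockO D₀.S).det : ℂ) ≠ 0 := ofReal_ne_zero.2 D₀.det_blockO_ne_zero
  have hζ0 : ζ ≠ 0 := fun h => by
    rw [h] at hζ
    simp at hζ
  have ho0 : o ≠ 0 := fun h => hdO (by rw [← ho2, h]; simp)
  have hw : ζ * o ≠ 0 := mul_ne_zero hζ0 ho0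
  have hexp : Complex.exp (-2 * Complex.log (ζ * o)) = body (Ber D₀.M : Λ κ) := by
    have hB := body_ber D₀.M_par D₀.left
    rw [D₀.body_M₁₁, D₀.body_M₂₂, det_ofReal, det_ofReal, ← ho2] at hB
    have h2 : Complex.exp (-2 * Complex.log (ζ * o)) * (ζ * o) ^ 2 = 1 := by
      have e : (ζ * o) ^ 2 = Complex.exp ((2 : ℕ) * Complex.log (ζ * o)) := by
        rw [Complex.exp_nat_mul, Complex.exp_log hw]
      rw [e, ← Complex.exp_add]
      simp
    have h3 : body (Ber D₀.M : Λ κ) * (ζ * o) ^ 2 = 1 := by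
      rw [mul_pow, mul_comm (ζ ^ 2), ← mul_assoc, hB, mul_comm, hζ]
    exact mul_right_cancel₀ (pow_ne_zero 2 hw) (h2.trans h3.symm)
  obtain ⟨c₂, hc₂, hbody, hgexp, hreal⟩ := exists_log (ber_realEven D₀.M_in D₀.left) hexp
  have hc : (1 / 2 : ℂ) • c₂ ∈ parityPart κ 0 := smul_mem _ _ hc₂
  refine ⟨⟨(1 / 2 : ℂ) • c₂, hc⟩, ?_, fun hpath => ?_, ?_⟩
  · change gexp ((2 : ℂ) • (1 / 2 : ℂ) • c₂) = _
    rw [smul_smul, ← hgexp]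
    norm_num
  · have hp := fun t h0 h1 => D₀.det_path_ne_zero (hpath t h0 h1)
    obtain ⟨r, hr, hr'⟩ := hζp fun t h0 h1 => (hp t h0 h1).1
    obtain ⟨s, hs, hs'⟩ := oddPoly_one_pos aT aS fun t h0 h1 => (hp t h0 h1).2
    have h := hreal ⟨-2 * Real.log (r * s), by
      rw [← ho] at hs'
      rw [hr', hs', ← ofReal_mul, ← Complex.ofReal_log (mul_pos hr hs).le]
      push_cast
      rfl⟩
    have h2 := (realPart κ).mul_mem (algebraMap_realEven (1 / 2)).2 h
    rw [← Algebra.smul_def] at h2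
    norm_num at h2
    simpa using h2
  · intro σ _ f D hT hS ħ hħ
    set c := (1 / 2 : ℂ) • c₂ with hcdef
    obtain ⟨z, hz⟩ := D.exists_SInt hħ (D.isOsc_g ħ)
    have hze : z ∈ parityPart σ 0 := hz.mem_parity fun y q => D.g_even ħ _
    have hbz : body z = ζ * o := by
      rw [D.body_integral hz (ζ := ζ) (by rw [hT, hS, blockE_mmap, blockE_mmap]; exact hlim ħ hħ), hT,
        hS, blockO_mmap, blockO_mmap, oddPoly_congr aT aS hħ]
    have hdc₂ : deg c₂ = -D₀.dlog := by
      have h1 : deg (gexp c₂) = deg c₂ * gexp c₂ := euler_gexp _ hc₂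
      rw [hgexp, D₀.deg_ber_M, ← hgexp] at h1
      have h2 := congrArg (· * gexp (-c₂)) h1
      simpa only [mul_assoc, gexp_mul_neg hc₂, mul_one] using h2.symm
    have hdc : deg (genMap f (gexp c)) = -(1 / 2 : ℂ) • (D.dlog * genMap f (gexp c)) := by
      rw [deg, euler_genMap f (fun _ => 1) _ (fun _ => rfl), euler_gexp _ hc, hcdef, map_smul, hdc₂,
        map_mul, map_smul, map_neg, ← dlog_mmap f hT hS, smul_mul_assoc, neg_mul, smul_neg, neg_smul]
    have hu : deg (z * genMap f (gexp c)) = 0 := by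
      have hm : deg (z * genMap f (gexp c)) = deg z * genMap f (gexp c) + z * deg (genMap f (gexp c)) :=
        euler_mul _ _ _
      rw [hm, hdc, D.deg_integral hħ hz, smul_mul_assoc, mul_smul_comm,
        ← mul_assoc z, even_comm hze D.dlog, neg_smul, add_neg_cancel]
    have hbu : body (z * genMap f (gexp c)) = 1 := by
      rw [map_mul, body_genMap, body_gexp hc, hbz, hcdef, map_smul, hbody]
      have : (1 / 2 : ℂ) • (-2 * Complex.log (ζ * o)) = -Complex.log (ζ * o) := by
        rw [smul_eq_mul]
        ring
      rw [this, Complex.exp_neg, Complex.exp_log hw, mul_inv_cancel₀ hw]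
    have h1 : z * genMap f (gexp c) = 1 := by
      rw [eq_body_of_euler_eq_zero hu, hbu, map_one]
    have h2 : z = genMap f (gexp (-c)) := by
      calc z = z * genMap f (gexp c) * genMap f (gexp (-c)) := by
            rw [mul_assoc, ← map_mul, gexp_mul_neg hc, map_one, mul_one]
        _ = _ := by rw [h1, one_mul]
    rw [h2] at hz
    exact hz

end GaussData

section Multiplier

variable {κ : Type} [Fintype κ] {V : SuperSpace}

open Classical in
/-- The exponent `c = ½ ln Ber (1 - T S)` of the multiplier of a composition. -/
noncomputable def multiplier (V : SuperSpace) (T S : V.Idx → V.Idx → Λ κ) : GEven κ :=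
  if h : ∃ D : GaussData κ V, D.T = of T ∧ D.S = of S then h.choose.exists_multiplier.choose else 0

theorem multiplier_spec (D : GaussData κ V) :
    gexp ((2 : ℂ) • (multiplier V D.T D.S : Λ κ)) = (Ber D.M : Λ κ) ∧
    ((∀ t : ℝ, 0 ≤ t → t ≤ 1 → IsUnit (1 - (t : ℂ) • (D.T * Sg κ V * D.S))) →
      (multiplier V D.T D.S : Λ κ) ∈ realPart κ) ∧
    ∀ (σ : Type) [Fintype σ] (f : κ → σ) (D' : GaussData σ V), D'.T = mmap f D.T → D'.S = mmap f D.S →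
      ∀ ħ : ℝ, 0 < ħ →
        GaussData.SInt ħ V (D'.g ħ) (genMap f (gexp (-(multiplier V D.T D.S : Λ κ)))) := by
  have h : ∃ D' : GaussData κ V, D'.T = of D.T ∧ D'.S = of D.S := ⟨D, rfl, rfl⟩
  have hs := h.choose_spec
  have hm : multiplier V D.T D.S = h.choose.exists_multiplier.choose := dif_pos h
  have h1 := h.choose.exists_multiplier.choose_spec
  rw [← hm, GaussData.M, hs.1, hs.2] at h1
  exact h1

end Multiplier

section Real

variable {σ τ : Type} {α β α' β' : Type}

theorem genMap_mem_realPart (f : σ → τ) {x : Λ σ} (hx : x ∈ realPart σ) :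
    genMap f x ∈ realPart τ := by
  induction hx using Algebra.adjoin_induction with
  | mem x hx => obtain ⟨k, rfl⟩ := hx; rw [genMap_gen]; exact Algebra.subset_adjoin ⟨_, rfl⟩
  | algebraMap r =>
    rw [IsScalarTower.algebraMap_apply ℝ ℂ (Λ σ), AlgHom.commutes]
    exact (algebraMap_realEven r).2
  | add x y _ _ hx hy => rw [map_add]; exact Subalgebra.add_mem _ hx hy
  | mul x y _ _ hx hy => rw [map_mul]; exact Subalgebra.mul_mem _ hx hy

theorem MatIn.mmap_real {X : Matrix (α ⊕ β) (α' ⊕ β') (Λ σ)} (h : MatIn (realParity σ) X)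
    (f : σ → τ) : MatIn (realParity τ) (SuperThick.mmap f X) := fun i j =>
  ⟨genMap_mem_parity f (h i j).1, genMap_mem_realPart f (h i j).2⟩

theorem VecIn.vmap_real {v : α ⊕ β → Λ σ} (h : VecIn (realParity σ) v)
    (f : σ → τ) : VecIn (realParity τ) (SuperThick.vmap f v) := fun i =>
  ⟨genMap_mem_parity f (h i).1, genMap_mem_realPart f (h i).2⟩

theorem coords_real {V : SuperSpace} (e : Fin V.even → ℝ) (o : Fin V.odd → τ) :
    VecIn (realParity τ) (coords e o) := by
  rintro (a | a)
  · exact ⟨algebraMap_even _, (algebraMap_realEven (e a)).2⟩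
  · exact ⟨gen_odd _, Algebra.subset_adjoin ⟨_, rfl⟩⟩

end Real

namespace QuadAction

variable {κ τ υ : Type} {V₁ V₂ V₃ : SuperSpace}

theorem eval_add_left (S : QuadAction κ V₁ V₂) (f : κ → τ) {x u : V₁.Idx → Λ τ}
    (hx : IsPoint x) (hu : IsPoint u) (q : V₂.Idx → Λ τ) :
    S.eval (genMap f) (x + u) q = S.eval (genMap f) x q + u ⬝ᵥ S.derivX (genMap f) x q +
      (1 / 2 : ℂ) • (u ⬝ᵥ (u ᵥ* mmap f (of S.xx))) := by
  have e1 : (fun a => genMap f (S.linX a) + S.derivX (genMap f) (x + u) q a) =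
      (fun a => genMap f (S.linX a) + S.derivX (genMap f) x q a) + u ᵥ* mmap f (of S.xx) := by
    rw [derivX_eq_vecMul, derivX_eq_vecMul, add_vecMul]
    funext a
    simp only [Pi.add_apply]
    abel
  have e2 : (fun i => genMap f (S.linQ i) + S.derivQ (genMap f) (x + u) q i) =
      (fun i => genMap f (S.linQ i) + S.derivQ (genMap f) x q i) + u ᵥ* mmap f (of S.xq) := by
    rw [derivQ_eq_vecMul, derivQ_eq_vecMul, add_vecMul]
    funext a
    simp only [Pi.add_apply]
    abel
  have e3 : u ⬝ᵥ S.derivX (genMap f) x q = u ⬝ᵥ vmap f S.linX + x ⬝ᵥ (u ᵥ* mmap f (of S.xx)) +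
      (u ᵥ* mmap f (of S.xq)) ⬝ᵥ q := by
    rw [derivX_eq_vecMul, dotProduct_add, dotProduct_add, dotProduct_mulVec,
      dot_symm_lower (by rw [← mmap_st, st_xx]) hu hx]
  have e4 : (fun a => genMap f (S.linX a) + S.derivX (genMap f) x q a) =
      vmap f S.linX + S.derivX (genMap f) x q := rfl
  rw [eval_eq, eval_eq, e1, e2, e4]
  simp only [add_dotProduct, dotProduct_add]
  rw [e3]
  module

theorem eval_add_right (S : QuadAction κ V₁ V₂) (f : κ → τ) (x : V₁.Idx → Λ τ)
    {q w : V₂.Idx → Λ τ} (hq : IsPoint q) (hw : IsPoint w) :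
    S.eval (genMap f) x (q + w) = S.eval (genMap f) x q + S.derivQ (genMap f) x q ⬝ᵥ w +
      (1 / 2 : ℂ) • ((mmap f (of S.qq) *ᵥ w) ⬝ᵥ w) := by
  have e1 : (fun a => genMap f (S.linX a) + S.derivX (genMap f) x (q + w) a) =
      (fun a => genMap f (S.linX a) + S.derivX (genMap f) x q a) + mmap f (of S.xq) *ᵥ w := by
    rw [derivX_eq_vecMul, derivX_eq_vecMul, mulVec_add]
    funext a
    simp only [Pi.add_apply]
    abel
  have e2 : (fun i => genMap f (S.linQ i) + S.derivQ (genMap f) x (q + w) i) =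
      (fun i => genMap f (S.linQ i) + S.derivQ (genMap f) x q i) + mmap f (of S.qq) *ᵥ w := by
    rw [derivQ_eq_vecMul, derivQ_eq_vecMul, mulVec_add]
    funext a
    simp only [Pi.add_apply]
    abel
  have e3 : S.derivQ (genMap f) x q ⬝ᵥ w = vmap f S.linQ ⬝ᵥ w + x ⬝ᵥ (mmap f (of S.xq) *ᵥ w) +
      (mmap f (of S.qq) *ᵥ w) ⬝ᵥ q := by
    rw [derivQ_eq_vecMul, add_dotProduct, add_dotProduct, dotProduct_mulVec,
      dot_symm_upper (by rw [← mmap_st, st_qq]) hq hw]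
  have e4 : (fun i => genMap f (S.linQ i) + S.derivQ (genMap f) x q i) =
      vmap f S.linQ + S.derivQ (genMap f) x q := rfl
  rw [eval_eq, eval_eq, e1, e2, e4]
  simp only [add_dotProduct, dotProduct_add]
  rw [e3]
  module

theorem vmap_derivX (S : QuadAction κ V₁ V₂) (g : τ → υ) (f : κ → τ) (x : V₁.Idx → Λ τ)
    (q : V₂.Idx → Λ τ) : vmap g (S.derivX (genMap f) x q) =
      S.derivX (genMap (g ∘ f)) (vmap g x) (vmap g q) := by
  funext a
  simp [vmap, derivX, genMap_genMap]

theorem vmap_derivQ (S : QuadAction κ V₁ V₂) (g : τ → υ) (f : κ → τ) (x : V₁.Idx → Λ τ)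
    (q : V₂.Idx → Λ τ) : vmap g (S.derivQ (genMap f) x q) =
      S.derivQ (genMap (g ∘ f)) (vmap g x) (vmap g q) := by
  funext a
  simp [vmap, derivQ, genMap_genMap]

theorem IsCrit.vmap {S₃₂ : QuadAction κ V₂ V₃} {S₂₁ : QuadAction κ V₁ V₂} {f : κ → τ}
    {x : V₁.Idx → Λ τ} {r : V₃.Idx → Λ τ} {y q : V₂.Idx → Λ τ}
    (h : IsCrit S₃₂ S₂₁ f x r y q) (g : τ → υ) :
    IsCrit S₃₂ S₂₁ (g ∘ f) (vmap g x) (vmap g r) (vmap g y) (vmap g q) :=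
  ⟨(congrArg (SuperThick.vmap g) h.1).trans (vmap_derivX _ _ _ _ _),
    (congrArg (SuperThick.vmap g) h.2).trans (vmap_derivQ _ _ _ _ _)⟩

section Crit

variable [Finite κ] {S₃₂ : QuadAction κ V₂ V₃} {S₂₁ : QuadAction κ V₁ V₂} (f : κ → τ)

/-- The expansion of the exponent at a critical point. -/
theorem eval_add_eval_sub_pairing (h : Composable S₃₂ S₂₁) {x : V₁.Idx → Λ τ}
    {r : V₃.Idx → Λ τ} {y q u w : V₂.Idx → Λ τ} (hx : IsPoint x) (hy : IsPoint y)
    (hq : IsPoint q) (hu : IsPoint u) (hw : IsPoint w) (hc : IsCrit S₃₂ S₂₁ f x r y q) :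
    S₃₂.eval (genMap f) (y + u) r + S₂₁.eval (genMap f) x (q + w) - pairing (y + u) (q + w) =
      (comp S₃₂ S₂₁ h).eval (genMap f) x r +
        ((1 / 2 : ℂ) • (u ⬝ᵥ (u ᵥ* mmap f (of S₃₂.xx))) +
          (1 / 2 : ℂ) • ((mmap f (of S₂₁.qq) *ᵥ w) ⬝ᵥ w) + (-1 : ℂ) • (u ⬝ᵥ w)) := by
  rw [comp_eval f h hx hy hq hc, eval_add_left _ _ hy hu, eval_add_right _ _ _ hq hw, ← hc.1, ← hc.2]
  change _ - (y + u) ⬝ᵥ (q + w) = _ - y ⬝ᵥ q + _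
  simp only [add_dotProduct, dotProduct_add]
  module

variable (S₃₂ S₂₁) in
/-- The momentum of the critical point. -/
noncomputable def critQ (x : V₁.Idx → Λ τ) (r : V₃.Idx → Λ τ) :
    V₂.Idx → Λ τ :=
  mmap f (compN S₃₂ S₂₁) *ᵥ (vmap f S₃₂.linX + (mmap f (of S₃₂.xx) * Sg τ V₂) *ᵥ
    (vmap f S₂₁.linQ + (st (mmap f (of S₂₁.xq)) * Sg τ V₁) *ᵥ x) + mmap f (of S₃₂.xq) *ᵥ r)

variable (S₃₂ S₂₁) in
/-- The position of the critical point. -/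
noncomputable def critY (x : V₁.Idx → Λ τ) (r : V₃.Idx → Λ τ) :
    V₂.Idx → Λ τ :=
  vmap f S₂₁.linQ + (st (mmap f (of S₂₁.xq)) * Sg τ V₁) *ᵥ x +
    mmap f (of S₂₁.qq) *ᵥ critQ S₃₂ S₂₁ f x r

variable (h : Composable S₃₂ S₂₁) {x : V₁.Idx → Λ τ} {r : V₃.Idx → Λ τ}
  (hx : VecIn (realParity τ) x) (hr : VecIn (realParity τ) r)

include h hx hr

theorem critQ_in : VecIn (realParity τ) (critQ S₃₂ S₂₁ f x r) :=
  ((compN_in h).mmap_real f).mulVec (((S₃₂.linX_in.vmap_real f).add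
    (((S₃₂.xx_in.mmap_real f).mul MatIn.sgm).mulVec ((S₂₁.linQ_in.vmap_real f).add
      (((S₂₁.xq_in.mmap_real f).st.mul MatIn.sgm).mulVec hx)))).add
        ((S₃₂.xq_in.mmap_real f).mulVec hr))

theorem critY_in : VecIn (realParity τ) (critY S₃₂ S₂₁ f x r) :=
  ((S₂₁.linQ_in.vmap_real f).add (((S₂₁.xq_in.mmap_real f).st.mul MatIn.sgm).mulVec hx)).add
    ((S₂₁.qq_in.mmap_real f).mulVec (critQ_in f h hx hr))

theorem isCrit_crit : IsCrit S₃₂ S₂₁ f x r (critY S₃₂ S₂₁ f x r) (critQ S₃₂ S₂₁ f x r) :=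
  (isCrit_iff f h hx.of_real (critY_in f h hx hr).of_real).2 ⟨rfl, rfl⟩

/-- The Gaussian data of the exponent of a composition. -/
noncomputable def gaussData : GaussData τ V₂ where
  T := mmap f (of S₃₂.xx)
  S := mmap f (of S₂₁.qq)
  N := mmap f (compN S₃₂ S₂₁)
  ys := critY S₃₂ S₂₁ f x r
  qs := critQ S₃₂ S₂₁ f x r
  T_in := S₃₂.xx_in.mmap_real f
  S_in := S₂₁.qq_in.mmap_real f
  st_T := by rw [← mmap_st, st_xx]
  st_S := by rw [← mmap_st, st_qq]
  left := mmap_compN_mul f h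
  right := mmap_mul_compN f h
  ys_point := (critY_in f h hx hr).of_real
  qs_point := (critQ_in f h hx hr).of_real
  ys_real := fun i => body_real (critY_in f h hx hr (.inl i)).2
  qs_real := fun i => body_real (critQ_in f h hx hr (.inl i)).2

theorem exponent_eq (ye qe : Fin V₂.even → ℝ) :
    S₃₂.eval (genMap (inl ∘ f)) (coords ye fun a => inr (inl a)) (vmap inl r) +
      S₂₁.eval (genMap (inl ∘ f)) (vmap inl x) (coords qe fun a => inr (inr a)) -
        pairing (coords ye fun a => inr (inl a)) (coords qe fun a => inr (inr a)) =
      genMap (inl (β := Fin V₂.odd ⊕ Fin V₂.odd)) ((comp S₃₂ S₂₁ h).eval (genMap f) x r) +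
        (gaussData f h hx hr).E (elim ye qe) := by
  set D := gaussData f h hx hr
  set g : τ → τ ⧺ V₂.odd := inl
  have hy := critY_in f h hx hr
  have hq := critQ_in f h hx hr
  have ey : (coords ye fun a => inr (inl a) : V₂.Idx → Λ (τ ⧺ V₂.odd)) =
      vmap g (critY S₃₂ S₂₁ f x r) + D.Y (elim ye qe) := by
    funext a
    have e : D.Y (elim ye qe) a = (coords ye fun a => inr (inl a) : V₂.Idx → _) a +
        genMap g (-critY S₃₂ S₂₁ f x r a) := by
      rcases a with a | a <;> rfl
    rw [Pi.add_apply, e, map_neg, vmap]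
    abel
  have eq : (coords qe fun a => inr (inr a) : V₂.Idx → Λ (τ ⧺ V₂.odd)) =
      vmap g (critQ S₃₂ S₂₁ f x r) + D.Q (elim ye qe) := by
    funext a
    have e : D.Q (elim ye qe) a = (coords qe fun a => inr (inr a) : V₂.Idx → _) a +
        genMap g (-critQ S₃₂ S₂₁ f x r a) := by
      rcases a with a | a <;> rfl
    rw [Pi.add_apply, e, map_neg, vmap]
    abel
  have hmm : ∀ X : Matrix V₂.Idx V₂.Idx (Λ κ), mmap (g ∘ f) X = mmap g (mmap f X) := fun X =>
    Matrix.ext fun i j => (genMap_genMap g f _).symm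
  rw [ey, eq, eval_add_eval_sub_pairing (g ∘ f) h (hx.of_real.vmap g) (hy.of_real.vmap g)
    (hq.of_real.vmap g) (D.Y_point _) (D.Q_point _) ((isCrit_crit f h hx hr).vmap g), map_eval,
    genMap_comp, hmm, hmm]
  rfl

end Crit

end QuadAction

namespace QuadAction

variable {κ τ : Type} {V₁ V₂ V₃ : SuperSpace}

section Coefficients

variable [Finite κ] {S₃₂ : QuadAction κ V₂ V₃} {S₂₁ : QuadAction κ V₁ V₂}

/-- The Gaussian data of a composition, centred at the origin. -/
noncomputable def coeffData (h : Composable S₃₂ S₂₁) : GaussData κ V₂ where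
  T := of S₃₂.xx
  S := of S₂₁.qq
  N := compN S₃₂ S₂₁
  ys := 0
  qs := 0
  T_in := S₃₂.xx_in
  S_in := S₂₁.qq_in
  st_T := S₃₂.st_xx
  st_S := S₂₁.st_qq
  left := compN_mul h
  right := mul_compN h
  ys_point := fun _ => zero_mem _
  qs_point := fun _ => zero_mem _
  ys_real := fun _ => ⟨0, by simp⟩
  qs_real := fun _ => ⟨0, by simp⟩

end Coefficients

section Composition

variable [Fintype κ] [Fintype τ] {S₃₂ : QuadAction κ V₂ V₃} {S₂₁ : QuadAction κ V₁ V₂}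

/-- The quantum correction of a composition. -/
noncomputable abbrev correction (S₃₂ : QuadAction κ V₂ V₃) (S₂₁ : QuadAction κ V₁ V₂) : GEven κ :=
  multiplier V₂ S₃₂.xx S₂₁.qq

theorem gexp_correction (h : Composable S₃₂ S₂₁) :
    gexp ((2 : ℂ) • (correction S₃₂ S₂₁ : Λ κ)) =
      (Ber (1 - tsMatrix S₃₂.xx S₂₁.qq) : Λ κ) := by
  rw [tsMatrix_eq]
  exact (multiplier_spec (coeffData h)).1

theorem correction_real (h : Composable S₃₂ S₂₁)
    (ht : ∀ t : ℝ, 0 ≤ t → t ≤ 1 → IsUnit (1 - (t : ℂ) • tsMatrix S₃₂.xx S₂₁.qq)) :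
    (correction S₃₂ S₂₁ : Λ κ) ∈ realPart κ := by
  rw [tsMatrix_eq] at ht
  exact (multiplier_spec (coeffData h)).2.1 ht

/-- The integral of the composition, at real points of any Grassmann algebra. -/
theorem integral_composition (h : Composable S₃₂ S₂₁) {ħ : ℝ} (hħ : 0 < ħ) (f : κ → τ)
    {x : V₁.Idx → Λ τ} {r : V₃.Idx → Λ τ} (hx : VecIn (realParity τ) x)
    (hr : VecIn (realParity τ) r) :
    HasSuperIntegral ħ V₂.even V₂.odd (fun ye qe => gexp ((I / ħ) •
      (S₃₂.eval (genMap (inl ∘ f)) (coords ye fun a => inr (inl a)) (vmap inl r) +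
      S₂₁.eval (genMap (inl ∘ f)) (vmap inl x) (coords qe fun a => inr (inr a)) -
        pairing (coords ye fun a => inr (inl a)) (coords qe fun a => inr (inr a)))))
      (gexp ((I / ħ) • (comp S₃₂ S₂₁ h).eval (genMap f) x r) *
        genMap f (gexp (-(correction S₃₂ S₂₁ : Λ κ)))) := by
  have hE := (comp S₃₂ S₂₁ h).eval_even f hx.of_real hr.of_real
  refine (((multiplier_spec (coeffData h)).2.2 τ f (gaussData f h hx hr) rfl rfl ħ hħ).mul_left
    (gexp ((I / ħ) • (comp S₃₂ S₂₁ h).eval (genMap f) x r))).congr fun ye qe => ?_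
  rw [exponent_eq f h hx hr, smul_add, gexp_add (smul_mem _ _ (genMap_mem_parity _ hE))
    (smul_mem _ _ (GaussData.E_even _ _)), genMap_gexp _ (smul_mem _ _ hE),
    map_smul]
  rfl

theorem continuous_body_eval (S : QuadAction κ V₁ V₃) (φ : Λ κ →ₐ[ℂ] Λ τ)
    (o : Fin V₁.odd → τ) (o' : Fin V₃.odd → τ) :
    Continuous fun v : (Fin V₁.even → ℝ) × (Fin V₃.even → ℝ) =>
      body (S.eval φ (coords v.1 o) (coords v.2 o')) := by
  have h1 : ∀ a : V₁.Idx, Continuous fun v : (Fin V₁.even → ℝ) × (Fin V₃.even → ℝ) =>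
      body (coords (V := V₁) v.1 o a) := by
    rintro (a | a) <;> simp only [coords, elim_inl, elim_inr, AlgHom.commutes, body_gen,
      Algebra.algebraMap_self_apply] <;> fun_prop
  have h2 : ∀ a : V₃.Idx, Continuous fun v : (Fin V₁.even → ℝ) × (Fin V₃.even → ℝ) =>
      body (coords (V := V₃) v.2 o' a) := by
    rintro (a | a) <;> simp only [coords, elim_inl, elim_inr, AlgHom.commutes, body_gen,
      Algebra.algebraMap_self_apply] <;> fun_prop
  simp only [eval, map_add, map_sum, map_mul, map_smul]
  fun_prop

theorem eq_of_gexp_eq_one [Finite τ] {d : Λ τ} (hd : d ∈ parityPart τ 0) (h : gexp d = 1) :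
    ∃ n : ℤ, d = algebraMap ℂ _ (n * (2 * π * I)) := by
  have : Fintype τ := Fintype.ofFinite τ
  have h1 : euler (fun _ => 1) d = 0 := by
    have := euler_gexp (fun _ => 1) hd
    rwa [h, mul_one, euler_one, eq_comm] at this
  have h2 : Complex.exp (body d) = 1 := by rw [← body_gexp hd, h, map_one]
  obtain ⟨n, hn⟩ := Complex.exp_eq_one_iff.1 h2
  exact ⟨n, by rw [← hn]; exact eq_body_of_euler_eq_zero h1⟩

theorem freeEval_even (S : QuadAction κ V₁ V₃) (v) : S.freeEval v ∈ parityPart _ 0 :=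
  S.eval_even _ (coords_point _ _) (coords_point _ _)

theorem freeEval_addConst_algebraMap (S : QuadAction κ V₁ V₃) (v) (z : ℂ) :
    (S.addConst (algebraMap ℂ _ z)).freeEval v = S.freeEval v + algebraMap ℂ _ z :=
  (eval_addConst _ _ _ _ _).trans (congrArg _ (AlgHom.commutes _ z))

/-- An action is determined by its exponential up to a constant. -/
theorem gexp_freeEval_eq_iff {ħ : ℝ} (hħ : 0 < ħ) (S S' : QuadAction κ V₁ V₃) :
    (∀ v, gexp ((I / ħ) • S.freeEval v) = gexp ((I / ħ) • S'.freeEval v)) ↔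
      ∃ n : ℤ, S = S'.addConst (algebraMap ℂ (GEven κ) (2 * π * ħ * n)) := by
  have hħ' : (ħ : ℂ) ≠ 0 := by exact_mod_cast hħ.ne'
  have hval : ∀ n : ℤ, (I / ħ : ℂ) * (2 * π * ħ * n) = n * (2 * π * I) := fun n => by
    field_simp
  have hd : ∀ v, (S.diff S').freeEval v = S.freeEval v - S'.freeEval v := fun v =>
    eval_diff S S' _ _ _
  constructor
  · intro hS
    have key : ∀ v, ∃ n : ℤ, (S.diff S').freeEval v = algebraMap ℂ _ (2 * π * ħ * n) := fun v => by
      have a' := smul_mem _ (I / ħ : ℂ) (S'.freeEval_even v)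
      obtain ⟨n, hn⟩ := eq_of_gexp_eq_one (d := (I / ħ : ℂ) • (S.diff S').freeEval v)
        (smul_mem _ _ (freeEval_even _ v)) (by
          rw [hd, smul_sub, sub_eq_add_neg, gexp_add (smul_mem _ _ (S.freeEval_even v))
            (neg_mem a'), hS v, gexp_mul_neg a'])
      refine ⟨n, smul_right_injective _ (div_ne_zero I_ne_zero hħ') ?_⟩
      beta_reduce
      rw [hn, Algebra.algebraMap_eq_smul_one, Algebra.algebraMap_eq_smul_one, smul_smul, hval]
    choose k hk using key
    have h2 : (2 * π * ħ : ℂ) ≠ 0 := by simp [pi_ne_zero, hħ.ne']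
    have hc : Continuous fun v => (k v : ℝ) := by
      have : (fun v => (k v : ℝ)) = fun v =>
          ((2 * π * ħ : ℂ)⁻¹ * body ((S.diff S').freeEval v)).re := funext fun v => by
        rw [hk, body_algebraMap, inv_mul_cancel_left₀ h2, Complex.intCast_re]
      rw [this]
      exact Complex.continuous_re.comp (continuous_const.mul (continuous_body_eval _ _ _ _))
    have hz : Continuous k := Int.isClosedEmbedding_coe_real.isEmbedding.continuous_iff.2 hc
    refine ⟨k 0, eval_ext fun v => ?_⟩
    rw [freeEval_addConst_algebraMap, ← PreconnectedSpace.constant inferInstance hz (x := v), ← hk, hd,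
      add_sub_cancel]
  · rintro ⟨n, rfl⟩ v
    rw [freeEval_addConst_algebraMap, smul_add, Algebra.algebraMap_eq_smul_one, smul_smul, hval,
      ← Algebra.algebraMap_eq_smul_one, gexp_add (smul_mem _ _ (freeEval_even _ _))
      (algebraMap_even _), gexp_algebraMap, Complex.exp_int_mul_two_pi_mul_I, map_one, mul_one]

theorem isQuantumComposite_iff (h : Composable S₃₂ S₂₁) {ħ : ℝ} (hħ : 0 < ħ)
    (S : QuadAction κ V₁ V₃) : IsQuantumComposite ħ S₃₂ S₂₁ S ↔ ∃ n : ℤ,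
      S = (comp S₃₂ S₂₁ h).addConst (-((ħ / I : ℂ) • correction S₃₂ S₂₁) +
        algebraMap ℂ (GEven κ) (2 * π * ħ * n)) := by
  have hadd : ∀ c d, ((comp S₃₂ S₂₁ h).addConst c).addConst d = (comp S₃₂ S₂₁ h).addConst (c + d) :=
    fun c d => QuadAction.ext (add_assoc _ _ _) rfl rfl rfl rfl rfl
  simp only [← hadd, ← gexp_freeEval_eq_iff hħ]
  refine Iff.trans (forall₂_congr fun xe re => ?_) Prod.forall.symm
  have key := integral_composition h hħ (inl : κ → κ ⊕ (Fin V₁.odd ⊕ Fin V₃.odd))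
    (coords_real xe (inr ∘ inl)) (coords_real re (inr ∘ inr))
  have e1 : vmap inl (coords xe (inr ∘ inl)) =
      (coords xe fun a => inl (inr (inl a)) : V₁.Idx → Λ
        ((κ ⊕ (Fin V₁.odd ⊕ Fin V₃.odd)) ⊕ (Fin V₂.odd ⊕ Fin V₂.odd))) := genMap_coords _ _ _
  have e2 : vmap inl (coords re (inr ∘ inr)) =
      (coords re fun a => inl (inr (inr a)) : V₃.Idx → Λ
        ((κ ⊕ (Fin V₁.odd ⊕ Fin V₃.odd)) ⊕ (Fin V₂.odd ⊕ Fin V₂.odd))) := genMap_coords _ _ _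
  have hc : (-(correction S₃₂ S₂₁ : Λ κ)) ∈ parityPart κ 0 := neg_mem (correction S₃₂ S₂₁).2
  have e3 : (I / ħ : ℂ) • genMap (inl : κ → κ ⊕ (Fin V₁.odd ⊕ Fin V₃.odd))
      ((-((ħ / I : ℂ) • correction S₃₂ S₂₁) : GEven κ) : Λ κ) =
        genMap inl (-(correction S₃₂ S₂₁ : Λ κ)) := by
    have hI : (I / ħ : ℂ) * (ħ / I) = 1 := by
      have : (ħ : ℂ) ≠ 0 := by exact_mod_cast hħ.ne'
      field_simp
    rw [Subalgebra.coe_neg, Subalgebra.coe_smul, ← smul_neg, map_smul, smul_smul, hI, one_smul]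
  have e4 : gexp ((I / ħ) • (comp S₃₂ S₂₁ h).eval (genMap inl) (coords xe (inr ∘ inl))
      (coords re (inr ∘ inr))) * genMap inl (gexp (-(correction S₃₂ S₂₁ : Λ κ))) = gexp ((I / ħ) •
        ((comp S₃₂ S₂₁ h).addConst (-((ħ / I : ℂ) • correction S₃₂ S₂₁))).freeEval (xe, re)) := by
    rw [freeEval, eval_addConst, smul_add, e3, genMap_gexp _ hc]
    exact (gexp_add (smul_mem _ _ (freeEval_even _ (xe, re)))
      (genMap_mem_parity _ hc)).symm
  rw [e1, e2, e4] at key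
  exact ⟨fun h' => h'.unique key, fun h' => h' ▸ key⟩

end Composition

end QuadAction

section Coefficient

variable {σ τ σ' τ' P : Type}

/-- The linear map that sends a generator to another generator, or kills it. -/
noncomputable def dropLin (p : σ → Option τ) : (σ →₀ ℂ) →ₗ[ℂ] (τ →₀ ℂ) :=
  Finsupp.linearCombination ℂ fun k => (p k).elim 0 fun j => Finsupp.single j 1

/-- The coefficient of a monomial in the odd variables `ι j` that `p` kills. -/
noncomputable def coef (p : σ → Option τ) (ι : P → σ) : List P → Λ σ →ₗ[ℂ] Λ τ
  | [] => (ExteriorAlgebra.map (dropLin p)).toLinearMap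
  | j :: L => coef p ι L ∘ₗ oddDeriv (ι j)

variable {p : σ → Option τ} {ι : P → σ}

theorem drop_gen (p : σ → Option τ) (k : σ) :
    ExteriorAlgebra.map (dropLin p) (gen k) = (p k).elim 0 gen := by
  rw [map_gen, dropLin, Finsupp.linearCombination_single, one_smul]
  cases p k
  · exact map_zero _
  · rfl

theorem drop_genMap {j : τ → σ} (hj : ∀ k, p (j k) = some k) (z : Λ τ) :
    ExteriorAlgebra.map (dropLin p) (genMap j z) = z := by
  have : (ExteriorAlgebra.map (dropLin p)).comp (genMap j) = AlgHom.id ℂ _ :=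
    grassmann_hom_ext fun k => by simp [drop_gen, hj]
  exact DFunLike.congr_fun this z

theorem coef_gen_mul {k : σ} {t : τ} (hk : p k = some t) (hι : ∀ j, ι j ≠ k) (L : List P) :
    ∃ s : ℂ, s * s = 1 ∧ ∀ x, coef p ι L (gen k * x) = s • (gen t * coef p ι L x) := by
  classical
  induction L with
  | nil => exact ⟨1, mul_one 1, fun x => by simp [coef, drop_gen, hk]⟩
  | cons j L ih =>
    obtain ⟨s, hs, h⟩ := ih
    refine ⟨-s, by rw [neg_mul_neg, hs], fun x => ?_⟩
    simp only [coef, LinearMap.comp_apply]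
    rw [oddDeriv_gen_mul, if_neg (hι j).symm, zero_sub, map_neg, h, neg_smul]

theorem coef_mul_even {j : τ → σ} (hj : ∀ k, p (j k) = some k) (hι : ∀ i k, j k ≠ ι i)
    {z : Λ τ} (hz : z ∈ parityPart τ 0) (L : List P) (x : Λ σ) :
    coef p ι L (genMap j z * x) = z * coef p ι L x := by
  induction L generalizing x with
  | nil => simp [coef, drop_genMap hj]
  | cons i L ih =>
    simp only [coef, LinearMap.comp_apply]
    rw [oddDeriv_even_mul _ (genMap_mem_parity _ hz), oddDeriv_genMap_of_notMem _ _ (hι i),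
      zero_mul, zero_add, ih]

theorem genMap_coef {p' : σ' → Option τ'} {ι' : P → σ'} {e : τ → τ'} {e' : σ → σ'}
    (hp : ∀ k, p' (e' k) = (p k).map e) (hι : ∀ j, e' (ι j) = ι' j) (he : Function.Injective e')
    (L : List P) (x : Λ σ) :
    genMap e (coef p ι L x) = coef p' ι' L (genMap e' x) := by
  induction L generalizing x with
  | nil =>
    have : (genMap e).comp (ExteriorAlgebra.map (dropLin p)) =
        (ExteriorAlgebra.map (dropLin p')).comp (genMap e') := grassmann_hom_ext fun k => by
      simp only [AlgHom.comp_apply, drop_gen, genMap_gen, hp]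
      cases p k <;> simp
    exact DFunLike.congr_fun this x
  | cons j L ih =>
    simp only [coef, LinearMap.comp_apply]
    have h := oddDeriv_map (Finsupp.lmapDomain ℂ ℂ e') (k := ι j) (k' := ι' j) (c := 1)
      (fun v => by rw [one_mul, ← hι]; exact Finsupp.mapDomain_apply he v _) x
    rw [one_smul] at h
    rw [ih, genMap, h]

theorem berezin_oddDeriv_inl (ħ : ℝ) {m : ℕ} (k : σ) (x : Λ (σ ⧺ m)) :
    berezin ħ m (oddDeriv (.inl k) x) = oddDeriv k (berezin ħ m x) := by
  classical
  refine (berezin_comm ħ (oddDeriv (.inl k)) (oddDeriv k) (fun j x => ?_) (fun x => ?_) x)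
  · rw [berezinPair_apply, berezinPair_apply, map_smul, oddDeriv_comm,
      oddDeriv_comm (inl k), map_neg, neg_neg]
  · have h := oddDeriv_map (dropOdd σ m) (k := inl k) (k' := k) (c := 1) (fun v => ?_) x
    · rw [h, one_smul]
    · have h : Finsupp.lapply k ∘ₗ dropOdd σ m = Finsupp.lapply (inl k) :=
        Finsupp.lhom_ext' fun i => LinearMap.ext_ring (by
          rcases i with i | i <;> simp [dropOdd, Finsupp.single_apply])
      rw [one_mul]
      exact DFunLike.congr_fun h v

/-- The extension of a partial map of generators to the algebras with variables of integration. -/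
def extend (p : σ → Option τ) (O : Type) : σ ⊕ O → Option (τ ⊕ O) :=
  elim (fun k => (p k).map .inl) fun o => some (.inr o)

theorem berezin_coef (ħ : ℝ) {m : ℕ} (L : List P) (x : Λ (σ ⧺ m)) :
    berezin ħ m (coef (extend p _) (inl ∘ ι) L x) = coef p ι L (berezin ħ m x) := by
  classical
  induction L generalizing x with
  | nil =>
    refine berezin_map ħ _ _ (fun v k => ?_) (Finsupp.lhom_ext' fun k => LinearMap.ext_ring ?_) x
    · have h : Finsupp.lapply (inr k) ∘ₗ dropLin (extend p _) = Finsupp.lapply (inr k) :=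
        Finsupp.lhom_ext' fun i => LinearMap.ext_ring (by
          rcases i with i | i
          · cases h : p i <;> simp [dropLin, extend, h]
          · simp [dropLin, extend, Finsupp.single_apply])
      exact DFunLike.congr_fun h v
    · rcases k with k | k
      · cases h : p k <;> simp [dropLin, dropOdd, extend, h]
      · simp [dropLin, dropOdd, extend]
  | cons j L ih =>
    simp only [coef, LinearMap.comp_apply, Function.comp_apply]
    rw [ih, berezin_oddDeriv_inl]

end Coefficient

section Span

/-- Forget the odd momenta. -/
def dropP (κ A P : Type) : κ ⊕ (A ⊕ P) → Option (κ ⊕ A) :=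
  elim (some ∘ .inl) (elim (some ∘ .inr) fun _ => none)

variable {κ : Type} {m : ℕ}

theorem drop_mem_span_coef {ħ : ℝ} (hħ : ħ ≠ 0) (w : Λ (κ ⊕ Fin m)) :
    w ∈ Submodule.span ℂ (Set.range fun aL : Λ κ × List (Fin m) => genMap inl aL.1 *
      coef (dropP κ (Fin m) (Fin m)) (inr ∘ inr) aL.2 (gexp ((I / ħ) •
        ∑ j : Fin m, gen (inr (inl j)) * gen (inr (inr j))))) := by
  classical
  set e : Λ (κ ⊕ (Fin m ⊕ Fin m)) := (I / ħ : ℂ) •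
    ∑ j : Fin m, gen (inr (inl j)) * gen (inr (inr j))
  have he : e ∈ parityPart _ 0 :=
    smul_mem _ _ (sum_mem fun j _ => gen_mul_gen_even _ _)
  set W := Submodule.span ℂ (Set.range fun aL : Λ κ × List (Fin m) => genMap inl aL.1 *
      coef (dropP κ (Fin m) (Fin m)) (inr ∘ inr) aL.2 (gexp e))
  have h1 : (1 : Λ (κ ⊕ Fin m)) ∈ W := by
    refine Submodule.subset_span ⟨(1, []), ?_⟩
    have : ExteriorAlgebra.map (dropLin (dropP κ (Fin m) (Fin m))) e = 0 := by
      simp [e, drop_gen, dropP]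
    change genMap inl 1 * ExteriorAlgebra.map _ (gexp e) = 1
    rw [map_one, one_mul, map_gexp _ he, this, gexp_zero]
  have hd : ∀ j : Fin m, oddDeriv (inr (inr j)) (gexp e) =
      -(I / ħ : ℂ) • (gen (inr (inl j)) * gexp e) := fun j => by
    rw [oddDeriv_gexp _ he]
    simp [e, oddDeriv_gen_mul, oddDeriv_gen, Finset.sum_ite_eq']
  induction w using grassmann_induction with
  | hC r => rw [Algebra.algebraMap_eq_smul_one]; exact W.smul_mem r h1
  | hadd x y hx hy => exact W.add_mem hx hy
  | hgen k x hx =>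
    induction hx using Submodule.span_induction with
    | zero => rw [mul_zero]; exact W.zero_mem
    | add x y _ _ hx hy => rw [mul_add]; exact W.add_mem hx hy
    | smul c x _ hx => rw [mul_smul_comm]; exact W.smul_mem c hx
    | mem x hx =>
      obtain ⟨⟨a, L⟩, rfl⟩ := hx
      rcases k with k | j
      · refine Submodule.subset_span ⟨(gen k * a, L), ?_⟩
        simp [mul_assoc]
      · obtain ⟨s, hs, h⟩ := coef_gen_mul (p := dropP κ (Fin m) (Fin m)) (ι := inr ∘ inr)
          (k := inr (inl j)) (t := inr j) rfl (fun _ h => by simp at h) L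
        have h2 : gen (inr j) * coef (dropP κ (Fin m) (Fin m)) (inr ∘ inr) L (gexp e) =
            (s * -(I / ħ : ℂ)⁻¹) •
              coef (dropP κ (Fin m) (Fin m)) (inr ∘ inr) (j :: L) (gexp e) := by
          have hne : (I / ħ : ℂ) ≠ 0 := div_ne_zero I_ne_zero (by exact_mod_cast hħ)
          simp only [coef, LinearMap.comp_apply, Function.comp_apply]
          rw [hd, map_smul, h, smul_smul, smul_smul,
            show s * -(I / ħ : ℂ)⁻¹ * -(I / ħ) * s = s * s * ((I / ħ)⁻¹ * (I / ħ)) by ring, hs,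
            inv_mul_cancel₀ hne, one_mul, one_smul]
        rw [← mul_assoc, gen_mul, mul_assoc, h2, mul_smul_comm,
          show inv (genMap inl a) = genMap inl (inv a) from inv_map _ _]
        exact W.smul_mem _ (Submodule.subset_span ⟨(inv a, j :: L), rfl⟩)

end Span

section Growth

variable {ι ι' : Type} [Fintype ι] [Fintype ι']

theorem norm_monomial_le (m : ι → ℕ) (v : ι → ℝ) :
    ‖∏ i, (v i : ℂ) ^ m i‖ ≤ (1 + ‖v‖) ^ ∑ i, m i := by
  rw [norm_prod, ← Finset.prod_pow_eq_pow_sum]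
  refine Finset.prod_le_prod (fun _ _ => norm_nonneg _) fun i _ => ?_
  rw [norm_pow, Complex.norm_real]
  exact pow_le_pow_left₀ (norm_nonneg _) ((norm_le_pi_norm v i).trans (by simp)) _

/-- Functions that grow at most polynomially. -/
def PolyBound {A B : Type*} [Norm A] [Norm B] (g : A → B) : Prop :=
  ∃ (C : ℝ) (k : ℕ), 0 ≤ C ∧ ∀ v, ‖g v‖ ≤ C * (1 + ‖v‖) ^ k

theorem add_le_polyBound {a b C C' s : ℝ} {k k' : ℕ} (hs : 0 ≤ s) (hC : 0 ≤ C) (hC' : 0 ≤ C')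
    (h : a ≤ C * (1 + s) ^ k) (h' : b ≤ C' * (1 + s) ^ k') :
    a + b ≤ (C + C') * (1 + s) ^ (max k k') := by
  have h1 : (1 : ℝ) ≤ 1 + s := by linarith
  rw [add_mul]
  exact add_le_add (h.trans (mul_le_mul_of_nonneg_left (pow_le_pow_right₀ h1 (le_max_left _ _)) hC))
    (h'.trans (mul_le_mul_of_nonneg_left (pow_le_pow_right₀ h1 (le_max_right _ _)) hC'))

theorem polyBound_of_mem_polyFun {g : (ι → ℝ) → ℂ} (hg : g ∈ polyFun ι ℂ) : PolyBound g := by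
  induction hg using polyFun_induction with
  | add f g _ _ hf hg =>
    obtain ⟨C, k, hC, h⟩ := hf
    obtain ⟨C', k', hC', h'⟩ := hg
    exact ⟨C + C', max k k', add_nonneg hC hC', fun v =>
      (norm_add_le _ _).trans (add_le_polyBound (norm_nonneg v) hC hC' (h v) (h' v))⟩
  | mono m a =>
    refine ⟨‖a‖, ∑ i, m i, norm_nonneg _, fun v => ?_⟩
    rw [norm_smul, mul_comm]
    exact mul_le_mul_of_nonneg_left (norm_monomial_le m v) (norm_nonneg _)

theorem integrable_schwartz_mul (φ : 𝓢(ι → ℝ, ℂ)) {g : (ι → ℝ) → ℂ} (hc : Continuous g)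
    (hg : PolyBound g) : Integrable fun r => φ r * g r := by
  obtain ⟨C, k, hC, h⟩ := hg
  refine ((((φ.integrable_pow_mul volume 0).add (φ.integrable_pow_mul volume k)).const_mul
    (C * 2 ^ (k - 1)))).mono' (φ.continuous.mul hc).aestronglyMeasurable (ae_of_all _ fun r => ?_)
  have h1 := add_pow_le zero_le_one (norm_nonneg r) k
  rw [one_pow] at h1
  rw [norm_mul, Pi.add_apply]
  calc ‖φ r‖ * ‖g r‖ ≤ ‖φ r‖ * (C * (2 ^ (k - 1) * (1 + ‖r‖ ^ k))) := by
        refine mul_le_mul_of_nonneg_left ((h r).trans ?_) (norm_nonneg _)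
        exact mul_le_mul_of_nonneg_left h1 hC
    _ = _ := by ring

end Growth

section Param

variable {ι ι' : Type} [Fintype ι] [Fintype ι'] [DecidableEq ι]

theorem monomial_sum_elim (m : ι ⊕ ι' → ℕ) (v : ι → ℝ) (r : ι' → ℝ) :
    ∏ i, ((elim v r i : ℝ) : ℂ) ^ m i =
      (∏ i, (v i : ℂ) ^ m (.inl i)) * ∏ i, (r i : ℂ) ^ m (.inr i) := by
  rw [Fintype.prod_sum_type]; rfl

theorem IsDiag.oscillatory_param {H O : Matrix ι ι ℝ} {l : ι → ℝ} (hd : IsDiag H O l)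
    (hl : ∀ i, l i ≠ 0) {p : (ι ⊕ ι' → ℝ) → ℂ} (hp : p ∈ polyFun (ι ⊕ ι') ℂ) :
    (∀ ε > 0, ∀ b r, Integrable fun v =>
      (reg ε v : ℂ) * (cexp (I * phase H b v) * p (elim v r))) ∧
    (∃ (C : ℝ) (k : ℕ), 0 ≤ C ∧ ∀ ε > 0, ∀ (b : ι → ℝ) (r : ι' → ℝ),
      ‖∫ v, (reg ε v : ℂ) * (cexp (I * phase H b v) * p (elim v r))‖ ≤
        C * (1 + (‖b‖ + ‖r‖)) ^ k) ∧
    ∀ ε > 0, ∀ φ : 𝓢(ι' → ℝ, ℂ), Integrable fun z : (ι → ℝ) × (ι' → ℝ) =>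
      (reg ε z.1 : ℂ) * p (elim z.1 z.2) * φ z.2 := by
  induction hp using polyFun_induction with
  | add f g _ _ hf hg =>
    obtain ⟨h1, ⟨C, k, hC, h2⟩, h3⟩ := hf
    obtain ⟨h1', ⟨C', k', hC', h2'⟩, h3'⟩ := hg
    simp only [Pi.add_apply, mul_add, add_mul]
    refine ⟨fun ε hε b r => (h1 ε hε b r).add (h1' ε hε b r), ⟨C + C', max k k', add_nonneg hC hC',
      fun ε hε b r => ?_⟩, fun ε hε φ => (h3 ε hε φ).add (h3' ε hε φ)⟩
    rw [integral_add (h1 ε hε b r) (h1' ε hε b r)]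
    exact (norm_add_le _ _).trans (add_le_polyBound (by positivity) hC hC' (h2 ε hε b r)
      (h2' ε hε b r))
  | mono m a =>
    simp only [monomial_sum_elim]
    have hm : (fun v : ι → ℝ => (∏ i, (v i : ℂ) ^ m (.inl i)) • (1 : ℂ)) ∈ polyFun ι ℂ :=
      monomial_mem_polyFun _ _
    obtain ⟨h1, ⟨C, k, hC, h2⟩, -⟩ := hd.oscillatory hl hm
    have e : ∀ ε (b v : ι → ℝ) (r : ι' → ℝ), (reg ε v : ℂ) * (cexp (I * phase H b v) *
        ((∏ i, (v i : ℂ) ^ m (.inl i)) * ∏ i, (r i : ℂ) ^ m (.inr i)) • a) =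
        (reg ε v : ℂ) * (cexp (I * phase H b v) * (∏ i, (v i : ℂ) ^ m (.inl i)) • (1 : ℂ)) *
          ((∏ i, (r i : ℂ) ^ m (.inr i)) * a) := fun ε b v r => by simp only [smul_eq_mul]; ring
    simp only [e]
    refine ⟨fun ε hε b r => (h1 ε hε b).mul_const _,
      ⟨C * ‖a‖, k + ∑ i, m (.inr i), by positivity, fun ε hε b r => ?_⟩, fun ε hε φ => ?_⟩
    · rw [integral_mul_const, norm_mul, norm_mul, pow_add, ← mul_assoc]
      have hb := norm_nonneg b
      have hr := norm_nonneg r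
      have e1 := (h2 ε hε b).trans (mul_le_mul_of_nonneg_left
        (pow_le_pow_left₀ (by positivity) (show 1 + ‖b‖ ≤ 1 + (‖b‖ + ‖r‖) by linarith) k) hC)
      have e2 := (norm_monomial_le (fun i => m (.inr i)) r).trans
        (pow_le_pow_left₀ (by positivity) (show 1 + ‖r‖ ≤ 1 + (‖b‖ + ‖r‖) by linarith) _)
      calc _ ≤ (C * (1 + (‖b‖ + ‖r‖)) ^ k) * ((1 + (‖b‖ + ‖r‖)) ^ ∑ i, m (.inr i)) * ‖a‖ :=
            mul_le_mul_of_nonneg_right (mul_le_mul e1 e2 (norm_nonneg _) (by positivity))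
              (norm_nonneg _)
        _ = _ := by ring
    · have h0 := ((integral_monomial_diagonal hε (0 : ι → ℝ) 0 fun i => m (.inl i)).1).mul_prod
        ((integrable_schwartz_mul φ (continuous_of_mem_polyFun (monomial_mem_polyFun _ _))
          (polyBound_of_mem_polyFun (monomial_mem_polyFun (fun i => m (.inr i)) a))))
      refine h0.congr (ae_of_all _ fun z => ?_)
      simp only [phase, smul_eq_mul, diagonal_zero', zero_mulVec, dotProduct_zero, zero_dotProduct]
      simp only [zero_div, add_zero, ofReal_zero, mul_zero, Complex.exp_zero, one_mul]
      ring

/-- A regularized oscillatory integral may be interchanged with an absolutely convergent one. -/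
theorem tendsto_integral_swap {H : Matrix ι ι ℝ} (hH : Hᵀ = H) (hdet : H.det ≠ 0)
    {p : (ι ⊕ ι' → ℝ) → ℂ} (hp : p ∈ polyFun (ι ⊕ ι') ℂ) {b : (ι' → ℝ) → ι → ℝ}
    (hb : Continuous b) (hbb : PolyBound b) {θ : (ι' → ℝ) → ℂ} (hθ : Continuous θ) {B : ℝ}
    (hθB : ∀ r, ‖θ r‖ ≤ B) {G : (ι → ℝ) → (ι' → ℝ) → ℂ}
    (hG : ∀ v r, G v r = θ r * (cexp (I * phase H (b r) v) * p (elim v r)))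
    (φ : 𝓢(ι' → ℝ, ℂ)) {c : ℂ} {J : (ι' → ℝ) → ℂ}
    (hJ : ∀ r, Tendsto (fun ε => c * ∫ v, (reg ε v : ℂ) * G v r) (𝓝[>] 0) (𝓝 (J r))) :
    (∀ ε > 0, Integrable fun v => (reg ε v : ℂ) * ∫ r, φ r * G v r) ∧
    Tendsto (fun ε => c * ∫ v, (reg ε v : ℂ) * ∫ r, φ r * G v r) (𝓝[>] 0)
      (𝓝 (∫ r, φ r * J r)) := by
  obtain ⟨O, l, hd, hdl⟩ := exists_isDiag hH
  have hl : ∀ i, l i ≠ 0 := fun i hi =>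
    hdet (by rw [hdl]; exact Finset.prod_eq_zero (mem_univ i) hi)
  obtain ⟨-, ⟨C, k, hC, h2⟩, h3⟩ := hd.oscillatory_param hl hp
  have hB : 0 ≤ B := (norm_nonneg _).trans (hθB 0)
  have hph : Continuous fun z : (ι → ℝ) × (ι' → ℝ) => phase H (b z.2) z.1 := by
    unfold phase
    simp only [dotProduct, mulVec]
    fun_prop
  have hK : ∀ ε > 0, Integrable fun z : (ι → ℝ) × (ι' → ℝ) =>
      (reg ε z.1 : ℂ) * (φ z.2 * G z.1 z.2) := fun ε hε => by
    refine (((h3 ε hε φ).bdd_mul (c := B) (f := fun z => θ z.2 * cexp (I * phase H (b z.2) z.1))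
      (by fun_prop) (ae_of_all _ fun z => ?_))).congr (ae_of_all _ fun z => ?_)
    · rw [norm_mul, mul_comm I, Complex.norm_exp_ofReal_mul_I, mul_one]
      exact hθB _
    · simp only [hG]; ring
  have hswap : ∀ ε > 0, c * ∫ v, (reg ε v : ℂ) * ∫ r, φ r * G v r =
      ∫ r, φ r * (c * ∫ v, (reg ε v : ℂ) * G v r) := fun ε hε => by
    simp only [← integral_const_mul]
    rw [integral_integral_swap ((hK ε hε).const_mul c)]
    exact integral_congr_ae (ae_of_all _ fun r => integral_congr_ae (ae_of_all _ fun v => by ring))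
  have hpos : ∀ᶠ ε : ℝ in 𝓝[>] 0, 0 < ε := self_mem_nhdsWithin
  refine ⟨fun ε hε => ?_, ?_⟩
  · simpa only [integral_const_mul] using (hK ε hε).integral_prod_left
  refine Tendsto.congr' (hpos.mono fun ε hε => (hswap ε hε).symm) ?_
  obtain ⟨C', k', hC', hb'⟩ := hbb
  let g : (ι' → ℝ) → ℂ := fun r => ((‖c‖ * (B * (C * (1 + (‖b r‖ + ‖r‖)) ^ k)) : ℝ) : ℂ)
  have hg : Integrable fun r => φ r * g r := by
    refine integrable_schwartz_mul φ (by fun_prop)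
      ⟨‖c‖ * (B * (C * (C' + 1 + 1) ^ k)), max k' 1 * k, by positivity, fun r => ?_⟩
    have hr := norm_nonneg r
    have h1 : 1 + (‖b r‖ + ‖r‖) ≤ (C' + 1 + 1) * (1 + ‖r‖) ^ max k' 1 := by
      have e1 : 1 ≤ 1 * (1 + ‖r‖) ^ 1 := by rw [pow_one, one_mul]; linarith
      have e2 : ‖r‖ ≤ 1 * (1 + ‖r‖) ^ 1 := by rw [pow_one, one_mul]; linarith
      have := add_le_polyBound hr (by positivity) zero_le_one
        (add_le_polyBound hr hC' zero_le_one (hb' r) e2) e1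
      rw [max_assoc, max_self] at this
      linarith
    rw [Complex.norm_real, Real.norm_of_nonneg (by positivity), pow_mul]
    have h2 := pow_le_pow_left₀ (by positivity) h1 k
    rw [mul_pow] at h2
    calc _ ≤ ‖c‖ * (B * (C * ((C' + 1 + 1) ^ k * ((1 + ‖r‖) ^ max k' 1) ^ k))) := by gcongr
      _ = _ := by ring
  refine tendsto_integral_filter_of_dominated_convergence (fun r => ‖φ r * g r‖)
    (hpos.mono fun ε hε => ?_) (hpos.mono fun ε hε => ae_of_all _ fun r => ?_) hg.norm
    (ae_of_all _ fun r => (hJ r).const_mul _)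
  · have h := ((hK ε hε).integral_prod_right.const_mul c).aestronglyMeasurable
    refine h.congr (ae_of_all _ fun r => ?_)
    simp only [mul_left_comm _ (φ r), integral_const_mul]
  · rw [norm_mul (φ r), norm_mul (φ r), norm_mul c]
    refine mul_le_mul_of_nonneg_left ?_ (norm_nonneg _)
    have e : ∫ v, (reg ε v : ℂ) * G v r =
        θ r * ∫ v, (reg ε v : ℂ) * (cexp (I * phase H (b r) v) * p (elim v r)) := by
      rw [← integral_const_mul]
      refine integral_congr_ae (ae_of_all _ fun v => ?_)
      simp only [hG]; ring
    rw [Complex.norm_real, Real.norm_of_nonneg (by positivity), e, norm_mul]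
    gcongr
    · exact hθB r
    · exact h2 ε hε _ _

end Param

/-- A Schwartz function is a superposition of plane waves, with a Schwartz function of the
momentum as coefficient. -/
theorem exists_planeWave {n : ℕ} (f : 𝓢(Fin n → ℝ, ℂ)) {ħ : ℝ} (hħ : 0 < ħ) :
    ∃ g : 𝓢(Fin n → ℝ, ℂ), ∀ z : Fin n → ℝ,
      ∫ r, g r * cexp ((I / ħ) * ((∑ j, z j * r j : ℝ) : ℂ)) = f z := by
  have hs : (2 * π * ħ) ≠ 0 := by have := pi_pos; positivity
  let e := (ContinuousLinearEquiv.smulLeft (Units.mk0 (2 * π * ħ) hs)).trans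
    (EuclideanSpace.equiv (Fin n) ℝ)
  let F : 𝓢(EuclideanSpace ℝ (Fin n), ℂ) := SchwartzMap.compCLMOfContinuousLinearEquiv ℂ e f
  let g := SchwartzMap.compCLMOfContinuousLinearEquiv ℂ (EuclideanSpace.equiv (Fin n) ℝ).symm
    (FourierTransform.fourier F)
  refine ⟨g, fun z => ?_⟩
  have h1 : FourierTransformInv.fourierInv (FourierTransform.fourier F) (e.symm z) = f z := by
    rw [FourierTransform.fourierInv_fourier_eq]
    exact congrArg f (e.apply_symm_apply z)
  rw [← h1, SchwartzMap.fourierInv_coe, Real.fourierInv_eq',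
    ← (EuclideanSpace.volume_preserving_symm_measurableEquiv_toLp (Fin n)).symm.integral_comp
      (MeasurableEquiv.measurableEmbedding _)]
  refine integral_congr_ae (ae_of_all _ fun r => ?_)
  have hi : inner ℝ (WithLp.toLp 2 r) (e.symm z) = (2 * π * ħ)⁻¹ * ∑ j, z j * r j := by
    rw [PiLp.inner_apply, mul_sum]
    refine sum_congr rfl fun j _ => ?_
    change ((2 * π * ħ)⁻¹ * z j) * r j = _
    ring
  change g r * _ = cexp (((2 * π * inner ℝ (WithLp.toLp 2 r) (e.symm z) : ℝ) : ℂ) * I) * g r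
  rw [hi, mul_comm]
  congr 2
  have := pi_ne_zero
  have := hħ.ne'
  push_cast
  field_simp

section Integral

variable {ι : Type} [Fintype ι] {A B : Type*} [AddCommGroup A] [Module ℂ A] [AddCommGroup B]
  [Module ℂ B]

/-- The function `F` with values in a finite-dimensional space has the integral `J`. -/
def HasInt (F : (ι → ℝ) → A) (J : A) : Prop :=
  ∀ l : Module.Dual ℂ A, Integrable (fun r => l (F r)) ∧ ∫ r, l (F r) = l J

theorem HasInt.map (X : A →ₗ[ℂ] B) {F : (ι → ℝ) → A} {J : A} (h : HasInt F J) :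
    HasInt (fun r => X (F r)) (X J) := fun l => h (l ∘ₗ X)

theorem exists_hasInt [Module.Finite ℂ A] {F : (ι → ℝ) → A}
    (h : ∀ l : Module.Dual ℂ A, Integrable fun r => l (F r)) : ∃ J, HasInt F J := by
  let b := Module.finBasis ℂ A
  refine ⟨∑ t, (∫ r, b.coord t (F r)) • b t, fun l => ⟨h l, ?_⟩⟩
  have e : ∀ r, l (F r) = ∑ t, b.coord t (F r) * l (b t) := fun r => by
    conv_lhs => rw [← b.sum_repr (F r), map_sum]
    simp
  simp only [e]
  rw [integral_finsetSum _ fun t _ => (h (b.coord t)).mul_const _]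
  simp [integral_mul_const]

end Integral

section Polynomials

variable {ι : Type} [Fintype ι] {κ τ : Type} {V W : SuperSpace}

theorem coords_mem_polyFun (j : Fin V.even → ι) (o : Fin V.odd → τ) (a : V.Idx) :
    (fun v : ι → ℝ => coords (V := V) (v ∘ j) o a) ∈ polyFun ι (Λ τ) := by
  rcases a with a | a
  · have := coord_smul_mem_polyFun (j a) (1 : Λ τ)
    simp only [← Algebra.algebraMap_eq_smul_one] at this
    exact this
  · exact const_mem_polyFun _

theorem mulVec_mem_polyFun {ι₁ ι₂ : Type} [Fintype ι₂] (X : Matrix ι₁ ι₂ (Λ τ))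
    {x : (ι → ℝ) → ι₂ → Λ τ} (hx : ∀ a, (fun v => x v a) ∈ polyFun ι (Λ τ)) (i : ι₁) :
    (fun v => (X *ᵥ x v) i) ∈ polyFun ι (Λ τ) :=
  sum_mem_polyFun _ fun _ _ => mul_mem_polyFun (const_mem_polyFun _) (hx _)

theorem pairing_mem_polyFun {x q : (ι → ℝ) → V.Idx → Λ τ}
    (hx : ∀ a, (fun v => x v a) ∈ polyFun ι (Λ τ))
    (hq : ∀ i, (fun v => q v i) ∈ polyFun ι (Λ τ)) :
    (fun v => pairing (x v) (q v)) ∈ polyFun ι (Λ τ) :=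
  sum_mem_polyFun _ fun _ _ => mul_mem_polyFun (hx _) (hq _)

namespace QuadAction

theorem eval_mem_polyFun (S : QuadAction κ V W) (φ : Λ κ →ₐ[ℂ] Λ τ)
    {x : (ι → ℝ) → V.Idx → Λ τ} {q : (ι → ℝ) → W.Idx → Λ τ}
    (hx : ∀ a, (fun v => x v a) ∈ polyFun ι (Λ τ))
    (hq : ∀ i, (fun v => q v i) ∈ polyFun ι (Λ τ)) :
    (fun v => S.eval φ (x v) (q v)) ∈ polyFun ι (Λ τ) := by
  have hc := fun a : Λ τ => const_mem_polyFun (ι := ι) a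
  refine add_mem (add_mem (add_mem (Submodule.add_mem _
    (add_mem (hc _) ?_) ?_) (smul_mem _ _ ?_)) ?_) (smul_mem _ _ ?_)
  · exact sum_mem_polyFun _ fun a _ => mul_mem_polyFun (hx a) (hc _)
  · exact sum_mem_polyFun _ fun i _ => mul_mem_polyFun (hc _) (hq i)
  · exact sum_mem_polyFun _ fun a _ => sum_mem_polyFun _ fun b _ =>
      mul_mem_polyFun (mul_mem_polyFun (hx a) (hx b)) (hc _)
  · exact sum_mem_polyFun _ fun a _ => sum_mem_polyFun _ fun i _ =>
      mul_mem_polyFun (mul_mem_polyFun (hx a) (hc _)) (hq i)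
  · exact sum_mem_polyFun _ fun i _ => sum_mem_polyFun _ fun j _ =>
      mul_mem_polyFun (mul_mem_polyFun (hc _) (hq j)) (hq i)

theorem eval_mem_realPart {S : QuadAction κ V W} (hS : (S.const : Λ κ) ∈ realPart κ)
    (f : κ → τ) {x : V.Idx → Λ τ} {q : W.Idx → Λ τ}
    (hx : VecIn (realParity τ) x) (hq : VecIn (realParity τ) q) :
    S.eval (genMap f) x q ∈ realPart τ := by
  have hg := fun {a : Λ κ} (ha : a ∈ realPart κ) => genMap_mem_realPart f ha
  have hh : ∀ a ∈ realPart τ, (1 / 2 : ℂ) • a ∈ realPart τ := fun a ha => by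
    have := (realPart τ).smul_mem ha (1 / 2 : ℝ)
    rwa [← Complex.coe_smul, Complex.ofReal_div, Complex.ofReal_one, Complex.ofReal_ofNat] at this
  have hmul := fun {a b : Λ τ} => (realPart τ).mul_mem (x := a) (y := b)
  refine add_mem (add_mem (add_mem (add_mem (add_mem (hg hS) ?_) ?_) (hh _ ?_)) ?_) (hh _ ?_)
  · exact sum_mem fun a _ => hmul (hx a).2 (hg (S.linX_real a))
  · exact sum_mem fun i _ => hmul (hg (S.linQ_real i)) (hq i).2
  · exact sum_mem fun a _ => sum_mem fun b _ => hmul (hmul (hx a).2 (hx b).2) (hg (S.xx_real b a))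
  · exact sum_mem fun a _ => sum_mem fun i _ => hmul (hmul (hx a).2 (hg (S.xq_real a i))) (hq i).2
  · exact sum_mem fun i _ => sum_mem fun j _ => hmul (hmul (hg (S.qq_real i j)) (hq j).2) (hq i).2

/-- The oscillating factor of a quadratic action has a constant modulus. -/
theorem norm_exp_body_eval (S : QuadAction κ V W) (ħ : ℝ) (f : κ → τ) {x : V.Idx → Λ τ}
    {q : W.Idx → Λ τ} (hx : VecIn (realParity τ) x) (hq : VecIn (realParity τ) q) :
    ‖cexp (I / ħ * body (S.eval (genMap f) x q))‖ = ‖cexp (I / ħ * body (S.const : Λ κ))‖ := by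
  have h := eval_mem_realPart (S := S.addConst (-S.const))
    (by simp [addConst]) f hx hq
  obtain ⟨s, hs⟩ := body_real h
  rw [eval_addConst, map_add, Subalgebra.coe_neg, map_neg, map_neg, body_genMap] at hs
  rw [sub_eq_iff_eq_add'.1 ((sub_eq_add_neg _ _).trans hs), mul_add, Complex.exp_add, norm_mul,
    show (I / ħ * s : ℂ) = (s / ħ : ℝ) * I by push_cast; ring, Complex.norm_exp_ofReal_mul_I, mul_one]

end QuadAction

end Polynomials

section Transform

variable {κ : Type} [Fintype κ] {V W : SuperSpace} (ħ : ℝ)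

/-- The exponential of an action, as a function of all variables. -/
noncomputable def kern (S : QuadAction κ V W) (xe : Fin V.even → ℝ) (r : Fin W.even → ℝ) :
    Λ (κ ⊕ (Fin V.odd ⊕ Fin W.odd)) :=
  gexp ((I / ħ) • S.eval (genMap inl) (coords xe (inr ∘ inl))
    (coords r (inr ∘ inr)))

/-- The superposition, with amplitude `φ`, of the exponentials of an action at the momenta `r`; of
the odd momenta, only the coefficient of the monomial `L` is kept. -/
def IsTransform (φ : 𝓢(Fin W.even → ℝ, ℂ)) (L : List (Fin W.odd)) (S : QuadAction κ V W)
    (u : WaveFun κ V) : Prop :=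
  ∀ xe, HasInt (fun r => φ r • coef (dropP κ _ _) (inr ∘ inr) L (kern ħ S xe r)) (u xe)

theorem exists_isTransform (φ : 𝓢(Fin W.even → ℝ, ℂ)) (L : List (Fin W.odd))
    (S : QuadAction κ V W) : ∃ u, IsTransform ħ φ L S u := by
  refine Classical.axiomOfChoice fun xe => exists_hasInt fun l => ?_
  have hE := S.eval_mem_polyFun (genMap (inl : κ → κ ⊕ (Fin V.odd ⊕ Fin W.odd)))
    (x := fun _ => coords xe (inr ∘ inl)) (q := fun r => coords r (inr ∘ inr))
    (fun a => const_mem_polyFun _) (coords_mem_polyFun id (inr ∘ inr))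
  obtain ⟨p, hp, h⟩ := exists_gexp_poly (smul_mem _ (I / ħ : ℂ) hE)
    (fun r => smul_mem _ _ (S.eval_even _ (coords_point _ _) (coords_point _ _)))
  have hb := (QuadAction.continuous_body_eval S
    (genMap (inl : κ → κ ⊕ (Fin V.odd ⊕ Fin W.odd))) (inr ∘ inl)
      (inr ∘ inr)).comp (continuous_const.prodMk continuous_id : Continuous fun r => (xe, r))
  have hn := fun r => S.norm_exp_body_eval ħ (inl : κ → κ ⊕ (Fin V.odd ⊕ Fin W.odd))
    (coords_real xe (inr ∘ inl)) (coords_real r (inr ∘ inr))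
  let ℓ := l ∘ₗ coef (dropP κ (Fin V.odd) (Fin W.odd)) (inr ∘ inr) L
  obtain ⟨C, k, hC, hℓ⟩ := polyBound_of_mem_polyFun (comp_mem_polyFun ℓ hp)
  refine (integrable_schwartz_mul φ ((Complex.continuous_exp.comp
    ((continuous_const (y := (I / ħ : ℂ))).mul hb)).mul
    (continuous_of_mem_polyFun (comp_mem_polyFun ℓ hp))) ⟨‖cexp (I / ħ *
      body (S.const : Λ κ))‖ * C, k, by positivity, fun r => ?_⟩).congr
    (ae_of_all _ fun r => ?_)
  · rw [Pi.mul_apply, norm_mul, mul_assoc]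
    exact mul_le_mul (hn r).le (hℓ r) (norm_nonneg _) (norm_nonneg _)
  · have hk : kern ħ S xe r = _ := h r
    change _ = l (φ r • coef (dropP κ _ _) (inr ∘ inr) L (kern ħ S xe r))
    rw [hk, map_smul, map_smul, map_smul, smul_eq_mul, smul_eq_mul, Pi.smul_apply, map_smul]
    rfl

/-- Fourier inversion on superspace. -/
theorem exists_isTransform_idAction {ħ : ℝ} (hħ : 0 < ħ) (f : 𝓢(Fin W.even → ℝ, ℂ)) :
    ∃ φ : 𝓢(Fin W.even → ℝ, ℂ), ∀ L, IsTransform ħ φ L (idAction κ W) fun z =>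
      f z • coef (dropP κ (Fin W.odd) (Fin W.odd)) (inr ∘ inr) L (gexp ((I / ħ) •
        ∑ j : Fin W.odd, gen (inr (inl j)) * gen (inr (inr j)))) := by
  obtain ⟨φ, hφ⟩ := exists_planeWave f hħ
  refine ⟨φ, fun L z l => ?_⟩
  set X := coef (dropP κ (Fin W.odd) (Fin W.odd)) (inr ∘ inr) L (gexp ((I / ħ) •
        ∑ j : Fin W.odd, gen (inr (inl j)) * gen (inr (inr j))))
  have e : ∀ r, l (φ r • coef (dropP κ _ _) (inr ∘ inr) L (kern ħ (idAction κ W) z r)) =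
      φ r * cexp ((I / ħ) * ((∑ j, z j * r j : ℝ) : ℂ)) * l X := fun r => by
    have : kern ħ (idAction κ W) z r = cexp ((I / ħ) * ((∑ j, z j * r j : ℝ) : ℂ)) •
        gexp ((I / ħ) • ∑ j : Fin W.odd, gen (inr (inl j)) * gen (inr (inr j))) := by
      have e1 : (I / ħ : ℂ) • pairing (V := W) (coords z (inr ∘ inl))
          (coords r (inr ∘ inr)) =
          algebraMap ℂ (Λ (κ ⊕ (Fin W.odd ⊕ Fin W.odd)))
            ((I / ħ) * ((∑ j, z j * r j : ℝ) : ℂ)) + (I / ħ : ℂ) •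
              ∑ j : Fin W.odd, gen (inr (inl j)) * gen (inr (inr j)) := by
        rw [pairing, Fintype.sum_sum_type, smul_add, map_mul, ← Algebra.smul_def]
        simp [coords]
      rw [kern, QuadAction.idAction_eval, e1, gexp_add (algebraMap_even _) (smul_mem _ _
        (sum_mem fun j _ => gen_mul_gen_even _ _)), gexp_algebraMap, ← Algebra.smul_def]
    rw [this, map_smul, map_smul, map_smul, smul_eq_mul, smul_eq_mul, mul_assoc]
  have hi : Integrable fun r => φ r * cexp ((I / ħ) * ((∑ j, z j * r j : ℝ) : ℂ)) :=
    integrable_schwartz_mul φ (by fun_prop) ⟨1, 0, zero_le_one, fun r => by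
      beta_reduce
      rw [show (I / ħ * ((∑ j, z j * r j : ℝ) : ℂ)) = ((∑ j, z j * r j) / ħ : ℝ) * I by
        push_cast; ring, Complex.norm_exp_ofReal_mul_I]
      simp⟩
  simp only [e]
  exact ⟨hi.mul_const _, by rw [integral_mul_const, hφ, map_smul, smul_eq_mul]⟩

end Transform

theorem continuous_polyBound {ι ι' : Type} [Fintype ι] [Fintype ι'] {c : (ι' → ℝ) → ι → ℝ}
    (hc : ∀ i, (fun r => (c r i : ℂ)) ∈ polyFun ι' ℂ) : Continuous c ∧ PolyBound c := by
  refine ⟨continuous_pi fun i => Complex.continuous_re.comp (continuous_of_mem_polyFun (hc i)), ?_⟩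
  choose C k hC h using fun i => polyBound_of_mem_polyFun (hc i)
  refine ⟨∑ i, C i, ∑ i, k i, Finset.sum_nonneg fun i _ => hC i, fun r => ?_⟩
  have h0 : (1 : ℝ) ≤ 1 + ‖r‖ := by simp
  have hs : 0 ≤ ∑ i, C i := Finset.sum_nonneg fun i _ => hC i
  refine (pi_norm_le_iff_of_nonneg (by positivity)).2 fun i => ?_
  rw [← Complex.norm_real]
  exact (h i r).trans (mul_le_mul (Finset.single_le_sum (fun j _ => hC j) (mem_univ i))
    (pow_le_pow_right₀ h0 (Finset.single_le_sum (fun j _ => (k j).zero_le) (mem_univ i)))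
    (by positivity) hs)

namespace QuadAction

variable {κ τ : Type} [Finite κ] [Finite τ] {V₁ V₂ V₃ : SuperSpace} {S₃₂ : QuadAction κ V₂ V₃}
  {S₂₁ : QuadAction κ V₁ V₂}

theorem crit_mem_polyFun {ι : Type} [Fintype ι] (f : κ → τ) (x : V₁.Idx → Λ τ)
    {r : (ι → ℝ) → V₃.Idx → Λ τ} (hr : ∀ a, (fun v => r v a) ∈ polyFun ι (Λ τ))
    (i : V₂.Idx) : (fun v => critQ S₃₂ S₂₁ f x (r v) i) ∈ polyFun ι (Λ τ) ∧
      (fun v => critY S₃₂ S₂₁ f x (r v) i) ∈ polyFun ι (Λ τ) := by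
  have h1 : ∀ i, (fun v => critQ S₃₂ S₂₁ f x (r v) i) ∈ polyFun ι (Λ τ) :=
    mulVec_mem_polyFun _ fun a => add_mem (const_mem_polyFun _)
      (mulVec_mem_polyFun _ hr a)
  exact ⟨h1 i, add_mem (const_mem_polyFun _) (mulVec_mem_polyFun _ h1 i)⟩

variable (S₃₂ S₂₁) in
/-- The exponent of a composition, as a function of the variables of integration. -/
noncomputable def compExponent (f : κ → τ) (x : V₁.Idx → Λ τ) (r : V₃.Idx → Λ τ)
    (v : 𝕋 V₂.even) : Λ (τ ⧺ V₂.odd) :=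
  S₃₂.eval (genMap (inl ∘ f)) (coords (v ∘ inl) fun a => inr (inl a))
      (vmap inl r) +
    S₂₁.eval (genMap (inl ∘ f)) (vmap inl x)
      (coords (v ∘ inr) fun a => inr (inr a)) -
    pairing (V := V₂) (coords (v ∘ inl) fun a => inr (inl a))
      (coords (v ∘ inr) fun a => inr (inr a))

theorem compExponent_mem_polyFun (f : κ → τ) (x : V₁.Idx → Λ τ) (o : Fin V₃.odd → τ) :
    (fun z : (Fin V₂.even ⊕ Fin V₂.even) ⊕ Fin V₃.even → ℝ =>
      compExponent S₃₂ S₂₁ f x (coords (z ∘ inr) o) (z ∘ inl)) ∈ polyFun _ _ := by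
  have hy := coords_mem_polyFun (V := V₂) (ι := (Fin V₂.even ⊕ Fin V₂.even) ⊕ Fin V₃.even)
    (inl ∘ inl) fun a => (inr (inl a) : τ ⧺ V₂.odd)
  have hq := coords_mem_polyFun (V := V₂) (ι := (Fin V₂.even ⊕ Fin V₂.even) ⊕ Fin V₃.even)
    (inl ∘ inr) fun a => (inr (inr a) : τ ⧺ V₂.odd)
  have hr := fun a => comp_mem_polyFun
    (genMap (inl : τ → τ ⧺ V₂.odd)).toLinearMap
    (coords_mem_polyFun (V := V₃) (ι := (Fin V₂.even ⊕ Fin V₂.even) ⊕ Fin V₃.even) inr o a)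
  exact sub_mem (add_mem (S₃₂.eval_mem_polyFun _ hy hr)
    (S₂₁.eval_mem_polyFun _ (fun a => const_mem_polyFun (vmap inl x a)) hq))
    (pairing_mem_polyFun hy hq)

theorem compExponent_even (f : κ → τ) {x : V₁.Idx → Λ τ} {r : V₃.Idx → Λ τ}
    (hx : IsPoint x) (hr : IsPoint r) (v : 𝕋 V₂.even) :
    compExponent S₃₂ S₂₁ f x r v ∈ parityPart _ 0 :=
  sub_mem (add_mem (S₃₂.eval_even _ (coords_point _ _) (VecIn.vmap _ hr))
    (S₂₁.eval_even _ (VecIn.vmap _ hx) (coords_point _ _)))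
    (dotProduct_even (coords_point _ _) (coords_point _ _))

/-- The exponential of the exponent of a composition oscillates quadratically in the variables of
integration, uniformly in the momenta. -/
theorem exists_oscillation (h : Composable S₃₂ S₂₁) {ħ : ℝ} (hħ : 0 < ħ) (f : κ → τ)
    {x : V₁.Idx → Λ τ} (hx : VecIn (realParity τ) x) (o : Fin V₃.odd → τ) :
    ∃ (H : Matrix (Fin V₂.even ⊕ Fin V₂.even) (Fin V₂.even ⊕ Fin V₂.even) ℝ)
      (b : (Fin V₃.even → ℝ) → 𝕋 V₂.even) (θ : (Fin V₃.even → ℝ) → ℂ) (B : ℝ)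
      (p : ((Fin V₂.even ⊕ Fin V₂.even) ⊕ Fin V₃.even → ℝ) →
        Λ (τ ⧺ V₂.odd)),
      Hᵀ = H ∧ H.det ≠ 0 ∧ Continuous b ∧ PolyBound b ∧ Continuous θ ∧ (∀ r, ‖θ r‖ ≤ B) ∧
      p ∈ polyFun _ _ ∧ ∀ v r, gexp ((I / ħ) • compExponent S₃₂ S₂₁ f x (coords r o) v) =
        θ r • cexp (I * phase H (b r) v) • p (elim v r) := by
  have : Fintype κ := Fintype.ofFinite κ
  have : Fintype τ := Fintype.ofFinite τ
  let D := fun r : Fin V₃.even → ℝ => gaussData f h hx (coords_real r o)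
  let H := (D 0).H ħ
  have hH : Hᵀ = H := (D 0).H_symm ħ
  have hc : ∀ i, (fun r => ((D r).center i : ℂ)) ∈ polyFun (Fin V₃.even) ℂ := fun i => by
    have hp := fun i => crit_mem_polyFun (S₃₂ := S₃₂) (S₂₁ := S₂₁) f x
      (coords_mem_polyFun (V := V₃) id o) i
    rcases i with i | i
    · refine (congrArg (· ∈ polyFun (Fin V₃.even) ℂ) (funext fun r => ?_)).mp
        (comp_mem_polyFun body.toLinearMap (hp (.inl i)).2)
      obtain ⟨s, hs⟩ := (D r).ys_real i
      change body ((D r).ys (.inl i)) = ((body ((D r).ys (.inl i))).re : ℂ)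
      rw [hs, Complex.ofReal_re]
    · refine (congrArg (· ∈ polyFun (Fin V₃.even) ℂ) (funext fun r => ?_)).mp
        (comp_mem_polyFun body.toLinearMap (hp (.inl i)).1)
      obtain ⟨s, hs⟩ := (D r).qs_real i
      change body ((D r).qs (.inl i)) = ((body ((D r).qs (.inl i))).re : ℂ)
      rw [hs, Complex.ofReal_re]
  have hb : ∀ i, (fun r => ((-(H *ᵥ (D r).center)) i : ℂ)) ∈ polyFun (Fin V₃.even) ℂ := fun i => by
    have := neg_mem (sum_mem_polyFun univ fun j _ =>
      mul_mem_polyFun (const_mem_polyFun (H i j : ℂ)) (hc j))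
    refine (congrArg (· ∈ polyFun (Fin V₃.even) ℂ) (funext fun r => ?_)).mp this
    simp [mulVec, dotProduct]
  obtain ⟨p, hp, hpe⟩ := exists_gexp_poly (smul_mem _ (I / ħ : ℂ)
    (compExponent_mem_polyFun (S₃₂ := S₃₂) (S₂₁ := S₂₁) f x o))
    fun z => smul_mem _ _ (compExponent_even f hx.of_real (coords_point _ _) _)
  have hph : Continuous fun r => phase H 0 (D r).center :=
    (continuous_phase H 0).comp (continuous_polyBound hc).1
  obtain ⟨p₀, hp₀, he₀⟩ : ∃ p₀ ∈ polyFun (Fin V₃.even) ℂ, ∀ r, p₀ r =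
      body ((comp S₃₂ S₂₁ h).eval (genMap f) x (coords r o)) :=
    ⟨_, comp_mem_polyFun body.toLinearMap ((comp S₃₂ S₂₁ h).eval_mem_polyFun (genMap f)
      (fun a => const_mem_polyFun (x a)) (coords_mem_polyFun id o)), fun r => rfl⟩
  refine ⟨H, fun r => -(H *ᵥ (D r).center), fun r => cexp (I / ħ * p₀ r) *
    cexp (I * phase H 0 (D r).center), ‖cexp (I / ħ * body ((comp S₃₂ S₂₁ h).const : Λ κ))‖,
    p, hH, (D 0).H_det hħ, (continuous_polyBound hb).1, (continuous_polyBound hb).2, ?_,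
    fun r => ?_, hp, fun v r => ?_⟩
  · have := continuous_of_mem_polyFun hp₀
    fun_prop
  · rw [norm_mul, mul_comm I (phase _ _ _ : ℂ), Complex.norm_exp_ofReal_mul_I, mul_one, he₀,
      norm_exp_body_eval _ ħ f hx (coords_real r o)]
  · have e1 : compExponent S₃₂ S₂₁ f x (coords r o) v = _ :=
      exponent_eq f h hx (coords_real r o) (v ∘ inl) (v ∘ inr)
    rw [Sum.elim_comp_inl_inr] at e1
    have e2 : body ((I / ħ : ℂ) • compExponent S₃₂ S₂₁ f x (coords r o) v) = I / ħ * p₀ r +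
        I * phase H 0 (D r).center + I * phase H (-(H *ᵥ (D r).center)) v := by
      rw [e1, smul_add, map_add, (D r).body_smul_E, map_smul, body_genMap, he₀, smul_eq_mul]
      change _ + I * ((phase H 0 (v - (D r).center) : ℝ) : ℂ) = _
      rw [phase_sub hH]
      push_cast
      ring
    have e3 : gexp ((I / ħ : ℂ) • compExponent S₃₂ S₂₁ f x (coords r o) v) =
        cexp (body ((I / ħ : ℂ) • compExponent S₃₂ S₂₁ f x (coords r o) v)) • p (elim v r) :=
      hpe (elim v r)
    rw [e3, e2, Complex.exp_add, Complex.exp_add, mul_smul]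

end QuadAction

section Pullback

variable {κ : Type} [Fintype κ] {V₁ V₂ V₃ : SuperSpace} {ħ : ℝ}

open QuadAction

variable {S₃₂ : QuadAction κ V₂ V₃} {S₂₁ : QuadAction κ V₁ V₂}

variable (ħ S₂₁) in
/-- The kernel of the pullback. -/
noncomputable def pullKernel (xe : Fin V₁.even → ℝ) (y q : Fin V₂.even → ℝ) :
    Λ ((κ ⊕ Fin V₁.odd) ⊕ (Fin V₂.odd ⊕ Fin V₂.odd)) :=
  gexp ((I / ħ) • (S₂₁.eval (genMap (inl ∘ inl))
    (coords (V := V₁) xe fun a => inl (inr a)) (coords q fun a => inr (inr a)) -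
      pairing (coords (V := V₂) y fun a => inr (inl a))
        (coords q fun a => inr (inr a))))

variable (S₃₂ S₂₁ ħ) in
/-- The integrand of the composition. -/
noncomputable def compKernel (xe : Fin V₁.even → ℝ) (r : Fin V₃.even → ℝ)
    (w : 𝕋 V₂.even) :
    Λ ((κ ⊕ (Fin V₁.odd ⊕ Fin V₃.odd)) ⊕ (Fin V₂.odd ⊕ Fin V₂.odd)) :=
  gexp ((I / ħ) • compExponent S₃₂ S₂₁ inl (coords xe (inr ∘ inl))
    (coords r (inr ∘ inr)) w)

theorem pullKernel_mul_coef (xe : Fin V₁.even → ℝ) (r : Fin V₃.even → ℝ)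
    (w : 𝕋 V₂.even) (L : List (Fin V₃.odd)) :
    pullKernel ħ S₂₁ xe (w ∘ inl) (w ∘ inr) *
      genMap (elim (inl ∘ inl) (inr ∘ inl))
        (coef (dropP κ _ _) (inr ∘ inr) L (kern ħ S₃₂ (w ∘ inl) r)) =
      coef (extend (dropP κ (Fin V₁.odd) (Fin V₃.odd)) _) (inl ∘ inr ∘ inr) L
        (compKernel ħ S₃₂ S₂₁ xe r w) := by
  have e1 := genMap_coef (p := dropP κ (Fin V₂.odd) (Fin V₃.odd)) (ι := inr ∘ inr)
    (p' := extend (dropP κ (Fin V₁.odd) (Fin V₃.odd)) (Fin V₂.odd ⊕ Fin V₂.odd)) (ι' := inl ∘ inr ∘ inr)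
    (e := (elim (inl ∘ inl) (inr ∘ inl) : κ ⊕ Fin V₂.odd → (κ ⊕ Fin V₁.odd) ⊕ (Fin V₂.odd ⊕ Fin V₂.odd)))
    (e' := elim (inl ∘ inl)
      (elim (inr ∘ inl) (inl ∘ inr ∘ inr)))
    (by rintro (k | k | k) <;> rfl) (fun j => rfl)
    (by rintro (k | k | k) (k' | k' | k') hk <;> cases hk <;> rfl) L (kern ħ S₃₂ (w ∘ inl) r)
  have he : (S₂₁.eval (genMap (inl ∘ inl))
        (coords (V := V₁) xe fun a => inl (inr a)) (coords (w ∘ inr) fun a => inr (inr a)) -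
        pairing (coords (V := V₂) (w ∘ inl) fun a => inr (inl a))
          (coords (w ∘ inr) fun a => inr (inr a)) : Λ ((κ ⊕ Fin V₁.odd) ⊕ (Fin V₂.odd ⊕ Fin V₂.odd))) ∈ parityPart _ 0 :=
    sub_mem (S₂₁.eval_even _ (coords_point _ _) (coords_point _ _))
      (dotProduct_even (coords_point _ _) (coords_point _ _))
  have he' := S₃₂.eval_even (inl : κ → κ ⊕ (Fin V₂.odd ⊕ Fin V₃.odd))
    (coords_point (w ∘ inl) (inr ∘ inl)) (coords_point r (inr ∘ inr))
  rw [pullKernel, compKernel, e1, ← coef_mul_even (p := extend (dropP κ (Fin V₁.odd) (Fin V₃.odd)) (Fin V₂.odd ⊕ Fin V₂.odd)) (ι := inl ∘ inr ∘ inr)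
    (j := Sum.map (Sum.map id inl) id) (by rintro ((k | k) | k) <;> rfl)
    (by rintro i ((k | k) | k) <;> simp) (gexp_even (smul_mem _ _ he)), kern,
    genMap_gexp _ (smul_mem _ _ he), genMap_gexp _ (smul_mem _ _ he'),
    ← gexp_add (genMap_mem_parity _ (smul_mem _ _ he))
      (genMap_mem_parity _ (smul_mem _ _ he')), map_smul, map_smul, ← smul_add]
  refine congrArg (fun z => coef _ _ L (gexp ((I / ħ : ℂ) • z))) ?_
  rw [map_sub, map_eval, map_eval, genMap_comp, genMap_comp, pairing, map_sum]
  simp only [map_mul, genMap_coords]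
  have e3 : vmap inl (coords (V := V₁) xe (inr ∘ inl : Fin V₁.odd → κ ⊕ (Fin V₁.odd ⊕ Fin V₃.odd))) =
    (coords xe (inl ∘ inr ∘ inl) : V₁.Idx → Λ ((κ ⊕ (Fin V₁.odd ⊕ Fin V₃.odd)) ⊕ (Fin V₂.odd ⊕ Fin V₂.odd))) :=
      genMap_coords _ _ _
  have e4 : vmap inl (coords (V := V₃) r (inr ∘ inr : Fin V₃.odd → κ ⊕ (Fin V₁.odd ⊕ Fin V₃.odd))) =
    (coords r (inl ∘ inr ∘ inr) : V₃.Idx → Λ ((κ ⊕ (Fin V₁.odd ⊕ Fin V₃.odd)) ⊕ (Fin V₂.odd ⊕ Fin V₂.odd))) :=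
      genMap_coords _ _ _
  rw [compExponent, e3, e4, sub_add_eq_add_sub, add_comm (S₂₁.eval _ _ _)]
  exact congrArg₂ (· - ·) rfl (sum_congr rfl fun a _ => congrArg₂ (· * ·)
    (congrFun (genMap_coords _ _ _) a) (congrFun (genMap_coords _ _ _) a))

theorem hasInt_pullKernel {φ : 𝓢(Fin V₃.even → ℝ, ℂ)} {L : List (Fin V₃.odd)} {u : WaveFun κ V₂}
    (hu : IsTransform ħ φ L S₃₂ u) (xe : Fin V₁.even → ℝ) (w : 𝕋 V₂.even) :
    HasInt (fun r => φ r • coef (dropP κ _ _) (inr ∘ inr) L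
        (berezin ħ V₂.odd (compKernel ħ S₃₂ S₂₁ xe r w)))
      (berezin ħ V₂.odd (pullKernel ħ S₂₁ xe (w ∘ inl) (w ∘ inr) *
        genMap (elim (inl ∘ inl) (inr ∘ inl)) (u (w ∘ inl)))) := by
  have := (((hu (w ∘ inl)).map (genMap (elim (inl ∘ inl) (inr ∘ inl) :
    κ ⊕ Fin V₂.odd → (κ ⊕ Fin V₁.odd) ⊕ (Fin V₂.odd ⊕ Fin V₂.odd))).toLinearMap).map
    (LinearMap.mulLeft ℂ (pullKernel ħ S₂₁ xe (w ∘ inl) (w ∘ inr)))).map (berezin ħ V₂.odd)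
  refine (congrArg (HasInt · _) (funext fun r => ?_)).mp this
  rw [map_smul, map_smul, map_smul, ← berezin_coef ħ L]
  exact congrArg (fun z => φ r • berezin ħ V₂.odd z) (pullKernel_mul_coef xe r w L)

theorem hasInt_mul_correction {S : QuadAction κ V₁ V₃} {φ : 𝓢(Fin V₃.even → ℝ, ℂ)}
    {L : List (Fin V₃.odd)} {v : WaveFun κ V₁} (hv : IsTransform ħ φ L S v) {g : Λ κ}
    (hg : g ∈ parityPart κ 0) (xe : Fin V₁.even → ℝ) :
    HasInt (fun r => φ r • coef (dropP κ _ _) (inr ∘ inr) L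
      (kern ħ S xe r * genMap inl g)) (genMap inl g * v xe) := by
  have := (hv xe).map (LinearMap.mulLeft ℂ (genMap inl g))
  refine (congrArg (HasInt · _) (funext fun r => ?_)).mp this
  have e := coef_mul_even (p := dropP κ (Fin V₁.odd) (Fin V₃.odd)) (ι := inr ∘ inr)
    (j := Sum.map id inl) (by rintro (k | k) <;> rfl) (by rintro i (k | k) <;> simp)
    (genMap_mem_parity (inl : κ → κ ⊕ Fin V₁.odd) hg) L (kern ħ S xe r)
  rw [map_smul, LinearMap.mulLeft_apply, ← e, genMap_genMap, even_comm (genMap_mem_parity _ hg)]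
  rfl

/-- The pullback of a superposition of exponentials of an action. -/
theorem IsTransform.pullback (h : Composable S₃₂ S₂₁) (hħ : 0 < ħ) {φ : 𝓢(Fin V₃.even → ℝ, ℂ)}
    {L : List (Fin V₃.odd)} {u : WaveFun κ V₂} {v : WaveFun κ V₁} (hu : IsTransform ħ φ L S₃₂ u)
    (hv : IsTransform ħ φ L (comp S₃₂ S₂₁ h) v) :
    IsPullback ħ S₂₁ u fun x =>
      genMap inl (gexp (-(correction S₃₂ S₂₁ : Λ κ))) * v x := by
  intro xe
  have hx := coords_real (V := V₁) xe
    (inr ∘ inl : Fin V₁.odd → κ ⊕ (Fin V₁.odd ⊕ Fin V₃.odd))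
  obtain ⟨H, b, θ, B, p, hH, hdet, hb, hbb, hθ, hθB, hp, hG⟩ := exists_oscillation h hħ inl hx
    (inr ∘ inr : Fin V₃.odd → κ ⊕ (Fin V₁.odd ⊕ Fin V₃.odd))
  have hF := fun r => integral_composition h hħ (inl : κ → κ ⊕ (Fin V₁.odd ⊕ Fin V₃.odd)) hx
    (coords_real (V := V₃) r (inr ∘ inr))
  refine (hasSuperIntegral_iff (F := fun w => pullKernel ħ S₂₁ xe (w ∘ inl) (w ∘ inr) *
    genMap (elim (inl ∘ inl) (inr ∘ inl)) (u (w ∘ inl)))).2 fun l => ?_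
  let ℓ := l ∘ₗ coef (dropP κ (Fin V₁.odd) (Fin V₃.odd)) (inr ∘ inr) L
  have hsmul : ∀ (z : ℂ) x, l (z • coef (dropP κ (Fin V₁.odd) (Fin V₃.odd)) (inr ∘ inr) L x) =
    z * ℓ x := fun z x => map_smul l z _
  have hU := fun w => (hasInt_pullKernel (S₂₁ := S₂₁) hu xe w l).2
  have hV := (hasInt_mul_correction hv (gexp_even (neg_mem (correction S₃₂ S₂₁).2))
    xe l).2
  simp only [hsmul] at hU hV
  simp only [← hU, ← hV]
  refine tendsto_integral_swap hH hdet (comp_mem_polyFun (ℓ ∘ₗ berezin ħ V₂.odd) hp) hb hbb hθ hθB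
    (G := fun w r => ℓ (berezin ħ V₂.odd (compKernel ħ S₃₂ S₂₁ xe r w))) (fun w r => ?_) φ
    fun r => (hasSuperIntegral_iff (F := compKernel ħ S₃₂ S₂₁ xe r).1 (hF r) ℓ).2
  rw [compKernel, hG, map_smul, map_smul, map_smul, map_smul, smul_eq_mul, smul_eq_mul]
  rfl

end Pullback

section PullbackLinear

variable {κ : Type} {V₁ V₂ : SuperSpace} {ħ : ℝ} {S : QuadAction κ V₁ V₂} {w w' : WaveFun κ V₂}
  {u u' : WaveFun κ V₁}

theorem IsPullback.zero : IsPullback ħ S 0 0 := fun _ =>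
  HasSuperIntegral.zero.congr fun y q => by simp

theorem IsPullback.add (h : IsPullback ħ S w u) (h' : IsPullback ħ S w' u') :
    IsPullback ħ S (w + w') (u + u') := fun xe =>
  ((h xe).add (h' xe)).congr fun y q => by
    rw [Pi.add_apply, map_add, mul_add]

theorem IsPullback.mul_left (a : Λ κ) (h : IsPullback ħ S w u) :
    IsPullback ħ S (fun y => genMap inl a * w y) (fun x => genMap inl a * u x) := fun xe =>
  ((h xe).mul_left (genMap inl a)).congr fun y q => by
    have hK : gexp ((I / ħ : ℂ) • (S.eval (genMap (inl ∘ inl))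
        (coords xe (fun a => inl (inr a)))
        (coords q (fun a => inr (inr a))) -
          pairing (coords y (fun a => inr (inl a)))
            (coords q (fun a => inr (inr a))))) ∈
        parityPart ((κ ⊕ Fin V₁.odd) ⊕ (Fin V₂.odd ⊕ Fin V₂.odd)) 0 :=
      gexp_even (smul_mem _ _ (Submodule.sub_mem _
        (S.eval_even _ (coords_point _ _) (coords_point _ _))
        (dotProduct_even (coords_point _ _) (coords_point _ _))))
    beta_reduce
    rw [map_mul, genMap_genMap, genMap_genMap, ← mul_assoc, ← mul_assoc, even_comm hK]
    rfl

end PullbackLinear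

section Representation

variable {κ : Type} [Fintype κ] {V₁ V₂ V₃ : SuperSpace} {ħ : ℝ}

open QuadAction

theorem Ber_one {V : SuperSpace} : Ber (1 : Matrix V.Idx V.Idx (Λ κ)) = 1 := by
  have h1 : evenComponent (1 : Λ κ) = 1 := Subtype.ext (evenComponent_val (one_mem (GEven κ)))
  have h0 : evenComponent (0 : Λ κ) = 0 := Subtype.ext (evenComponent_val (zero_mem (GEven κ)))
  have h11 : (1 : Matrix V.Idx V.Idx (Λ κ)).toBlocks₁₁ = 1 := by
    ext i j; simp [toBlocks₁₁, Matrix.one_apply]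
  have h22 : (1 : Matrix V.Idx V.Idx (Λ κ)).toBlocks₂₂ = 1 := by
    ext i j; simp [toBlocks₂₂, Matrix.one_apply]
  have h12 : (1 : Matrix V.Idx V.Idx (Λ κ)).toBlocks₁₂ = 0 := by
    ext i j; simp [toBlocks₁₂]
  simp only [Ber, h11, h22, h12, Matrix.zero_mul, sub_zero, Matrix.map_one _ h0 h1, det_one, one_mul,
    Ring.inverse_one]

theorem correction_idAction {W : SuperSpace} (S : QuadAction κ V₁ W) :
    correction (idAction κ W) S = 0 := by
  have hz : tsMatrix (idAction κ W).xx S.qq = 0 := tsMatrix_zero_left _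
  have h := composable_idAction_left S
  have h1 := gexp_correction h
  rw [hz, sub_zero, Ber_one] at h1
  obtain ⟨n, hn⟩ := eq_of_gexp_eq_one (smul_mem _ _ (correction (idAction κ W) S).2) h1
  obtain ⟨r, hr⟩ := body_real (correction_real h fun t _ _ => by
    rw [hz, smul_zero, sub_zero]; exact isUnit_one)
  have h2 := congrArg body hn
  rw [map_smul, hr, body_algebraMap, smul_eq_mul] at h2
  have h3 := congrArg Complex.im h2
  have hn0 : n = 0 := by
    have : (n : ℝ) * (2 * π) = 0 := by simpa using h3.symm
    exact_mod_cast (mul_eq_zero.1 this).resolve_right (by positivity)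
  rw [hn0, Int.cast_zero, zero_mul, map_zero] at hn
  exact Subtype.ext ((smul_eq_zero.1 hn).resolve_left two_ne_zero)

theorem IsTransform.pullback_idAction (hħ : 0 < ħ) {φ : 𝓢(Fin V₂.even → ℝ, ℂ)}
    {L : List (Fin V₂.odd)} {S : QuadAction κ V₁ V₂} {w : WaveFun κ V₂} {u : WaveFun κ V₁}
    (hw : IsTransform ħ φ L (idAction κ V₂) w) (hu : IsTransform ħ φ L S u) :
    IsPullback ħ S w u := by
  have h := composable_idAction_left S
  rw [(isClassicalComposite_iff h S).1 (isClassicalComposite_idAction_left S)] at hu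
  simpa [correction_idAction] using hw.pullback h hħ hu

/-- The pullbacks of `w` by two morphisms and by their composition exist and are compatible, and
the identity acts trivially on `w`. -/
def IsRepresented (ħ : ℝ) (S₃₂ : QuadAction κ V₂ V₃) (S₂₁ : QuadAction κ V₁ V₂)
    (S₃₁ : QuadAction κ V₁ V₃) (w : WaveFun κ V₃) : Prop :=
  IsPullback ħ (idAction κ V₃) w w ∧ ∃ u v, IsPullback ħ S₃₂ w u ∧ IsPullback ħ S₃₁ w v ∧
    IsPullback ħ S₂₁ u fun x =>
      genMap inl (gexp (-(correction S₃₂ S₂₁ : Λ κ))) * v x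

section

variable {S₃₂ : QuadAction κ V₂ V₃} {S₂₁ : QuadAction κ V₁ V₂} {S₃₁ : QuadAction κ V₁ V₃}
  {w w' : WaveFun κ V₃}

theorem IsRepresented.zero : IsRepresented ħ S₃₂ S₂₁ S₃₁ 0 :=
  ⟨.zero, 0, 0, .zero, .zero, by
    simp only [Pi.zero_apply, mul_zero]; exact IsPullback.zero⟩

theorem IsRepresented.add (h : IsRepresented ħ S₃₂ S₂₁ S₃₁ w) (h' : IsRepresented ħ S₃₂ S₂₁ S₃₁ w') :
    IsRepresented ħ S₃₂ S₂₁ S₃₁ (w + w') := by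
  obtain ⟨h0, u, v, h1, h2, h3⟩ := h
  obtain ⟨h0', u', v', h1', h2', h3'⟩ := h'
  refine ⟨h0.add h0', u + u', v + v', h1.add h1', h2.add h2', ?_⟩
  simp only [Pi.add_apply, mul_add]
  exact h3.add h3'

theorem IsRepresented.mul_left (a : Λ κ) (h : IsRepresented ħ S₃₂ S₂₁ S₃₁ w) :
    IsRepresented ħ S₃₂ S₂₁ S₃₁ fun y => genMap inl a * w y := by
  obtain ⟨h0, u, v, h1, h2, h3⟩ := h
  refine ⟨h0.mul_left a, _, _, h1.mul_left a, h2.mul_left a, ?_⟩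
  have := h3.mul_left a
  simp only [← mul_assoc, ← map_mul] at this ⊢
  rwa [even_comm (gexp_even (neg_mem (correction S₃₂ S₂₁).2))]

theorem IsRepresented.sum {ι : Type*} (s : Finset ι) {w : ι → WaveFun κ V₃}
    (h : ∀ i, IsRepresented ħ S₃₂ S₂₁ S₃₁ (w i)) :
    IsRepresented ħ S₃₂ S₂₁ S₃₁ (∑ i ∈ s, w i) :=
  Finset.sum_induction _ _ (fun _ _ => .add) .zero fun i _ => h i

end

/-- The composition law for quantum pullbacks. -/
theorem isRepresented_of_isSchwartz (hħ : 0 < ħ) {S₃₂ : QuadAction κ V₂ V₃}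
    {S₂₁ : QuadAction κ V₁ V₂} (h : Composable S₃₂ S₂₁) {w : WaveFun κ V₃} (hw : IsSchwartz w) :
    IsRepresented ħ S₃₂ S₂₁ (comp S₃₂ S₂₁ h) w := by
  have key : ∀ (f : 𝓢(Fin V₃.even → ℝ, ℂ)) (b : Λ (κ ⊕ Fin V₃.odd)),
      IsRepresented ħ S₃₂ S₂₁ (comp S₃₂ S₂₁ h) fun y => f y • b := fun f b => by
    obtain ⟨φ, hφ⟩ := exists_isTransform_idAction (κ := κ) hħ f
    induction drop_mem_span_coef hħ.ne' b using Submodule.span_induction with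
    | mem b hb =>
      obtain ⟨⟨a, L⟩, rfl⟩ := hb
      obtain ⟨u, hu⟩ := exists_isTransform ħ φ L S₃₂
      obtain ⟨v, hv⟩ := exists_isTransform ħ φ L (comp S₃₂ S₂₁ h)
      have := IsRepresented.mul_left a ⟨(hφ L).pullback_idAction hħ (hφ L), u, v,
        (hφ L).pullback_idAction hħ hu, (hφ L).pullback_idAction hħ hv, hu.pullback h hħ hv⟩
      simpa only [mul_smul_comm] using this
    | zero => simp only [smul_zero]; exact IsRepresented.zero
    | add x y _ _ hx hy => simp only [smul_add]; exact hx.add hy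
    | smul c x _ hx =>
      have := hx.mul_left (algebraMap ℂ _ c)
      simpa only [AlgHom.commutes, ← Algebra.smul_def, smul_comm c] using this
  let b := Module.finBasis ℂ (Λ (κ ⊕ Fin V₃.odd))
  choose f hf using fun t => hw (b.coord t)
  have : w = ∑ t, fun y => f t y • b t := by
    funext y
    rw [Finset.sum_apply]
    simp only [hf, Module.Basis.coord_apply, Module.Basis.sum_repr]
  rw [this]
  exact IsRepresented.sum _ fun t => key _ _

end Representation

end SuperThick

open SuperThick in
theorem mainTheorem1 (N : ℕ) :
    ∃ c : ∀ V : SuperSpace, (V.Idx → V.Idx → Grassmann (Fin N)) →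
        (V.Idx → V.Idx → Grassmann (Fin N)) → GEven (Fin N),
      -- the action of the composition, with the quantum correction `c = ½ ln Ber (δ - T S (-1)^k)`
      (∀ (V₁ V₂ V₃ : SuperSpace) (S₃₂ : QuadAction (Fin N) V₂ V₃) (S₂₁ : QuadAction (Fin N) V₁ V₂),
        Composable S₃₂ S₂₁ →
        gexp ((2 : ℂ) • (c V₂ S₃₂.xx S₂₁.qq : Grassmann (Fin N))) =
            (Ber (1 - tsMatrix S₃₂.xx S₂₁.qq) : Grassmann (Fin N)) ∧
        ((∀ t : ℝ, 0 ≤ t → t ≤ 1 → IsUnit (1 - (t : ℂ) • tsMatrix S₃₂.xx S₂₁.qq)) →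
          (c V₂ S₃₂.xx S₂₁.qq : Grassmann (Fin N)) ∈ realPart (Fin N)) ∧
        ∃ Scl : QuadAction (Fin N) V₁ V₃,
          (∀ S, IsClassicalComposite S₃₂ S₂₁ S ↔ S = Scl) ∧
          (∀ M P, P ∈ Scl.rel M ↔ ∃ Y, (P.1, Y) ∈ S₂₁.rel M ∧ (Y, P.2) ∈ S₃₂.rel M) ∧
          ∀ ħ : ℝ, 0 < ħ →
            (∀ S, IsQuantumComposite ħ S₃₂ S₂₁ S ↔
              ∃ n : ℤ, S = Scl.addConst (-((ħ / Complex.I : ℂ) • c V₂ S₃₂.xx S₂₁.qq)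
                + algebraMap ℂ (GEven (Fin N)) (2 * Real.pi * ħ * n))) ∧
            -- composition of the pullbacks, up to the multiplier `exp (-c)`
            ∀ w : WaveFun (Fin N) V₃, IsSchwartz w →
              ∃ (u : WaveFun (Fin N) V₂) (v : WaveFun (Fin N) V₁),
                IsPullback ħ S₃₂ w u ∧ IsPullback ħ Scl w v ∧
                IsPullback ħ S₂₁ u (fun x =>
                  genMap Sum.inl (gexp (-(c V₂ S₃₂.xx S₂₁.qq : Grassmann (Fin N)))) * v x)) ∧
      -- a quadratic action is a canonical relation framed by a constant
      (∀ (V₁ V₂ : SuperSpace) (S S' : QuadAction (Fin N) V₁ V₂),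
        S.const = S'.const → (∀ M, S.rel M = S'.rel M) → S = S') ∧
      -- identities and their representation
      (∀ (V₁ V₂ : SuperSpace) (S : QuadAction (Fin N) V₁ V₂),
        (Composable S (idAction (Fin N) V₁) ∧ IsClassicalComposite S (idAction (Fin N) V₁) S) ∧
        (Composable (idAction (Fin N) V₂) S ∧ IsClassicalComposite (idAction (Fin N) V₂) S S)) ∧
      (∀ (V : SuperSpace) (ħ : ℝ), 0 < ħ → ∀ w : WaveFun (Fin N) V, IsSchwartz w →
        IsPullback ħ (idAction (Fin N) V) w w) ∧
      -- associativity of the classical composition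
      (∀ (V₁ V₂ V₃ V₄ : SuperSpace) (S₄₃ : QuadAction (Fin N) V₃ V₄)
        (S₃₂ : QuadAction (Fin N) V₂ V₃) (S₂₁ : QuadAction (Fin N) V₁ V₂)
        (S₃₁ : QuadAction (Fin N) V₁ V₃) (S₄₂ : QuadAction (Fin N) V₂ V₄)
        (S₄₁ : QuadAction (Fin N) V₁ V₄),
        Composable S₃₂ S₂₁ → IsClassicalComposite S₃₂ S₂₁ S₃₁ →
        Composable S₄₃ S₃₂ → IsClassicalComposite S₄₃ S₃₂ S₄₂ →
        ((Composable S₄₃ S₃₁ ∧ IsClassicalComposite S₄₃ S₃₁ S₄₁) ↔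
          (Composable S₄₂ S₂₁ ∧ IsClassicalComposite S₄₂ S₂₁ S₄₁))) := by
  refine ⟨fun V T S => multiplier V T S, fun V₁ V₂ V₃ S₃₂ S₂₁ h => ⟨QuadAction.gexp_correction h,
    QuadAction.correction_real h, QuadAction.comp S₃₂ S₂₁ h, QuadAction.isClassicalComposite_iff h,
    QuadAction.mem_rel_comp h, fun ħ hħ => ⟨QuadAction.isQuantumComposite_iff h hħ,
    fun w hw => (isRepresented_of_isSchwartz hħ h hw).2⟩⟩,
    fun V₁ V₂ S S' => QuadAction.ext_of_rel, fun V₁ V₂ S =>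
    ⟨⟨QuadAction.composable_idAction_right S, QuadAction.isClassicalComposite_idAction_right S⟩,
      QuadAction.composable_idAction_left S, QuadAction.isClassicalComposite_idAction_left S⟩,
    fun V ħ hħ w hw => (isRepresented_of_isSchwartz hħ
      (QuadAction.composable_idAction_left (idAction (Fin N) V)) hw).1,
    fun V₁ V₂ V₃ V₄ S₄₃ S₃₂ S₂₁ S₃₁ S₄₂ S₄₁ => classical_assoc⟩
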